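/- **Setting.** Let $\theta>0$, $\omega=2\pi/\theta$, $\lambda,\mu_0\in\mathbb R$. On functions on $\mathbb C^2$ put $\langle\varphi,\chi\rangle_B=\int_{\mathbb C^2}(\omega/\pi)^2e^{-\omega|z|^2}\overline{\varphi(z)}\chi(z)\,dz$ and $(T_v\varphi)(z)=e^{-\omega|v|^2/2-\omega\bar v\cdot z}\varphi(z+v)$ for $v\in\mathbb C^2$. Let $\Gamma=\frac{\theta}{\sqrt2}(\mathbb Z^2+i\mathbb Z^2)$, $\widehat\Gamma=\frac1{\sqrt2}(\mathbb Z^2+i\mathbb Z^2)$, $\varphi U_\gamma=T_\gamma\varphi$ for $\gamma\in\Gamma$. Let $\mathcal E_B$ be the image of the Schwartz space $\mathcal S(\mathbb R^2)$ under the Bargmann transform $(Bf)(z)=(\omega/\pi)^{1/2}\int_{\mathbb R^2}e^{-\frac\omega2(x\cdot x+z\cdot z)+\sqrt2\,\omega z\cdot x}f(x)\,dx$. The pairing $(\varphi,\chi)_{\mathcal A_\theta}=\sum_{\gamma\in\Gamma}\langle\varphi,\chi U_\gamma\rangle_B\,U_{-\gamma}$ takes values in the four-dimensional noncommutative torus,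 with trace $\mathrm{Tr}_{\mathcal A_\theta}\big(\sum_\gamma a_\gamma U_\gamma\big)=a_0$. Let $H=2\omega(z\cdot\partial_z+1)+\mu_0^2$, so that $(e^{-\beta H}\varphi)(z)=e^{-\beta(2\omega+\mu_0^2)}\varphi(e^{-2\omega\beta}z)$, and for $\varepsilon>0$ let $H_\varepsilon^{-1}=\int_\varepsilon^\infty e^{-\beta H}\,d\beta$ be the regularized propagator of the $\lambda\phi^4$ theory on $\mathcal E_B$. For $v,w\in\mathbb C^2$ put $$a^c_\varepsilon(v,w)=\langle\varphi_1,T_v\varphi_2\rangle_B\,\langle\varphi_3,T_{w}H_\varepsilon^{-1}T_{-v}H_\varepsilon^{-1}T_{-w}\varphi_4\rangle_B,$$ $$a^d_\varepsilon(v,w)=\langle\varphi_1,T_{v}H_\varepsilon^{-1}T_{w}\varphi_2\rangle_B\,\langle\varphi_3,T_{-v}H_\varepsilon^{-1}T_{-w}\varphi_4\rangle_B .$$ The non-planar one-loop four-point function $\Gamma_\varepsilon=\Gamma^c_\varepsilon+\Gamma^d_\varepsilon$ is the sum of the two non-planar graphs $$\Gamma^c_\varepsilon=-4\Big(\frac\lambda2\Big)^2\sum_{\gamma_1,\gamma_2\in\Gamma}a^c_\varepsilon(\gamma_1,\gamma_2),\qquad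 \Gamma^d_\varepsilon=-2\Big(\frac\lambda2\Big)^2\sum_{\gamma_1,\gamma_2\in\Gamma}a^d_\varepsilon(\gamma_1,\gamma_2).$$ Poisson resummation of one lattice sum defines, for $(\gamma,\gamma^*)\in\Gamma\times\widehat\Gamma$, the modes $$\Gamma^{c}_\varepsilon(\gamma,\gamma^*)=-\lambda^2\,\frac{4}{\theta^4}\int_{\mathbb C^2}a^c_\varepsilon(\gamma,w)\,e^{-2i\omega\,\mathrm{Re}(\overline{\gamma^*}\cdot w)}dw,\qquad \Gamma^{d}_\varepsilon(\gamma,\gamma^*)=-\frac{\lambda^2}{2}\,\frac4{\theta^4}\int_{\mathbb C^2}a^d_\varepsilon(v,\gamma-v)\,e^{-2i\omega\,\mathrm{Re}(\overline{\gamma^*}\cdot v)}dv.$$ "The divergent part of $f(\varepsilon)$ is $c\ln\frac1\varepsilon$" means that $f(\varepsilon)-c\ln\frac1\varepsilon$ converges in $\mathbb C$ as $\varepsilon\to0^+$. **Proposition.** For all $\theta,\varepsilon>0$ and $\varphi_1,\dots,\varphi_4\in\mathcal E_B$ the sums defining $\Gamma^c_\varepsilon$ and $\Gamma^d_\varepsilon$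 converge absolutely, and: (1) *Rational case.* Let $\theta=p/q$ with coprime positive integers $p,q$, let $f_1,\dots,f_4\in\mathcal S(\mathbb R^2)$, $\varphi_k=Bf_k$, and let $M_k$ be the matrix-valued function on $\mathbb R^2\times\mathbb R^2$ attached to $f_k$, $$(M_k)_{ij}(x,y)=\sum_{n\in\mathbb Z^2}f_k\Big(x+\frac{iq+jp+npq}{q}\Big)e^{-2\pi i q\,n\cdot y},\qquad i\in\{0,\dots,p-1\}^2,\ j\in\{0,\dots,q-1\}^2.$$ Then the divergent part of $\Gamma_\varepsilon$ is local in the matrix picture: $$-\frac{3\lambda^2}{8\omega^2\theta^2}\int_{[0,1/q]^2}dx\int_{[0,1/q]^2}dy\ \mathrm{Tr}\big[M_1^\dagger M_2\big](x,y)\,\mathrm{Tr}\big[M_3^\dagger M_4\big](x,y)\ \ln\frac1\varepsilon .$$ (2) *Irrational case.* Let $\theta>0$ be irrational and satisfy the weak Diophantine condition: there are $C_1,C_2>0$ with $\inf_{m\in\mathbb Z}|n\theta-m|\ge C_1e^{-C_2|n|}$ for all $n\in\mathbb Z\setminus\{0\}$. Then for all $\varphi_1,\dots,\varphi_4\in\mathcal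 E_B$ the divergent part of $\Gamma_\varepsilon$ is the non-local product of traces $$-\frac{3\lambda^2}{8\omega^2\theta^2}\,\mathrm{Tr}_{\mathcal A_\theta}\big[(\varphi_1,\varphi_2)_{\mathcal A_\theta}\big]\,\mathrm{Tr}_{\mathcal A_\theta}\big[(\varphi_3,\varphi_4)_{\mathcal A_\theta}\big]\,\ln\frac1\varepsilon .$$ Moreover, for every $\varepsilon>0$, $\Gamma^c_\varepsilon$ and $\Gamma^d_\varepsilon$ are the (absolutely convergent) sums of their modes; $\Gamma^c_\varepsilon(0,0)+\Gamma^d_\varepsilon(0,0)$ has the divergent part just displayed; and all other modes are finite: for each of the two graphs, every mode $(\gamma,\gamma^*)\ne(0,0)$, and also the sum of all these modes, has a finite limit as $\varepsilon\to0^+$ (UV/IR mixing). -/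

import Mathlib

open MeasureTheory Filter Topology
open scoped SchwartzMap Matrix

namespace HeisenbergQFT

noncomputable section

/-- Configuration space `ℝ²` of the four-dimensional noncommutative torus. -/
abbrev R2 : Type := EuclideanSpace ℝ (Fin 2)

/-- The space `ℂ²` of holomorphic coordinates. -/
abbrev C2 : Type := Fin 2 → ℂ

/-- Labels `(m, n) ∈ ℤ² × ℤ²` of the points of the lattices in `ℂ²`. -/
abbrev LatIdx : Type := (Fin 2 → ℤ) × (Fin 2 → ℤ)

/-- The oscillator frequency `ω = 2π/θ`. -/
def freq (θ : ℝ) : ℝ := 2 * Real.pi / θ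

/-- The bilinear (not sesquilinear) product `∑ⱼ vⱼ zⱼ` on `ℂ²`. -/
def cdot (v z : C2) : ℂ := ∑ j, v j * z j

/-- `|z|² = ∑ⱼ |zⱼ|²`. -/
def normSq2 (z : C2) : ℝ := ∑ j, ‖z j‖ ^ 2

/-- The point `γ = (θ/√2)(m + i n)` of the lattice `Γ ⊂ ℂ²`. -/
def latPt (θ : ℝ) (g : LatIdx) : C2 :=
  fun j => ((θ / Real.sqrt 2 : ℝ) : ℂ) * ((g.1 j : ℂ) + Complex.I * (g.2 j : ℂ))

/-- The point `γ* = (1/√2)(m + i n)` of the dual lattice. -/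
def dualPt (g : LatIdx) : C2 :=
  fun j => ((1 / Real.sqrt 2 : ℝ) : ℂ) * ((g.1 j : ℂ) + Complex.I * (g.2 j : ℂ))

/-! ### The Bargmann module -/

/-- The scalar product `⟨φ, χ⟩_B = ∫ dμ(z) conj(φ(z)) χ(z)` with the normalized Gaussian measure
`dμ(z) = (ω/π)² exp(-ω|z|²) dz` on `ℂ²`. -/
def bInner (θ : ℝ) (φ χ : C2 → ℂ) : ℂ :=
  ∫ z : C2, (((freq θ / Real.pi) ^ 2 * Real.exp (-freq θ * normSq2 z) : ℝ) : ℂ) *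
    ((starRingEnd ℂ) (φ z) * χ z)

/-- The Bargmann transform from functions on `ℝ²` to functions on `ℂ²`. -/
def bargmann (θ : ℝ) (f : 𝓢(R2, ℂ)) : C2 → ℂ := fun z =>
  ((Real.sqrt (freq θ / Real.pi) : ℝ) : ℂ) *
    ∫ x : R2, Complex.exp (-((freq θ : ℂ) / 2) * (∑ j, ((x j : ℂ) ^ 2 + z j ^ 2))
      + ((Real.sqrt 2 : ℝ) : ℂ) * (freq θ : ℂ) * ∑ j, z j * (x j : ℂ)) * f x

/-- The smooth Heisenberg module in the holomorphic representation:
the image of the Schwartz space under the Bargmann transform. -/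
def smoothModule (θ : ℝ) : Set (C2 → ℂ) := Set.range (bargmann θ)

/-- The projective action of `ℂ²`:
`(T_v φ)(z) = exp(-ω|v|²/2 - ω ⟨v, z⟩) φ(z + v)`, antilinear in `v` in the exponent. -/
def transl (θ : ℝ) (v : C2) (φ : C2 → ℂ) : C2 → ℂ := fun z =>
  Complex.exp (-((freq θ * normSq2 v / 2 : ℝ) : ℂ)
    - (freq θ : ℂ) * cdot (fun j => (starRingEnd ℂ) (v j)) z) * φ (z + v)

/-- The operator of (right) multiplication by the unitary `U_γ`, `γ ∈ Γ`. -/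
def unitaryU (θ : ℝ) (g : LatIdx) (φ : C2 → ℂ) : C2 → ℂ := transl θ (latPt θ g) φ

/-- The hermitian pairing `(φ, χ) = ∑_γ ⟨φ, χ U_γ⟩_B U_{-γ}` with values in the noncommutative
torus, whose elements `∑_γ a_γ U_γ` are given by their coefficients `γ ↦ a_γ`. -/
def hermPairing (θ : ℝ) (φ χ : C2 → ℂ) : LatIdx → ℂ :=
  fun g => bInner θ φ (unitaryU θ (-g) χ)

/-- The trace `∑_γ a_γ U_γ ↦ a_0` of the noncommutative torus. -/
def torusTrace (a : LatIdx → ℂ) : ℂ := a 0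

/-! ### The regularized propagator -/

/-- The harmonic oscillator `H = ∑ⱼ 2ω (zⱼ ∂ⱼ + 1/2) + μ₀²` on `ℂ²`. -/
def hamiltonian (θ μ₀ : ℝ) (φ : C2 → ℂ) : C2 → ℂ := fun z =>
  2 * (freq θ : ℂ) * (fderiv ℂ φ z z + φ z) + (μ₀ : ℂ) ^ 2 * φ z

/-- The semigroup `e^{-βH}`, which acts on holomorphic functions by dilations. -/
def heat (θ μ₀ β : ℝ) (φ : C2 → ℂ) : C2 → ℂ := fun z =>
  ((Real.exp (-β * (2 * freq θ + μ₀ ^ 2)) : ℝ) : ℂ) *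
    φ (((Real.exp (-2 * freq θ * β) : ℝ) : ℂ) • z)

theorem heat_zero (θ μ₀ : ℝ) (φ : C2 → ℂ) : heat θ μ₀ 0 φ = φ := by
  funext z
  simp [heat]

theorem hasDerivAt_heat (θ μ₀ β : ℝ) (φ : C2 → ℂ) (hφ : Differentiable ℂ φ) (z : C2) :
    HasDerivAt (fun b : ℝ => heat θ μ₀ b φ z) (-hamiltonian θ μ₀ (heat θ μ₀ β φ) z) β := by
  have hE : HasDerivAt (fun b : ℝ => ((Real.exp (-b * (2 * freq θ + μ₀ ^ 2)) : ℝ) : ℂ))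
      ((Real.exp (-β * (2 * freq θ + μ₀ ^ 2)) * (-1 * (2 * freq θ + μ₀ ^ 2)) : ℝ) : ℂ) β :=
    (((hasDerivAt_neg β).mul_const (2 * freq θ + μ₀ ^ 2)).exp).ofReal_comp
  have hr : HasDerivAt (fun b : ℝ => ((Real.exp (-2 * freq θ * b) : ℝ) : ℂ))
      ((Real.exp (-2 * freq θ * β) * (-2 * freq θ * 1) : ℝ) : ℂ) β :=
    (((hasDerivAt_id β).const_mul (-2 * freq θ)).exp).ofReal_comp
  have hrz := hr.smul_const z
  set r : ℂ := ((Real.exp (-2 * freq θ * β) : ℝ) : ℂ) with hrdef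
  have hφd : HasFDerivAt φ ((fderiv ℂ φ (r • z)).restrictScalars ℝ) (r • z) :=
    (hφ (r • z)).hasFDerivAt.restrictScalars ℝ
  have hφr := hφd.comp_hasDerivAt β hrz
  have hmul := hE.mul hφr
  have hF : fderiv ℂ (heat θ μ₀ β φ) z z =
      ((Real.exp (-β * (2 * freq θ + μ₀ ^ 2)) : ℝ) : ℂ) * (r * fderiv ℂ φ (r • z) z) := by
    have h1 : HasFDerivAt (fun w : C2 => r • w) (r • ContinuousLinearMap.id ℂ C2) z :=
      (hasFDerivAt_id z).const_smul r
    have h2 := ((hφ (r • z)).hasFDerivAt.comp z h1).const_mul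
      ((Real.exp (-β * (2 * freq θ + μ₀ ^ 2)) : ℝ) : ℂ)
    have h3 : fderiv ℂ (heat θ μ₀ β φ) z = _ := h2.fderiv
    rw [h3]
    simp
  have hval : -hamiltonian θ μ₀ (heat θ μ₀ β φ) z =
      ((Real.exp (-β * (2 * freq θ + μ₀ ^ 2)) * (-1 * (2 * freq θ + μ₀ ^ 2)) : ℝ) : ℂ) *
        φ (r • z) + ((Real.exp (-β * (2 * freq θ + μ₀ ^ 2)) : ℝ) : ℂ) *
        fderiv ℂ φ (r • z)
          (((Real.exp (-2 * freq θ * β) * (-2 * freq θ * 1) : ℝ) : ℂ) • z) := by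
    simp only [hamiltonian, hF]
    simp only [heat, map_smul, smul_eq_mul]
    rw [Complex.ofReal_mul (Real.exp (-2 * freq θ * β)), ← hrdef]
    push_cast
    ring
  rw [hval]
  exact hmul

/-- The regularized propagator `H_ε⁻¹ = ∫_ε^∞ e^{-βH} dβ = H⁻¹ e^{-εH}`. -/
def regProp (θ μ₀ ε : ℝ) (φ : C2 → ℂ) : C2 → ℂ := fun z =>
  ∫ β in Set.Ioi ε, heat θ μ₀ β φ z

/-! ### The two non-planar one-loop four-point graphs

The external fields are `φ 0, φ 1, φ 2, φ 3`, of which `φ 0` and `φ 2` enter antilinearly. -/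

/-- First graph: product of the operators along its two lines,
`⟨φ₁, T_v φ₂⟩ ⟨φ₃, T_w H_ε⁻¹ T_{-v} H_ε⁻¹ T_{-w} φ₄⟩`. -/
def ampC (θ μ₀ ε : ℝ) (φ : Fin 4 → C2 → ℂ) (v w : C2) : ℂ :=
  bInner θ (φ 0) (transl θ v (φ 1)) *
    bInner θ (φ 2) (transl θ w (regProp θ μ₀ ε (transl θ (-v)
      (regProp θ μ₀ ε (transl θ (-w) (φ 3))))))

/-- Second graph: `⟨φ₁, T_v H_ε⁻¹ T_w φ₂⟩ ⟨φ₃, T_{-v} H_ε⁻¹ T_{-w} φ₄⟩`. -/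
def ampD (θ μ₀ ε : ℝ) (φ : Fin 4 → C2 → ℂ) (v w : C2) : ℂ :=
  bInner θ (φ 0) (transl θ v (regProp θ μ₀ ε (transl θ w (φ 1)))) *
    bInner θ (φ 2) (transl θ (-v) (regProp θ μ₀ ε (transl θ (-w) (φ 3))))

/-- The first graph, with two vertices `λ/2` and combinatorial factor `-4`. -/
def graphC (θ lam μ₀ ε : ℝ) (φ : Fin 4 → C2 → ℂ) : ℂ :=
  -4 * ((lam : ℂ) / 2) ^ 2 *
    ∑' g : LatIdx × LatIdx, ampC θ μ₀ ε φ (latPt θ g.1) (latPt θ g.2)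

/-- The second graph, with two vertices `λ/2` and combinatorial factor `-2`. -/
def graphD (θ lam μ₀ ε : ℝ) (φ : Fin 4 → C2 → ℂ) : ℂ :=
  -2 * ((lam : ℂ) / 2) ^ 2 *
    ∑' g : LatIdx × LatIdx, ampD θ μ₀ ε φ (latPt θ g.1) (latPt θ g.2)

/-- The regularized non-planar one-loop four-point function. -/
def nonPlanar (θ lam μ₀ ε : ℝ) (φ : Fin 4 → C2 → ℂ) : ℂ :=
  graphC θ lam μ₀ ε φ + graphD θ lam μ₀ ε φ

/-! ### Lattice modes after Poisson resummation of the loop sum -/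

/-- The Poisson-dual mode `γ*` of the sum of `f` over `Γ`:
`(θ⁴/4)⁻¹ ∫ f(w) exp(-2iω Re ⟨γ*, w⟩) dw`, where `θ⁴/4` is the covolume of `Γ`. -/
def poissonMode (θ : ℝ) (f : C2 → ℂ) (d : LatIdx) : ℂ :=
  ((4 / θ ^ 4 : ℝ) : ℂ) * ∫ w : C2, f w *
    Complex.exp (-2 * Complex.I * (freq θ : ℂ) *
      (((cdot (fun j => (starRingEnd ℂ) (dualPt d j)) w).re : ℝ) : ℂ))

/-- The mode `(γ₁, γ₂*)` of the first graph: `γ₁ ∈ Γ` is kept, the sum over `γ₂` is dualized. -/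
def modeC (θ lam μ₀ ε : ℝ) (φ : Fin 4 → C2 → ℂ) (k : LatIdx × LatIdx) : ℂ :=
  -4 * ((lam : ℂ) / 2) ^ 2 *
    poissonMode θ (fun w => ampC θ μ₀ ε φ (latPt θ k.1) w) k.2

/-- The mode `(γ, γ₁*)` of the second graph: `γ = γ₁ + γ₂ ∈ Γ` is kept, the sum over `γ₁` is
dualized. -/
def modeD (θ lam μ₀ ε : ℝ) (φ : Fin 4 → C2 → ℂ) (k : LatIdx × LatIdx) : ℂ :=
  -2 * ((lam : ℂ) / 2) ^ 2 *
    poissonMode θ (fun v => ampD θ μ₀ ε φ v (latPt θ k.1 - v)) k.2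

/-! ### Divergent parts -/

/-- `f(ε)` converges as `ε → 0⁺`. -/
def HasFiniteLimit (f : ℝ → ℂ) : Prop := ∃ L : ℂ, Tendsto f (𝓝[>] 0) (𝓝 L)

/-- The divergent part of `f(ε)` as `ε → 0⁺` is `c · ln(1/ε)`. -/
def HasLogDivergence (f : ℝ → ℂ) (c : ℂ) : Prop :=
  HasFiniteLimit (fun ε => f ε - c * ((Real.log (1 / ε) : ℝ) : ℂ))

/-! ### Arithmetic of `θ` and the matrix picture -/

/-- Weak Diophantine condition: `inf_m |nθ - m| ≥ C₁ exp(-C₂|n|)` for all `n ≠ 0`. -/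
def WeakDiophantine (θ : ℝ) : Prop :=
  ∃ C₁ C₂ : ℝ, 0 < C₁ ∧ 0 < C₂ ∧ ∀ n : ℤ, n ≠ 0 →
    C₁ * Real.exp (-C₂ * |(n : ℝ)|) ≤ ⨅ m : ℤ, |(n : ℝ) * θ - (m : ℝ)|

/-- The matrix-valued function
`M_{ij}(x,y) = ∑_{n ∈ ℤ²} f(x + (iq + jp + npq)/q) exp(-2πi q n·y)` attached to `f`, for
`i ∈ {0,…,p-1}²` and `j ∈ {0,…,q-1}²`. -/
def matrixField (p q : ℕ) (f : 𝓢(R2, ℂ)) (x y : Fin 2 → ℝ) :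
    Matrix (Fin 2 → Fin p) (Fin 2 → Fin q) ℂ :=
  fun i j => ∑' n : Fin 2 → ℤ,
    f (WithLp.toLp 2 (fun l : Fin 2 =>
        x l + (((i l : ℕ) : ℝ) * q + ((j l : ℕ) : ℝ) * p + (n l : ℝ) * p * q) / q)) *
      Complex.exp (-2 * Real.pi * Complex.I * (q : ℂ) * ∑ l, (n l : ℂ) * (y l : ℂ))

/-- `∫∫ Tr[M₁†M₂](x,y) Tr[M₃†M₄](x,y) dx dy` over `x, y ∈ [0, 1/q]²`. -/
def matrixDoubleTrace (p q : ℕ) (f : Fin 4 → 𝓢(R2, ℂ)) : ℂ :=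
  ∫ x in Set.Icc (0 : Fin 2 → ℝ) (fun _ => 1 / (q : ℝ)),
    ∫ y in Set.Icc (0 : Fin 2 → ℝ) (fun _ => 1 / (q : ℝ)),
      ((matrixField p q (f 0) x y)ᴴ * matrixField p q (f 1) x y).trace *
        ((matrixField p q (f 2) x y)ᴴ * matrixField p q (f 3) x y).trace

end

end HeisenbergQFT

open HeisenbergQFT

/-!
The analysis consists of three facts, valid for every `θ > 0`; what distinguishes rational from
irrational `θ` is the arithmetic of the displacements `δ` below.

*The propagator is a superposition of translations.* A holomorphic function of Fock-space growth
is reproduced by Gaussian averages, and therefore `e^{-βH} = ∫ K_β(u) T_u du` with an explicit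
Gaussian `K_β` (`heatKer`), and `H_ε⁻¹ = ∫ k_ε(u) T_u du` with `k_ε = ∫_ε^∞ K_β dβ`
(`regProp_eq_integral`). The fields enter through their matrix coefficients `v ↦ ⟨φ, T_v χ⟩`
(`matCoef`), which decay rapidly and are Lipschitz. The rapid decay survives insertions of the
propagator, whence the absolute convergence of the lattice sums (`summable_ampC`,
`summable_ampD`).

*Each mode is a loop integral.* Conjugating a translation by `T_w` multiplies it by a phase that is
a character in `w`. The integral over `w` defining a mode is thus a Fourier inversion on `ℂ²` and
pins the relative displacement of the two propagators: with `σ = iγ*`, each mode is a constant times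
`∫ k_ε(u) k_ε(u + δ) P(u) du` with displacement `δ = -(γ + σ)` for the first graph and
`δ = γ - σ` for the second (`poissonMode_ampC`, `poissonMode_ampD`). The profile `P` is a product of
matrix coefficients and a phase, and is bounded by a rapidly decaying function of `γ` and `σ`,
up to powers of `1 + |u|`. Poisson summation over `Γ` gives the decomposition into modes
(`hasSum_modeC`, `hasSum_modeD`).

*The loop integrals diverge only at `δ = 0`.* The kernel `k_ε` is dominated, uniformly in `ε`, by
a multiple of `|u|⁻²` with a Gaussian cutoff. For `δ ≠ 0` the loop integral converges as `ε → 0⁺`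
and costs at most a factor `1 + ln(1 + 1/|δ|)` (`logW`). For `δ = 0` it equals
`P(0) ∫ k_ε² + finite`, since `P` is Lipschitz at the origin, and by the semigroup law `∫ k_ε²` is
an elementary double integral over `β₁, β₂ > ε`, which equals `(4π²)⁻¹ ln(1/ε)` up to a convergent
term (`exists_tendsto_loopConst_sub_log`). Provided that the factors `ln(1/|δ|)` grow at most
polynomially along the lattice (`LogBound`), dominated convergence sums these asymptotics: the
divergence is the sum of the values `P(0)` over the resonant modes, those with `δ = 0`
(`hasLogDivergence_tsum_loopInt`, `hasLogDivergence_graphC`, `hasLogDivergence_graphD`).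

*Arithmetic.* The components of `δ` are multiples of numbers `nθ - m`. Under the weak Diophantine
condition `LogBound` holds and only the mode `(0, 0)` is resonant, so the divergence is the product
of the two values `⟨φ, χ⟩`, the traces of the pairings. For `θ = p/q` nonzero displacements are
bounded below and the resonant modes form a lattice `ℤ² × ℤ²`; the residues are the values
`⟨φ₁, T_x φ₂⟩⟨φ₃, T_{-x} φ₄⟩` for `x ∈ (p/√2)(ℤ² + iℤ²)` (`resonanceSum`). Inversion of the Bargmann
transform (`matCoef_bargmann`) turns these into integrals of `conj(f(y)) f'(y + pk) e^{2πi q b·y}`.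
By the Chinese remainder theorem and Poisson summation the same numbers are the Fourier
coefficients of `(x, y) ↦ Tr[M₁†M₂](x, y)` (`trace_matrixField_eq`), and the sum over the resonances
is Parseval's identity for the double trace (`matrixDoubleTrace_eq`).
-/

namespace HeisenbergQFT

/-! ### Polynomial weights -/

/-- The weight `1 + ‖x‖` in which rapid decay is measured. -/
noncomputable def br {E : Type*} [SeminormedAddCommGroup E] (x : E) : ℝ := 1 + ‖x‖

section Weight

variable {E : Type*} [SeminormedAddCommGroup E]

lemma one_le_br (x : E) : 1 ≤ br x := by
  have := norm_nonneg x
  simp only [br]; linarith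

lemma br_pos (x : E) : 0 < br x := lt_of_lt_of_le one_pos (one_le_br x)

lemma norm_le_br (x : E) : ‖x‖ ≤ br x := by simp [br]

@[simp] lemma br_neg (x : E) : br (-x) = br x := by simp [br]

@[simp] lemma br_zero : br (0 : E) = 1 := by simp [br]

lemma br_add_le (x y : E) : br (x + y) ≤ br x * br y := by
  have h := norm_add_le x y
  have h1 := norm_nonneg x
  have h2 := norm_nonneg y
  simp only [br]
  nlinarith [mul_nonneg h1 h2]

lemma br_sub_le (x y : E) : br (x - y) ≤ br x * br y := by
  simpa [sub_eq_add_neg] using br_add_le x (-y)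

lemma inv_br_pow_nonneg (x : E) (N : ℕ) : 0 ≤ (br x ^ N)⁻¹ :=
  inv_nonneg.2 (pow_nonneg (br_pos x).le N)

lemma inv_br_pow_le_one (x : E) (N : ℕ) : (br x ^ N)⁻¹ ≤ 1 :=
  inv_le_one_of_one_le₀ (one_le_pow₀ (one_le_br x))

lemma inv_br_pow_anti (x : E) {M N : ℕ} (h : M ≤ N) : (br x ^ N)⁻¹ ≤ (br x ^ M)⁻¹ :=
  inv_anti₀ (pow_pos (br_pos x) M) (pow_le_pow_right₀ (one_le_br x) h)

lemma inv_br_pow_mul_le (x y : E) (N : ℕ) :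
    (br x ^ N)⁻¹ * (br y ^ N)⁻¹ ≤ (br (x + y) ^ N)⁻¹ := by
  rw [← mul_inv, ← mul_pow]
  exact inv_anti₀ (pow_pos (br_pos _) N) (pow_le_pow_left₀ (br_pos _).le (br_add_le x y) N)

/-- Peetre's inequality in the form in which a shift is traded for powers of the weight. -/
lemma inv_br_pow_add_le (x y : E) (N : ℕ) :
    (br (x + y) ^ N)⁻¹ ≤ br x ^ N * (br y ^ N)⁻¹ := by
  have h := inv_br_pow_mul_le (-x) (x + y) N
  rw [neg_add_cancel_left, br_neg] at h
  have hx := pow_pos (br_pos x) N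
  calc (br (x + y) ^ N)⁻¹ = br x ^ N * ((br x ^ N)⁻¹ * (br (x + y) ^ N)⁻¹) := by
        field_simp
    _ ≤ _ := by gcongr

lemma inv_br_pow_smul_add_le [NormedSpace ℝ E] {r : ℝ} (h0 : 0 ≤ r) (h1 : r ≤ 1) (x y : E)
    (N : ℕ) : (br (r • x + y) ^ N)⁻¹ ≤ br x ^ N * (br y ^ N)⁻¹ := by
  refine (inv_br_pow_add_le (r • x) y N).trans ?_
  have : br (r • x) ≤ br x := by
    simp only [br, norm_smul, Real.norm_of_nonneg h0]
    nlinarith [norm_nonneg x]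
  gcongr
  · exact inv_br_pow_nonneg y N
  · exact (br_pos _).le

end Weight

/-- A Gaussian beats every power of the weight. -/
lemma exists_br_pow_mul_exp_le (E : Type*) [SeminormedAddCommGroup E] {c : ℝ} (hc : 0 < c)
    (K : ℕ) : ∃ C : ℝ, 0 < C ∧ ∀ x : E, br x ^ K * Real.exp (-c * ‖x‖ ^ 2) ≤ C := by
  refine ⟨Real.exp (K ^ 2 / c), Real.exp_pos _, fun x => ?_⟩
  have h1 : br x ^ K ≤ Real.exp (K * ‖x‖) := by
    rw [Real.exp_nat_mul]
    exact pow_le_pow_left₀ (br_pos x).le (by simpa [br, add_comm] using Real.add_one_le_exp ‖x‖) K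
  calc br x ^ K * Real.exp (-c * ‖x‖ ^ 2)
      ≤ Real.exp (K * ‖x‖) * Real.exp (-c * ‖x‖ ^ 2) := by gcongr
    _ = Real.exp (K * ‖x‖ + -c * ‖x‖ ^ 2) := by rw [Real.exp_add]
    _ ≤ _ := by
        apply Real.exp_le_exp.2
        rw [le_div_iff₀ hc]
        nlinarith [sq_nonneg (K - c * ‖x‖), sq_nonneg (c * ‖x‖), sq_nonneg (K : ℝ)]

lemma integrable_inv_br_pow {E : Type*} [NormedAddCommGroup E] [NormedSpace ℝ E]
    [FiniteDimensional ℝ E] [MeasurableSpace E] [BorelSpace E] (μ : Measure E)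
    [μ.IsAddHaarMeasure] {N : ℕ} (h : Module.finrank ℝ E < N) :
    Integrable (fun x : E => (br x ^ N)⁻¹) μ := by
  have := integrable_one_add_norm (E := E) (μ := μ) (r := (N : ℝ)) (by exact_mod_cast h)
  refine this.congr (Eventually.of_forall fun x => ?_)
  have h0 : 0 ≤ 1 + ‖x‖ := by positivity
  simp only [br]
  rw [Real.rpow_neg h0, Real.rpow_natCast]

lemma finrank_C2 : Module.finrank ℝ C2 = 4 := by
  rw [Module.finrank_pi_fintype]
  simp [Complex.finrank_real_complex]

lemma integrable_inv_br_pow_C2 {N : ℕ} (h : 5 ≤ N) :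
    Integrable (fun x : C2 => (br x ^ N)⁻¹) :=
  integrable_inv_br_pow volume (by rw [finrank_C2]; omega)

lemma normSq2_nonneg (z : C2) : 0 ≤ normSq2 z := Finset.sum_nonneg fun _ _ => sq_nonneg _

lemma norm_sq_le_normSq2 (z : C2) : ‖z‖ ^ 2 ≤ normSq2 z := by
  obtain ⟨j, hj⟩ : ∃ j, ‖z‖ = ‖z j‖ := by
    obtain ⟨j, -, hj⟩ := Finset.exists_max_image Finset.univ (fun j => ‖z j‖) ⟨0, by simp⟩
    exact ⟨j, le_antisymm ((pi_norm_le_iff_of_nonneg (norm_nonneg _)).2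
      fun i => hj i (Finset.mem_univ i)) (norm_le_pi_norm z j)⟩
  rw [hj]
  exact Finset.single_le_sum (f := fun j => ‖z j‖ ^ 2) (fun _ _ => sq_nonneg _)
    (Finset.mem_univ j)

lemma continuous_normSq2 : Continuous normSq2 := by
  unfold normSq2; fun_prop

lemma normSq2_smul (c : ℂ) (z : C2) : normSq2 (c • z) = ‖c‖ ^ 2 * normSq2 z := by
  simp [normSq2, mul_pow, mul_add]

@[simp] lemma normSq2_neg (z : C2) : normSq2 (-z) = normSq2 z := by simp [normSq2]

lemma integrable_exp_neg_normSq2 {c : ℝ} (hc : 0 < c) :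
    Integrable (fun z : C2 => Real.exp (-c * normSq2 z)) := by
  obtain ⟨C, hC, h⟩ := exists_br_pow_mul_exp_le C2 hc 5
  refine ((integrable_inv_br_pow_C2 le_rfl).const_mul C).mono'
    (Continuous.aestronglyMeasurable (by have := continuous_normSq2; fun_prop))
    (Eventually.of_forall fun z => ?_)
  rw [Real.norm_of_nonneg (Real.exp_pos _).le, ← div_eq_mul_inv,
    le_div_iff₀ (pow_pos (br_pos z) 5), mul_comm]
  refine le_trans ?_ (h z)
  have := norm_sq_le_normSq2 z
  have := pow_pos (br_pos z) 5
  gcongr ?_ * Real.exp ?_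
  nlinarith

/-! ### Summability over the lattices -/

lemma summable_inv_br_pow_int2 {N : ℕ} (h : 3 ≤ N) :
    Summable (fun n : Fin 2 → ℤ => (br n ^ N)⁻¹) := by
  have h2 := EisensteinSeries.summable_one_div_norm_rpow (k := (N : ℝ))
    (by exact_mod_cast (by omega : 2 < N))
  refine Summable.of_norm_bounded_eventually h2 ?_
  refine (Set.finite_singleton (0 : Fin 2 → ℤ)).subset fun n hn => ?_
  by_contra hne
  apply hn
  have hpos : 0 < ‖n‖ := norm_pos_iff.2 hne
  show ‖(br n ^ N)⁻¹‖ ≤ ‖n‖ ^ (-(N : ℝ))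
  rw [Real.norm_of_nonneg (inv_br_pow_nonneg n N), Real.rpow_neg hpos.le, Real.rpow_natCast]
  exact inv_anti₀ (pow_pos hpos N) (pow_le_pow_left₀ hpos.le (norm_le_br n) N)

lemma br_fst_mul_br_snd_le (g : LatIdx) : br g.1 * br g.2 ≤ br g ^ 2 := by
  have h1 : br g.1 ≤ br g := by simpa [br] using norm_fst_le g
  have h2 : br g.2 ≤ br g := by simpa [br] using norm_snd_le g
  nlinarith [br_pos g.1, br_pos g.2, br_pos g]

lemma summable_inv_br_pow_latIdx {N : ℕ} (h : 6 ≤ N) :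
    Summable (fun g : LatIdx => (br g ^ N)⁻¹) := by
  have h3 := summable_inv_br_pow_int2 (le_refl 3)
  refine Summable.of_nonneg_of_le (fun g => inv_br_pow_nonneg g N) (fun g => ?_)
    (h3.mul_of_nonneg h3 (fun n => inv_br_pow_nonneg n 3) fun n => inv_br_pow_nonneg n 3)
  refine (inv_br_pow_anti g h).trans ?_
  rw [← mul_inv, ← mul_pow, show br g ^ 6 = (br g ^ 2) ^ 3 by ring]
  have := br_fst_mul_br_snd_le g
  exact inv_anti₀ (pow_pos (mul_pos (br_pos _) (br_pos _)) 3)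
    (pow_le_pow_left₀ (mul_pos (br_pos _) (br_pos _)).le this 3)

lemma norm_int_add_I_mul_int (m n : ℤ) :
    max |(m : ℝ)| |(n : ℝ)| ≤ ‖(m : ℂ) + Complex.I * (n : ℂ)‖ := by
  have h1 := Complex.abs_re_le_norm ((m : ℂ) + Complex.I * (n : ℂ))
  have h2 := Complex.abs_im_le_norm ((m : ℂ) + Complex.I * (n : ℂ))
  simp at h1 h2
  exact max_le h1 h2

/-- A lattice point `c(m + i n)` is at least as large as its label, up to the factor `c`. -/
lemma mul_norm_le_norm_gaussianPt {c : ℝ} (hc : 0 ≤ c) (g : LatIdx) :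
    c * ‖g‖ ≤ ‖(fun j => (c : ℂ) * ((g.1 j : ℂ) + Complex.I * (g.2 j : ℂ)) : C2)‖ := by
  set z : C2 := fun j => (c : ℂ) * ((g.1 j : ℂ) + Complex.I * (g.2 j : ℂ)) with hz
  have key (j : Fin 2) : c * max |(g.1 j : ℝ)| |(g.2 j : ℝ)| ≤ ‖z‖ := by
    refine le_trans ?_ (norm_le_pi_norm z j)
    rw [hz]
    simp only [norm_mul, Complex.norm_real, Real.norm_of_nonneg hc]
    exact mul_le_mul_of_nonneg_left (norm_int_add_I_mul_int _ _) hc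
  rcases hc.eq_or_lt with rfl | hc'
  · simp
  rw [← le_div_iff₀' hc']
  have hnn : 0 ≤ ‖z‖ / c := by positivity
  rw [Prod.norm_def]
  refine max_le ?_ ?_ <;> refine (pi_norm_le_iff_of_nonneg hnn).2 fun j => ?_ <;>
    rw [le_div_iff₀' hc', Int.norm_eq_abs] <;>
    refine le_trans (mul_le_mul_of_nonneg_left ?_ hc) (key j)
  · exact le_max_left _ _
  · exact le_max_right _ _

/-- Rapid decay at the points `c(m + i n)` is rapid decay in the labels. -/
lemma exists_inv_br_gaussianPt_le {c : ℝ} (hc : 0 < c) : ∃ A : ℝ, 0 < A ∧ ∀ (g : LatIdx) (N : ℕ),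
    (br (fun j => (c : ℂ) * ((g.1 j : ℂ) + Complex.I * (g.2 j : ℂ)) : C2) ^ N)⁻¹ ≤
      A ^ N * (br g ^ N)⁻¹ := by
  refine ⟨max 1 c⁻¹, by positivity, fun g N => ?_⟩
  have h := mul_norm_le_norm_gaussianPt hc.le g
  rw [← div_eq_mul_inv, le_div_iff₀ (pow_pos (br_pos g) N), inv_mul_eq_div,
    div_le_iff₀ (pow_pos (br_pos _) N), ← mul_pow]
  refine pow_le_pow_left₀ (br_pos g).le ?_ N
  have h1 : ‖g‖ ≤ c⁻¹ * ‖(fun j => (c : ℂ) * ((g.1 j : ℂ) + Complex.I * (g.2 j : ℂ)) : C2)‖ := by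
    rw [inv_mul_eq_div, le_div_iff₀' hc]; exact h
  simp only [br]
  rw [mul_add, mul_one]
  refine add_le_add (le_max_left _ _) (h1.trans ?_)
  gcongr
  exact le_max_right _ _

lemma exists_inv_br_latPt_le {θ : ℝ} (hθ : 0 < θ) : ∃ A : ℝ, 0 < A ∧ ∀ (g : LatIdx) (N : ℕ),
    (br (latPt θ g) ^ N)⁻¹ ≤ A ^ N * (br g ^ N)⁻¹ :=
  exists_inv_br_gaussianPt_le (c := θ / Real.sqrt 2) (by positivity)

lemma exists_inv_br_dualPt_le : ∃ A : ℝ, 0 < A ∧ ∀ (g : LatIdx) (N : ℕ),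
    (br (dualPt g) ^ N)⁻¹ ≤ A ^ N * (br g ^ N)⁻¹ :=
  exists_inv_br_gaussianPt_le (c := 1 / Real.sqrt 2) (by positivity)

/-! ### Poisson summation on `ℝ^ι` -/

section Poisson

variable {ι : Type*} [Fintype ι]

/-- The half-open unit cube `(0,1]^ι`. -/
def unitCube (ι : Type*) : Set (ι → ℝ) := {x | ∀ i, x i ∈ Set.Ioc (0 : ℝ) (0 + 1)}

/-- An integer vector as a real vector. -/
def intVec (n : ι → ℤ) : ι → ℝ := fun i => (n i : ℝ)

/-- The character `x ↦ exp(2πi m·x)` of `ℝ^ι`. -/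
noncomputable def expChar (m : ι → ℤ) (x : ι → ℝ) : ℂ :=
  Complex.exp (2 * Real.pi * Complex.I * ∑ i, (m i : ℂ) * (x i : ℂ))

lemma norm_expChar (m : ι → ℤ) (x : ι → ℝ) : ‖expChar m x‖ = 1 := by
  have : (2 * Real.pi * Complex.I * ∑ i, (m i : ℂ) * (x i : ℂ) : ℂ) =
      ((2 * Real.pi * ∑ i, (m i : ℝ) * x i : ℝ) : ℂ) * Complex.I := by push_cast; ring
  rw [expChar, this, Complex.norm_exp_ofReal_mul_I]

lemma continuous_expChar (m : ι → ℤ) : Continuous (expChar m) := by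
  unfold expChar; fun_prop

lemma expChar_add_intVec (m n : ι → ℤ) (x : ι → ℝ) :
    expChar m (x + intVec n) = expChar m x := by
  have : (2 * Real.pi * Complex.I * ∑ i, (m i : ℂ) * ((x + intVec n) i : ℂ) : ℂ) =
      2 * Real.pi * Complex.I * ∑ i, (m i : ℂ) * (x i : ℂ) +
        ((∑ i, m i * n i : ℤ) : ℂ) * (2 * Real.pi * Complex.I) := by
    simp only [Pi.add_apply, intVec]
    push_cast
    simp only [mul_add, Finset.sum_add_distrib]
    ring
  rw [expChar, this, Complex.exp_add, Complex.exp_int_mul_two_pi_mul_I, mul_one, expChar]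

lemma expChar_add (m n : ι → ℤ) (x : ι → ℝ) :
    expChar (m + n) x = expChar m x * expChar n x := by
  simp only [expChar, ← Complex.exp_add, ← mul_add, ← Finset.sum_add_distrib]
  congr 2
  refine Finset.sum_congr rfl fun i _ => ?_
  simp only [Pi.add_apply]; push_cast; ring

lemma mFourier_coe (m : ι → ℤ) (x : ι → ℝ) :
    UnitAddTorus.mFourier m (fun i => (x i : UnitAddCircle)) = expChar m x := by
  simp only [UnitAddTorus.mFourier, ContinuousMap.coe_mk, fourier_coe_apply, expChar,
    ← Complex.exp_sum, Finset.mul_sum]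
  congr 1
  refine Finset.sum_congr rfl fun i _ => ?_
  push_cast; ring

lemma measurableSet_unitCube : MeasurableSet (unitCube ι) := by
  have : unitCube ι = Set.univ.pi fun _ => Set.Ioc (0 : ℝ) (0 + 1) := by
    ext x; simp [unitCube]
  rw [this]
  exact MeasurableSet.univ_pi fun _ => measurableSet_Ioc

/-- Unfolding: the integral over `ℝ^ι` is the sum of the integrals over the unit cubes. -/
lemma hasSum_integral_unitCube {G : (ι → ℝ) → ℂ} (hG : Integrable G) :
    HasSum (fun n : ι → ℤ => ∫ x in unitCube ι, G (x + intVec n)) (∫ x, G x) := by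
  set s : (ι → ℤ) → Set (ι → ℝ) := fun n => (fun x => x + intVec (-n)) ⁻¹' unitCube ι with hs
  have hmem (n : ι → ℤ) (x : ι → ℝ) : x ∈ s n ↔ ∀ i, ⌈x i⌉ = n i + 1 := by
    simp only [hs, Set.mem_preimage, unitCube, Set.mem_ofPred_eq, Set.mem_Ioc, intVec,
      Pi.add_apply, Pi.neg_apply, Int.ceil_eq_iff]
    refine forall_congr' fun i => ?_
    push_cast
    constructor <;> rintro ⟨h1, h2⟩ <;> constructor <;> linarith
  have hU : ⋃ n, s n = Set.univ := by
    refine Set.eq_univ_of_forall fun x => Set.mem_iUnion.2 ⟨fun i => ⌈x i⌉ - 1, ?_⟩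
    rw [hmem]; intro i; ring
  have hd : Pairwise (Function.onFun Disjoint s) := by
    intro m n hmn
    refine Set.disjoint_left.2 fun x hx hy => hmn (funext fun i => ?_)
    have h1 := (hmem m x).1 hx i
    have h2 := (hmem n x).1 hy i
    omega
  have hm (n) : MeasurableSet (s n) :=
    measurableSet_unitCube.preimage (measurable_id.add_const _)
  have h := hasSum_integral_iUnion (f := G) (μ := volume) hm hd hG.integrableOn
  rw [hU, Measure.restrict_univ] at h
  refine h.congr_fun fun n => ?_
  have hp := (measurePreserving_add_right (volume : Measure (ι → ℝ))
    (intVec (-n))).setIntegral_preimage_emb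
    (measurableEmbedding_addRight _) (fun x => G (x + intVec n)) (unitCube ι)
  rw [← hp]
  refine setIntegral_congr_fun (hm n) fun x _ => ?_
  congr 1
  ext i; simp [intVec]

/-- The Fourier transform of `F` at the integer point `m`. -/
noncomputable def fourierInt (F : (ι → ℝ) → ℂ) (m : ι → ℤ) : ℂ := ∫ x, F x * expChar (-m) x

variable {F : (ι → ℝ) → ℂ} {N : ℕ} {C : ℝ}

lemma br_intVec (n : ι → ℤ) : br (intVec n) = br n := by
  have : ‖intVec n‖ = ‖n‖ := by
    simp only [Pi.norm_def, intVec]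
    norm_cast
  rw [br, br, this]

lemma norm_translate_le (hC : ∀ x, ‖F x‖ ≤ C * (br x ^ N)⁻¹) (x : ι → ℝ) (n : ι → ℤ) :
    ‖F (x + intVec n)‖ ≤ C * (br x ^ N * (br n ^ N)⁻¹) := by
  have hC0 : 0 ≤ C := by
    have := (norm_nonneg _).trans (hC 0)
    simpa using this
  refine (hC _).trans (mul_le_mul_of_nonneg_left ?_ hC0)
  rw [← br_intVec n]
  exact inv_br_pow_add_le x (intVec n) N

lemma continuous_periodization (hF : Continuous F) (hC : ∀ x, ‖F x‖ ≤ C * (br x ^ N)⁻¹)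
    (hN : Summable fun n : ι → ℤ => (br n ^ N)⁻¹) :
    Continuous fun x => ∑' n : ι → ℤ, F (x + intVec n) := by
  have hC0 : 0 ≤ C := by
    have := (norm_nonneg _).trans (hC 0)
    simpa using this
  rw [continuous_iff_continuousAt]
  intro x
  have : ContinuousOn (fun x => ∑' n : ι → ℤ, F (x + intVec n)) (Metric.ball x 1) := by
    refine continuousOn_tsum (u := fun n => C * ((br x * 2) ^ N * (br n ^ N)⁻¹))
      (fun n => (hF.comp (continuous_id.add continuous_const)).continuousOn)
      ((hN.mul_left _).mul_left _) fun n y hy => (norm_translate_le hC y n).trans ?_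
    have hy' : br y ≤ br x * 2 := by
      have h1 : ‖y‖ ≤ ‖x‖ + 1 := by
        have := norm_le_norm_add_norm_sub x y
        rw [Metric.mem_ball, dist_eq_norm] at hy
        rw [norm_sub_rev] at this
        linarith
      simp only [br]
      nlinarith [norm_nonneg x]
    have := inv_br_pow_nonneg n N
    have := (br_pos y).le
    gcongr
  exact this.continuousAt (Metric.ball_mem_nhds x one_pos)

lemma periodization_add_intVec {ι : Type*} {F : (ι → ℝ) → ℂ} (x : ι → ℝ) (k : ι → ℤ) :
    ∑' n : ι → ℤ, F (x + intVec k + intVec n) = ∑' n : ι → ℤ, F (x + intVec n) := by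
  rw [← (Equiv.addLeft k).tsum_eq (fun n => F (x + intVec n))]
  refine tsum_congr fun n => ?_
  congr 1
  ext i; simp [intVec, add_assoc]

lemma norm_le_one_of_mem_unitCube {x : ι → ℝ} (hx : x ∈ unitCube ι) : ‖x‖ ≤ 1 := by
  refine (pi_norm_le_iff_of_nonneg zero_le_one).2 fun i => ?_
  have := hx i
  rw [zero_add, Set.mem_Ioc] at this
  rw [Real.norm_of_nonneg this.1.le]
  exact this.2

lemma volume_unitCube : volume (unitCube ι) = 1 := by
  have : unitCube ι = Set.univ.pi fun _ => Set.Ioc (0 : ℝ) (0 + 1) := by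
    ext x; simp [unitCube]
  rw [this, volume_pi_pi]
  simp

/-- Integrating the periodization against a character of the torus unfolds to an integral
over the whole space. -/
lemma integral_unitCube_periodization (hF : Continuous F)
    (hC : ∀ x, ‖F x‖ ≤ C * (br x ^ N)⁻¹) (hN : Summable fun n : ι → ℤ => (br n ^ N)⁻¹)
    (hI : Integrable fun x : ι → ℝ => (br x ^ N)⁻¹) (m : ι → ℤ) :
    ∫ x in unitCube ι, (∑' n : ι → ℤ, F (x + intVec n)) * expChar m x =
      ∫ x, F x * expChar m x := by
  have hC0 : 0 ≤ C := by
    have := (norm_nonneg _).trans (hC 0)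
    simpa using this
  have hG : Integrable (fun x => F x * expChar m x) := by
    refine (hI.const_mul C).mono' (hF.mul (continuous_expChar m)).aestronglyMeasurable
      (Eventually.of_forall fun x => ?_)
    rw [norm_mul, norm_expChar, mul_one]
    exact hC x
  rw [← (hasSum_integral_unitCube hG).tsum_eq]
  have hfin : volume (unitCube ι) < ⊤ := by rw [volume_unitCube]; simp
  have hb (n : ι → ℤ) : ∀ x ∈ unitCube ι, ‖F (x + intVec n) * expChar m (x + intVec n)‖ ≤
      C * (2 ^ N * (br n ^ N)⁻¹) := by
    intro x hx
    rw [norm_mul, norm_expChar, mul_one]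
    refine (norm_translate_le hC x n).trans ?_
    have h2 : br x ≤ 2 := by
      have := norm_le_one_of_mem_unitCube hx
      simp only [br]; linarith
    have := inv_br_pow_nonneg n N
    have := (br_pos x).le
    gcongr
  have hcont (n : ι → ℤ) :
      Continuous fun x : ι → ℝ => F (x + intVec n) * expChar m (x + intVec n) :=
    (hF.mul (continuous_expChar m)).comp (continuous_id.add continuous_const)
  have hint (n : ι → ℤ) : Integrable (fun x : ι → ℝ =>
      F (x + intVec n) * expChar m (x + intVec n)) (volume.restrict (unitCube ι)) :=
    Measure.integrableOn_of_bounded hfin.ne (hcont n).aestronglyMeasurable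
      ((ae_restrict_iff' measurableSet_unitCube).2 (Eventually.of_forall (hb n)))
  have hsw := hasSum_integral_of_summable_integral_norm hint ?_
  · rw [hsw.tsum_eq]
    refine setIntegral_congr_fun measurableSet_unitCube fun x _ => ?_
    simp only [expChar_add_intVec]
    rw [tsum_mul_right]
  · refine Summable.of_nonneg_of_le (fun n => by positivity) (fun n => ?_)
      ((hN.mul_left (2 ^ N)).mul_left C)
    have := norm_setIntegral_le_of_norm_le_const (f := fun x =>
      ‖F (x + intVec n) * expChar m (x + intVec n)‖) hfin
      (fun x hx => by rw [norm_norm]; exact hb n x hx)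
    rw [Real.norm_of_nonneg (integral_nonneg fun _ => norm_nonneg _)] at this
    simpa [Measure.real, volume_unitCube] using this

/-- **Poisson summation** on `ℝ^ι` for continuous functions of sufficient decay whose Fourier
transform is summable over the integer points. -/
theorem hasSum_fourierInt (hF : Continuous F)
    (hC : ∀ x, ‖F x‖ ≤ C * (br x ^ N)⁻¹) (hN : Summable fun n : ι → ℤ => (br n ^ N)⁻¹)
    (hI : Integrable fun x : ι → ℝ => (br x ^ N)⁻¹) (hs : Summable (fourierInt F))
    (x : ι → ℝ) :
    HasSum (fun m => fourierInt F m * expChar m x) (∑' n : ι → ℤ, F (x + intVec n)) := by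
  set P : (ι → ℝ) → ℂ := fun x => ∑' n : ι → ℤ, F (x + intVec n) with hP
  have hPc : Continuous P := continuous_periodization hF hC hN
  set π : (ι → ℝ) → UnitAddTorus ι := fun x i => (x i : UnitAddCircle) with hπ
  have hq : IsOpenQuotientMap π :=
    IsOpenQuotientMap.piMap fun _ => QuotientAddGroup.isOpenQuotientMap_mk
  have hfac (x y : ι → ℝ) (h : π x = π y) : P x = P y := by
    have hk (i : ι) : ∃ k : ℤ, y i = x i + k := by
      have h1 : (x i : UnitAddCircle) = (y i : UnitAddCircle) := congrFun h i
      obtain ⟨k, hk⟩ := (AddCircle.coe_eq_zero_iff 1).1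
        (by rw [AddCircle.coe_sub, h1, sub_self] : ((y i - x i : ℝ) : UnitAddCircle) = 0)
      exact ⟨k, by simp at hk; linarith⟩
    choose k hk using hk
    have hy : y = x + intVec k := funext hk
    rw [hy, hP]
    exact (periodization_add_intVec x k).symm
  let Q : C(UnitAddTorus ι, ℂ) :=
    Topology.IsQuotientMap.lift (f := ⟨π, hq.continuous⟩) hq.isQuotientMap ⟨P, hPc⟩
      fun a b hab => hfac a b hab
  have hQ (x : ι → ℝ) : Q (π x) = P x :=
    DFunLike.congr_fun (Topology.IsQuotientMap.lift_comp (f := ⟨π, hq.continuous⟩)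
      hq.isQuotientMap ⟨P, hPc⟩
      fun a b hab => hfac a b hab) x
  have hcoef : UnitAddTorus.mFourierCoeff (⇑Q) = fourierInt F := by
    funext m
    rw [UnitAddTorus.mFourierCoeff_eq_integral _ _ 0, fourierInt,
      ← integral_unitCube_periodization hF hC hN hI (-m)]
    refine setIntegral_congr_fun measurableSet_unitCube fun x _ => ?_
    have h1 := hQ x
    simp only [hπ] at h1
    simp only [smul_eq_mul]
    rw [h1, mFourier_coe, mul_comm]
  have := UnitAddTorus.hasSum_mFourier_series_apply_of_summable (f := Q)
    (by rw [hcoef]; exact hs) (π x)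
  rw [hQ, hcoef] at this
  simpa only [hπ, mFourier_coe, smul_eq_mul] using this

end Poisson

/-! ### Real coordinates, Poisson summation and Fourier inversion on `ℂ²` -/

/-- The measurable identification `(a, b) ↦ a + i b` of `ℝ² × ℝ²` with `ℂ²`. -/
noncomputable def complexify : ((Fin 2 → ℝ) × (Fin 2 → ℝ)) ≃ᵐ C2 :=
  (MeasurableEquiv.arrowProdEquivProdArrow ℝ ℝ (Fin 2)).symm.trans
    (MeasurableEquiv.piCongrRight fun _ => Complex.measurableEquivRealProd.symm)

lemma complexify_apply (p : (Fin 2 → ℝ) × (Fin 2 → ℝ)) (j : Fin 2) :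
    complexify p j = (p.1 j : ℂ) + Complex.I * (p.2 j : ℂ) := by
  have : complexify p j = ⟨p.1 j, p.2 j⟩ := rfl
  rw [this]
  apply Complex.ext <;> simp

lemma measurePreserving_complexify : MeasurePreserving complexify :=
  (volume_measurePreserving_arrowProdEquivProdArrow ℝ ℝ (Fin 2)).symm.trans
    (volume_preserving_pi fun _ => Complex.volume_preserving_equiv_real_prod.symm)

/-- The real coordinates of `ℂ²`, real parts first. -/
abbrev Idx4 : Type := Fin 2 ⊕ Fin 2

/-- The measurable identification of `ℝ⁴` with `ℂ²`. -/
noncomputable def complexify4 : (Idx4 → ℝ) ≃ᵐ C2 :=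
  (MeasurableEquiv.sumPiEquivProdPi fun _ : Idx4 => ℝ).trans complexify

lemma complexify4_apply (x : Idx4 → ℝ) (j : Fin 2) :
    complexify4 x j = (x (Sum.inl j) : ℂ) + Complex.I * (x (Sum.inr j) : ℂ) :=
  complexify_apply _ j

lemma measurePreserving_complexify4 : MeasurePreserving complexify4 :=
  (volume_measurePreserving_sumPiEquivProdPi fun _ : Idx4 => ℝ).trans measurePreserving_complexify

lemma continuous_complexify4 : Continuous complexify4 := by
  refine continuous_pi fun j => ?_
  simp only [complexify4_apply]
  fun_prop

lemma norm_le_norm_complexify4 (x : Idx4 → ℝ) : ‖x‖ ≤ ‖complexify4 x‖ := by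
  refine (pi_norm_le_iff_of_nonneg (norm_nonneg _)).2 ?_
  rintro (j | j) <;> refine le_trans ?_ (norm_le_pi_norm (complexify4 x) j) <;>
    rw [complexify4_apply]
  · simpa using Complex.abs_re_le_norm ((x (Sum.inl j) : ℂ) + Complex.I * (x (Sum.inr j) : ℂ))
  · simpa using Complex.abs_im_le_norm ((x (Sum.inl j) : ℂ) + Complex.I * (x (Sum.inr j) : ℂ))

/-- Multiplication by a complex number of modulus one preserves the volume of `ℂ²`. -/
lemma measurePreserving_circle_smul (c : Circle) :
    MeasurePreserving (fun z : C2 => (c : ℂ) • z) := by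
  have := volume_preserving_pi (ι := Fin 2) fun _ => (rotation c).measurePreserving
  convert this using 1
  ext z j
  simp [rotation_apply]

lemma integral_comp_circle_smul {E : Type*} [NormedAddCommGroup E] [NormedSpace ℝ E]
    (c : Circle) (f : C2 → E) : ∫ z, f ((c : ℂ) • z) = ∫ z, f z := by
  refine (measurePreserving_circle_smul c).integral_comp ?_ f
  have : IsUnit (c : ℂ) := (Circle.coe_ne_zero c).isUnit
  exact (Homeomorph.smulOfNeZero (c : ℂ) (Circle.coe_ne_zero c)).measurableEmbedding

/-- The symplectic form `Im ∑ⱼ conj(xⱼ) yⱼ` of `ℂ²`. -/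
noncomputable def sform (x y : C2) : ℝ := (∑ j, (starRingEnd ℂ) (x j) * y j).im

lemma sform_add_left (x y z : C2) : sform (x + y) z = sform x z + sform y z := by
  simp [sform]; ring

lemma sform_add_right (x y z : C2) : sform x (y + z) = sform x y + sform x z := by
  simp [sform]; ring

lemma sform_neg_left (x y : C2) : sform (-x) y = -sform x y := by
  simp [sform]

lemma sform_neg_right (x y : C2) : sform x (-y) = -sform x y := by
  simp [sform]

lemma sform_sub_left (x y z : C2) : sform (x - y) z = sform x z - sform y z := by
  rw [sub_eq_add_neg, sform_add_left, sform_neg_left, sub_eq_add_neg]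

lemma sform_sub_right (x y z : C2) : sform x (y - z) = sform x y - sform x z := by
  rw [sub_eq_add_neg, sform_add_right, sform_neg_right, sub_eq_add_neg]

lemma sform_comm (x y : C2) : sform x y = -sform y x := by
  simp [sform]; ring

lemma sform_self (x : C2) : sform x x = 0 := by
  have := sform_comm x x; linarith

@[simp] lemma sform_zero_left (x : C2) : sform 0 x = 0 := by simp [sform]

@[simp] lemma sform_zero_right (x : C2) : sform x 0 = 0 := by simp [sform]

lemma sform_smul_left (r : ℝ) (x y : C2) : sform (r • x) y = r * sform x y := by
  simp [sform]; ring

lemma continuous_sform : Continuous fun p : C2 × C2 => sform p.1 p.2 := by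
  unfold sform; fun_prop

lemma abs_sform_le (x y : C2) : |sform x y| ≤ 2 * (‖x‖ * ‖y‖) := by
  refine (Complex.abs_im_le_norm _).trans ((norm_sum_le _ _).trans ?_)
  rw [Fin.sum_univ_two]
  simp only [norm_mul, RCLike.norm_conj]
  have h (j) : ‖x j‖ * ‖y j‖ ≤ ‖x‖ * ‖y‖ :=
    mul_le_mul (norm_le_pi_norm x j) (norm_le_pi_norm y j) (norm_nonneg _) (norm_nonneg _)
  linarith [h 0, h 1]

/-- A phase `exp(i t)`. -/
noncomputable def phase (t : ℝ) : ℂ := Complex.exp ((t : ℂ) * Complex.I)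

@[simp] lemma norm_phase (t : ℝ) : ‖phase t‖ = 1 := Complex.norm_exp_ofReal_mul_I t

lemma phase_add (s t : ℝ) : phase (s + t) = phase s * phase t := by
  rw [phase, phase, phase, ← Complex.exp_add]; congr 1; push_cast; ring

@[simp] lemma phase_zero : phase 0 = 1 := by simp [phase]

lemma continuous_phase : Continuous phase := by unfold phase; fun_prop

lemma norm_phase_sub_le (s t : ℝ) : ‖phase s - phase t‖ ≤ |s - t| := by
  have h := Real.norm_exp_I_mul_ofReal_sub_one_le (x := s - t)
  have : phase s - phase t = phase t * (Complex.exp (Complex.I * ((s - t : ℝ) : ℂ)) - 1) := by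
    rw [mul_sub, mul_one, phase, phase, ← Complex.exp_add]
    congr 2; push_cast; ring
  rw [this, norm_mul, norm_phase, one_mul]
  simpa using h

/-- The symplectic Fourier transform `w ↦ ∫ f(s) exp(2iω B(w,s)) ds` on `ℂ²`. -/
noncomputable def sympFourier (ω : ℝ) (f : C2 → ℂ) (w : C2) : ℂ :=
  ∫ s, f s * phase (2 * ω * sform w s)

lemma continuous_sympFourier (ω : ℝ) {f : C2 → ℂ} (hf : Integrable f) :
    Continuous (sympFourier ω f) := by
  refine continuous_of_dominated (bound := fun s => ‖f s‖) (fun w => ?_) (fun w => ?_) hf.norm ?_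
  · refine hf.1.mul (Continuous.aestronglyMeasurable ?_)
    exact continuous_phase.comp
      (continuous_const.mul (continuous_sform.comp (continuous_const.prodMk continuous_id)))
  · exact Eventually.of_forall fun s => by rw [norm_mul, norm_phase, mul_one]
  · refine Eventually.of_forall fun s => continuous_const.mul (continuous_phase.comp
      (continuous_const.mul (continuous_sform.comp (continuous_id.prodMk continuous_const))))

open scoped FourierTransform in
/-- Fourier inversion for the symplectic Fourier transform of `ℂ²`. -/
theorem integral_sympFourier_mul_phase {ω : ℝ} (hω : 0 < ω) {f : C2 → ℂ} (hf : Continuous f)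
    (hfi : Integrable f) (hft : Integrable (sympFourier ω f)) (σ : C2) :
    ∫ w, sympFourier ω f w * phase (-(2 * ω * sform w σ)) =
      (((Real.pi / ω) ^ 4 : ℝ) : ℂ) * f σ := by
  let E : EuclideanSpace ℝ Idx4 ≃ᵐ C2 := (MeasurableEquiv.toLp 2 (Idx4 → ℝ)).symm.trans complexify4
  have hE : MeasurePreserving E :=
    (EuclideanSpace.volume_preserving_symm_measurableEquiv_toLp Idx4).trans
      measurePreserving_complexify4
  have hEc : Continuous E :=
    continuous_complexify4.comp (PiLp.continuous_ofLp 2 _)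
  have hEa (x : EuclideanSpace ℝ Idx4) (j : Fin 2) :
      E x j = (x (Sum.inl j) : ℂ) + Complex.I * (x (Sum.inr j) : ℂ) :=
    complexify4_apply _ j
  set F : EuclideanSpace ℝ Idx4 → ℂ := fun x => f (E x) with hF
  have hFi : Integrable F := (hE.integrable_comp_emb E.measurableEmbedding).2 hfi
  have hpi := Real.pi_pos
  -- the frequency variable `ξ` corresponds to the point `(π/ω) i E(ξ)` of `ℂ²`
  set W : EuclideanSpace ℝ Idx4 → C2 := fun ξ => (Real.pi / ω) • (Complex.I • E ξ) with hW
  have hB (ξ x : EuclideanSpace ℝ Idx4) :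
      2 * ω * sform (W ξ) (E x) = -2 * Real.pi * inner ℝ x ξ := by
    have hin : inner ℝ x ξ = x (Sum.inl 0) * ξ (Sum.inl 0) + x (Sum.inl 1) * ξ (Sum.inl 1) +
        (x (Sum.inr 0) * ξ (Sum.inr 0) + x (Sum.inr 1) * ξ (Sum.inr 1)) := by
      simp [PiLp.inner_apply, Fintype.sum_sum_type, Fin.sum_univ_two, mul_comm]
    rw [hW, sform_smul_left, hin]
    simp only [sform, Pi.smul_apply, hEa, Fin.sum_univ_two]
    simp
    field_simp
    ring
  have hFT (ξ : EuclideanSpace ℝ Idx4) : 𝓕 F ξ = sympFourier ω f (W ξ) := by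
    rw [Real.fourier_eq', sympFourier, ← hE.integral_comp E.measurableEmbedding]
    refine integral_congr_ae (Eventually.of_forall fun x => ?_)
    simp only [hB, phase, smul_eq_mul, hF]
    rw [mul_comm]
  have hcv {G : C2 → ℂ} : ∫ w, G w = (((Real.pi / ω) ^ 4 : ℝ) : ℂ) * ∫ ξ, G (W ξ) := by
    have h1 : ∫ ξ, G (W ξ) = ∫ z, G ((Real.pi / ω) • (Complex.I • z)) :=
      hE.integral_comp E.measurableEmbedding fun z => G ((Real.pi / ω) • (Complex.I • z))
    have h3 : ∫ z : C2, G ((Real.pi / ω) • (Complex.I • z)) = ∫ z, G ((Real.pi / ω) • z) :=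
      integral_comp_circle_smul ⟨Complex.I, by simp [Submonoid.unitSphere]⟩
        fun z => G ((Real.pi / ω) • z)
    rw [h1, h3, Measure.integral_comp_smul, finrank_C2, abs_of_pos (by positivity),
      Complex.real_smul, ← mul_assoc, ← Complex.ofReal_mul, mul_inv_cancel₀ (by positivity),
      Complex.ofReal_one, one_mul]
  have hWi : Integrable (fun ξ => sympFourier ω f (W ξ)) := by
    have h1 : Integrable (fun z : C2 => sympFourier ω f ((Real.pi / ω) • z)) :=
      hft.comp_smul (by positivity)
    have h2 := (measurePreserving_circle_smul
      ⟨Complex.I, by simp [Submonoid.unitSphere]⟩).integrable_comp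
      h1.aestronglyMeasurable |>.2 h1
    exact (hE.integrable_comp h2.aestronglyMeasurable).2 h2
  have hinv := hFi.fourierInv_fourier_eq (by
    refine hWi.congr (Eventually.of_forall fun ξ => (hFT ξ).symm)) (v := E.symm σ)
    (hf.comp hEc).continuousAt
  have hFσ : F (E.symm σ) = f σ := by simp only [hF, E.apply_symm_apply]
  rw [hFσ] at hinv
  rw [hcv, ← hinv, Real.fourierInv_eq']
  congr 1
  refine integral_congr_ae (Eventually.of_forall fun ξ => ?_)
  have h1 := hB ξ (E.symm σ)
  rw [E.apply_symm_apply] at h1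
  simp only [smul_eq_mul, hFT]
  rw [h1, phase, mul_comm, real_inner_comm]
  congr 3
  push_cast; ring

/-! ### Poisson summation over `Γ` -/

lemma re_cdot_dualPt (d : LatIdx) (z : C2) :
    (cdot (fun j => (starRingEnd ℂ) (dualPt d j)) z).re = sform z (Complex.I • dualPt d) := by
  simp [cdot, sform]; ring

lemma poissonMode_eq (θ : ℝ) (f : C2 → ℂ) (d : LatIdx) :
    poissonMode θ f d = ((4 / θ ^ 4 : ℝ) : ℂ) *
      ∫ w, f w * phase (-(2 * freq θ * sform w (Complex.I • dualPt d))) := by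
  rw [poissonMode]
  congr 1
  refine integral_congr_ae (Eventually.of_forall fun w => ?_)
  simp only [re_cdot_dualPt, phase]
  congr 2
  push_cast; ring

lemma summable_inv_br_pow_idx4 {N : ℕ} (h : 6 ≤ N) :
    Summable fun n : Idx4 → ℤ => (br n ^ N)⁻¹ := by
  rw [← (Equiv.sumArrowEquivProdArrow (Fin 2) (Fin 2) ℤ).symm.summable_iff]
  refine Summable.of_nonneg_of_le (fun g => inv_br_pow_nonneg _ N) (fun g => ?_)
    (summable_inv_br_pow_latIdx h)
  refine inv_anti₀ (pow_pos (br_pos _) N) (pow_le_pow_left₀ (br_pos _).le ?_ N)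
  refine add_le_add le_rfl (max_le ?_ ?_) <;>
    refine (pi_norm_le_iff_of_nonneg (norm_nonneg _)).2 fun j => ?_
  · exact norm_le_pi_norm ((Equiv.sumArrowEquivProdArrow (Fin 2) (Fin 2) ℤ).symm g) (Sum.inl j)
  · exact norm_le_pi_norm ((Equiv.sumArrowEquivProdArrow (Fin 2) (Fin 2) ℤ).symm g) (Sum.inr j)

/-- Poisson summation over the lattice `Γ ⊂ ℂ²`. -/
theorem hasSum_poissonMode {θ : ℝ} (hθ : 0 < θ) {F : C2 → ℂ} (hF : Continuous F) {C : ℝ} {N : ℕ}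
    (hN : 6 ≤ N) (hC : ∀ z, ‖F z‖ ≤ C * (br z ^ N)⁻¹) (hs : Summable (poissonMode θ F)) :
    HasSum (poissonMode θ F) (∑' g, F (latPt θ g)) := by
  have hC0 : 0 ≤ C := by
    have := (norm_nonneg _).trans (hC 0)
    simpa using this
  set c : ℝ := θ / Real.sqrt 2 with hc
  have hcpos : 0 < c := by positivity
  set G : (Idx4 → ℝ) → ℂ := fun x => F (c • complexify4 x) with hG
  let e := (Equiv.sumArrowEquivProdArrow (Fin 2) (Fin 2) ℤ)
  have hlat (n : Idx4 → ℤ) : G (intVec n) = F (latPt θ (e n)) := by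
    simp only [hG]
    congr 1
    ext j
    simp only [Pi.smul_apply, complexify4_apply, latPt, intVec, e, hc, Complex.real_smul,
      Equiv.sumArrowEquivProdArrow_apply_fst, Equiv.sumArrowEquivProdArrow_apply_snd]
    push_cast
    rfl
  have hmode (n : Idx4 → ℤ) : fourierInt G n = poissonMode θ F (e n) := by
    rw [poissonMode_eq]
    set H : C2 → ℂ := fun w => F w *
      phase (-(2 * freq θ * sform w (Complex.I • dualPt (e n)))) with hH
    have h1 : fourierInt G n = ∫ x, H (c • complexify4 x) := by
      refine integral_congr_ae (Eventually.of_forall fun x => ?_)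
      simp only [hG, hH]
      congr 1
      rw [expChar, phase, sform_smul_left]
      congr 1
      simp only [sform, freq, hc, complexify4_apply, dualPt, Fintype.sum_sum_type,
        Fin.sum_univ_two, e, Pi.smul_apply, Pi.neg_apply, smul_eq_mul,
        Equiv.sumArrowEquivProdArrow_apply_fst, Equiv.sumArrowEquivProdArrow_apply_snd]
      have h2 : (Real.sqrt 2) * (Real.sqrt 2) = 2 := Real.mul_self_sqrt (by norm_num)
      have h3 : Real.sqrt 2 ≠ 0 := by positivity
      apply Complex.ext <;> simp
      field_simp
      ring
    have h4 : (4 / θ ^ 4 : ℝ) = (c ^ 4)⁻¹ := by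
      rw [hc, div_pow, show (4 : ℕ) = 2 * 2 by rfl, pow_mul (Real.sqrt 2),
        Real.sq_sqrt (by norm_num)]
      field_simp
      norm_num
    rw [h1, measurePreserving_complexify4.integral_comp complexify4.measurableEmbedding
      (fun z => H (c • z)), Measure.integral_comp_smul, finrank_C2, abs_of_pos (by positivity),
      Complex.real_smul, h4]
  have hdecay (x : Idx4 → ℝ) : ‖G x‖ ≤ C * max 1 c⁻¹ ^ N * (br x ^ N)⁻¹ := by
    refine (hC _).trans ?_
    rw [mul_assoc]
    refine mul_le_mul_of_nonneg_left ?_ hC0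
    rw [← div_eq_mul_inv, le_div_iff₀ (pow_pos (br_pos x) N), inv_mul_eq_div,
      div_le_iff₀ (pow_pos (br_pos _) N), ← mul_pow]
    refine pow_le_pow_left₀ (br_pos x).le ?_ N
    have h1 : ‖x‖ ≤ c⁻¹ * ‖c • complexify4 x‖ := by
      rw [norm_smul, Real.norm_of_nonneg hcpos.le, inv_mul_cancel_left₀ hcpos.ne']
      exact norm_le_norm_complexify4 x
    simp only [br]
    rw [mul_add, mul_one]
    refine add_le_add (le_max_left _ _) (h1.trans ?_)
    gcongr
    exact le_max_right _ _
  have hGc : Continuous G := hF.comp (continuous_complexify4.const_smul c)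
  have hI : Integrable fun x : Idx4 → ℝ => (br x ^ N)⁻¹ :=
    integrable_inv_br_pow volume (by simp; omega)
  have hs' : Summable (fourierInt G) := by
    have : fourierInt G = poissonMode θ F ∘ e := funext hmode
    rw [this]
    exact e.summable_iff.2 hs
  have := hasSum_fourierInt hGc hdecay (summable_inv_br_pow_idx4 hN) hI hs' 0
  have h0 (m : Idx4 → ℤ) : expChar m (0 : Idx4 → ℝ) = 1 := by simp [expChar]
  simp only [h0, mul_one, zero_add, hlat] at this
  rw [e.tsum_eq (fun g => F (latPt θ g))] at this
  rw [← e.hasSum_iff]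
  convert this using 1
  exact (funext hmode).symm

/-! ### The projective action of `ℂ²` on Fock space -/

lemma freq_pos {θ : ℝ} (hθ : 0 < θ) : 0 < freq θ := by
  unfold freq; positivity

/-- The modulus `|φ(z)| exp(-ω|z|²/2)`, the square root of the Husimi density of `φ`. -/
noncomputable def husimi (θ : ℝ) (φ : C2 → ℂ) (z : C2) : ℝ :=
  ‖φ z‖ * Real.exp (-(freq θ * normSq2 z / 2))

lemma husimi_nonneg (θ : ℝ) (φ : C2 → ℂ) (z : C2) : 0 ≤ husimi θ φ z := by
  unfold husimi; positivity

lemma norm_eq_husimi_mul (θ : ℝ) (φ : C2 → ℂ) (z : C2) :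
    ‖φ z‖ = husimi θ φ z * Real.exp (freq θ * normSq2 z / 2) := by
  rw [husimi, mul_assoc, ← Real.exp_add, neg_add_cancel, Real.exp_zero, mul_one]

lemma continuous_cdot : Continuous fun p : C2 × C2 => cdot p.1 p.2 := by
  unfold cdot; fun_prop

lemma cdot_eq (v z : C2) : cdot v z = v 0 * z 0 + v 1 * z 1 := by
  simp [cdot]

lemma normSq2_ofReal (z : C2) :
    ((normSq2 z : ℝ) : ℂ) = cdot (fun j => (starRingEnd ℂ) (z j)) z := by
  simp only [normSq2, cdot]
  push_cast
  refine Finset.sum_congr rfl fun j _ => ?_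
  rw [mul_comm, Complex.mul_conj, Complex.normSq_eq_norm_sq]
  push_cast; ring

lemma normSq2_eq (z : C2) :
    normSq2 z = (z 0).re ^ 2 + (z 0).im ^ 2 + ((z 1).re ^ 2 + (z 1).im ^ 2) := by
  simp [normSq2, ← Complex.normSq_eq_norm_sq, Complex.normSq_apply]
  ring

lemma continuous_transl_right (θ : ℝ) (v : C2) {φ : C2 → ℂ} (hφ : Continuous φ) :
    Continuous (transl θ v φ) := by
  unfold transl cdot
  fun_prop

lemma continuous_transl_left (θ : ℝ) (z : C2) {φ : C2 → ℂ} (hφ : Continuous φ) :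
    Continuous fun v => transl θ v φ z := by
  have := continuous_normSq2
  unfold transl cdot
  fun_prop

lemma husimi_transl (θ : ℝ) (v : C2) (φ : C2 → ℂ) (z : C2) :
    husimi θ (transl θ v φ) z = husimi θ φ (z + v) := by
  rw [husimi, husimi, transl, norm_mul, Complex.norm_exp, mul_right_comm, mul_comm, ← Real.exp_add]
  congr 2
  simp only [Complex.sub_re, Complex.neg_re, Complex.ofReal_re, Complex.re_ofReal_mul,
    cdot_eq, normSq2_eq, Pi.add_apply]
  simp
  ring

/-- The cocycle of the projective representation. -/
lemma transl_transl (θ : ℝ) (a b : C2) (φ : C2 → ℂ) :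
    transl θ a (transl θ b φ) = fun z => phase (freq θ * sform a b) * transl θ (a + b) φ z := by
  funext z
  simp only [transl, phase]
  rw [← mul_assoc, ← mul_assoc, ← Complex.exp_add, ← Complex.exp_add, add_comm a b, ← add_assoc,
    add_right_comm z a b]
  congr 2
  simp only [cdot_eq, normSq2_eq, sform, Pi.add_apply, Fin.sum_univ_two, pow_two]
  apply Complex.ext <;> simp <;> ring

lemma transl_zero (θ : ℝ) (φ : C2 → ℂ) : transl θ 0 φ = φ := by
  funext z
  simp [transl, normSq2, cdot]

/-! ### Circle means and Gaussian integrals of holomorphic functions -/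

lemma circleAverage_integral_swap {α : Type*} [MeasurableSpace α] {μ : Measure α} [SFinite μ]
    {G : ℂ → α → ℂ}
    (hm : AEStronglyMeasurable (fun p : ℝ × α => G (circleMap 0 1 p.1) p.2)
      ((volume.restrict (Set.Ioc 0 (2 * Real.pi))).prod μ))
    {g : α → ℝ} (hg : Integrable g μ) (hb : ∀ (t : ℝ) x, ‖G (circleMap 0 1 t) x‖ ≤ g x) :
    Real.circleAverage (fun ζ => ∫ x, G ζ x ∂μ) 0 1 =
      ∫ x, Real.circleAverage (fun ζ => G ζ x) 0 1 ∂μ := by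
  simp only [Real.circleAverage_def, intervalIntegral.integral_of_le Real.two_pi_pos.le]
  rw [integral_smul, integral_integral_swap]
  have h1 : Integrable (fun p : ℝ × α => (1 : ℝ) * g p.2)
      ((volume.restrict (Set.Ioc 0 (2 * Real.pi))).prod μ) :=
    (integrable_const (1 : ℝ)).mul_prod hg
  refine h1.mono' hm (Eventually.of_forall fun p => ?_)
  rw [one_mul]
  exact hb p.1 p.2

lemma integral_exp_neg_normSq2 {a : ℝ} (ha : 0 < a) :
    ∫ z : C2, Real.exp (-a * normSq2 z) = (Real.pi / a) ^ 2 := by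
  have h1 (z : C2) : Real.exp (-a * normSq2 z) = ∏ j, Real.exp (-a * ‖z j‖ ^ 2) := by
    rw [← Real.exp_sum, normSq2, Finset.mul_sum]
  simp only [h1]
  rw [integral_fintype_prod_volume_eq_prod (fun (_ : Fin 2) (w : ℂ) => Real.exp (-a * ‖w‖ ^ 2))]
  have h2 := GaussianFourier.integral_rexp_neg_mul_sq_norm (V := ℂ) ha
  simp only [h2, Complex.finrank_real_complex]
  simp [div_pow]

/-- A Gaussian integral of a function whose means over the circles `|ζ| = 1` of all complex lines
equal its value at the origin. -/
lemma integral_exp_neg_normSq2_mul {a : ℝ} (ha : 0 < a) {E : C2 → ℂ} (hc : Continuous E)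
    (hint : Integrable fun u => (Real.exp (-a * normSq2 u) : ℂ) * E u)
    (hmean : ∀ u, Real.circleAverage (fun ζ => E (ζ • u)) 0 1 = E 0) :
    ∫ u, (Real.exp (-a * normSq2 u) : ℂ) * E u = (((Real.pi / a) ^ 2 : ℝ) : ℂ) * E 0 := by
  set g : C2 → ℂ := fun u => (Real.exp (-a * normSq2 u) : ℂ) * E u with hg
  have hgc : Continuous g := by
    have := continuous_normSq2
    fun_prop
  have hcirc (t : ℝ) : circleMap 0 1 t = (Circle.exp t : ℂ) := by simp [circleMap]
  have hrot (t : ℝ) : ∫ u, g (circleMap 0 1 t • u) = ∫ u, g u := by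
    rw [hcirc]; exact integral_comp_circle_smul _ g
  have hrotn (t : ℝ) : ∫ u, ‖g (circleMap 0 1 t • u)‖ = ∫ u, ‖g u‖ := by
    rw [hcirc]; exact integral_comp_circle_smul _ fun u => ‖g u‖
  have hroti (t : ℝ) : Integrable fun u => g (circleMap 0 1 t • u) := by
    rw [hcirc]
    exact ((measurePreserving_circle_smul _).integrable_comp hint.aestronglyMeasurable).2 hint
  have hprod : Integrable (fun p : ℝ × C2 => g (circleMap 0 1 p.1 • p.2))
      ((volume.restrict (Set.Ioc 0 (2 * Real.pi))).prod volume) := by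
    rw [integrable_prod_iff]
    · refine ⟨Eventually.of_forall hroti, ?_⟩
      simp only [hrotn]
      exact integrable_const _
    · refine Continuous.aestronglyMeasurable ?_
      have : Continuous (circleMap 0 1) := continuous_circleMap 0 1
      fun_prop
  have hswap : Real.circleAverage (fun ζ => ∫ u, g (ζ • u)) 0 1 =
      ∫ u, Real.circleAverage (fun ζ => g (ζ • u)) 0 1 := by
    simp only [Real.circleAverage_def, intervalIntegral.integral_of_le Real.two_pi_pos.le]
    rw [integral_smul, integral_integral_swap hprod]
  have hl : Real.circleAverage (fun ζ => ∫ u, g (ζ • u)) 0 1 = ∫ u, g u := by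
    simp only [Real.circleAverage_def, hrot]
    have := Real.pi_pos.ne'
    simp
    field_simp
  have hr (u : C2) : Real.circleAverage (fun ζ => g (ζ • u)) 0 1 =
      (Real.exp (-a * normSq2 u) : ℂ) * E 0 := by
    rw [← hmean u, Real.circleAverage_def, Real.circleAverage_def, mul_smul_comm,
      ← intervalIntegral.integral_const_mul]
    congr 2
    funext t
    simp [hg, normSq2_smul]
  rw [← hl, hswap]
  simp only [hr]
  rw [integral_mul_const, integral_complex_ofReal, integral_exp_neg_normSq2 ha]

/-- Functions in the domain of the superposition formulas below: continuous functions of the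
growth of Fock space whose products with exponentials have the mean value property over circles
in complex lines. All three properties are stable under translations and under the regularized
propagator. -/
structure FockLike (θ : ℝ) (ψ : C2 → ℂ) : Prop where
  cont : Continuous ψ
  growth : ∃ C, ∀ z, husimi θ ψ z ≤ C
  mean : ∀ (z u : C2) (c : ℂ),
    Real.circleAverage (fun ζ => ψ (z + ζ • u) * Complex.exp (c * ζ)) 0 1 = ψ z

lemma circleAverage_const_mul (c : ℂ) (f : ℂ → ℂ) :
    Real.circleAverage (fun ζ => c * f ζ) 0 1 = c * Real.circleAverage f 0 1 := by
  simpa [smul_eq_mul] using Real.circleAverage_fun_smul (𝕜 := ℂ) (a := c) (f := f) (c := 0) (R := 1)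

lemma cdot_add_smul (w z u : C2) (ζ : ℂ) : cdot w (z + ζ • u) = cdot w z + ζ * cdot w u := by
  simp [cdot_eq]; ring

lemma transl_add_smul_mul_exp (θ : ℝ) (v z u : C2) (ψ : C2 → ℂ) (c ζ : ℂ) :
    transl θ v ψ (z + ζ • u) * Complex.exp (c * ζ) =
      Complex.exp (-((freq θ * normSq2 v / 2 : ℝ) : ℂ)
        - (freq θ : ℂ) * cdot (fun j => (starRingEnd ℂ) (v j)) z) *
      (ψ (z + v + ζ • u) *
        Complex.exp ((c - freq θ * cdot (fun j => (starRingEnd ℂ) (v j)) u) * ζ)) := by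
  rw [transl, cdot_add_smul, add_right_comm z _ v, mul_right_comm, ← Complex.exp_add,
    mul_left_comm, ← Complex.exp_add, mul_comm]
  congr 2
  ring

lemma fockLike_transl {θ : ℝ} {ψ : C2 → ℂ} (h : FockLike θ ψ) (v : C2) :
    FockLike θ (transl θ v ψ) := by
  refine ⟨continuous_transl_right θ v h.cont, ?_, ?_⟩
  · obtain ⟨C, hC⟩ := h.growth
    exact ⟨C, fun z => by rw [husimi_transl]; exact hC _⟩
  · intro z u c
    simp only [transl_add_smul_mul_exp]
    rw [circleAverage_const_mul, h.mean, transl]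

/-! ### The heat semigroup as a superposition of translations -/

/-- The weight of `T_u` in `e^{-βH}`. -/
noncomputable def heatKer (θ μ₀ β : ℝ) (u : C2) : ℝ :=
  Real.exp (-β * (2 * freq θ + μ₀ ^ 2)) *
    (freq θ / (Real.pi * (1 - Real.exp (-2 * freq θ * β)))) ^ 2 *
      Real.exp (-(freq θ * (1 / (1 - Real.exp (-2 * freq θ * β)) - 1 / 2)) * normSq2 u)

/-- The weight of `T_u` in the regularized propagator `H_ε⁻¹`. -/
noncomputable def propKer (θ μ₀ ε : ℝ) (u : C2) : ℝ := ∫ β in Set.Ioi ε, heatKer θ μ₀ β u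

section Heat

variable {θ : ℝ}

lemma one_sub_exp_pos (hθ : 0 < θ) {β : ℝ} (hβ : 0 < β) :
    0 < 1 - Real.exp (-2 * freq θ * β) := by
  have := freq_pos hθ
  rw [sub_pos, Real.exp_lt_one_iff]
  have := mul_pos this hβ
  linarith

lemma one_sub_exp_le_one (β : ℝ) : 1 - Real.exp (-2 * freq θ * β) ≤ 1 := by
  have := Real.exp_pos (-2 * freq θ * β)
  linarith

lemma heatKer_nonneg (θ μ₀ β : ℝ) (u : C2) : 0 ≤ heatKer θ μ₀ β u := by
  unfold heatKer; positivity

@[simp] lemma heatKer_neg (θ μ₀ β : ℝ) (u : C2) : heatKer θ μ₀ β (-u) = heatKer θ μ₀ β u := by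
  simp [heatKer]

@[simp] lemma propKer_neg (θ μ₀ ε : ℝ) (u : C2) : propKer θ μ₀ ε (-u) = propKer θ μ₀ ε u := by
  simp [propKer]

lemma propKer_nonneg (θ μ₀ ε : ℝ) (u : C2) : 0 ≤ propKer θ μ₀ ε u :=
  integral_nonneg fun β => heatKer_nonneg θ μ₀ β u

lemma measurable_heatKer (θ μ₀ : ℝ) :
    Measurable fun p : ℝ × C2 => heatKer θ μ₀ p.1 p.2 := by
  have := continuous_normSq2.measurable
  unfold heatKer; fun_prop

lemma heatKer_le (hθ : 0 < θ) (μ₀ : ℝ) {ε β : ℝ} (hε : 0 < ε) (hβ : ε < β) (u : C2) :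
    heatKer θ μ₀ β u ≤ (freq θ / (Real.pi * (1 - Real.exp (-2 * freq θ * ε)))) ^ 2 *
      Real.exp (-(2 * freq θ + μ₀ ^ 2) * β) * Real.exp (-(freq θ / 2) * normSq2 u) := by
  have hω := freq_pos hθ
  have h1 := one_sub_exp_pos hθ hε
  have h2 := one_sub_exp_pos hθ (hε.trans hβ)
  have h3 : 1 - Real.exp (-2 * freq θ * ε) ≤ 1 - Real.exp (-2 * freq θ * β) := by
    have : Real.exp (-2 * freq θ * β) ≤ Real.exp (-2 * freq θ * ε) := by
      apply Real.exp_le_exp.2; nlinarith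
    linarith
  have h4 : 1 ≤ 1 / (1 - Real.exp (-2 * freq θ * β)) := by
    rw [le_div_iff₀ h2, one_mul]; exact one_sub_exp_le_one β
  have hn := normSq2_nonneg u
  have hpi := Real.pi_pos
  have h5 : -β * (2 * freq θ + μ₀ ^ 2) = -(2 * freq θ + μ₀ ^ 2) * β := by ring
  unfold heatKer
  rw [h5, mul_comm (Real.exp (-(2 * freq θ + μ₀ ^ 2) * β))]
  gcongr ?_ * ?_ * Real.exp ?_
  · gcongr
  · have : freq θ / 2 ≤ freq θ * (1 / (1 - Real.exp (-2 * freq θ * β)) - 1 / 2) := by nlinarith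
    nlinarith

lemma integrable_exp_neg_mul_Ioi {m : ℝ} (hm : 0 < m) (ε : ℝ) :
    Integrable (fun β : ℝ => Real.exp (-m * β)) (volume.restrict (Set.Ioi ε)) :=
  exp_neg_integrableOn_Ioi ε hm

lemma mass_pos (hθ : 0 < θ) (μ₀ : ℝ) : 0 < 2 * freq θ + μ₀ ^ 2 := by
  have := freq_pos hθ; positivity

lemma integrable_heatKer_prod (hθ : 0 < θ) (μ₀ : ℝ) {ε : ℝ} (hε : 0 < ε) :
    Integrable (fun p : ℝ × C2 => heatKer θ μ₀ p.1 p.2)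
      ((volume.restrict (Set.Ioi ε)).prod volume) := by
  have h1 := ((integrable_exp_neg_mul_Ioi (mass_pos hθ μ₀) ε).mul_prod
    (integrable_exp_neg_normSq2 (half_pos (freq_pos hθ)))).const_mul
      ((freq θ / (Real.pi * (1 - Real.exp (-2 * freq θ * ε)))) ^ 2)
  refine h1.mono' (measurable_heatKer θ μ₀).aestronglyMeasurable ?_
  have : ∀ᵐ p : ℝ × C2 ∂((volume.restrict (Set.Ioi ε)).prod volume), p.1 ∈ Set.Ioi ε :=
    Measure.quasiMeasurePreserving_fst.ae (ae_restrict_mem measurableSet_Ioi)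
  filter_upwards [this] with p hp
  rw [Real.norm_of_nonneg (heatKer_nonneg _ _ _ _), ← mul_assoc]
  exact heatKer_le hθ μ₀ hε hp p.2

/-- The constant in the Gaussian bound of `propKer`. -/
noncomputable def propBound (θ μ₀ ε : ℝ) : ℝ :=
  (freq θ / (Real.pi * (1 - Real.exp (-2 * freq θ * ε)))) ^ 2 *
    ∫ β in Set.Ioi ε, Real.exp (-(2 * freq θ + μ₀ ^ 2) * β)

lemma propBound_nonneg (θ μ₀ ε : ℝ) : 0 ≤ propBound θ μ₀ ε :=
  mul_nonneg (sq_nonneg _) (integral_nonneg fun _ => (Real.exp_pos _).le)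

lemma propKer_le (hθ : 0 < θ) (μ₀ : ℝ) {ε : ℝ} (hε : 0 < ε) (u : C2) :
    propKer θ μ₀ ε u ≤ propBound θ μ₀ ε * Real.exp (-(freq θ / 2) * normSq2 u) := by
  rw [propKer, propBound, ← integral_const_mul, ← integral_mul_const]
  refine integral_mono_of_nonneg (Eventually.of_forall fun β => heatKer_nonneg _ _ _ _)
    (((integrable_exp_neg_mul_Ioi (mass_pos hθ μ₀) ε).const_mul _).mul_const _) ?_
  filter_upwards [ae_restrict_mem measurableSet_Ioi] with β hβ
  exact heatKer_le hθ μ₀ hε hβ u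

lemma continuous_heatKer (θ μ₀ β : ℝ) : Continuous (heatKer θ μ₀ β) := by
  have := continuous_normSq2
  unfold heatKer; fun_prop

lemma continuous_propKer (hθ : 0 < θ) (μ₀ : ℝ) {ε : ℝ} (hε : 0 < ε) :
    Continuous (propKer θ μ₀ ε) := by
  refine continuous_of_dominated (bound := fun β =>
    (freq θ / (Real.pi * (1 - Real.exp (-2 * freq θ * ε)))) ^ 2 *
      Real.exp (-(2 * freq θ + μ₀ ^ 2) * β)) (fun u => ?_) (fun u => ?_)
    ((integrable_exp_neg_mul_Ioi (mass_pos hθ μ₀) ε).const_mul _)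
    (Eventually.of_forall fun β => continuous_heatKer θ μ₀ β)
  · exact ((measurable_heatKer θ μ₀).comp
      (measurable_id.prodMk measurable_const)).aestronglyMeasurable
  · filter_upwards [ae_restrict_mem measurableSet_Ioi] with β hβ
    rw [Real.norm_of_nonneg (heatKer_nonneg _ _ _ _)]
    refine (heatKer_le hθ μ₀ hε hβ u).trans (mul_le_of_le_one_right (by positivity) ?_)
    rw [Real.exp_le_one_iff]
    have := normSq2_nonneg u
    have := freq_pos hθ
    nlinarith [mul_nonneg this.le (normSq2_nonneg u)]

lemma integrable_propKer (hθ : 0 < θ) (μ₀ : ℝ) {ε : ℝ} (hε : 0 < ε) :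
    Integrable (propKer θ μ₀ ε) := by
  refine ((integrable_exp_neg_normSq2 (half_pos (freq_pos hθ))).const_mul
    (propBound θ μ₀ ε)).mono' (continuous_propKer hθ μ₀ hε).aestronglyMeasurable
    (Eventually.of_forall fun u => ?_)
  rw [Real.norm_of_nonneg (propKer_nonneg _ _ _ _)]
  exact propKer_le hθ μ₀ hε u

/-- `e^{-βH}` is a Gaussian superposition of translations. -/
theorem heat_eq_integral (hθ : 0 < θ) (μ₀ : ℝ) {β : ℝ} (hβ : 0 < β) {ψ : C2 → ℂ}
    (hψ : FockLike θ ψ) (z : C2) :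
    heat θ μ₀ β ψ z = ∫ u, (heatKer θ μ₀ β u : ℂ) * transl θ u ψ z := by
  have hω := freq_pos hθ
  set t : ℝ := 1 - Real.exp (-2 * freq θ * β) with ht
  have htp : 0 < t := one_sub_exp_pos hθ hβ
  have ht1 : t ≤ 1 := one_sub_exp_le_one β
  set a : ℝ := freq θ / t with ha
  have hap : 0 < a := by positivity
  set b : C2 := (-t) • z with hb
  set vb : C2 := fun j => (starRingEnd ℂ) (b j) with hvb
  -- after the shift by `b` the integrand has no antiholomorphic factor left
  set E : C2 → ℂ := fun u => Complex.exp (-(a : ℂ) * cdot vb u) * ψ (z + b + u) with hE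
  set K : ℂ := ((Real.exp (-β * (2 * freq θ + μ₀ ^ 2)) * (freq θ / (Real.pi * t)) ^ 2 : ℝ) : ℂ)
    with hK
  have hψc := hψ.cont
  have hEc : Continuous E := by
    have : Continuous fun u => cdot vb u := continuous_cdot.comp
      (continuous_const.prodMk continuous_id)
    fun_prop
  have hshift (u : C2) : (heatKer θ μ₀ β (u + b) : ℂ) * transl θ (u + b) ψ z =
      K * ((Real.exp (-a * normSq2 u) : ℂ) * E u) := by
    rw [heatKer, ← ht, hK, hE, transl]
    have e1 : z + (u + b) = z + b + u := by abel
    rw [e1]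
    push_cast
    simp only [mul_assoc]
    congr 2
    rw [← mul_assoc, ← mul_assoc, ← Complex.exp_add, ← Complex.exp_add]
    congr 2
    have htne : (t : ℂ) ≠ 0 := by exact_mod_cast htp.ne'
    rw [hvb, hb, ha]
    simp only [cdot_eq, normSq2_eq, Pi.add_apply, Pi.smul_apply, pow_two]
    apply Complex.ext
    · simp
      field_simp
      ring
    · simp
      field_simp
      ring
  have hbound : ∃ C, ∀ u, ‖transl θ u ψ z‖ ≤ C := by
    obtain ⟨C, hC⟩ := hψ.growth
    refine ⟨C * Real.exp (freq θ * normSq2 z / 2), fun u => ?_⟩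
    rw [norm_eq_husimi_mul θ, husimi_transl]
    have := hC (z + u)
    gcongr
  have hint0 : Integrable fun u => (heatKer θ μ₀ β u : ℂ) * transl θ u ψ z := by
    obtain ⟨C, hC⟩ := hbound
    have h1 : Integrable (heatKer θ μ₀ β) := by
      have h2 : 0 < freq θ * (1 / t - 1 / 2) := by
        have : 1 ≤ 1 / t := by rw [le_div_iff₀ htp]; linarith
        apply mul_pos hω; linarith
      unfold heatKer
      exact (integrable_exp_neg_normSq2 h2).const_mul _
    refine (h1.mul_const C).mono' ?_ (Eventually.of_forall fun u => ?_)
    · refine Continuous.aestronglyMeasurable (Continuous.mul ?_ ?_)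
      · exact Complex.continuous_ofReal.comp (continuous_heatKer θ μ₀ β)
      · exact continuous_transl_left θ z hψ.cont
    · rw [norm_mul, Complex.norm_real, Real.norm_of_nonneg (heatKer_nonneg _ _ _ _)]
      exact mul_le_mul_of_nonneg_left (hC u) (heatKer_nonneg _ _ _ _)
  have hKne : K ≠ 0 := by
    rw [hK]
    have hpi := Real.pi_pos
    exact_mod_cast (by positivity : Real.exp (-β * (2 * freq θ + μ₀ ^ 2)) *
      (freq θ / (Real.pi * t)) ^ 2 ≠ 0)
  have hint : Integrable fun u => (Real.exp (-a * normSq2 u) : ℂ) * E u := by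
    have h1 := hint0.comp_add_right b
    simp only [hshift] at h1
    exact (integrable_const_mul_iff hKne.isUnit _).1 h1
  have hmean (u : C2) : Real.circleAverage (fun ζ => E (ζ • u)) 0 1 = E 0 := by
    have h1 := hψ.mean (z + b) u (-(a : ℂ) * cdot vb u)
    have h2 : E 0 = ψ (z + b) := by simp [hE, cdot_eq]
    rw [h2, ← h1]
    congr 1
    funext ζ
    have : cdot vb (ζ • u) = cdot vb u * ζ := by simp [cdot_eq]; ring
    simp only [hE, this]
    rw [mul_comm, mul_assoc]
  rw [← integral_add_right_eq_self _ b]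
  simp only [hshift]
  rw [integral_const_mul, integral_exp_neg_normSq2_mul hap hEc hint hmean]
  have h2 : E 0 = ψ (((Real.exp (-2 * freq θ * β) : ℝ) : ℂ) • z) := by
    simp only [hE, cdot_eq]
    simp only [Pi.zero_apply, mul_zero, add_zero, Complex.exp_zero, one_mul]
    congr 1
    ext j
    simp [hb, ht]
    ring
  rw [h2, heat, hK, ← mul_assoc, ← Complex.ofReal_mul]
  congr 2
  have hpi := Real.pi_pos
  rw [ha]
  field_simp

lemma continuous_heat (θ μ₀ : ℝ) {ψ : C2 → ℂ} (hψ : Continuous ψ) :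
    Continuous fun p : ℝ × C2 => heat θ μ₀ p.1 ψ p.2 := by
  unfold heat; fun_prop

/-- The regularized propagator as a superposition of translations. -/
theorem regProp_eq_integral (hθ : 0 < θ) (μ₀ : ℝ) {ε : ℝ} (hε : 0 < ε) {ψ : C2 → ℂ}
    (hψ : FockLike θ ψ) (z : C2) :
    regProp θ μ₀ ε ψ z = ∫ u, (propKer θ μ₀ ε u : ℂ) * transl θ u ψ z := by
  have h1 : regProp θ μ₀ ε ψ z =
      ∫ β in Set.Ioi ε, ∫ u, (heatKer θ μ₀ β u : ℂ) * transl θ u ψ z :=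
    setIntegral_congr_fun measurableSet_Ioi fun β hβ =>
      heat_eq_integral hθ μ₀ (hε.trans hβ) hψ z
  obtain ⟨C, hC⟩ := hψ.growth
  have hint : Integrable (Function.uncurry fun (β : ℝ) (u : C2) =>
      (heatKer θ μ₀ β u : ℂ) * transl θ u ψ z) ((volume.restrict (Set.Ioi ε)).prod volume) := by
    refine ((integrable_heatKer_prod hθ μ₀ hε).mul_const
      (C * Real.exp (freq θ * normSq2 z / 2))).mono' ?_ (Eventually.of_forall fun p => ?_)
    · refine (Complex.measurable_ofReal.comp (measurable_heatKer θ μ₀)).aestronglyMeasurable.mul ?_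
      exact ((continuous_transl_left θ z hψ.cont).comp continuous_snd).aestronglyMeasurable
    · simp only [Function.uncurry]
      rw [norm_mul, Complex.norm_real, Real.norm_of_nonneg (heatKer_nonneg _ _ _ _)]
      refine mul_le_mul_of_nonneg_left ?_ (heatKer_nonneg _ _ _ _)
      rw [norm_eq_husimi_mul θ, husimi_transl]
      have := hC (z + p.2)
      gcongr
  rw [h1, integral_integral_swap hint]
  refine integral_congr_ae (Eventually.of_forall fun u => ?_)
  simp only
  rw [integral_mul_const, propKer, integral_complex_ofReal]

lemma norm_heat_mul_exp (θ μ₀ β : ℝ) (ψ : C2 → ℂ) (z : C2) :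
    ‖heat θ μ₀ β ψ z‖ * Real.exp (-(freq θ * normSq2 z / 2)) =
      Real.exp (-(2 * freq θ + μ₀ ^ 2) * β) *
        (husimi θ ψ (Real.exp (-2 * freq θ * β) • z) *
          Real.exp (-(freq θ * (1 - Real.exp (-2 * freq θ * β) ^ 2) / 2) * normSq2 z)) := by
  rw [heat, norm_mul, Complex.norm_real, Real.norm_of_nonneg (Real.exp_pos _).le, husimi]
  set r := Real.exp (-2 * freq θ * β) with hr
  have h0 : normSq2 (r • z) = r ^ 2 * normSq2 z := by
    have := normSq2_smul (r : ℂ) z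
    rw [Complex.norm_real, Real.norm_of_nonneg (Real.exp_pos _).le] at this
    rw [← this]; rfl
  have h1 : ((r : ℂ) • z) = r • z := rfl
  have h2 : -β * (2 * freq θ + μ₀ ^ 2) = -(2 * freq θ + μ₀ ^ 2) * β := by ring
  rw [h0, h1, h2, mul_assoc, mul_assoc, ← Real.exp_add]
  congr 3
  ring

lemma fockLike_regProp (hθ : 0 < θ) (μ₀ : ℝ) {ε : ℝ} (hε : 0 < ε) {ψ : C2 → ℂ}
    (hψ : FockLike θ ψ) : FockLike θ (regProp θ μ₀ ε ψ) := by
  obtain ⟨C, hC⟩ := hψ.growth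
  have hω := freq_pos hθ
  have hm := mass_pos hθ μ₀
  have hb (β : ℝ) (hβ : ε < β) (z : C2) : ‖heat θ μ₀ β ψ z‖ * Real.exp (-(freq θ * normSq2 z / 2)) ≤
      Real.exp (-(2 * freq θ + μ₀ ^ 2) * β) * C := by
    rw [norm_heat_mul_exp]
    refine mul_le_mul_of_nonneg_left ?_ (Real.exp_pos _).le
    refine (mul_le_of_le_one_right (husimi_nonneg _ _ _) ?_).trans (hC _)
    rw [Real.exp_le_one_iff]
    have h1 := one_sub_exp_pos hθ (hε.trans hβ)
    have h2 := Real.exp_pos (-2 * freq θ * β)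
    have h3 : 0 ≤ 1 - Real.exp (-2 * freq θ * β) ^ 2 := by nlinarith
    have h4 := normSq2_nonneg z
    have : 0 ≤ freq θ * (1 - Real.exp (-2 * freq θ * β) ^ 2) / 2 := by positivity
    nlinarith
  have hb' (β : ℝ) (hβ : ε < β) (z : C2) : ‖heat θ μ₀ β ψ z‖ ≤
      Real.exp (-(2 * freq θ + μ₀ ^ 2) * β) * (C * Real.exp (freq θ * normSq2 z / 2)) := by
    have := hb β hβ z
    rw [← mul_assoc]
    calc _ = ‖heat θ μ₀ β ψ z‖ * Real.exp (-(freq θ * normSq2 z / 2)) *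
          Real.exp (freq θ * normSq2 z / 2) := by
          rw [mul_assoc, ← Real.exp_add, neg_add_cancel, Real.exp_zero, mul_one]
      _ ≤ _ := by gcongr
  have hi := integrable_exp_neg_mul_Ioi hm ε
  refine ⟨?_, ?_, ?_⟩
  · rw [continuous_iff_continuousAt]
    intro z
    obtain ⟨U, hU⟩ : ∃ B, ∀ y ∈ Metric.closedBall z 1, Real.exp (freq θ * normSq2 y / 2) ≤ B := by
      have hc := continuous_normSq2
      obtain ⟨B, hB⟩ := (isCompact_closedBall z 1).bddAbove_image
        (f := fun y => Real.exp (freq θ * normSq2 y / 2)) (by fun_prop)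
      exact ⟨B, fun y hy => hB ⟨y, hy, rfl⟩⟩
    have hC0 : 0 ≤ C := (husimi_nonneg _ _ _).trans (hC 0)
    refine continuousAt_of_dominated (bound := fun β =>
      Real.exp (-(2 * freq θ + μ₀ ^ 2) * β) * (C * U)) ?_ ?_ (hi.mul_const _) ?_
    · exact Eventually.of_forall fun y => ((continuous_heat θ μ₀ hψ.cont).comp
        (continuous_id.prodMk continuous_const)).aestronglyMeasurable
    · filter_upwards [Metric.closedBall_mem_nhds z one_pos] with y hy
      filter_upwards [ae_restrict_mem measurableSet_Ioi] with β hβ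
      refine (hb' β hβ y).trans ?_
      have := hU y hy
      gcongr
    · exact Eventually.of_forall fun β => ((continuous_heat θ μ₀ hψ.cont).comp
        (continuous_const.prodMk continuous_id)).continuousAt
  · refine ⟨(∫ β in Set.Ioi ε, Real.exp (-(2 * freq θ + μ₀ ^ 2) * β)) * C, fun z => ?_⟩
    rw [husimi, regProp, ← integral_mul_const]
    refine (mul_le_mul_of_nonneg_right (norm_integral_le_integral_norm _)
      (Real.exp_pos _).le).trans ?_
    rw [← integral_mul_const]
    refine integral_mono_of_nonneg (Eventually.of_forall fun β => by positivity)
      (hi.mul_const C) ?_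
    filter_upwards [ae_restrict_mem measurableSet_Ioi] with β hβ
    exact hb β hβ z
  · intro z u c
    have hC0 : 0 ≤ C := (husimi_nonneg _ _ _).trans (hC 0)
    have hc := continuous_normSq2
    obtain ⟨U, hU⟩ : ∃ B, ∀ t : ℝ, Real.exp (freq θ * normSq2 (z + circleMap 0 1 t • u) / 2) *
        ‖Complex.exp (c * circleMap 0 1 t)‖ ≤ B := by
      obtain ⟨B, hB⟩ := (isCompact_closedBall (0 : ℂ) 1).bddAbove_image
        (f := fun ζ => Real.exp (freq θ * normSq2 (z + ζ • u) / 2) * ‖Complex.exp (c * ζ)‖)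
        (by fun_prop)
      exact ⟨B, fun t => hB ⟨circleMap 0 1 t, by simp, rfl⟩⟩
    simp only [regProp, ← integral_mul_const]
    have hae : ∀ β ∈ Set.Ioi ε, ∀ t : ℝ,
        ‖heat θ μ₀ β ψ (z + circleMap 0 1 t • u) * Complex.exp (c * circleMap 0 1 t)‖ ≤
          Real.exp (-(2 * freq θ + μ₀ ^ 2) * β) * (C * U) := by
      intro β hβ t
      rw [norm_mul]
      calc _ ≤ Real.exp (-(2 * freq θ + μ₀ ^ 2) * β) *
            (C * Real.exp (freq θ * normSq2 (z + circleMap 0 1 t • u) / 2)) *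
              ‖Complex.exp (c * circleMap 0 1 t)‖ := by
            gcongr
            exact hb' β hβ _
        _ = Real.exp (-(2 * freq θ + μ₀ ^ 2) * β) *
            (C * (Real.exp (freq θ * normSq2 (z + circleMap 0 1 t • u) / 2) *
              ‖Complex.exp (c * circleMap 0 1 t)‖)) := by ring
        _ ≤ _ := by
            gcongr
            exact hU t
    -- the indicator turns the bound on `β > ε` into a global one
    have hswap := circleAverage_integral_swap (μ := volume.restrict (Set.Ioi ε))
      (G := fun ζ β => (Set.Ioi ε).indicator
        (fun β => heat θ μ₀ β ψ (z + ζ • u) * Complex.exp (c * ζ)) β)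
      (g := fun β => Real.exp (-(2 * freq θ + μ₀ ^ 2) * β) * (C * U)) ?_ (hi.mul_const _) ?_
    · have e1 (ζ : ℂ) : ∫ β in Set.Ioi ε, (Set.Ioi ε).indicator
          (fun β => heat θ μ₀ β ψ (z + ζ • u) * Complex.exp (c * ζ)) β =
          ∫ β in Set.Ioi ε, heat θ μ₀ β ψ (z + ζ • u) * Complex.exp (c * ζ) :=
        setIntegral_congr_fun measurableSet_Ioi fun β hβ => Set.indicator_of_mem hβ _
      simp only [e1] at hswap
      rw [hswap]
      refine setIntegral_congr_fun measurableSet_Ioi fun β hβ => ?_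
      simp only [Set.indicator_of_mem hβ]
      set r : ℂ := ((Real.exp (-2 * freq θ * β) : ℝ) : ℂ)
      have h1 := hψ.mean (r • z) (r • u) c
      rw [heat, ← h1, ← circleAverage_const_mul]
      congr 1
      funext ζ
      rw [heat, mul_assoc]
      congr 3
      rw [smul_add, smul_comm]
    · have hcont : Continuous fun p : ℝ × ℝ =>
          heat θ μ₀ p.2 ψ (z + circleMap 0 1 p.1 • u) * Complex.exp (c * circleMap 0 1 p.1) := by
        have h1 : Continuous (circleMap 0 1) := continuous_circleMap 0 1
        refine ((continuous_heat θ μ₀ hψ.cont).comp (continuous_snd.prodMk ?_)).mul ?_ <;> fun_prop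
      have : (fun p : ℝ × ℝ => (Set.Ioi ε).indicator (fun β =>
          heat θ μ₀ β ψ (z + circleMap 0 1 p.1 • u) * Complex.exp (c * circleMap 0 1 p.1)) p.2) =
          (Prod.snd ⁻¹' Set.Ioi ε).indicator (fun p : ℝ × ℝ =>
          heat θ μ₀ p.2 ψ (z + circleMap 0 1 p.1 • u) * Complex.exp (c * circleMap 0 1 p.1)) := by
        funext p; rfl
      rw [this]
      exact hcont.aestronglyMeasurable.indicator (measurableSet_Ioi.preimage measurable_snd)
    · intro t β
      by_cases hβ : β ∈ Set.Ioi ε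
      · rw [Set.indicator_of_mem hβ]; exact hae β hβ t
      · rw [Set.indicator_of_notMem hβ, norm_zero]
        have h1 : 0 ≤ U := le_trans (by positivity) (hU 0)
        positivity

end Heat

/-! ### The Bargmann transform -/

/-- The integral kernel of the Bargmann transform, without its normalization. -/
noncomputable def bargmannKer (θ : ℝ) (z : C2) (x : R2) : ℂ :=
  Complex.exp (-((freq θ : ℂ) / 2) * (∑ j, ((x j : ℂ) ^ 2 + z j ^ 2))
      + ((Real.sqrt 2 : ℝ) : ℂ) * (freq θ : ℂ) * ∑ j, z j * (x j : ℂ))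

section Bargmann

variable {θ : ℝ}

lemma norm_bargmannKer_mul_exp (θ : ℝ) (z : C2) (x : R2) :
    ‖bargmannKer θ z x‖ * Real.exp (-(freq θ * normSq2 z / 2)) =
      Real.exp (-(freq θ / 2) * ∑ j, (x j - Real.sqrt 2 * (z j).re) ^ 2) := by
  rw [bargmannKer, Complex.norm_exp, ← Real.exp_add]
  congr 1
  have h2 : Real.sqrt 2 ^ 2 = 2 := Real.sq_sqrt (by norm_num)
  simp only [normSq2_eq, Fin.sum_univ_two, pow_two] at h2 ⊢
  simp
  linear_combination ((freq θ / 2) * ((z 0).re * (z 0).re + (z 1).re * (z 1).re)) * h2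

lemma norm_bargmannKer_mul_exp_le_one (hθ : 0 < θ) (z : C2) (x : R2) :
    ‖bargmannKer θ z x‖ * Real.exp (-(freq θ * normSq2 z / 2)) ≤ 1 := by
  rw [norm_bargmannKer_mul_exp, Real.exp_le_one_iff]
  have h1 : 0 ≤ ∑ j, (x j - Real.sqrt 2 * (z j).re) ^ 2 := Finset.sum_nonneg fun _ _ => sq_nonneg _
  have h2 := freq_pos hθ
  have : 0 ≤ freq θ / 2 * ∑ j, (x j - Real.sqrt 2 * (z j).re) ^ 2 := by positivity
  linarith

lemma norm_bargmannKer_le (hθ : 0 < θ) (z : C2) (x : R2) :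
    ‖bargmannKer θ z x‖ ≤ Real.exp (freq θ * normSq2 z / 2) := by
  have := norm_bargmannKer_mul_exp_le_one hθ z x
  rwa [Real.exp_neg, ← div_eq_mul_inv, div_le_one (Real.exp_pos _)] at this

lemma continuous_bargmannKer (θ : ℝ) :
    Continuous fun p : C2 × R2 => bargmannKer θ p.1 p.2 := by
  unfold bargmannKer; fun_prop

lemma continuous_bargmannKer_left (θ : ℝ) (x : R2) : Continuous fun z => bargmannKer θ z x := by
  unfold bargmannKer; fun_prop

lemma continuous_bargmannKer_right (θ : ℝ) (z : C2) : Continuous fun x => bargmannKer θ z x := by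
  unfold bargmannKer; fun_prop

lemma bargmann_eq (θ : ℝ) (f : 𝓢(R2, ℂ)) (z : C2) :
    bargmann θ f z = ((Real.sqrt (freq θ / Real.pi) : ℝ) : ℂ) * ∫ x, bargmannKer θ z x * f x := rfl

lemma integrable_bargmannKer_mul (hθ : 0 < θ) (z : C2) {f : R2 → ℂ} (hf : Integrable f) :
    Integrable fun x => bargmannKer θ z x * f x :=
  hf.bdd_mul (continuous_bargmannKer_right θ z).aestronglyMeasurable
    (Eventually.of_forall fun x => norm_bargmannKer_le hθ z x)

lemma husimi_bargmann_le (hθ : 0 < θ) (f : 𝓢(R2, ℂ)) (z : C2) :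
    husimi θ (bargmann θ f) z ≤ Real.sqrt (freq θ / Real.pi) * ∫ x, ‖f x‖ := by
  rw [husimi, bargmann_eq, norm_mul, Complex.norm_real, Real.norm_of_nonneg (Real.sqrt_nonneg _),
    mul_assoc]
  refine mul_le_mul_of_nonneg_left ?_ (Real.sqrt_nonneg _)
  refine (mul_le_mul_of_nonneg_right (norm_integral_le_integral_norm _)
    (Real.exp_pos _).le).trans ?_
  rw [← integral_mul_const]
  refine integral_mono_of_nonneg (Eventually.of_forall fun x => by positivity)
    f.integrable.norm (Eventually.of_forall fun x => ?_)
  simp only [norm_mul]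
  rw [mul_right_comm]
  exact mul_le_of_le_one_left (norm_nonneg _) (norm_bargmannKer_mul_exp_le_one hθ z x)

lemma continuous_bargmann (hθ : 0 < θ) (f : 𝓢(R2, ℂ)) : Continuous (bargmann θ f) := by
  have hn := continuous_normSq2
  -- multiplied by the Gaussian weight the kernel is bounded uniformly in `z`
  have h1 : Continuous fun z => ∫ x, (Real.exp (-(freq θ * normSq2 z / 2)) : ℂ) *
      (bargmannKer θ z x * f x) := by
    refine continuous_of_dominated (bound := fun x => ‖f x‖) (fun z => ?_) (fun z => ?_)
      f.integrable.norm (Eventually.of_forall fun x => ?_)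
    · exact ((integrable_bargmannKer_mul hθ z f.integrable).const_mul _).aestronglyMeasurable
    · refine Eventually.of_forall fun x => ?_
      rw [norm_mul, norm_mul, Complex.norm_real, Real.norm_of_nonneg (Real.exp_pos _).le,
        ← mul_assoc, mul_comm (Real.exp _)]
      exact mul_le_of_le_one_left (norm_nonneg _) (norm_bargmannKer_mul_exp_le_one hθ z x)
    · have := continuous_bargmannKer_left θ x
      fun_prop
  have h2 : bargmann θ f = fun z => ((Real.sqrt (freq θ / Real.pi) : ℝ) : ℂ) *
      ((Real.exp (freq θ * normSq2 z / 2) : ℂ) *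
        ∫ x, (Real.exp (-(freq θ * normSq2 z / 2)) : ℂ) * (bargmannKer θ z x * f x)) := by
    funext z
    rw [bargmann_eq, integral_const_mul, ← mul_assoc (Real.exp (freq θ * normSq2 z / 2) : ℂ),
      ← Complex.ofReal_mul, ← Real.exp_add, add_neg_cancel, Real.exp_zero, Complex.ofReal_one,
      one_mul]
  rw [h2]
  fun_prop

lemma circleAverage_bargmannKer (θ : ℝ) (z u : C2) (x : R2) (c : ℂ) :
    Real.circleAverage (fun ζ => bargmannKer θ (z + ζ • u) x * Complex.exp (c * ζ)) 0 1 =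
      bargmannKer θ z x := by
  have hd : Differentiable ℂ fun ζ : ℂ =>
      bargmannKer θ (z + ζ • u) x * Complex.exp (c * ζ) := by
    unfold bargmannKer
    simp only [Pi.add_apply, Pi.smul_apply, smul_eq_mul, Fin.sum_univ_two]
    fun_prop
  have := (hd.diffContOnCl (s := Metric.ball 0 |1|)).circleAverage
  rw [this]
  simp

lemma fockLike_bargmann (hθ : 0 < θ) (f : 𝓢(R2, ℂ)) : FockLike θ (bargmann θ f) := by
  refine ⟨continuous_bargmann hθ f, ⟨_, husimi_bargmann_le hθ f⟩, fun z u c => ?_⟩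
  have hn := continuous_normSq2
  obtain ⟨U, hU⟩ : ∃ B, ∀ t : ℝ, Real.exp (freq θ * normSq2 (z + circleMap 0 1 t • u) / 2) *
      ‖Complex.exp (c * circleMap 0 1 t)‖ ≤ B := by
    obtain ⟨B, hB⟩ := (isCompact_closedBall (0 : ℂ) 1).bddAbove_image
      (f := fun ζ => Real.exp (freq θ * normSq2 (z + ζ • u) / 2) * ‖Complex.exp (c * ζ)‖)
      (by fun_prop)
    exact ⟨B, fun t => hB ⟨circleMap 0 1 t, by simp, rfl⟩⟩
  have hswap := circleAverage_integral_swap (μ := (volume : Measure R2))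
    (G := fun ζ x => bargmannKer θ (z + ζ • u) x * Complex.exp (c * ζ) * f x)
    (g := fun x => U * ‖f x‖) ?_ (f.integrable.norm.const_mul _) ?_
  · have e1 (ζ : ℂ) : bargmann θ f (z + ζ • u) * Complex.exp (c * ζ) =
        ((Real.sqrt (freq θ / Real.pi) : ℝ) : ℂ) *
          ∫ x, bargmannKer θ (z + ζ • u) x * Complex.exp (c * ζ) * f x := by
      rw [bargmann_eq, mul_assoc, ← integral_mul_const]
      congr 2
      funext x; ring
    have e2 (x : R2) : Real.circleAverage (fun ζ =>
        bargmannKer θ (z + ζ • u) x * Complex.exp (c * ζ) * f x) 0 1 =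
        bargmannKer θ z x * f x := by
      rw [← circleAverage_bargmannKer θ z u x c, mul_comm, ← circleAverage_const_mul]
      congr 1
      funext ζ; ring
    simp only [e1]
    rw [circleAverage_const_mul, hswap]
    simp only [e2]
    rfl
  · have h1 : Continuous (circleMap 0 1) := continuous_circleMap 0 1
    have h2 : Continuous fun p : ℝ × R2 =>
        bargmannKer θ (z + circleMap 0 1 p.1 • u) p.2 := by
      unfold bargmannKer
      simp only [Pi.add_apply, Pi.smul_apply, smul_eq_mul, Fin.sum_univ_two]
      fun_prop
    have h3 := f.continuous
    exact Continuous.aestronglyMeasurable (by fun_prop)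
  · intro t x
    rw [norm_mul, norm_mul]
    refine mul_le_mul_of_nonneg_right (le_trans ?_ (hU t)) (norm_nonneg _)
    exact mul_le_mul_of_nonneg_right (norm_bargmannKer_le hθ _ _) (norm_nonneg _)

/-! ### Rapid decay of the Bargmann transform -/

lemma fderiv_bargmannKer (θ : ℝ) (z : C2) (x : R2) (j : Fin 2) :
    fderiv ℝ (fun x => bargmannKer θ z x) x (EuclideanSpace.single j 1) =
      bargmannKer θ z x * (-(freq θ : ℂ) * x j + ((Real.sqrt 2 : ℝ) : ℂ) * freq θ * z j) := by
  have hd : Differentiable ℝ fun x => bargmannKer θ z x := by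
    unfold bargmannKer
    simp only [Fin.sum_univ_two]
    have h (i : Fin 2) : Differentiable ℝ fun x : R2 => ((x i : ℝ) : ℂ) :=
      Complex.ofRealCLM.differentiable.comp (EuclideanSpace.proj (𝕜 := ℝ) i).differentiable
    have h0 := h 0
    have h1 := h 1
    fun_prop
  rw [← (hd x).lineDeriv_eq_fderiv]
  refine HasLineDerivAt.lineDeriv ?_
  have hc (i : Fin 2) : HasDerivAt
      (fun t : ℝ => (((x + t • EuclideanSpace.single j (1 : ℝ)) i : ℝ) : ℂ))
      (if i = j then 1 else 0) 0 := by
    have h1 : HasDerivAt (fun t : ℝ => x i + t * (EuclideanSpace.single j (1 : ℝ)) i)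
        ((EuclideanSpace.single j (1 : ℝ)) i) 0 := by
      simpa using ((hasDerivAt_id (0 : ℝ)).mul_const ((EuclideanSpace.single j (1 : ℝ)) i)).const_add (x i)
    have := h1.ofReal_comp
    refine (this.congr_deriv ?_)
    rw [EuclideanSpace.single, PiLp.single_apply]
    split_ifs with h <;> simp
  have h2 : HasDerivAt (fun t : ℝ => -((freq θ : ℂ) / 2) *
      (∑ i, ((((x + t • EuclideanSpace.single j (1 : ℝ)) i : ℝ) : ℂ) ^ 2 + z i ^ 2))
      + ((Real.sqrt 2 : ℝ) : ℂ) * (freq θ : ℂ) *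
        ∑ i, z i * (((x + t • EuclideanSpace.single j (1 : ℝ)) i : ℝ) : ℂ))
      (-(freq θ : ℂ) * x j + ((Real.sqrt 2 : ℝ) : ℂ) * freq θ * z j) 0 := by
    have h3 := (HasDerivAt.fun_sum (u := Finset.univ) fun i _ =>
      ((hc i).pow 2).add_const (z i ^ 2)).const_mul (-((freq θ : ℂ) / 2))
    have h4 := (HasDerivAt.fun_sum (u := Finset.univ) fun i _ =>
      (hc i).const_mul (z i)).const_mul (((Real.sqrt 2 : ℝ) : ℂ) * (freq θ : ℂ))
    refine (h3.add h4).congr_deriv ?_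
    have hj : j = 0 ∨ j = 1 := by omega
    rcases hj with rfl | rfl <;> simp <;> ring
  have h5 := h2.cexp
  simp only [zero_smul, add_zero] at h5
  exact h5

open scoped LineDeriv in
/-- The space of Bargmann transforms of Schwartz functions is stable under multiplication by the
coordinates (creation operators), through an integration by parts. -/
lemma exists_bargmann_eq_coord_mul (hθ : 0 < θ) (f : 𝓢(R2, ℂ)) (j : Fin 2) :
    ∃ f' : 𝓢(R2, ℂ), ∀ z, bargmann θ f' z = z j * bargmann θ f z := by
  have hω := freq_pos hθ
  set X : 𝓢(R2, ℂ) := SchwartzMap.smulLeftCLM ℂ (fun x : R2 => ((x j : ℝ) : ℂ)) f with hX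
  have hXa (x : R2) : X x = (x j : ℂ) * f x := by
    rw [hX, SchwartzMap.smulLeftCLM_apply_apply]
    · rfl
    · exact (Complex.ofRealCLM.comp (EuclideanSpace.proj (𝕜 := ℝ) j)).hasTemperateGrowth
  set D : 𝓢(R2, ℂ) := ∂_{EuclideanSpace.single j (1 : ℝ)} f with hD
  have hDa (x : R2) : D x = fderiv ℝ f x (EuclideanSpace.single j 1) :=
    SchwartzMap.lineDerivOp_apply_eq_fderiv _ f x
  have hne : (((Real.sqrt 2 : ℝ) : ℂ) * freq θ) ≠ 0 := by
    rw [← Complex.ofReal_mul]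
    exact_mod_cast (by positivity : Real.sqrt 2 * freq θ ≠ 0)
  refine ⟨(((Real.sqrt 2 : ℝ) : ℂ) * freq θ)⁻¹ • ((freq θ : ℂ) • X - D), fun z => ?_⟩
  have i1 := integrable_bargmannKer_mul hθ z f.integrable
  have i2 := integrable_bargmannKer_mul hθ z X.integrable
  have i3 := integrable_bargmannKer_mul hθ z D.integrable
  have hder (x : R2) : fderiv ℝ (fun x => bargmannKer θ z x) x (EuclideanSpace.single j 1) * f x =
      -(freq θ : ℂ) * (bargmannKer θ z x * X x) +
        ((Real.sqrt 2 : ℝ) : ℂ) * freq θ * z j * (bargmannKer θ z x * f x) := by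
    rw [fderiv_bargmannKer, hXa]; ring
  have hdiff : Differentiable ℝ fun x => bargmannKer θ z x := by
    unfold bargmannKer
    simp only [Fin.sum_univ_two]
    have h (i : Fin 2) : Differentiable ℝ fun x : R2 => ((x i : ℝ) : ℂ) :=
      Complex.ofRealCLM.differentiable.comp (EuclideanSpace.proj (𝕜 := ℝ) i).differentiable
    have h0 := h 0
    have h1 := h 1
    fun_prop
  have hparts := integral_mul_fderiv_eq_neg_fderiv_mul_of_integrable (μ := (volume : Measure R2))
    (f := fun x => bargmannKer θ z x) (g := f) (v := EuclideanSpace.single j (1 : ℝ))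
    (by simp only [hder]; exact (i2.const_mul _).add (i1.const_mul _))
    (by simp only [← hDa]; exact i3) i1 (fun x _ => hdiff x)
    fun x _ => f.differentiable x
  simp only [hder, ← hDa] at hparts
  rw [integral_add (i2.const_mul _) (i1.const_mul _), integral_const_mul, integral_const_mul]
    at hparts
  have hlin : ∫ x, bargmannKer θ z x *
      ((((Real.sqrt 2 : ℝ) : ℂ) * freq θ)⁻¹ • ((freq θ : ℂ) • X - D)) x =
      (((Real.sqrt 2 : ℝ) : ℂ) * freq θ)⁻¹ * ((freq θ : ℂ) * (∫ x, bargmannKer θ z x * X x) -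
        ∫ x, bargmannKer θ z x * D x) := by
    rw [← integral_const_mul, ← integral_sub (i2.const_mul _) i3, ← integral_const_mul]
    refine integral_congr_ae (Eventually.of_forall fun x => ?_)
    simp only [_root_.smul_apply, _root_.sub_apply, smul_eq_mul]
    ring
  rw [bargmann_eq, bargmann_eq, hlin, hparts]
  rw [show (freq θ : ℂ) * (∫ x, bargmannKer θ z x * X x) -
      -(-(freq θ : ℂ) * (∫ x, bargmannKer θ z x * X x) +
        ((Real.sqrt 2 : ℝ) : ℂ) * freq θ * z j * ∫ x, bargmannKer θ z x * f x) =
      (((Real.sqrt 2 : ℝ) : ℂ) * freq θ) * (z j * ∫ x, bargmannKer θ z x * f x) by ring,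
    inv_mul_cancel_left₀ hne]
  ring

lemma exists_bargmann_eq_coord_pow_mul (hθ : 0 < θ) (f : 𝓢(R2, ℂ)) (j : Fin 2) (N : ℕ) :
    ∃ f' : 𝓢(R2, ℂ), ∀ z, bargmann θ f' z = z j ^ N * bargmann θ f z := by
  induction N with
  | zero => exact ⟨f, fun z => by simp⟩
  | succ N ih =>
    obtain ⟨f', hf'⟩ := ih
    obtain ⟨f'', hf''⟩ := exists_bargmann_eq_coord_mul hθ f' j
    exact ⟨f'', fun z => by rw [hf'', hf']; ring⟩

/-- Bargmann transforms of Schwartz functions decay rapidly in phase space. -/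
theorem exists_husimi_le (hθ : 0 < θ) {φ : C2 → ℂ} (hφ : φ ∈ smoothModule θ) (N : ℕ) :
    ∃ C : ℝ, 0 < C ∧ ∀ z, husimi θ φ z ≤ C * (br z ^ N)⁻¹ := by
  obtain ⟨f, rfl⟩ := hφ
  have h (j : Fin 2) : ∃ C : ℝ, ∀ z : C2, ‖z j‖ ^ N * husimi θ (bargmann θ f) z ≤ C := by
    obtain ⟨f', hf'⟩ := exists_bargmann_eq_coord_pow_mul hθ f j N
    refine ⟨_, fun z => le_trans (le_of_eq ?_) (husimi_bargmann_le hθ f' z)⟩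
    rw [husimi, husimi, hf', norm_mul, norm_pow, mul_assoc]
  obtain ⟨C0, h0⟩ := h 0
  obtain ⟨C1, h1⟩ := h 1
  set B := Real.sqrt (freq θ / Real.pi) * ∫ x, ‖f x‖
  have hB (z) : husimi θ (bargmann θ f) z ≤ B := husimi_bargmann_le hθ f z
  have hmain (z : C2) : br z ^ N * husimi θ (bargmann θ f) z ≤ 2 ^ N * (B + C0 + C1) := by
    have hh := husimi_nonneg θ (bargmann θ f) z
    have hz : ‖z‖ ^ N ≤ ‖z 0‖ ^ N + ‖z 1‖ ^ N := by
      have h2 : ‖z‖ ≤ max ‖z 0‖ ‖z 1‖ := by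
        refine (pi_norm_le_iff_of_nonneg (le_max_of_le_left (norm_nonneg _))).2 fun i => ?_
        fin_cases i
        · exact le_max_left _ _
        · exact le_max_right _ _
      refine (pow_le_pow_left₀ (norm_nonneg _) h2 N).trans ?_
      rcases max_choice ‖z 0‖ ‖z 1‖ with h | h <;> rw [h] <;> simp
    have h3 : br z ^ N ≤ 2 ^ N * (1 + ‖z‖ ^ N) := by
      have h4 : br z ≤ 2 * max 1 ‖z‖ := by
        simp only [br]
        linarith [le_max_left 1 ‖z‖, le_max_right 1 ‖z‖]
      refine (pow_le_pow_left₀ (br_pos z).le h4 N).trans ?_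
      rw [mul_pow]
      refine mul_le_mul_of_nonneg_left ?_ (by positivity)
      rcases max_choice 1 ‖z‖ with h | h <;> rw [h] <;> simp
    calc br z ^ N * husimi θ (bargmann θ f) z
        ≤ 2 ^ N * (1 + (‖z 0‖ ^ N + ‖z 1‖ ^ N)) * husimi θ (bargmann θ f) z := by
          refine mul_le_mul_of_nonneg_right (h3.trans ?_) hh
          gcongr
      _ = 2 ^ N * (husimi θ (bargmann θ f) z + ‖z 0‖ ^ N * husimi θ (bargmann θ f) z +
            ‖z 1‖ ^ N * husimi θ (bargmann θ f) z) := by ring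
      _ ≤ _ := by gcongr <;> [exact hB z; exact h0 z; exact h1 z]
  have hnn : 0 ≤ 2 ^ N * (B + C0 + C1) :=
    (mul_nonneg (pow_nonneg (br_pos 0).le N) (husimi_nonneg _ _ _)).trans (hmain 0)
  refine ⟨2 ^ N * (B + C0 + C1) + 1, by linarith, fun z => ?_⟩
  rw [← div_eq_mul_inv, le_div_iff₀ (pow_pos (br_pos z) N), mul_comm]
  linarith [hmain z]

lemma fockLike_of_mem (hθ : 0 < θ) {φ : C2 → ℂ} (hφ : φ ∈ smoothModule θ) : FockLike θ φ := by
  obtain ⟨f, rfl⟩ := hφ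
  exact fockLike_bargmann hθ f

end Bargmann

/-! ### Matrix coefficients of the translations -/

/-- The matrix coefficient `v ↦ ⟨φ, T_v χ⟩_B` of the projective representation of `ℂ²`. -/
noncomputable def matCoef (θ : ℝ) (φ χ : C2 → ℂ) (v : C2) : ℂ := bInner θ φ (transl θ v χ)

section MatCoef

variable {θ : ℝ}

lemma norm_bInner_integrand (θ : ℝ) (φ χ : C2 → ℂ) (z : C2) :
    ‖(((freq θ / Real.pi) ^ 2 * Real.exp (-freq θ * normSq2 z) : ℝ) : ℂ) *
      ((starRingEnd ℂ) (φ z) * χ z)‖ =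
      (freq θ / Real.pi) ^ 2 * (husimi θ φ z * husimi θ χ z) := by
  rw [norm_mul, norm_mul, Complex.norm_real, Real.norm_of_nonneg (by positivity), RCLike.norm_conj,
    husimi, husimi, show -freq θ * normSq2 z = -(freq θ * normSq2 z / 2) + -(freq θ * normSq2 z / 2)
      by ring, Real.exp_add]
  ring

/-- The constant `(ω/π)² ∫ (1 + |z|)⁻⁵ dz` in the bounds for the scalar product. -/
noncomputable def innerBound (θ : ℝ) : ℝ :=
  (freq θ / Real.pi) ^ 2 * ∫ z : C2, (br z ^ 5)⁻¹

lemma innerBound_nonneg (θ : ℝ) : 0 ≤ innerBound θ :=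
  mul_nonneg (sq_nonneg _) (integral_nonneg fun z => inv_br_pow_nonneg z 5)

lemma norm_bInner_le {φ χ : C2 → ℂ} {A B : ℝ} {N : ℕ} {v : C2}
    (hB : 0 ≤ B) (hφ : ∀ z, husimi θ φ z ≤ A * (br z ^ (N + 5))⁻¹)
    (hχ : ∀ z, husimi θ χ z ≤ B * (br (z + v) ^ N)⁻¹) :
    ‖bInner θ φ χ‖ ≤ innerBound θ * A * B * (br v ^ N)⁻¹ := by
  have hA : 0 ≤ A := by
    have := (husimi_nonneg θ φ 0).trans (hφ 0)
    simpa using this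
  have key (z : C2) : ‖(((freq θ / Real.pi) ^ 2 * Real.exp (-freq θ * normSq2 z) : ℝ) : ℂ) *
      ((starRingEnd ℂ) (φ z) * χ z)‖ ≤
      (freq θ / Real.pi) ^ 2 * A * B * (br v ^ N)⁻¹ * (br z ^ 5)⁻¹ := by
    rw [norm_bInner_integrand, mul_assoc ((freq θ / Real.pi) ^ 2), mul_assoc ((freq θ / Real.pi) ^ 2),
      mul_assoc ((freq θ / Real.pi) ^ 2)]
    refine mul_le_mul_of_nonneg_left ?_ (sq_nonneg _)
    have hz := pow_pos (br_pos z) N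
    have h5 := pow_pos (br_pos z) 5
    have hv := inv_br_pow_nonneg v N
    calc husimi θ φ z * husimi θ χ z
        ≤ (A * (br z ^ (N + 5))⁻¹) * (B * (br z ^ N * (br v ^ N)⁻¹)) :=
          mul_le_mul (hφ z) ((hχ z).trans (mul_le_mul_of_nonneg_left (inv_br_pow_add_le z v N) hB))
            (husimi_nonneg _ _ _) (mul_nonneg hA (inv_br_pow_nonneg _ _))
      _ = _ := by rw [pow_add]; field_simp
  refine (norm_integral_le_of_norm_le ((integrable_inv_br_pow_C2 le_rfl).const_mul _)
    (Eventually.of_forall key)).trans (le_of_eq ?_)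
  rw [integral_const_mul, innerBound]
  ring

lemma exists_norm_matCoef_le (hθ : 0 < θ) {φ χ : C2 → ℂ} (hφ : φ ∈ smoothModule θ)
    (hχ : χ ∈ smoothModule θ) (N : ℕ) :
    ∃ C : ℝ, 0 < C ∧ ∀ v, ‖matCoef θ φ χ v‖ ≤ C * (br v ^ N)⁻¹ := by
  obtain ⟨A, hA, h1⟩ := exists_husimi_le hθ hφ (N + 5)
  obtain ⟨B, hB, h2⟩ := exists_husimi_le hθ hχ N
  refine ⟨innerBound θ * A * B + 1, ?_, fun v => ?_⟩
  · have := innerBound_nonneg θ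
    positivity
  · refine (norm_bInner_le hB.le h1 fun z => ?_).trans
      (mul_le_mul_of_nonneg_right (by linarith) (inv_br_pow_nonneg v N))
    rw [husimi_transl]
    exact h2 _

lemma continuous_bInner_integrand {φ χ : C2 → ℂ} (hφ : Continuous φ) (hχ : Continuous χ) :
    Continuous fun z => (((freq θ / Real.pi) ^ 2 * Real.exp (-freq θ * normSq2 z) : ℝ) : ℂ) *
      ((starRingEnd ℂ) (φ z) * χ z) := by
  have := continuous_normSq2
  have h2 : Continuous fun z => (starRingEnd ℂ) (φ z) := Complex.continuous_conj.comp hφ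
  fun_prop

lemma integrable_husimi (hθ : 0 < θ) {φ : C2 → ℂ} (hφ : φ ∈ smoothModule θ) :
    Integrable (husimi θ φ) := by
  obtain ⟨A, hA, h1⟩ := exists_husimi_le hθ hφ 5
  have hc := (fockLike_of_mem hθ hφ).cont
  have hn := continuous_normSq2
  refine ((integrable_inv_br_pow_C2 le_rfl).const_mul A).mono'
    (Continuous.aestronglyMeasurable (by unfold husimi; fun_prop))
    (Eventually.of_forall fun z => ?_)
  rw [Real.norm_of_nonneg (husimi_nonneg _ _ _)]
  exact h1 z

lemma continuous_matCoef (hθ : 0 < θ) {φ χ : C2 → ℂ} (hφ : φ ∈ smoothModule θ)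
    (hχ : FockLike θ χ) : Continuous (matCoef θ φ χ) := by
  obtain ⟨B, hB⟩ := hχ.growth
  have hc := (fockLike_of_mem hθ hφ).cont
  refine continuous_of_dominated
    (bound := fun z => (freq θ / Real.pi) ^ 2 * (husimi θ φ z * B)) (fun v => ?_) (fun v => ?_)
    (((integrable_husimi hθ hφ).mul_const B).const_mul _) (Eventually.of_forall fun z => ?_)
  · exact (continuous_bInner_integrand hc
      (continuous_transl_right θ v hχ.cont)).aestronglyMeasurable
  · refine Eventually.of_forall fun z => ?_
    rw [norm_bInner_integrand, husimi_transl]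
    have := husimi_nonneg θ φ z
    gcongr
    exact hB _
  · have := continuous_transl_left θ z hχ.cont
    fun_prop

lemma integrable_matCoef (hθ : 0 < θ) {φ χ : C2 → ℂ} (hφ : φ ∈ smoothModule θ)
    (hχ : χ ∈ smoothModule θ) : Integrable (matCoef θ φ χ) := by
  obtain ⟨C, -, hC⟩ := exists_norm_matCoef_le hθ hφ hχ 5
  exact ((integrable_inv_br_pow_C2 le_rfl).const_mul C).mono'
    (continuous_matCoef hθ hφ (fockLike_of_mem hθ hχ)).aestronglyMeasurable
    (Eventually.of_forall hC)

lemma bInner_const_mul (θ : ℝ) (φ χ : C2 → ℂ) (c : ℂ) :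
    bInner θ φ (fun z => c * χ z) = c * bInner θ φ χ := by
  rw [bInner, bInner, ← integral_const_mul]
  congr 1
  funext z; ring

lemma bInner_transl_transl (θ : ℝ) (φ χ : C2 → ℂ) (a b : C2) :
    bInner θ φ (transl θ a (transl θ b χ)) =
      phase (freq θ * sform a b) * bInner θ φ (transl θ (a + b) χ) := by
  rw [transl_transl, bInner_const_mul]

/-- Inside a matrix coefficient the regularized propagator is a superposition of translations. -/
theorem bInner_transl_regProp (hθ : 0 < θ) (μ₀ : ℝ) {ε : ℝ} (hε : 0 < ε) {φ ψ : C2 → ℂ}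
    (hφ : φ ∈ smoothModule θ) (hψ : FockLike θ ψ) (v : C2) :
    bInner θ φ (transl θ v (regProp θ μ₀ ε ψ)) =
      ∫ u, (propKer θ μ₀ ε u : ℂ) * bInner θ φ (transl θ v (transl θ u ψ)) := by
  obtain ⟨B, hB⟩ := hψ.growth
  have hφc := (fockLike_of_mem hθ hφ).cont
  have hk := continuous_propKer hθ μ₀ hε
  set W : C2 → C2 → ℂ := fun z u =>
    (((freq θ / Real.pi) ^ 2 * Real.exp (-freq θ * normSq2 z) : ℝ) : ℂ) *
      ((starRingEnd ℂ) (φ z) * ((propKer θ μ₀ ε u : ℂ) * transl θ v (transl θ u ψ) z)) with hW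
  have hWc : Continuous fun p : C2 × C2 => W p.1 p.2 := by
    have h1 := continuous_normSq2
    have h2 : Continuous fun z => (starRingEnd ℂ) (φ z) := Complex.continuous_conj.comp hφc
    have h3 : Continuous fun p : C2 × C2 => transl θ v (transl θ p.2 ψ) p.1 := by
      have h0 := hψ.cont
      unfold transl cdot
      fun_prop
    fun_prop
  have hWi : Integrable (Function.uncurry W) (volume.prod volume) := by
    refine (((integrable_husimi hθ hφ).mul_prod (integrable_propKer hθ μ₀ hε)).const_mul
      ((freq θ / Real.pi) ^ 2 * B)).mono' hWc.aestronglyMeasurable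
      (Eventually.of_forall fun p => ?_)
    have h1 : W p.1 p.2 = (propKer θ μ₀ ε p.2 : ℂ) *
        ((((freq θ / Real.pi) ^ 2 * Real.exp (-freq θ * normSq2 p.1) : ℝ) : ℂ) *
          ((starRingEnd ℂ) (φ p.1) * transl θ v (transl θ p.2 ψ) p.1)) := by
      rw [hW]; ring
    rw [Function.uncurry, h1, norm_mul, norm_bInner_integrand, husimi_transl, husimi_transl,
      Complex.norm_real, Real.norm_of_nonneg (propKer_nonneg _ _ _ _)]
    have h2 := husimi_nonneg θ φ p.1
    have h3 := propKer_nonneg θ μ₀ ε p.2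
    calc _ ≤ propKer θ μ₀ ε p.2 * ((freq θ / Real.pi) ^ 2 * (husimi θ φ p.1 * B)) := by
          gcongr; exact hB _
      _ = _ := by ring
  have h1 (z : C2) : (((freq θ / Real.pi) ^ 2 * Real.exp (-freq θ * normSq2 z) : ℝ) : ℂ) *
      ((starRingEnd ℂ) (φ z) * transl θ v (regProp θ μ₀ ε ψ) z) = ∫ u, W z u := by
    rw [hW, integral_const_mul, integral_const_mul]
    congr 2
    rw [transl, regProp_eq_integral hθ μ₀ hε hψ, ← integral_const_mul]
    congr 1
    funext u
    exact mul_left_comm _ _ _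
  rw [bInner]
  simp only [h1]
  rw [integral_integral_swap hWi]
  congr 1
  funext u
  rw [← bInner_const_mul]
  rfl

end MatCoef

/-! ### Bounds for the amplitudes -/

section Amplitudes

variable {θ : ℝ}

/-- The regularized propagator localizes near the origin of phase space. -/
lemma exists_husimi_regProp_le (hθ : 0 < θ) (μ₀ : ℝ) {ε : ℝ} (hε : 0 < ε) (N : ℕ) :
    ∃ C : ℝ, 0 < C ∧ ∀ (ψ : C2 → ℂ) (A : ℝ) (w : C2), 0 ≤ A →
      (∀ z, husimi θ ψ z ≤ A * (br (z + w) ^ N)⁻¹) →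
      ∀ z, husimi θ (regProp θ μ₀ ε ψ) z ≤ C * A * (br w ^ N)⁻¹ * (br z ^ N)⁻¹ := by
  have hω := freq_pos hθ
  have hm := mass_pos hθ μ₀
  set q := Real.exp (-2 * freq θ * ε) with hq
  have hq1 : 0 < 1 - q := one_sub_exp_pos hθ hε
  have hq0 : 0 < q := Real.exp_pos _
  set c := freq θ * (1 - q ^ 2) / 2 with hc
  have hcpos : 0 < c := by
    have : 0 < 1 - q ^ 2 := by nlinarith
    positivity
  obtain ⟨D, hD, hDb⟩ := exists_br_pow_mul_exp_le C2 hcpos (2 * N)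
  set I := ∫ β in Set.Ioi ε, Real.exp (-(2 * freq θ + μ₀ ^ 2) * β) with hI
  have hI0 : 0 ≤ I := integral_nonneg fun _ => (Real.exp_pos _).le
  refine ⟨(I + 1) * D, by positivity, fun ψ A w hA hψ z => ?_⟩
  have hzN := pow_pos (br_pos z) N
  have hw := inv_br_pow_nonneg w N
  have hb (β : ℝ) (hβ : ε < β) : ‖heat θ μ₀ β ψ z‖ * Real.exp (-(freq θ * normSq2 z / 2)) ≤
      Real.exp (-(2 * freq θ + μ₀ ^ 2) * β) * (D * A * (br w ^ N)⁻¹ * (br z ^ N)⁻¹) := by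
    rw [norm_heat_mul_exp]
    refine mul_le_mul_of_nonneg_left ?_ (Real.exp_pos _).le
    have hr0 := Real.exp_pos (-2 * freq θ * β)
    have hrq : Real.exp (-2 * freq θ * β) ≤ q := by
      rw [hq, Real.exp_le_exp]
      nlinarith
    have hr1 : Real.exp (-2 * freq θ * β) ≤ 1 := by linarith
    have h1 : husimi θ ψ (Real.exp (-2 * freq θ * β) • z) ≤ A * (br z ^ N * (br w ^ N)⁻¹) :=
      (hψ _).trans (mul_le_mul_of_nonneg_left (inv_br_pow_smul_add_le hr0.le hr1 z w N) hA)
    have h2 : Real.exp (-(freq θ * (1 - Real.exp (-2 * freq θ * β) ^ 2) / 2) * normSq2 z) ≤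
        Real.exp (-c * ‖z‖ ^ 2) := by
      rw [Real.exp_le_exp, hc]
      have h3 : Real.exp (-2 * freq θ * β) ^ 2 ≤ q ^ 2 := pow_le_pow_left₀ hr0.le hrq 2
      have h4 := norm_sq_le_normSq2 z
      have h5 : freq θ * (1 - q ^ 2) / 2 ≤ freq θ * (1 - Real.exp (-2 * freq θ * β) ^ 2) / 2 := by
        gcongr
      have h6 := mul_le_mul h5 h4 (sq_nonneg _) (hcpos.le.trans h5)
      linarith
    have h3 : Real.exp (-c * ‖z‖ ^ 2) ≤ D * (br z ^ (2 * N))⁻¹ := by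
      rw [← div_eq_mul_inv, le_div_iff₀ (pow_pos (br_pos z) _), mul_comm]
      exact hDb z
    calc _ ≤ (A * (br z ^ N * (br w ^ N)⁻¹)) * (D * (br z ^ (2 * N))⁻¹) :=
          mul_le_mul h1 (h2.trans h3) (Real.exp_pos _).le (by positivity)
      _ = _ := by rw [two_mul, pow_add]; field_simp
  have hint : Integrable (fun β => Real.exp (-(2 * freq θ + μ₀ ^ 2) * β) *
      (D * A * (br w ^ N)⁻¹ * (br z ^ N)⁻¹)) (volume.restrict (Set.Ioi ε)) :=
    (integrable_exp_neg_mul_Ioi hm ε).mul_const _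
  have h7 : husimi θ (regProp θ μ₀ ε ψ) z ≤ I * (D * A * (br w ^ N)⁻¹ * (br z ^ N)⁻¹) := by
    rw [husimi, regProp, ← Real.norm_of_nonneg (Real.exp_pos (-(freq θ * normSq2 z / 2))).le,
      ← Complex.norm_real, ← norm_mul, ← integral_mul_const, hI, ← integral_mul_const]
    refine norm_integral_le_of_norm_le hint ?_
    filter_upwards [ae_restrict_mem measurableSet_Ioi] with β hβ
    rw [norm_mul, Complex.norm_real, Real.norm_of_nonneg (Real.exp_pos _).le]
    exact hb β hβ
  refine h7.trans ?_
  have hz' := inv_br_pow_nonneg z N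
  calc _ ≤ (I + 1) * (D * A * (br w ^ N)⁻¹ * (br z ^ N)⁻¹) := by gcongr; linarith
    _ = _ := by ring

/-- The factor of `ampD` belonging to one of its two lines is rapidly decreasing. -/
lemma exists_norm_lineD_le (hθ : 0 < θ) (μ₀ : ℝ) {ε : ℝ} (hε : 0 < ε) {φ χ : C2 → ℂ}
    (hφ : φ ∈ smoothModule θ) (hχ : χ ∈ smoothModule θ) (N : ℕ) :
    ∃ C : ℝ, 0 < C ∧ ∀ v w, ‖bInner θ φ (transl θ v (regProp θ μ₀ ε (transl θ w χ)))‖ ≤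
      C * (br v ^ N)⁻¹ * (br w ^ N)⁻¹ := by
  obtain ⟨A, hA, h1⟩ := exists_husimi_le hθ hφ (N + 5)
  obtain ⟨B, hB, h2⟩ := exists_husimi_le hθ hχ N
  obtain ⟨R, hR, h3⟩ := exists_husimi_regProp_le hθ μ₀ hε N
  have hI := innerBound_nonneg θ
  refine ⟨innerBound θ * A * (R * B) + 1, by positivity, fun v w => ?_⟩
  have hv := inv_br_pow_nonneg v N
  have hw := inv_br_pow_nonneg w N
  have h4 := norm_bInner_le (θ := θ) (φ := φ) (v := v)
    (χ := transl θ v (regProp θ μ₀ ε (transl θ w χ)))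
    (B := R * B * (br w ^ N)⁻¹) (by positivity) h1 fun z => by
      rw [husimi_transl]
      exact h3 _ B w hB.le (fun z => by rw [husimi_transl]; exact h2 _) _
  refine h4.trans ?_
  calc innerBound θ * A * (R * B * (br w ^ N)⁻¹) * (br v ^ N)⁻¹
      = innerBound θ * A * (R * B) * ((br v ^ N)⁻¹ * (br w ^ N)⁻¹) := by ring
    _ ≤ (innerBound θ * A * (R * B) + 1) * ((br v ^ N)⁻¹ * (br w ^ N)⁻¹) := by gcongr; linarith
    _ = _ := by ring

/-- The loop factor of `ampC` is rapidly decreasing. -/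
lemma exists_norm_loopC_le (hθ : 0 < θ) (μ₀ : ℝ) {ε : ℝ} (hε : 0 < ε) {φ χ : C2 → ℂ}
    (hφ : φ ∈ smoothModule θ) (hχ : χ ∈ smoothModule θ) (N : ℕ) :
    ∃ C : ℝ, 0 < C ∧ ∀ v w, ‖bInner θ φ (transl θ w (regProp θ μ₀ ε (transl θ (-v)
      (regProp θ μ₀ ε (transl θ (-w) χ)))))‖ ≤ C * (br v ^ N)⁻¹ * (br w ^ N)⁻¹ := by
  obtain ⟨A, hA, h1⟩ := exists_husimi_le hθ hφ (N + 5)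
  obtain ⟨B, hB, h2⟩ := exists_husimi_le hθ hχ N
  obtain ⟨R, hR, h3⟩ := exists_husimi_regProp_le hθ μ₀ hε N
  have hI := innerBound_nonneg θ
  refine ⟨innerBound θ * A * (R * (R * B)) + 1, by positivity, fun v w => ?_⟩
  have hv := inv_br_pow_nonneg v N
  have hw := inv_br_pow_nonneg w N
  have h4 (z) : husimi θ (transl θ (-v) (regProp θ μ₀ ε (transl θ (-w) χ))) z ≤
      R * B * (br w ^ N)⁻¹ * (br (z + -v) ^ N)⁻¹ := by
    rw [husimi_transl, ← br_neg w]
    exact h3 _ B (-w) hB.le (fun z => by rw [husimi_transl]; exact h2 _) _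
  have h5 := norm_bInner_le (θ := θ) (φ := φ) (v := w)
    (χ := transl θ w (regProp θ μ₀ ε (transl θ (-v) (regProp θ μ₀ ε (transl θ (-w) χ)))))
    (B := R * (R * B * (br w ^ N)⁻¹) * (br v ^ N)⁻¹) (by positivity) h1 fun z => by
      rw [husimi_transl, ← br_neg v]
      exact h3 _ (R * B * (br w ^ N)⁻¹) (-v) (by positivity) h4 _
  refine h5.trans ?_
  have hw1 := inv_br_pow_le_one w N
  have hK : 0 ≤ innerBound θ * A * (R * (R * B)) := by positivity
  calc innerBound θ * A * (R * (R * B * (br w ^ N)⁻¹) * (br v ^ N)⁻¹) * (br w ^ N)⁻¹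
      = innerBound θ * A * (R * (R * B)) * ((br v ^ N)⁻¹ * (br w ^ N)⁻¹) * (br w ^ N)⁻¹ := by ring
    _ ≤ innerBound θ * A * (R * (R * B)) * ((br v ^ N)⁻¹ * (br w ^ N)⁻¹) * 1 := by gcongr
    _ ≤ (innerBound θ * A * (R * (R * B)) + 1) * ((br v ^ N)⁻¹ * (br w ^ N)⁻¹) := by
      rw [mul_one]; gcongr; linarith
    _ = _ := by ring

lemma exists_norm_ampC_le (hθ : 0 < θ) (μ₀ : ℝ) {ε : ℝ} (hε : 0 < ε) {φ : Fin 4 → C2 → ℂ}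
    (hφ : ∀ i, φ i ∈ smoothModule θ) (N : ℕ) :
    ∃ C : ℝ, 0 < C ∧ ∀ v w, ‖ampC θ μ₀ ε φ v w‖ ≤ C * (br v ^ N)⁻¹ * (br w ^ N)⁻¹ := by
  obtain ⟨A, hA, h1⟩ := exists_norm_matCoef_le hθ (hφ 0) (hφ 1) 0
  obtain ⟨B, hB, h2⟩ := exists_norm_loopC_le hθ μ₀ hε (hφ 2) (hφ 3) N
  refine ⟨A * B, by positivity, fun v w => ?_⟩
  rw [ampC, norm_mul]
  calc _ ≤ A * (B * (br v ^ N)⁻¹ * (br w ^ N)⁻¹) := by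
        refine mul_le_mul ?_ (h2 v w) (norm_nonneg _) hA.le
        simpa [matCoef] using h1 v
    _ = _ := by ring

lemma exists_norm_ampD_le (hθ : 0 < θ) (μ₀ : ℝ) {ε : ℝ} (hε : 0 < ε) {φ : Fin 4 → C2 → ℂ}
    (hφ : ∀ i, φ i ∈ smoothModule θ) (N : ℕ) :
    ∃ C : ℝ, 0 < C ∧ ∀ v w, ‖ampD θ μ₀ ε φ v w‖ ≤ C * (br v ^ N)⁻¹ * (br w ^ N)⁻¹ := by
  obtain ⟨A, hA, h1⟩ := exists_norm_lineD_le hθ μ₀ hε (hφ 0) (hφ 1) 0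
  obtain ⟨B, hB, h2⟩ := exists_norm_lineD_le hθ μ₀ hε (hφ 2) (hφ 3) N
  refine ⟨A * B, by positivity, fun v w => ?_⟩
  rw [ampD, norm_mul]
  calc _ ≤ A * (B * (br v ^ N)⁻¹ * (br w ^ N)⁻¹) := by
        refine mul_le_mul ?_ ?_ (norm_nonneg _) hA.le
        · simpa using h1 v w
        · simpa using h2 (-v) (-w)
    _ = _ := by ring

lemma summable_of_norm_le_latPt (hθ : 0 < θ) {a : C2 → C2 → ℂ} {C : ℝ} (hC : 0 ≤ C)
    (h : ∀ v w, ‖a v w‖ ≤ C * (br v ^ 6)⁻¹ * (br w ^ 6)⁻¹) :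
    Summable fun g : LatIdx × LatIdx => a (latPt θ g.1) (latPt θ g.2) := by
  obtain ⟨A, hA, hA'⟩ := exists_inv_br_latPt_le hθ
  have hs := summable_inv_br_pow_latIdx le_rfl
  refine Summable.of_norm_bounded ((hs.mul_of_nonneg hs (fun n => inv_br_pow_nonneg n 6)
    fun n => inv_br_pow_nonneg n 6).mul_left (C * A ^ 6 * A ^ 6)) fun g => (h _ _).trans ?_
  have h1 := inv_br_pow_nonneg (latPt θ g.2) 6
  calc _ ≤ C * (A ^ 6 * (br g.1 ^ 6)⁻¹) * (A ^ 6 * (br g.2 ^ 6)⁻¹) := by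
        have h2 := inv_br_pow_nonneg g.1 6
        gcongr
        · exact hA' g.1 6
        · exact hA' g.2 6
    _ = _ := by ring

theorem summable_ampC (hθ : 0 < θ) (μ₀ : ℝ) {ε : ℝ} (hε : 0 < ε) {φ : Fin 4 → C2 → ℂ}
    (hφ : ∀ i, φ i ∈ smoothModule θ) :
    Summable fun g : LatIdx × LatIdx => ampC θ μ₀ ε φ (latPt θ g.1) (latPt θ g.2) := by
  obtain ⟨C, hC, h⟩ := exists_norm_ampC_le hθ μ₀ hε hφ 6
  exact summable_of_norm_le_latPt hθ hC.le h

theorem summable_ampD (hθ : 0 < θ) (μ₀ : ℝ) {ε : ℝ} (hε : 0 < ε) {φ : Fin 4 → C2 → ℂ}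
    (hφ : ∀ i, φ i ∈ smoothModule θ) :
    Summable fun g : LatIdx × LatIdx => ampD θ μ₀ ε φ (latPt θ g.1) (latPt θ g.2) := by
  obtain ⟨C, hC, h⟩ := exists_norm_ampD_le hθ μ₀ hε hφ 6
  exact summable_of_norm_le_latPt hθ hC.le h

end Amplitudes

/-! ### The loop integrals behind the Poisson modes -/

/-- The loop integral `∫ k_ε(u) k_ε(u + δ) P(u) du` with two propagators at relative
displacement `δ`. -/
noncomputable def loopInt (θ μ₀ ε : ℝ) (δ : C2) (P : C2 → ℂ) : ℂ :=
  ∫ u, (propKer θ μ₀ ε u : ℂ) * (propKer θ μ₀ ε (u + δ) : ℂ) * P u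

/-- The Fourier profile of one line of the second graph. -/
noncomputable def lineFun (θ μ₀ ε : ℝ) (φ χ : C2 → ℂ) (γ u : C2) : ℂ :=
  (propKer θ μ₀ ε u : ℂ) * (phase (freq θ * sform u γ) * matCoef θ φ χ (u + γ))

/-- The Fourier profile of the loop of the first graph. -/
noncomputable def loopFun (θ μ₀ ε : ℝ) (φ χ : C2 → ℂ) (v s : C2) : ℂ :=
  matCoef θ φ χ s * loopInt θ μ₀ ε (-(v + s))
    fun u => phase (freq θ * (sform u (s - v) - sform v s))

section Modes

variable {θ : ℝ}

lemma propKer_le_propBound (hθ : 0 < θ) (μ₀ : ℝ) {ε : ℝ} (hε : 0 < ε) (u : C2) :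
    propKer θ μ₀ ε u ≤ propBound θ μ₀ ε := by
  refine (propKer_le hθ μ₀ hε u).trans (mul_le_of_le_one_right (propBound_nonneg _ _ _) ?_)
  rw [Real.exp_le_one_iff]
  have := mul_nonneg (freq_pos hθ).le (normSq2_nonneg u)
  linarith

lemma norm_propKer (θ μ₀ ε : ℝ) (u : C2) : ‖(propKer θ μ₀ ε u : ℂ)‖ = propKer θ μ₀ ε u := by
  rw [Complex.norm_real, Real.norm_of_nonneg (propKer_nonneg _ _ _ _)]

lemma continuous_phase_comp {X : Type*} [TopologicalSpace X] {f : X → ℝ} (hf : Continuous f) :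
    Continuous fun x => phase (f x) := continuous_phase.comp hf

lemma continuous_sform_comp {X : Type*} [TopologicalSpace X] {f g : X → C2} (hf : Continuous f)
    (hg : Continuous g) : Continuous fun x => sform (f x) (g x) :=
  continuous_sform.comp (hf.prodMk hg)

lemma lineD_eq (hθ : 0 < θ) (μ₀ : ℝ) {ε : ℝ} (hε : 0 < ε) {φ χ : C2 → ℂ}
    (hφ : φ ∈ smoothModule θ) (hχ : χ ∈ smoothModule θ) (v w : C2) :
    bInner θ φ (transl θ v (regProp θ μ₀ ε (transl θ w χ))) =
      ∫ u, (propKer θ μ₀ ε u : ℂ) *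
        (phase (freq θ * (sform v u + sform (v + u) w)) * matCoef θ φ χ (v + u + w)) := by
  rw [bInner_transl_regProp hθ μ₀ hε hφ (fockLike_transl (fockLike_of_mem hθ hχ) w)]
  congr 1
  funext u
  rw [transl_transl, bInner_const_mul, bInner_transl_transl, mul_add, phase_add, matCoef]
  ring

lemma lineD_eq_sympFourier (hθ : 0 < θ) (μ₀ : ℝ) {ε : ℝ} (hε : 0 < ε) {φ χ : C2 → ℂ}
    (hφ : φ ∈ smoothModule θ) (hχ : χ ∈ smoothModule θ) (γ v : C2) :
    bInner θ φ (transl θ v (regProp θ μ₀ ε (transl θ (γ - v) χ))) =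
      phase (freq θ * sform v γ) * sympFourier (freq θ) (lineFun θ μ₀ ε φ χ γ) v := by
  rw [lineD_eq hθ μ₀ hε hφ hχ, sympFourier, ← integral_const_mul]
  congr 1
  funext u
  rw [lineFun, show v + u + (γ - v) = u + γ by abel,
    show freq θ * (sform v u + sform (v + u) (γ - v)) =
      freq θ * sform v γ + freq θ * sform u γ + 2 * freq θ * sform v u by
        rw [sform_sub_right, sform_add_left, sform_add_left, sform_self, sform_comm u v]; ring,
    phase_add, phase_add]
  ring

lemma continuous_lineFun (hθ : 0 < θ) (μ₀ : ℝ) {ε : ℝ} (hε : 0 < ε) {φ χ : C2 → ℂ}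
    (hφ : φ ∈ smoothModule θ) (hχ : χ ∈ smoothModule θ) (γ : C2) :
    Continuous (lineFun θ μ₀ ε φ χ γ) := by
  have h1 := continuous_propKer hθ μ₀ hε
  have h2 := continuous_matCoef hθ hφ (fockLike_of_mem hθ hχ)
  have h3 : Continuous fun u => phase (freq θ * sform u γ) :=
    continuous_phase_comp (continuous_const.mul (continuous_sform_comp continuous_id
      continuous_const))
  unfold lineFun
  fun_prop

lemma integrable_lineFun (hθ : 0 < θ) (μ₀ : ℝ) {ε : ℝ} (hε : 0 < ε) {φ χ : C2 → ℂ}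
    (hφ : φ ∈ smoothModule θ) (hχ : χ ∈ smoothModule θ) (γ : C2) :
    Integrable (lineFun θ μ₀ ε φ χ γ) := by
  refine (((integrable_matCoef hθ hφ hχ).comp_add_right γ).norm.const_mul
    (propBound θ μ₀ ε)).mono' (continuous_lineFun hθ μ₀ hε hφ hχ γ).aestronglyMeasurable
    (Eventually.of_forall fun u => ?_)
  rw [lineFun, norm_mul, norm_mul, norm_phase, one_mul, norm_propKer]
  exact mul_le_mul_of_nonneg_right (propKer_le_propBound hθ μ₀ hε u) (norm_nonneg _)

lemma integrable_sympFourier_lineFun (hθ : 0 < θ) (μ₀ : ℝ) {ε : ℝ} (hε : 0 < ε) {φ χ : C2 → ℂ}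
    (hφ : φ ∈ smoothModule θ) (hχ : χ ∈ smoothModule θ) (γ : C2) :
    Integrable (sympFourier (freq θ) (lineFun θ μ₀ ε φ χ γ)) := by
  obtain ⟨C, hC, h⟩ := exists_norm_lineD_le hθ μ₀ hε hφ hχ 5
  refine ((integrable_inv_br_pow_C2 le_rfl).const_mul C).mono'
    (continuous_sympFourier _ (integrable_lineFun hθ μ₀ hε hφ hχ γ)).aestronglyMeasurable
    (Eventually.of_forall fun v => ?_)
  have h1 := h v (γ - v)
  rw [lineD_eq_sympFourier hθ μ₀ hε hφ hχ, norm_mul, norm_phase, one_mul] at h1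
  exact h1.trans (mul_le_of_le_one_right (mul_nonneg hC.le (inv_br_pow_nonneg _ _))
    (inv_br_pow_le_one _ _))

lemma ampD_eq (hθ : 0 < θ) (μ₀ : ℝ) {ε : ℝ} (hε : 0 < ε) {φ : Fin 4 → C2 → ℂ}
    (hφ : ∀ i, φ i ∈ smoothModule θ) (γ v : C2) :
    ampD θ μ₀ ε φ v (γ - v) = phase (2 * freq θ * sform v γ) *
      (sympFourier (freq θ) (lineFun θ μ₀ ε (φ 0) (φ 1) γ) v *
        sympFourier (freq θ) (lineFun θ μ₀ ε (φ 2) (φ 3) (-γ)) (-v)) := by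
  rw [ampD, lineD_eq_sympFourier hθ μ₀ hε (hφ 0) (hφ 1), show -(γ - v) = -γ - -v by abel,
    lineD_eq_sympFourier hθ μ₀ hε (hφ 2) (hφ 3), sform_neg_left, sform_neg_right, neg_neg,
    show 2 * freq θ * sform v γ = freq θ * sform v γ + freq θ * sform v γ by ring, phase_add]
  ring

lemma continuous_ampD_sub (hθ : 0 < θ) (μ₀ : ℝ) {ε : ℝ} (hε : 0 < ε) {φ : Fin 4 → C2 → ℂ}
    (hφ : ∀ i, φ i ∈ smoothModule θ) (γ : C2) :
    Continuous fun v => ampD θ μ₀ ε φ v (γ - v) := by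
  simp only [ampD_eq hθ μ₀ hε hφ]
  have h1 := continuous_sympFourier (freq θ) (integrable_lineFun hθ μ₀ hε (hφ 0) (hφ 1) γ)
  have h2 := continuous_sympFourier (freq θ) (integrable_lineFun hθ μ₀ hε (hφ 2) (hφ 3) (-γ))
  have h3 : Continuous fun v => phase (2 * freq θ * sform v γ) :=
    continuous_phase_comp (continuous_const.mul (continuous_sform_comp continuous_id
      continuous_const))
  fun_prop

lemma covolume_mul (hθ : 0 < θ) (x : ℂ) :
    ((4 / θ ^ 4 : ℝ) : ℂ) * ((((Real.pi / freq θ) ^ 4 : ℝ) : ℂ) * x) = x / 4 := by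
  rw [← mul_assoc, ← Complex.ofReal_mul]
  have : 4 / θ ^ 4 * (Real.pi / freq θ) ^ 4 = 1 / 4 := by
    have := Real.pi_pos
    unfold freq
    field_simp
    norm_num
  rw [this]
  push_cast
  ring

/-- The product of the two external matrix coefficients in a mode of the second graph. -/
noncomputable def profileD (θ : ℝ) (φ : Fin 4 → C2 → ℂ) (γ σ u : C2) : ℂ :=
  phase (freq θ * sform σ γ) *
    (matCoef θ (φ 0) (φ 1) (u + γ) * matCoef θ (φ 2) (φ 3) (u - σ))

theorem poissonMode_ampD (hθ : 0 < θ) (μ₀ : ℝ) {ε : ℝ} (hε : 0 < ε) {φ : Fin 4 → C2 → ℂ}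
    (hφ : ∀ i, φ i ∈ smoothModule θ) (γ : C2) (d : LatIdx) :
    poissonMode θ (fun v => ampD θ μ₀ ε φ v (γ - v)) d =
      loopInt θ μ₀ ε (γ - Complex.I • dualPt d)
        (profileD θ φ γ (Complex.I • dualPt d)) / 4 := by
  set σ := Complex.I • dualPt d with hσ
  set f₁ := lineFun θ μ₀ ε (φ 0) (φ 1) γ with hf₁
  set f₂ := lineFun θ μ₀ ε (φ 2) (φ 3) (-γ) with hf₂
  have c₁ : Continuous f₁ := continuous_lineFun hθ μ₀ hε (hφ 0) (hφ 1) γ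
  have i₁ : Integrable f₁ := integrable_lineFun hθ μ₀ hε (hφ 0) (hφ 1) γ
  have s₁ : Integrable (sympFourier (freq θ) f₁) :=
    integrable_sympFourier_lineFun hθ μ₀ hε (hφ 0) (hφ 1) γ
  have c₂ : Continuous f₂ := continuous_lineFun hθ μ₀ hε (hφ 2) (hφ 3) (-γ)
  have i₂ : Integrable f₂ := integrable_lineFun hθ μ₀ hε (hφ 2) (hφ 3) (-γ)
  have e1 (v : C2) : ampD θ μ₀ ε φ v (γ - v) * phase (-(2 * freq θ * sform v σ)) =
      ∫ u, sympFourier (freq θ) f₁ v * f₂ u *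
        phase (-(2 * freq θ * sform v (u + (σ - γ)))) := by
    rw [ampD_eq hθ μ₀ hε hφ, ← hf₁, ← hf₂, sympFourier.eq_1 _ f₂]
    rw [show ∀ a b c d : ℂ, a * (b * c) * d = (a * b * d) * c by intros; ring,
      ← integral_const_mul]
    congr 1
    funext u
    rw [show -(2 * freq θ * sform v (u + (σ - γ))) = 2 * freq θ * sform v γ +
      -(2 * freq θ * sform v σ) + 2 * freq θ * sform (-v) u by
        rw [sform_add_right, sform_sub_right, sform_neg_left]; ring, phase_add, phase_add]
    ring
  have hint : Integrable (Function.uncurry fun v u => sympFourier (freq θ) f₁ v * f₂ u *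
      phase (-(2 * freq θ * sform v (u + (σ - γ))))) (volume.prod volume) := by
    refine (s₁.mul_prod i₂).mul_bdd (c := 1) (Continuous.aestronglyMeasurable ?_)
      (Eventually.of_forall fun p => (norm_phase _).le)
    exact continuous_phase_comp (continuous_const.mul (continuous_sform_comp continuous_fst
      (by fun_prop))).neg
  rw [poissonMode_eq, ← hσ]
  simp only [e1]
  rw [integral_integral_swap hint]
  have e2 (u : C2) : ∫ v, sympFourier (freq θ) f₁ v * f₂ u *
      phase (-(2 * freq θ * sform v (u + (σ - γ)))) =
      (((Real.pi / freq θ) ^ 4 : ℝ) : ℂ) * (f₂ u * f₁ (u + (σ - γ))) := by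
    rw [mul_left_comm, ← integral_sympFourier_mul_phase (freq_pos hθ) c₁ i₁ s₁,
      ← integral_const_mul]
    congr 1
    funext v
    ring
  simp only [e2]
  rw [integral_const_mul, covolume_mul hθ, loopInt]
  congr 1
  rw [← integral_add_right_eq_self _ (γ - σ)]
  congr 1
  funext u
  rw [show u + (γ - σ) + (σ - γ) = u by abel, hf₁, hf₂, lineFun, lineFun, profileD,
    show u + (γ - σ) + -γ = u - σ by abel]
  have h : phase (freq θ * sform (u + (γ - σ)) (-γ)) * phase (freq θ * sform u γ) =
      phase (freq θ * sform σ γ) := by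
    rw [← phase_add, sform_neg_right, sform_add_left, sform_sub_left, sform_self]
    congr 1
    ring
  rw [← h]
  ring

lemma sform_loop_identity (u v w s : C2) :
    sform w u + sform (w + u) (-v) +
      (sform (w + u + -v) (s + (v - u)) + sform (w + u + -v + (s + (v - u))) (-w)) =
    2 * sform w s + (sform u (s - v) - sform v s) := by
  simp [sform]
  ring

lemma continuous_loopFun_integrand (hθ : 0 < θ) (μ₀ : ℝ) {ε : ℝ} (hε : 0 < ε) (v : C2)
    {X : Type*} [TopologicalSpace X] {s u : X → C2} (hs : Continuous s) (hu : Continuous u) :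
    Continuous fun x => (propKer θ μ₀ ε (u x) : ℂ) * (propKer θ μ₀ ε (u x + -(v + s x)) : ℂ) *
      phase (freq θ * (sform (u x) (s x - v) - sform v (s x))) := by
  have h1 := continuous_propKer hθ μ₀ hε
  have h2 : Continuous fun x => phase (freq θ * (sform (u x) (s x - v) - sform v (s x))) :=
    continuous_phase_comp (continuous_const.mul ((continuous_sform_comp hu
      (by fun_prop)).sub (continuous_sform_comp (by fun_prop) hs)))
  fun_prop

lemma norm_loopFun_integrand_le (hθ : 0 < θ) (μ₀ : ℝ) {ε : ℝ} (hε : 0 < ε) (u δ : C2) (t : ℝ) :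
    ‖(propKer θ μ₀ ε u : ℂ) * (propKer θ μ₀ ε (u + δ) : ℂ) * phase t‖ ≤
      propKer θ μ₀ ε u * propBound θ μ₀ ε := by
  rw [norm_mul, norm_mul, norm_phase, mul_one, norm_propKer, norm_propKer]
  exact mul_le_mul_of_nonneg_left (propKer_le_propBound hθ μ₀ hε _) (propKer_nonneg _ _ _ _)

lemma continuous_loopFun (hθ : 0 < θ) (μ₀ : ℝ) {ε : ℝ} (hε : 0 < ε) {φ χ : C2 → ℂ}
    (hφ : φ ∈ smoothModule θ) (hχ : χ ∈ smoothModule θ) (v : C2) :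
    Continuous (loopFun θ μ₀ ε φ χ v) := by
  refine (continuous_matCoef hθ hφ (fockLike_of_mem hθ hχ)).mul ?_
  unfold loopInt
  refine continuous_of_dominated (bound := fun u => propKer θ μ₀ ε u * propBound θ μ₀ ε)
    (fun s => ?_) (fun s => Eventually.of_forall fun u => ?_)
    ((integrable_propKer hθ μ₀ hε).mul_const _) (Eventually.of_forall fun u => ?_)
  · exact (continuous_loopFun_integrand hθ μ₀ hε v continuous_const
      continuous_id).aestronglyMeasurable
  · exact norm_loopFun_integrand_le hθ μ₀ hε _ _ _
  · exact continuous_loopFun_integrand hθ μ₀ hε v continuous_id continuous_const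

lemma integrable_loopFun (hθ : 0 < θ) (μ₀ : ℝ) {ε : ℝ} (hε : 0 < ε) {φ χ : C2 → ℂ}
    (hφ : φ ∈ smoothModule θ) (hχ : χ ∈ smoothModule θ) (v : C2) :
    Integrable (loopFun θ μ₀ ε φ χ v) := by
  refine ((integrable_matCoef hθ hφ hχ).norm.mul_const
    (∫ u, propKer θ μ₀ ε u * propBound θ μ₀ ε)).mono'
    (continuous_loopFun hθ μ₀ hε hφ hχ v).aestronglyMeasurable (Eventually.of_forall fun s => ?_)
  rw [loopFun, norm_mul]
  refine mul_le_mul_of_nonneg_left ?_ (norm_nonneg _)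
  exact norm_integral_le_of_norm_le ((integrable_propKer hθ μ₀ hε).mul_const _)
    (Eventually.of_forall fun u => norm_loopFun_integrand_le hθ μ₀ hε _ _ _)

lemma loopC_eq_sympFourier (hθ : 0 < θ) (μ₀ : ℝ) {ε : ℝ} (hε : 0 < ε) {φ χ : C2 → ℂ}
    (hφ : φ ∈ smoothModule θ) (hχ : χ ∈ smoothModule θ) (v w : C2) :
    bInner θ φ (transl θ w (regProp θ μ₀ ε (transl θ (-v) (regProp θ μ₀ ε (transl θ (-w) χ))))) =
      sympFourier (freq θ) (loopFun θ μ₀ ε φ χ v) w := by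
  have hχ' := fockLike_transl (fockLike_of_mem hθ hχ) (-w)
  rw [bInner_transl_regProp hθ μ₀ hε hφ (fockLike_transl (fockLike_regProp hθ μ₀ hε hχ') (-v))]
  set G : C2 → C2 → ℂ := fun u s => matCoef θ φ χ s * phase (2 * freq θ * sform w s) *
    ((propKer θ μ₀ ε u : ℂ) * (propKer θ μ₀ ε (u + -(v + s)) : ℂ) *
      phase (freq θ * (sform u (s - v) - sform v s))) with hG
  have e1 (u : C2) : (propKer θ μ₀ ε u : ℂ) * bInner θ φ (transl θ w (transl θ u
      (transl θ (-v) (regProp θ μ₀ ε (transl θ (-w) χ))))) = ∫ s, G u s := by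
    rw [transl_transl θ w u, bInner_const_mul, bInner_transl_transl, lineD_eq hθ μ₀ hε hφ hχ,
      ← integral_add_right_eq_self _ (v - u), ← integral_const_mul, ← integral_const_mul,
      ← integral_const_mul]
    congr 1
    funext s
    have h1 : propKer θ μ₀ ε (s + (v - u)) = propKer θ μ₀ ε (u + -(v + s)) := by
      rw [← propKer_neg]; congr 1; abel
    have h2 : phase (freq θ * sform w u) * phase (freq θ * sform (w + u) (-v)) *
        phase (freq θ * (sform (w + u + -v) (s + (v - u)) +
          sform (w + u + -v + (s + (v - u))) (-w))) =
        phase (2 * freq θ * sform w s) * phase (freq θ * (sform u (s - v) - sform v s)) := by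
      rw [← phase_add, ← phase_add, ← phase_add, ← mul_add, ← mul_add, sform_loop_identity]
      congr 1
      ring
    rw [show w + u + -v + (s + (v - u)) + -w = s by abel, h1]
    simp only [hG]
    linear_combination (propKer θ μ₀ ε u : ℂ) * (propKer θ μ₀ ε (u + -(v + s)) : ℂ) *
      matCoef θ φ χ s * h2
  have hGi : Integrable (Function.uncurry G) (volume.prod volume) := by
    have hm := continuous_matCoef hθ hφ (fockLike_of_mem hθ hχ)
    have hc := continuous_loopFun_integrand hθ μ₀ hε v (continuous_snd (X := C2) (Y := C2))
      continuous_fst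
    have hp : Continuous fun p : C2 × C2 => phase (2 * freq θ * sform w p.2) :=
      continuous_phase_comp (continuous_const.mul (continuous_sform_comp (by fun_prop)
        (by fun_prop)))
    refine (((integrable_propKer hθ μ₀ hε).mul_const (propBound θ μ₀ ε)).mul_prod
      (integrable_matCoef hθ hφ hχ).norm).mono' ?_ (Eventually.of_forall fun p => ?_)
    · exact (((hm.comp continuous_snd).mul hp).mul hc).aestronglyMeasurable
    · simp only [Function.uncurry, hG]
      rw [norm_mul, norm_mul, norm_phase, mul_one, mul_comm]
      exact mul_le_mul_of_nonneg_right (norm_loopFun_integrand_le hθ μ₀ hε _ _ _) (norm_nonneg _)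
  simp only [e1]
  rw [integral_integral_swap hGi, sympFourier]
  congr 1
  funext s
  rw [hG, integral_const_mul, loopFun, loopInt]
  ring

lemma ampC_eq (hθ : 0 < θ) (μ₀ : ℝ) {ε : ℝ} (hε : 0 < ε) {φ : Fin 4 → C2 → ℂ}
    (hφ : ∀ i, φ i ∈ smoothModule θ) (v w : C2) :
    ampC θ μ₀ ε φ v w = matCoef θ (φ 0) (φ 1) v *
      sympFourier (freq θ) (loopFun θ μ₀ ε (φ 2) (φ 3) v) w := by
  rw [ampC, loopC_eq_sympFourier hθ μ₀ hε (hφ 2) (hφ 3), matCoef]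

lemma continuous_ampC_right (hθ : 0 < θ) (μ₀ : ℝ) {ε : ℝ} (hε : 0 < ε) {φ : Fin 4 → C2 → ℂ}
    (hφ : ∀ i, φ i ∈ smoothModule θ) (v : C2) :
    Continuous fun w => ampC θ μ₀ ε φ v w := by
  simp only [ampC_eq hθ μ₀ hε hφ]
  exact continuous_const.mul
    (continuous_sympFourier _ (integrable_loopFun hθ μ₀ hε (hφ 2) (hφ 3) v))

/-- The product of the external matrix coefficients in a mode of the first graph. -/
noncomputable def profileC (θ : ℝ) (φ : Fin 4 → C2 → ℂ) (γ σ u : C2) : ℂ :=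
  phase (freq θ * (sform u (σ - γ) - sform γ σ)) *
    (matCoef θ (φ 0) (φ 1) γ * matCoef θ (φ 2) (φ 3) σ)

theorem poissonMode_ampC (hθ : 0 < θ) (μ₀ : ℝ) {ε : ℝ} (hε : 0 < ε) {φ : Fin 4 → C2 → ℂ}
    (hφ : ∀ i, φ i ∈ smoothModule θ) (γ : C2) (d : LatIdx) :
    poissonMode θ (fun w => ampC θ μ₀ ε φ γ w) d =
      loopInt θ μ₀ ε (-(γ + Complex.I • dualPt d))
        (profileC θ φ γ (Complex.I • dualPt d)) / 4 := by
  set σ := Complex.I • dualPt d with hσ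
  have hs : Integrable (sympFourier (freq θ) (loopFun θ μ₀ ε (φ 2) (φ 3) γ)) := by
    obtain ⟨C, hC, h⟩ := exists_norm_loopC_le hθ μ₀ hε (hφ 2) (hφ 3) 5
    refine ((integrable_inv_br_pow_C2 le_rfl).const_mul C).mono'
      (continuous_sympFourier _ (integrable_loopFun hθ μ₀ hε (hφ 2) (hφ 3) γ)).aestronglyMeasurable
      (Eventually.of_forall fun w => ?_)
    rw [← loopC_eq_sympFourier hθ μ₀ hε (hφ 2) (hφ 3)]
    refine (h γ w).trans (mul_le_mul_of_nonneg_right ?_ (inv_br_pow_nonneg _ _))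
    exact mul_le_of_le_one_right hC.le (inv_br_pow_le_one _ _)
  rw [poissonMode_eq, ← hσ]
  simp only [ampC_eq hθ μ₀ hε hφ, mul_assoc (matCoef θ (φ 0) (φ 1) γ)]
  rw [integral_const_mul, integral_sympFourier_mul_phase (freq_pos hθ)
    (continuous_loopFun hθ μ₀ hε (hφ 2) (hφ 3) γ) (integrable_loopFun hθ μ₀ hε (hφ 2) (hφ 3) γ) hs,
    mul_left_comm (matCoef θ (φ 0) (φ 1) γ), covolume_mul hθ]
  congr 1
  rw [loopFun, loopInt, loopInt, ← integral_const_mul, ← integral_const_mul]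
  congr 1
  funext u
  rw [profileC]
  ring

end Modes

/-! ### The propagator kernel near its singularity -/

section Kernel

variable {θ : ℝ}

lemma hasDerivAt_one_sub_exp (θ β : ℝ) : HasDerivAt (fun β : ℝ => 1 - Real.exp (-2 * freq θ * β))
    (2 * freq θ * Real.exp (-2 * freq θ * β)) β := by
  have := (((hasDerivAt_id β).const_mul (-2 * freq θ)).exp).const_sub 1
  refine this.congr_deriv ?_
  simp [mul_comm]

lemma tendsto_exp_neg_freq_atTop (hθ : 0 < θ) :
    Tendsto (fun β : ℝ => Real.exp (-2 * freq θ * β)) atTop (𝓝 0) := by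
  refine Real.tendsto_exp_atBot.comp ?_
  exact tendsto_id.const_mul_atTop_of_neg (by have := freq_pos hθ; linarith)

lemma exp_neg_mass_le (θ μ₀ : ℝ) {β : ℝ} (hβ : 0 ≤ β) :
    Real.exp (-β * (2 * freq θ + μ₀ ^ 2)) ≤ Real.exp (-2 * freq θ * β) := by
  rw [Real.exp_le_exp]
  have := mul_nonneg hβ (sq_nonneg μ₀)
  linarith

/-- The derivative in `β` of `exp(-ω|u|²/(1 - e^{-2ωβ}))` dominates the heat kernel, so that its
integral over `β` is explicit. -/
lemma propKer_le_inv_normSq2 (hθ : 0 < θ) (μ₀ : ℝ) {ε : ℝ} (hε : 0 < ε) {u : C2} (hu : u ≠ 0) :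
    propKer θ μ₀ ε u ≤
      (2 * Real.pi ^ 2)⁻¹ * (Real.exp (-(freq θ / 2) * normSq2 u) * (normSq2 u)⁻¹) := by
  have hω := freq_pos hθ
  have hN : 0 < normSq2 u := lt_of_lt_of_le (pow_pos (norm_pos_iff.2 hu) 2) (norm_sq_le_normSq2 u)
  set n := normSq2 u with hn
  set t : ℝ → ℝ := fun β => 1 - Real.exp (-2 * freq θ * β) with ht
  have htpos (β) (hβ : 0 < β) : 0 < t β := one_sub_exp_pos hθ hβ
  set g : ℝ → ℝ := fun β => (2 * Real.pi ^ 2 * n)⁻¹ * Real.exp (freq θ / 2 * n) *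
    Real.exp (-(freq θ * n) * (t β)⁻¹) with hg
  set g' : ℝ → ℝ := fun β => (2 * Real.pi ^ 2 * n)⁻¹ * Real.exp (freq θ / 2 * n) *
    (Real.exp (-(freq θ * n) * (t β)⁻¹) *
      (-(freq θ * n) * (-(2 * freq θ * Real.exp (-2 * freq θ * β)) / t β ^ 2))) with hg'
  have hder (β : ℝ) (hβ : β ∈ Set.Ici ε) : HasDerivAt g (g' β) β := by
    have h1 := (hasDerivAt_one_sub_exp θ β).inv (htpos β (hε.trans_le hβ)).ne'
    exact ((h1.const_mul (-(freq θ * n))).exp).const_mul _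
  have hpos (β : ℝ) (hβ : β ∈ Set.Ioi ε) : 0 ≤ g' β := by
    have h2 : -(freq θ * n) * (-(2 * freq θ * Real.exp (-2 * freq θ * β)) / t β ^ 2) =
      (freq θ * n) * (2 * freq θ * Real.exp (-2 * freq θ * β) / t β ^ 2) := by ring
    simp only [hg', h2]
    positivity
  have hlim : Tendsto g atTop (𝓝 ((2 * Real.pi ^ 2 * n)⁻¹ * Real.exp (freq θ / 2 * n) *
      Real.exp (-(freq θ * n) * (1 - 0)⁻¹))) := by
    refine Tendsto.const_mul _ ((Real.continuous_exp.tendsto _).comp (Tendsto.const_mul _ ?_))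
    exact ((tendsto_exp_neg_freq_atTop hθ).const_sub 1).inv₀ (by norm_num)
  have hle (β : ℝ) (hβ : β ∈ Set.Ioi ε) : heatKer θ μ₀ β u ≤ g' β := by
    have h0 : 0 < t β := htpos β (hε.trans hβ)
    have h1 := exp_neg_mass_le θ μ₀ (hε.trans hβ).le
    have h2 : g' β = Real.exp (-2 * freq θ * β) * (freq θ / (Real.pi * t β)) ^ 2 *
        Real.exp (-(freq θ * (1 / t β - 1 / 2)) * n) := by
      rw [show -(freq θ * (1 / t β - 1 / 2)) * n = freq θ / 2 * n + -(freq θ * n) * (t β)⁻¹ by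
        field_simp; ring, Real.exp_add]
      simp only [hg']
      have := Real.pi_pos
      field_simp
    rw [h2, heatKer]
    gcongr
  rw [propKer]
  refine (setIntegral_mono_on₀ ?_ (integrableOn_Ioi_deriv_of_nonneg' hder hpos hlim)
    measurableSet_Ioi.nullMeasurableSet fun β hβ => hle β hβ).trans ?_
  · refine (integrableOn_Ioi_deriv_of_nonneg' hder hpos hlim).mono'
      ((measurable_heatKer θ μ₀).comp (measurable_id.prodMk measurable_const)).aestronglyMeasurable ?_
    filter_upwards [ae_restrict_mem measurableSet_Ioi] with β hβ
    rw [Real.norm_of_nonneg (heatKer_nonneg _ _ _ _)]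
    exact hle β hβ
  · rw [integral_Ioi_of_hasDerivAt_of_nonneg' hder hpos hlim, sub_zero, inv_one, mul_one, mul_assoc,
      ← Real.exp_add, mul_inv _ n]
    have h3 : 0 ≤ g ε := by simp only [hg]; positivity
    rw [show freq θ / 2 * n + -(freq θ * n) = -(freq θ / 2) * n by ring]
    linarith

lemma propKer_le_inv_norm_sq (hθ : 0 < θ) (μ₀ : ℝ) {ε : ℝ} (hε : 0 < ε) {u : C2} (hu : u ≠ 0) :
    propKer θ μ₀ ε u ≤ Real.exp (-(freq θ / 2) * ‖u‖ ^ 2) * (‖u‖ ^ 2)⁻¹ := by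
  have hω := freq_pos hθ
  have h0 : 0 < ‖u‖ ^ 2 := pow_pos (norm_pos_iff.2 hu) 2
  have h1 := norm_sq_le_normSq2 u
  have h2 : (2 * Real.pi ^ 2)⁻¹ ≤ 1 := by
    refine inv_le_one_of_one_le₀ ?_
    nlinarith [Real.pi_gt_three]
  refine (propKer_le_inv_normSq2 hθ μ₀ hε hu).trans ?_
  have h3 : 0 ≤ (normSq2 u)⁻¹ := inv_nonneg.2 (h0.le.trans h1)
  calc _ ≤ 1 * (Real.exp (-(freq θ / 2) * ‖u‖ ^ 2) * (‖u‖ ^ 2)⁻¹) := by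
        refine mul_le_mul h2 ?_ (by positivity) zero_le_one
        refine mul_le_mul ?_ (inv_anti₀ h0 h1) h3 (Real.exp_pos _).le
        rw [Real.exp_le_exp]
        nlinarith
    _ = _ := one_mul _

/-- Away from the origin the kernel converges when the cutoff is removed. -/
lemma exists_tendsto_propKer (hθ : 0 < θ) (μ₀ : ℝ) {u : C2} (hu : u ≠ 0) :
    ∃ k : ℝ, Tendsto (fun ε => propKer θ μ₀ ε u) (𝓝[>] 0) (𝓝 k) := by
  have hω := freq_pos hθ
  have hN : 0 < normSq2 u := lt_of_lt_of_le (pow_pos (norm_pos_iff.2 hu) 2) (norm_sq_le_normSq2 u)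
  set n := normSq2 u with hn
  have hint : IntegrableOn (fun β => heatKer θ μ₀ β u) (Set.Ioi 0) := by
    refine ((integrable_exp_neg_mul_Ioi (mass_pos hθ μ₀) 0).mul_const
      (2 / (Real.pi ^ 2 * n ^ 2) * Real.exp (freq θ / 2 * n))).mono'
      ((measurable_heatKer θ μ₀).comp (measurable_id.prodMk measurable_const)).aestronglyMeasurable ?_
    filter_upwards [ae_restrict_mem measurableSet_Ioi] with β hβ
    rw [Real.norm_of_nonneg (heatKer_nonneg _ _ _ _), heatKer, mul_assoc,
      show -β * (2 * freq θ + μ₀ ^ 2) = -(2 * freq θ + μ₀ ^ 2) * β by ring]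
    refine mul_le_mul_of_nonneg_left ?_ (Real.exp_pos _).le
    have ht := one_sub_exp_pos hθ hβ
    set t := 1 - Real.exp (-2 * freq θ * β)
    rw [show -(freq θ * (1 / t - 1 / 2)) * normSq2 u = -(freq θ * n / t) + freq θ / 2 * n by
      rw [← hn]; ring, Real.exp_add, ← mul_assoc]
    refine mul_le_mul_of_nonneg_right ?_ (Real.exp_pos _).le
    have h1 := Real.quadratic_le_exp_of_nonneg (x := freq θ * n / t) (by positivity)
    have h2 : (freq θ * n / t) ^ 2 / 2 ≤ Real.exp (freq θ * n / t) := by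
      have : 0 ≤ freq θ * n / t := by positivity
      linarith
    rw [Real.exp_neg, ← div_eq_mul_inv, div_le_iff₀ (Real.exp_pos _)]
    calc (freq θ / (Real.pi * t)) ^ 2 = 2 / (Real.pi ^ 2 * n ^ 2) * ((freq θ * n / t) ^ 2 / 2) := by
          have := Real.pi_pos
          field_simp
      _ ≤ _ := by gcongr
  refine ⟨∫ β in Set.Ioi 0, heatKer θ μ₀ β u, ?_⟩
  have hA : AECover (volume.restrict (Set.Ioi (0 : ℝ))) (𝓝[>] (0 : ℝ)) fun ε => Set.Ioi ε :=
    aecover_Ioi_of_Ioi (tendsto_id.mono_left nhdsWithin_le_nhds)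
  refine (hA.integral_tendsto_of_countably_generated hint).congr' ?_
  filter_upwards [self_mem_nhdsWithin] with ε hε
  rw [propKer, Measure.restrict_restrict measurableSet_Ioi,
    Set.inter_eq_self_of_subset_left (Set.Ioi_subset_Ioi (le_of_lt hε))]

end Kernel

/-! ### The logarithmically divergent constant -/

/-- The loop integral `∫ k_ε(u)² du` at coinciding positions. -/
noncomputable def loopConst (θ μ₀ ε : ℝ) : ℝ := ∫ u, propKer θ μ₀ ε u ^ 2

section LoopConst

variable {θ : ℝ}

/-- By the semigroup law two heat kernels at times `β₁, β₂` overlap in a function of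
`β₁ + β₂`. -/
noncomputable def heatOverlap (θ μ₀ s : ℝ) : ℝ :=
  Real.exp (-s * (2 * freq θ + μ₀ ^ 2)) / (1 - Real.exp (-2 * freq θ * s)) ^ 2

lemma integral_heatKer_mul_heatKer (hθ : 0 < θ) (μ₀ : ℝ) {a b : ℝ} (ha : 0 < a) (hb : 0 < b) :
    ∫ u, heatKer θ μ₀ a u * heatKer θ μ₀ b u =
      (freq θ / Real.pi) ^ 2 * heatOverlap θ μ₀ (a + b) := by
  have hω := freq_pos hθ
  have hpi := Real.pi_pos
  have h1 := one_sub_exp_pos hθ ha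
  have h2 := one_sub_exp_pos hθ hb
  have h3 := one_sub_exp_pos hθ (add_pos ha hb)
  have hab : Real.exp (-2 * freq θ * (a + b)) =
      Real.exp (-2 * freq θ * a) * Real.exp (-2 * freq θ * b) := by
    rw [← Real.exp_add]; congr 1; ring
  simp only [heatKer, heatOverlap]
  rw [hab] at h3 ⊢
  set x := Real.exp (-2 * freq θ * a)
  set y := Real.exp (-2 * freq θ * b)
  have hc : 0 < freq θ * ((1 - x * y) / ((1 - x) * (1 - y))) := by positivity
  have e1 (u : C2) : Real.exp (-a * (2 * freq θ + μ₀ ^ 2)) * (freq θ / (Real.pi * (1 - x))) ^ 2 *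
      Real.exp (-(freq θ * (1 / (1 - x) - 1 / 2)) * normSq2 u) *
      (Real.exp (-b * (2 * freq θ + μ₀ ^ 2)) * (freq θ / (Real.pi * (1 - y))) ^ 2 *
      Real.exp (-(freq θ * (1 / (1 - y) - 1 / 2)) * normSq2 u)) =
      Real.exp (-(a + b) * (2 * freq θ + μ₀ ^ 2)) * (freq θ / (Real.pi * (1 - x))) ^ 2 *
        (freq θ / (Real.pi * (1 - y))) ^ 2 *
      Real.exp (-(freq θ * ((1 - x * y) / ((1 - x) * (1 - y)))) * normSq2 u) := by
    rw [show -(freq θ * ((1 - x * y) / ((1 - x) * (1 - y)))) * normSq2 u =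
      -(freq θ * (1 / (1 - x) - 1 / 2)) * normSq2 u +
      -(freq θ * (1 / (1 - y) - 1 / 2)) * normSq2 u by field_simp; ring, Real.exp_add,
      show -(a + b) * (2 * freq θ + μ₀ ^ 2) = -a * (2 * freq θ + μ₀ ^ 2) +
        -b * (2 * freq θ + μ₀ ^ 2) by ring, Real.exp_add]
    ring
  simp only [e1]
  rw [integral_const_mul, integral_exp_neg_normSq2 hc]
  field_simp

lemma heatOverlap_nonneg (θ μ₀ s : ℝ) : 0 ≤ heatOverlap θ μ₀ s := by
  unfold heatOverlap; positivity

/-- The square `(ε, ∞)²` of proper times with Lebesgue measure. -/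
noncomputable abbrev timeMeasure (ε : ℝ) : Measure (ℝ × ℝ) :=
  (volume.restrict (Set.Ioi ε)).prod (volume.restrict (Set.Ioi ε))

lemma timeMeasure_eq (ε : ℝ) :
    timeMeasure ε = volume.restrict (Set.Ioi ε ×ˢ Set.Ioi ε) := by
  rw [timeMeasure, Measure.prod_restrict]; rfl

lemma ae_timeMeasure (ε : ℝ) : ∀ᵐ p ∂timeMeasure ε, ε < p.1 ∧ ε < p.2 := by
  rw [timeMeasure_eq]
  exact ae_restrict_mem (measurableSet_Ioi.prod measurableSet_Ioi)

lemma measurable_heatOverlap (θ μ₀ : ℝ) : Measurable (heatOverlap θ μ₀) := by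
  unfold heatOverlap; fun_prop

lemma loopConst_eq (hθ : 0 < θ) (μ₀ : ℝ) {ε : ℝ} (hε : 0 < ε) :
    loopConst θ μ₀ ε = (freq θ / Real.pi) ^ 2 *
      ∫ p, heatOverlap θ μ₀ (p.1 + p.2) ∂timeMeasure ε := by
  have hω := freq_pos hθ
  have hm := mass_pos hθ μ₀
  have e1 (u : C2) : propKer θ μ₀ ε u ^ 2 =
      ∫ p, heatKer θ μ₀ p.1 u * heatKer θ μ₀ p.2 u ∂timeMeasure ε := by
    rw [integral_prod_mul (fun β => heatKer θ μ₀ β u) fun β => heatKer θ μ₀ β u, pow_two]; rfl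
  have hmeas : Measurable fun q : C2 × (ℝ × ℝ) =>
      heatKer θ μ₀ q.2.1 q.1 * heatKer θ μ₀ q.2.2 q.1 := by
    have h := measurable_heatKer θ μ₀
    exact (h.comp (by fun_prop : Measurable fun q : C2 × (ℝ × ℝ) => (q.2.1, q.1))).mul
      (h.comp (by fun_prop : Measurable fun q : C2 × (ℝ × ℝ) => (q.2.2, q.1)))
  have hint : Integrable (Function.uncurry fun (u : C2) (p : ℝ × ℝ) =>
      heatKer θ μ₀ p.1 u * heatKer θ μ₀ p.2 u) (volume.prod (timeMeasure ε)) := by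
    set K := (freq θ / (Real.pi * (1 - Real.exp (-2 * freq θ * ε)))) ^ 2
    have hb := ((integrable_exp_neg_normSq2 (half_pos hω)).mul_prod
      ((integrable_exp_neg_mul_Ioi hm ε).mul_prod (integrable_exp_neg_mul_Ioi hm ε))).const_mul
      (K * K)
    refine hb.mono' hmeas.aestronglyMeasurable ?_
    have hae : ∀ᵐ q ∂(volume : Measure C2).prod (timeMeasure ε), ε < q.2.1 ∧ ε < q.2.2 :=
      Measure.quasiMeasurePreserving_snd.ae (ae_timeMeasure ε)
    filter_upwards [hae] with q hq
    have h1 := heatKer_le hθ μ₀ hε hq.1 q.1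
    have h2 := heatKer_le hθ μ₀ hε hq.2 q.1
    have h3 : Real.exp (-(freq θ / 2) * normSq2 q.1) ≤ 1 := by
      rw [Real.exp_le_one_iff]
      have := mul_nonneg hω.le (normSq2_nonneg q.1)
      linarith
    simp only [Function.uncurry]
    rw [Real.norm_of_nonneg (mul_nonneg (heatKer_nonneg _ _ _ _) (heatKer_nonneg _ _ _ _))]
    refine (mul_le_mul h1 (h2.trans (mul_le_of_le_one_right (by positivity) h3))
      (heatKer_nonneg _ _ _ _) (by positivity)).trans (le_of_eq ?_)
    ring
  rw [loopConst]
  simp only [e1]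
  rw [integral_integral_swap hint, ← integral_const_mul]
  refine integral_congr_ae ?_
  filter_upwards [ae_timeMeasure ε] with p hp
  exact integral_heatKer_mul_heatKer hθ μ₀ (hε.trans hp.1) (hε.trans hp.2)

lemma mul_sq_exp_le {x : ℝ} (hx : 0 < x) :
    Real.exp (-x) / (1 - Real.exp (-x)) ^ 2 ≤ 16 * Real.exp (-x / 2) / x ^ 2 := by
  have h1 : 0 < 1 - Real.exp (-x) := by rw [sub_pos, Real.exp_lt_one_iff]; linarith
  have h2 : x ≤ (1 + x) * (1 - Real.exp (-x)) := by
    have : Real.exp (-x) * (1 + x) ≤ 1 := by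
      rw [Real.exp_neg, inv_mul_le_iff₀ (Real.exp_pos _)]
      linarith [Real.add_one_le_exp x]
    nlinarith
  have h3 : 1 + x ≤ 4 * Real.exp (x / 4) := by
    linarith [Real.add_one_le_exp (x / 4)]
  rw [div_le_div_iff₀ (by positivity) (by positivity)]
  have h4 : x ^ 2 ≤ 16 * Real.exp (x / 2) * (1 - Real.exp (-x)) ^ 2 := by
    calc x ^ 2 ≤ ((1 + x) * (1 - Real.exp (-x))) ^ 2 := pow_le_pow_left₀ hx.le h2 2
      _ = (1 + x) ^ 2 * (1 - Real.exp (-x)) ^ 2 := by ring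
      _ ≤ (4 * Real.exp (x / 4)) ^ 2 * (1 - Real.exp (-x)) ^ 2 := by gcongr
      _ = _ := by
        rw [mul_pow, ← Real.exp_nat_mul, show ((2 : ℕ) : ℝ) * (x / 4) = x / 2 by push_cast; ring]
        norm_num
  calc Real.exp (-x) * x ^ 2
      ≤ Real.exp (-x) * (16 * Real.exp (x / 2) * (1 - Real.exp (-x)) ^ 2) := by gcongr
    _ = 16 * (Real.exp (-x) * Real.exp (x / 2)) * (1 - Real.exp (-x)) ^ 2 := by ring
    _ = _ := by rw [← Real.exp_add]; congr 4; ring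

/-- The mass changes the loop constant only by an integrable amount. -/
lemma integrable_heatOverlap_sub (hθ : 0 < θ) (μ₀ : ℝ) :
    Integrable (fun p : ℝ × ℝ => heatOverlap θ 0 (p.1 + p.2) - heatOverlap θ μ₀ (p.1 + p.2))
      (timeMeasure 0) := by
  have hω := freq_pos hθ
  have hG : IntegrableOn (fun x : ℝ => x ^ (-(1 / 2) : ℝ) * Real.exp (-freq θ * x)) (Set.Ioi 0) :=
    integrableOn_rpow_mul_exp_neg_mul_rpow (s := -(1 / 2)) (p := 1) (by norm_num) (by norm_num) hω |>.congr_fun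
      (fun x _ => by simp) measurableSet_Ioi
  refine ((hG.mul_prod hG).const_mul (4 * μ₀ ^ 2 / freq θ ^ 2)).mono' ?_ ?_
  · exact (((measurable_heatOverlap θ 0).comp (by fun_prop)).sub
      ((measurable_heatOverlap θ μ₀).comp (by fun_prop))).aestronglyMeasurable
  filter_upwards [ae_timeMeasure 0] with p hp
  obtain ⟨h1, h2⟩ := hp
  set s := p.1 + p.2 with hs
  have hspos : 0 < s := add_pos h1 h2
  have e1 : heatOverlap θ 0 s - heatOverlap θ μ₀ s = (1 - Real.exp (-(s * μ₀ ^ 2))) *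
      (Real.exp (-(2 * freq θ * s)) / (1 - Real.exp (-(2 * freq θ * s))) ^ 2) := by
    have : Real.exp (-s * (2 * freq θ + μ₀ ^ 2)) =
        Real.exp (-(2 * freq θ * s)) * Real.exp (-(s * μ₀ ^ 2)) := by
      rw [← Real.exp_add]; congr 1; ring
    rw [heatOverlap, heatOverlap, this, show -s * (2 * freq θ + 0 ^ 2) = -(2 * freq θ * s) by ring,
      show -2 * freq θ * s = -(2 * freq θ * s) by ring]
    ring
  have h3 : 0 ≤ 1 - Real.exp (-(s * μ₀ ^ 2)) := by
    rw [sub_nonneg, Real.exp_le_one_iff]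
    have := mul_nonneg hspos.le (sq_nonneg μ₀)
    linarith
  have h4 : 1 - Real.exp (-(s * μ₀ ^ 2)) ≤ s * μ₀ ^ 2 := by
    linarith [Real.add_one_le_exp (-(s * μ₀ ^ 2))]
  have h5 := mul_sq_exp_le (x := 2 * freq θ * s) (by positivity)
  rw [e1, Real.norm_of_nonneg (mul_nonneg h3 (by positivity))]
  refine (mul_le_mul h4 h5 (by positivity) (by positivity)).trans ?_
  have h6 : Real.exp (-(2 * freq θ * s) / 2) =
      Real.exp (-freq θ * p.1) * Real.exp (-freq θ * p.2) := by
    rw [← Real.exp_add, hs]; congr 1; ring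
  -- `1/(a + b) ≤ a^{-1/2} b^{-1/2}`
  have h7 : s⁻¹ ≤ p.1 ^ (-(1 / 2) : ℝ) * p.2 ^ (-(1 / 2) : ℝ) := by
    rw [Real.rpow_neg h1.le, Real.rpow_neg h2.le, ← Real.sqrt_eq_rpow, ← Real.sqrt_eq_rpow,
      ← mul_inv]
    refine inv_anti₀ (by positivity) ?_
    nlinarith [Real.sq_sqrt h1.le, Real.sq_sqrt h2.le, sq_nonneg (Real.sqrt p.1 - Real.sqrt p.2),
      Real.sqrt_nonneg p.1, Real.sqrt_nonneg p.2]
  rw [h6]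
  calc s * μ₀ ^ 2 * (16 * (Real.exp (-freq θ * p.1) * Real.exp (-freq θ * p.2)) /
        (2 * freq θ * s) ^ 2)
      = 4 * μ₀ ^ 2 / freq θ ^ 2 * (s⁻¹ * (Real.exp (-freq θ * p.1) * Real.exp (-freq θ * p.2))) := by
        field_simp; ring
    _ ≤ 4 * μ₀ ^ 2 / freq θ ^ 2 * ((p.1 ^ (-(1 / 2) : ℝ) * p.2 ^ (-(1 / 2) : ℝ)) *
        (Real.exp (-freq θ * p.1) * Real.exp (-freq θ * p.2))) := by gcongr
    _ = _ := by ring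

/-- The logarithm that generates the massless loop constant. -/
noncomputable def logPot (θ s : ℝ) : ℝ :=
  -(4 * freq θ ^ 2)⁻¹ * Real.log (1 - Real.exp (-2 * freq θ * s))

/-- Minus the derivative of `logPot`. -/
noncomputable def logPot' (θ s : ℝ) : ℝ :=
  (2 * freq θ)⁻¹ * (Real.exp (-2 * freq θ * s) / (1 - Real.exp (-2 * freq θ * s)))

lemma hasDerivAt_logPot (hθ : 0 < θ) {s : ℝ} (hs : 0 < s) :
    HasDerivAt (logPot θ) (-logPot' θ s) s := by
  have hω := freq_pos hθ
  have h := ((hasDerivAt_one_sub_exp θ s).log (one_sub_exp_pos hθ hs).ne').const_mul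
    (-(4 * freq θ ^ 2)⁻¹)
  refine h.congr_deriv ?_
  have := one_sub_exp_pos hθ hs
  rw [logPot']
  field_simp
  ring

lemma hasDerivAt_logPot' (hθ : 0 < θ) {s : ℝ} (hs : 0 < s) :
    HasDerivAt (logPot' θ) (-heatOverlap θ 0 s) s := by
  have hω := freq_pos hθ
  have h0 : HasDerivAt (fun s : ℝ => Real.exp (-2 * freq θ * s))
      (-(2 * freq θ * Real.exp (-2 * freq θ * s))) s := by
    have := (hasDerivAt_one_sub_exp θ s).const_sub 1
    simpa using this
  have h := (h0.div (hasDerivAt_one_sub_exp θ s) (one_sub_exp_pos hθ hs).ne').const_mul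
    ((2 * freq θ)⁻¹)
  refine h.congr_deriv ?_
  have := one_sub_exp_pos hθ hs
  rw [heatOverlap, show -s * (2 * freq θ + 0 ^ 2) = -2 * freq θ * s by ring]
  field_simp
  ring

lemma tendsto_logPot (hθ : 0 < θ) : Tendsto (logPot θ) atTop (𝓝 0) := by
  have h1 := (tendsto_exp_neg_freq_atTop hθ).const_sub 1
  have h2 := ((Real.continuousAt_log (by norm_num : (1 : ℝ) - 0 ≠ 0)).tendsto.comp h1).const_mul
    (-(4 * freq θ ^ 2)⁻¹)
  rwa [sub_zero, Real.log_one, mul_zero] at h2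

lemma tendsto_logPot' (hθ : 0 < θ) : Tendsto (logPot' θ) atTop (𝓝 0) := by
  have h1 := (tendsto_exp_neg_freq_atTop hθ).const_sub 1
  have h2 := ((tendsto_exp_neg_freq_atTop hθ).div h1 (by norm_num)).const_mul ((2 * freq θ)⁻¹)
  rwa [zero_div, mul_zero] at h2

lemma integral_heatOverlap_add (hθ : 0 < θ) {ε a : ℝ} (h : 0 < a + ε) :
    IntegrableOn (fun b => heatOverlap θ 0 (a + b)) (Set.Ioi ε) ∧
      ∫ b in Set.Ioi ε, heatOverlap θ 0 (a + b) = logPot' θ (a + ε) := by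
  have hd (b : ℝ) (hb : b ∈ Set.Ici ε) :
      HasDerivAt (fun b => -logPot' θ (a + b)) (heatOverlap θ 0 (a + b)) b := by
    have hb' : 0 < a + b := by have : ε ≤ b := hb; linarith
    have := ((hasDerivAt_logPot' hθ hb').comp_const_add a b).neg
    rwa [neg_neg] at this
  have hl : Tendsto (fun b => -logPot' θ (a + b)) atTop (𝓝 (-0)) :=
    ((tendsto_logPot' hθ).comp (tendsto_atTop_add_const_left _ a tendsto_id)).neg
  refine ⟨integrableOn_Ioi_deriv_of_nonneg' hd (fun _ _ => heatOverlap_nonneg _ _ _) hl, ?_⟩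
  rw [integral_Ioi_of_hasDerivAt_of_nonneg' hd (fun _ _ => heatOverlap_nonneg _ _ _) hl]
  ring

lemma logPot'_nonneg (hθ : 0 < θ) {s : ℝ} (hs : 0 < s) : 0 ≤ logPot' θ s := by
  have := freq_pos hθ
  have := one_sub_exp_pos hθ hs
  unfold logPot'; positivity

lemma integral_logPot'_add (hθ : 0 < θ) {ε : ℝ} (h : 0 < ε) :
    IntegrableOn (fun a => logPot' θ (a + ε)) (Set.Ioi ε) ∧
      ∫ a in Set.Ioi ε, logPot' θ (a + ε) = logPot θ (2 * ε) := by
  have hd (b : ℝ) (hb : b ∈ Set.Ici ε) :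
      HasDerivAt (fun b => -logPot θ (b + ε)) (logPot' θ (b + ε)) b := by
    have hb' : 0 < b + ε := by have : ε ≤ b := hb; linarith
    have := ((hasDerivAt_logPot hθ hb').comp_add_const b ε).neg
    rwa [neg_neg] at this
  have hn (b : ℝ) (hb : b ∈ Set.Ioi ε) : 0 ≤ logPot' θ (b + ε) :=
    logPot'_nonneg hθ (by have : ε < b := hb; linarith)
  have hl : Tendsto (fun b => -logPot θ (b + ε)) atTop (𝓝 (-0)) :=
    ((tendsto_logPot hθ).comp (tendsto_atTop_add_const_right _ ε tendsto_id)).neg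
  refine ⟨integrableOn_Ioi_deriv_of_nonneg' hd hn hl, ?_⟩
  rw [integral_Ioi_of_hasDerivAt_of_nonneg' hd hn hl, two_mul]
  ring

lemma integral_heatOverlap_timeMeasure (hθ : 0 < θ) {ε : ℝ} (hε : 0 < ε) :
    Integrable (fun p : ℝ × ℝ => heatOverlap θ 0 (p.1 + p.2)) (timeMeasure ε) ∧
      ∫ p, heatOverlap θ 0 (p.1 + p.2) ∂timeMeasure ε = logPot θ (2 * ε) := by
  have hm : AEStronglyMeasurable (fun p : ℝ × ℝ => heatOverlap θ 0 (p.1 + p.2)) (timeMeasure ε) :=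
    ((measurable_heatOverlap θ 0).comp (by fun_prop)).aestronglyMeasurable
  have hint : Integrable (fun p : ℝ × ℝ => heatOverlap θ 0 (p.1 + p.2)) (timeMeasure ε) := by
    rw [integrable_prod_iff hm]
    constructor
    · filter_upwards [ae_restrict_mem measurableSet_Ioi] with a ha
      exact (integral_heatOverlap_add hθ (add_pos (hε.trans ha) hε)).1
    · refine (integral_logPot'_add hθ hε).1.congr ?_
      filter_upwards [ae_restrict_mem measurableSet_Ioi] with a ha
      rw [← (integral_heatOverlap_add hθ (add_pos (hε.trans ha) hε)).2]
      simp only [Real.norm_of_nonneg (heatOverlap_nonneg _ _ _)]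
  refine ⟨hint, ?_⟩
  rw [integral_prod _ hint, ← (integral_logPot'_add hθ hε).2]
  refine setIntegral_congr_fun measurableSet_Ioi fun a ha => ?_
  exact (integral_heatOverlap_add hθ (add_pos (hε.trans ha) hε)).2

lemma exists_tendsto_logPot_sub_log (hθ : 0 < θ) :
    ∃ L : ℝ, Tendsto (fun ε => (freq θ / Real.pi) ^ 2 * logPot θ (2 * ε) -
      (4 * Real.pi ^ 2)⁻¹ * Real.log (1 / ε)) (𝓝[>] 0) (𝓝 L) := by
  have hω := freq_pos hθ
  have hd : HasDerivAt (fun ε : ℝ => 1 - Real.exp (-2 * freq θ * (2 * ε))) (4 * freq θ) 0 := by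
    have := (((hasDerivAt_id (0 : ℝ)).const_mul (-2 * freq θ * 2)).exp).const_sub 1
    simp only [mul_assoc, id] at this ⊢
    refine this.congr_deriv ?_
    simp; ring
  have h1 := hasDerivAt_iff_tendsto_slope.1 hd
  have h2 : Tendsto (slope (fun ε : ℝ => 1 - Real.exp (-2 * freq θ * (2 * ε))) 0) (𝓝[>] 0)
      (𝓝 (4 * freq θ)) := h1.mono_left (nhdsWithin_mono _ fun x hx => ne_of_gt hx)
  have h3 := ((Real.continuousAt_log (by positivity : 4 * freq θ ≠ 0)).tendsto.comp h2).const_mul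
    (-(4 * Real.pi ^ 2)⁻¹)
  refine ⟨_, h3.congr' ?_⟩
  filter_upwards [self_mem_nhdsWithin] with ε hε
  have hε' : 0 < ε := hε
  have h4 := one_sub_exp_pos hθ (by positivity : 0 < 2 * ε)
  have hpi := Real.pi_pos
  simp only [Function.comp, slope_def_field, mul_zero, Real.exp_zero, sub_self, sub_zero, logPot]
  rw [Real.log_div h4.ne' hε'.ne', one_div, Real.log_inv]
  field_simp
  ring

/-- The loop constant diverges like `(4π²)⁻¹ ln(1/ε)`. -/
theorem exists_tendsto_loopConst_sub_log (hθ : 0 < θ) (μ₀ : ℝ) :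
    ∃ L : ℝ, Tendsto (fun ε => loopConst θ μ₀ ε - (4 * Real.pi ^ 2)⁻¹ * Real.log (1 / ε))
      (𝓝[>] 0) (𝓝 L) := by
  obtain ⟨L, hL⟩ := exists_tendsto_logPot_sub_log hθ
  have hI := integrable_heatOverlap_sub hθ μ₀
  have hA : AECover (timeMeasure 0) (𝓝[>] (0 : ℝ)) fun ε => Set.Ioi ε ×ˢ Set.Ioi ε := by
    refine ⟨?_, fun ε => measurableSet_Ioi.prod measurableSet_Ioi⟩
    filter_upwards [ae_timeMeasure 0] with p hp
    have h1 : ∀ᶠ ε in 𝓝[>] (0 : ℝ), ε < p.1 := nhdsWithin_le_nhds (eventually_lt_nhds hp.1)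
    have h2 : ∀ᶠ ε in 𝓝[>] (0 : ℝ), ε < p.2 := nhdsWithin_le_nhds (eventually_lt_nhds hp.2)
    filter_upwards [h1, h2] with ε h1 h2 using ⟨h1, h2⟩
  have h1 := (hA.integral_tendsto_of_countably_generated hI).const_mul ((freq θ / Real.pi) ^ 2)
  refine ⟨_, (hL.sub h1).congr' ?_⟩
  filter_upwards [self_mem_nhdsWithin] with ε hε
  have hε' : 0 < ε := hε
  have hr : (timeMeasure 0).restrict (Set.Ioi ε ×ˢ Set.Ioi ε) = timeMeasure ε := by
    rw [timeMeasure, ← Measure.prod_restrict, Measure.restrict_restrict measurableSet_Ioi,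
      Set.inter_eq_self_of_subset_left (Set.Ioi_subset_Ioi hε'.le)]
  have hI' : Integrable (fun p : ℝ × ℝ => heatOverlap θ 0 (p.1 + p.2) -
      heatOverlap θ μ₀ (p.1 + p.2)) (timeMeasure ε) := by
    rw [← hr]; exact hI.restrict
  obtain ⟨i0, e0⟩ := integral_heatOverlap_timeMeasure hθ hε'
  have i1 : Integrable (fun p : ℝ × ℝ => heatOverlap θ μ₀ (p.1 + p.2)) (timeMeasure ε) := by
    refine (i0.sub hI').congr (Eventually.of_forall fun p => ?_)
    simp
  rw [hr, integral_sub i0 i1, e0, loopConst_eq hθ μ₀ hε']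
  ring

end LoopConst

/-! ### Divergent parts -/

section Divergence

lemma HasFiniteLimit.add {f g : ℝ → ℂ} (hf : HasFiniteLimit f) (hg : HasFiniteLimit g) :
    HasFiniteLimit fun ε => f ε + g ε := by
  obtain ⟨a, ha⟩ := hf
  obtain ⟨b, hb⟩ := hg
  exact ⟨a + b, ha.add hb⟩

lemma HasFiniteLimit.const_mul {f : ℝ → ℂ} (c : ℂ) (hf : HasFiniteLimit f) :
    HasFiniteLimit fun ε => c * f ε := by
  obtain ⟨a, ha⟩ := hf
  exact ⟨c * a, ha.const_mul c⟩

lemma HasFiniteLimit.congr {f g : ℝ → ℂ} (hf : HasFiniteLimit f) (h : ∀ ε, 0 < ε → f ε = g ε) :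
    HasFiniteLimit g := by
  obtain ⟨a, ha⟩ := hf
  refine ⟨a, ha.congr' ?_⟩
  filter_upwards [self_mem_nhdsWithin] with ε hε using h ε hε

lemma HasLogDivergence.congr {f g : ℝ → ℂ} {c : ℂ} (hf : HasLogDivergence f c)
    (h : ∀ ε, 0 < ε → f ε = g ε) : HasLogDivergence g c :=
  HasFiniteLimit.congr hf fun ε hε => by rw [h ε hε]

lemma HasLogDivergence.add {f g : ℝ → ℂ} {c d : ℂ} (hf : HasLogDivergence f c)
    (hg : HasLogDivergence g d) : HasLogDivergence (fun ε => f ε + g ε) (c + d) :=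
  (HasFiniteLimit.add hf hg).congr fun ε _ => by ring

lemma HasLogDivergence.const_mul {f : ℝ → ℂ} {c : ℂ} (a : ℂ) (hf : HasLogDivergence f c) :
    HasLogDivergence (fun ε => a * f ε) (a * c) :=
  (HasFiniteLimit.const_mul a hf).congr fun ε _ => by ring

lemma hasLogDivergence_loopConst {θ : ℝ} (hθ : 0 < θ) (μ₀ : ℝ) (c : ℂ) :
    HasLogDivergence (fun ε => c * (loopConst θ μ₀ ε : ℂ)) (c * ((4 * Real.pi ^ 2)⁻¹ : ℝ)) := by
  obtain ⟨L, hL⟩ := exists_tendsto_loopConst_sub_log hθ μ₀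
  refine HasLogDivergence.const_mul c ⟨L, ?_⟩
  have := (Complex.continuous_ofReal.tendsto L).comp hL
  refine this.congr fun ε => ?_
  simp only [Function.comp, Complex.ofReal_sub, Complex.ofReal_mul]

end Divergence

/-! ### Uniform bounds for the loop integrals -/

/-- The weight `1 + log(1 + 1/|δ|)`, which measures the near-coincidence singularity of the loop
integrals. At `δ = 0` the inverse vanishes and the weight is `1`. -/
noncomputable def logW (δ : C2) : ℝ := 1 + Real.log (1 + ‖δ‖⁻¹)

lemma one_le_logW (δ : C2) : 1 ≤ logW δ := by
  have : 0 ≤ Real.log (1 + ‖δ‖⁻¹) := Real.log_nonneg (by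
    have := inv_nonneg.2 (norm_nonneg δ); linarith)
  unfold logW; linarith

lemma logW_pos (δ : C2) : 0 < logW δ := zero_lt_one.trans_le (one_le_logW δ)

@[simp] lemma logW_zero : logW 0 = 1 := by simp [logW]

/-- The radial majorant `e^{-c r²} r⁻² (r + d)⁻²` of a product of two propagators. -/
noncomputable def pairBound (c d r : ℝ) : ℝ := Real.exp (-c * r ^ 2) * (r ^ 2)⁻¹ * ((r + d) ^ 2)⁻¹

section LoopBounds

lemma integral_pairBound_radial_le {c d : ℝ} (hc : 0 < c) (hd : 0 < d) :
    IntegrableOn (fun y => y ^ 3 • pairBound c d y) (Set.Ioi 0) ∧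
      ∫ y in Set.Ioi 0, y ^ 3 • pairBound c d y ≤
        Real.log (1 + d⁻¹) + ∫ y : ℝ, Real.exp (-c * y ^ 2) := by
  have hg := integrable_exp_neg_mul_sq hc
  have hle (y : ℝ) (hy : 0 < y) : y ^ 3 • pairBound c d y ≤ Real.exp (-c * y ^ 2) * (y + d)⁻¹ := by
    rw [pairBound, smul_eq_mul]
    have h1 : y * (y + d)⁻¹ ≤ 1 := by
      rw [← div_eq_mul_inv, div_le_one (by positivity)]; linarith
    calc y ^ 3 * (Real.exp (-c * y ^ 2) * (y ^ 2)⁻¹ * ((y + d) ^ 2)⁻¹)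
        = Real.exp (-c * y ^ 2) * (y + d)⁻¹ * (y * (y + d)⁻¹) := by field_simp
      _ ≤ Real.exp (-c * y ^ 2) * (y + d)⁻¹ * 1 := by gcongr
      _ = _ := mul_one _
  have hnn (y : ℝ) (hy : 0 < y) : 0 ≤ y ^ 3 • pairBound c d y := by
    rw [pairBound, smul_eq_mul]; positivity
  have hmeas : AEStronglyMeasurable (fun y => y ^ 3 • pairBound c d y)
      (volume.restrict (Set.Ioi 0)) := by
    unfold pairBound
    exact Measurable.aestronglyMeasurable (by fun_prop)
  have hint : IntegrableOn (fun y => y ^ 3 • pairBound c d y) (Set.Ioi 0) := by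
    refine (hg.mul_const d⁻¹).integrableOn.mono' hmeas ?_
    filter_upwards [ae_restrict_mem measurableSet_Ioi] with y hy
    rw [Real.norm_of_nonneg (hnn y hy)]
    refine (hle y hy).trans (mul_le_mul_of_nonneg_left ?_ (Real.exp_pos _).le)
    exact inv_anti₀ hd (by have : 0 < y := hy; linarith)
  refine ⟨hint, ?_⟩
  rw [← Set.Ioc_union_Ioi_eq_Ioi zero_le_one, setIntegral_union Set.Ioc_disjoint_Ioi_same
    measurableSet_Ioi (hint.mono_set Set.Ioc_subset_Ioi_self)
    (hint.mono_set (Set.Ioi_subset_Ioi zero_le_one))]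
  refine add_le_add ?_ ?_
  · have h1 : IntervalIntegrable (fun y => (y + d)⁻¹) volume 0 1 := by
      refine ContinuousOn.intervalIntegrable (ContinuousOn.inv₀ (by fun_prop) fun y hy => ?_)
      rw [Set.uIcc_of_le zero_le_one] at hy
      have := hy.1
      positivity
    have h2 : ∫ y in (0 : ℝ)..1, (y + d)⁻¹ = Real.log (1 + d⁻¹) := by
      have := intervalIntegral.integral_comp_add_right (a := 0) (b := 1) (fun y : ℝ => y⁻¹) d
      rw [this, zero_add, integral_inv_of_pos hd (by positivity)]
      congr 1
      field_simp
      ring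
    rw [← h2, intervalIntegral.integral_of_le zero_le_one]
    refine setIntegral_mono_on (hint.mono_set Set.Ioc_subset_Ioi_self)
      ((intervalIntegrable_iff_integrableOn_Ioc_of_le zero_le_one).1 h1) measurableSet_Ioc
      fun y hy => (hle y hy.1).trans ?_
    have := hy.1
    refine mul_le_of_le_one_left (by positivity) ?_
    rw [Real.exp_le_one_iff]
    have := mul_nonneg hc.le (sq_nonneg y)
    linarith
  · refine le_trans (setIntegral_mono_on (hint.mono_set (Set.Ioi_subset_Ioi zero_le_one))
      hg.integrableOn measurableSet_Ioi fun y hy => (hle y (zero_lt_one.trans hy)).trans ?_)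
      (setIntegral_le_integral hg (Eventually.of_forall fun y => (Real.exp_pos _).le))
    have hy1 : 1 < y := hy
    refine mul_le_of_le_one_right (Real.exp_pos _).le (inv_le_one_of_one_le₀ (by linarith))

lemma integrable_pairBound {c d : ℝ} (hc : 0 < c) (hd : 0 < d) :
    Integrable fun u : C2 => pairBound c d ‖u‖ := by
  rw [integrable_fun_norm_addHaar volume (f := pairBound c d), finrank_C2]
  exact (integral_pairBound_radial_le hc hd).1

lemma exists_integral_pairBound_le {c : ℝ} (hc : 0 < c) :
    ∃ C : ℝ, 0 < C ∧ ∀ δ : C2, δ ≠ 0 → ∫ u : C2, pairBound c ‖δ‖ ‖u‖ ≤ C * logW δ := by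
  set B := 4 * (volume : Measure C2).real (Metric.ball 0 1) with hB
  set I := ∫ y : ℝ, Real.exp (-c * y ^ 2) with hI
  have hI0 : 0 ≤ I := integral_nonneg fun _ => (Real.exp_pos _).le
  have hB0 : 0 ≤ B := by positivity
  refine ⟨B * (1 + I) + 1, by positivity, fun δ hδ => ?_⟩
  have hd := norm_pos_iff.2 hδ
  rw [integral_fun_norm_addHaar volume (pairBound c ‖δ‖), finrank_C2, nsmul_eq_mul, smul_eq_mul,
    ← mul_assoc]
  have h1 := (integral_pairBound_radial_le hc hd).2
  have hl : 0 ≤ Real.log (1 + ‖δ‖⁻¹) := Real.log_nonneg (by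
    have := inv_nonneg.2 hd.le; linarith)
  calc _ ≤ B * (Real.log (1 + ‖δ‖⁻¹) + I) := by
        rw [hB]; exact mul_le_mul_of_nonneg_left h1 hB0
    _ ≤ B * ((1 + I) * (1 + Real.log (1 + ‖δ‖⁻¹))) := by
        refine mul_le_mul_of_nonneg_left ?_ hB0
        nlinarith [mul_nonneg hI0 hl]
    _ ≤ (B * (1 + I) + 1) * logW δ := by
        rw [logW]; nlinarith

lemma inv_sq_le_of_le {a b d : ℝ} (ha : 0 < a) (hab : a ≤ b) (hd : 0 < d) (h : d ≤ a + b) :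
    (b ^ 2)⁻¹ ≤ 9 * ((a + d) ^ 2)⁻¹ := by
  have hb := ha.trans_le hab
  rw [← div_eq_mul_inv, le_div_iff₀ (by positivity), inv_mul_le_iff₀ (by positivity)]
  nlinarith

variable {θ : ℝ}

lemma exists_propKer_mul_propKer_le (hθ : 0 < θ) (K : ℕ) :
    ∃ C : ℝ, 0 < C ∧ ∀ (μ₀ ε : ℝ) (δ u : C2), 0 < ε → δ ≠ 0 → u ≠ 0 → u + δ ≠ 0 →
      propKer θ μ₀ ε u * propKer θ μ₀ ε (u + δ) * br u ^ K ≤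
        C * (pairBound (freq θ / 4) ‖δ‖ ‖u‖ + pairBound (freq θ / 4) ‖δ‖ ‖u + δ‖) := by
  have hω := freq_pos hθ
  obtain ⟨D, hD, hDb⟩ := exists_br_pow_mul_exp_le C2 (by positivity : 0 < freq θ / 4) K
  refine ⟨9 * D, by positivity, fun μ₀ ε δ u hε hδ hu hv => ?_⟩
  have h1 := propKer_le_inv_norm_sq hθ μ₀ hε hu
  have h2 := propKer_le_inv_norm_sq hθ μ₀ hε hv
  have hd : ‖δ‖ ≤ ‖u‖ + ‖u + δ‖ := by
    have := norm_sub_le (u + δ) u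
    rw [add_sub_cancel_left] at this
    linarith
  have h3 := hDb u
  set a := ‖u‖
  set b := ‖u + δ‖
  have ha : 0 < a := norm_pos_iff.2 hu
  have hb : 0 < b := norm_pos_iff.2 hv
  have hd0 : 0 < ‖δ‖ := norm_pos_iff.2 hδ
  have hbr : 0 ≤ br u ^ K := pow_nonneg (br_pos u).le K
  have e1 : Real.exp (-(freq θ / 2) * a ^ 2) =
      Real.exp (-(freq θ / 4) * a ^ 2) * Real.exp (-(freq θ / 4) * a ^ 2) := by
    rw [← Real.exp_add]; congr 1; ring
  have e2 : Real.exp (-(freq θ / 2) * b ^ 2) =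
      Real.exp (-(freq θ / 4) * b ^ 2) * Real.exp (-(freq θ / 4) * b ^ 2) := by
    rw [← Real.exp_add]; congr 1; ring
  have hexp (r : ℝ) : Real.exp (-(freq θ / 4) * r ^ 2) ≤ 1 := by
    rw [Real.exp_le_one_iff]
    have := mul_nonneg hω.le (sq_nonneg r)
    linarith
  have hpb (r : ℝ) : 0 ≤ pairBound (freq θ / 4) ‖δ‖ r := by unfold pairBound; positivity
  set x := Real.exp (-(freq θ / 4) * a ^ 2) with hx
  set y := Real.exp (-(freq θ / 4) * b ^ 2) with hy
  have hx0 : 0 < x := Real.exp_pos _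
  have hy0 : 0 < y := Real.exp_pos _
  have key : propKer θ μ₀ ε u * propKer θ μ₀ ε (u + δ) * br u ^ K ≤
      D * (x * y * (a ^ 2)⁻¹ * (b ^ 2)⁻¹) := by
    calc _ ≤ (Real.exp (-(freq θ / 2) * a ^ 2) * (a ^ 2)⁻¹) *
          (Real.exp (-(freq θ / 2) * b ^ 2) * (b ^ 2)⁻¹) * br u ^ K := by
          refine mul_le_mul_of_nonneg_right ?_ hbr
          exact mul_le_mul h1 h2 (propKer_nonneg _ _ _ _) (by positivity)
      _ = (br u ^ K * x) * y * (x * y * (a ^ 2)⁻¹ * (b ^ 2)⁻¹) := by rw [e1, e2]; ring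
      _ ≤ D * 1 * (x * y * (a ^ 2)⁻¹ * (b ^ 2)⁻¹) := by
          refine mul_le_mul_of_nonneg_right ?_ (by positivity)
          exact mul_le_mul h3 (hexp b) hy0.le hD.le
      _ = _ := by ring
  refine key.trans ?_
  rw [mul_comm 9 D, mul_assoc D]
  refine mul_le_mul_of_nonneg_left ?_ hD.le
  rcases le_total a b with hab | hab
  · have h4 := inv_sq_le_of_le ha hab hd0 hd
    calc x * y * (a ^ 2)⁻¹ * (b ^ 2)⁻¹ ≤ x * 1 * (a ^ 2)⁻¹ * (9 * ((a + ‖δ‖) ^ 2)⁻¹) := by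
          gcongr; exact hexp b
      _ = 9 * pairBound (freq θ / 4) ‖δ‖ a := by rw [pairBound, hx]; ring
      _ ≤ _ := by have := hpb b; linarith
  · have h4 := inv_sq_le_of_le hb hab hd0 (by linarith : ‖δ‖ ≤ b + a)
    calc x * y * (a ^ 2)⁻¹ * (b ^ 2)⁻¹ ≤ 1 * y * (9 * ((b + ‖δ‖) ^ 2)⁻¹) * (b ^ 2)⁻¹ := by
          gcongr; exact hexp a
      _ = 9 * pairBound (freq θ / 4) ‖δ‖ b := by rw [pairBound, hy]; ring
      _ ≤ _ := by have := hpb a; linarith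

lemma ae_ne_zero_and_add_ne_zero (δ : C2) : ∀ᵐ u : C2, u ≠ 0 ∧ u + δ ≠ 0 := by
  filter_upwards [Measure.ae_ne volume (0 : C2), Measure.ae_ne volume (-δ)] with u h1 h2
  exact ⟨h1, fun h => h2 (eq_neg_of_add_eq_zero_left h)⟩

/-- The part of a loop integral that stays finite when the cutoff is removed: at coinciding
positions the constant term of the profile is split off. -/
noncomputable def regLoop (θ μ₀ ε : ℝ) (δ : C2) (P : C2 → ℂ) : ℂ :=
  open scoped Classical in
  loopInt θ μ₀ ε δ P - (if δ = 0 then P 0 else 0) * (loopConst θ μ₀ ε : ℂ)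

/-- Profiles that are continuous, of polynomial growth, and Lipschitz at the origin. -/
structure IsProfile (P : C2 → ℂ) (M : ℝ) (K : ℕ) : Prop where
  cont : Continuous P
  bound : ∀ u, ‖P u‖ ≤ M * br u ^ K
  lip : ∀ u, ‖P u - P 0‖ ≤ M * ‖u‖ * br u ^ K

lemma IsProfile.nonneg {P : C2 → ℂ} {M : ℝ} {K : ℕ} (h : IsProfile P M K) : 0 ≤ M := by
  have := (norm_nonneg _).trans (h.bound 0)
  simpa using this

lemma continuous_loopInt_integrand (hθ : 0 < θ) (μ₀ : ℝ) {ε : ℝ} (hε : 0 < ε) (δ : C2)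
    {P : C2 → ℂ} (hP : Continuous P) :
    Continuous fun u => (propKer θ μ₀ ε u : ℂ) * (propKer θ μ₀ ε (u + δ) : ℂ) * P u := by
  have := continuous_propKer hθ μ₀ hε
  fun_prop

lemma norm_loopInt_integrand (θ μ₀ ε : ℝ) (δ : C2) (P : C2 → ℂ) (u : C2) :
    ‖(propKer θ μ₀ ε u : ℂ) * (propKer θ μ₀ ε (u + δ) : ℂ) * P u‖ =
      propKer θ μ₀ ε u * propKer θ μ₀ ε (u + δ) * ‖P u‖ := by
  rw [norm_mul, norm_mul, norm_propKer, norm_propKer]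

/-- At fixed cutoff the loop integrals are bounded uniformly in the displacement. -/
lemma exists_loopInt_le_of_cutoff (hθ : 0 < θ) (μ₀ : ℝ) {ε : ℝ} (hε : 0 < ε) (K : ℕ) :
    ∃ C : ℝ, 0 < C ∧ ∀ (δ : C2) (P : C2 → ℂ) (M : ℝ), IsProfile P M K →
      Integrable (fun u => (propKer θ μ₀ ε u : ℂ) * (propKer θ μ₀ ε (u + δ) : ℂ) * P u) ∧
      ‖loopInt θ μ₀ ε δ P‖ ≤ C * M := by
  have hω := freq_pos hθ
  obtain ⟨D, hD, hDb⟩ := exists_br_pow_mul_exp_le C2 (by positivity : 0 < freq θ / 4) K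
  set B := propBound θ μ₀ ε
  have hB : 0 ≤ B := propBound_nonneg _ _ _
  have hG := integrable_exp_neg_normSq2 (by positivity : 0 < freq θ / 4)
  have hb (δ : C2) (P : C2 → ℂ) (M : ℝ) (hP : IsProfile P M K) (u : C2) :
      ‖(propKer θ μ₀ ε u : ℂ) * (propKer θ μ₀ ε (u + δ) : ℂ) * P u‖ ≤
        B * B * D * M * Real.exp (-(freq θ / 4) * normSq2 u) := by
    rw [norm_loopInt_integrand]
    have h1 := propKer_le hθ μ₀ hε u
    have h2 := propKer_le_propBound hθ μ₀ hε (u + δ)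
    have e1 : Real.exp (-(freq θ / 2) * normSq2 u) =
        Real.exp (-(freq θ / 4) * normSq2 u) * Real.exp (-(freq θ / 4) * normSq2 u) := by
      rw [← Real.exp_add]; congr 1; ring
    have h3 : br u ^ K * Real.exp (-(freq θ / 4) * normSq2 u) ≤ D := by
      refine le_trans (mul_le_mul_of_nonneg_left ?_ (pow_nonneg (br_pos u).le K)) (hDb u)
      rw [Real.exp_le_exp]
      nlinarith [norm_sq_le_normSq2 u]
    have hM := hP.nonneg
    calc _ ≤ (B * Real.exp (-(freq θ / 2) * normSq2 u)) * B * (M * br u ^ K) :=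
          mul_le_mul (mul_le_mul h1 h2 (propKer_nonneg _ _ _ _) (by positivity)) (hP.bound u)
            (norm_nonneg _) (by positivity)
      _ = B * B * M * Real.exp (-(freq θ / 4) * normSq2 u) *
            (br u ^ K * Real.exp (-(freq θ / 4) * normSq2 u)) := by rw [e1]; ring
      _ ≤ B * B * M * Real.exp (-(freq θ / 4) * normSq2 u) * D := by gcongr
      _ = _ := by ring
  have hI : 0 ≤ ∫ u : C2, Real.exp (-(freq θ / 4) * normSq2 u) :=
    integral_nonneg fun _ => (Real.exp_pos _).le
  refine ⟨B * B * D * (∫ u : C2, Real.exp (-(freq θ / 4) * normSq2 u)) + 1, by positivity,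
    fun δ P M hP => ⟨?_, ?_⟩⟩
  · exact (hG.const_mul _).mono' (continuous_loopInt_integrand hθ μ₀ hε δ
      hP.cont).aestronglyMeasurable (Eventually.of_forall (hb δ P M hP))
  · refine (norm_integral_le_of_norm_le (hG.const_mul _)
      (Eventually.of_forall (hb δ P M hP))).trans ?_
    rw [integral_const_mul]
    have := hP.nonneg
    nlinarith

lemma regLoop_of_ne {θ μ₀ ε : ℝ} {δ : C2} (hδ : δ ≠ 0) (P : C2 → ℂ) :
    regLoop θ μ₀ ε δ P = loopInt θ μ₀ ε δ P := by
  rw [regLoop, if_neg hδ, zero_mul, sub_zero]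

lemma isProfile_const (c : ℂ) : IsProfile (fun _ => c) ‖c‖ 0 :=
  ⟨continuous_const, fun u => by simp, fun u => by simp; positivity⟩

lemma regLoop_zero (hθ : 0 < θ) (μ₀ : ℝ) {ε : ℝ} (hε : 0 < ε) {P : C2 → ℂ} {M : ℝ} {K : ℕ}
    (hP : IsProfile P M K) : regLoop θ μ₀ ε 0 P =
      ∫ u, (propKer θ μ₀ ε u : ℂ) * (propKer θ μ₀ ε u : ℂ) * (P u - P 0) := by
  obtain ⟨C, -, hC⟩ := exists_loopInt_le_of_cutoff hθ μ₀ hε K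
  obtain ⟨C', -, hC'⟩ := exists_loopInt_le_of_cutoff hθ μ₀ hε 0
  have i1 := (hC 0 P M hP).1
  have i2 := (hC' 0 _ _ (isProfile_const (P 0))).1
  simp only [add_zero] at i1 i2
  rw [regLoop, if_pos rfl, loopInt, loopConst, ← integral_complex_ofReal, ← integral_const_mul]
  simp only [add_zero, mul_sub]
  rw [integral_sub i1 i2]
  congr 2
  funext u
  push_cast
  ring

/-- The majorant of a loop integral at coinciding positions after subtraction. -/
lemma integrable_exp_mul_inv_norm_cube {c : ℝ} (hc : 0 < c) :
    Integrable fun u : C2 => Real.exp (-c * ‖u‖ ^ 2) * (‖u‖ ^ 3)⁻¹ := by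
  rw [integrable_fun_norm_addHaar volume (f := fun y => Real.exp (-c * y ^ 2) * (y ^ 3)⁻¹),
    finrank_C2]
  refine (integrable_exp_neg_mul_sq hc).integrableOn.congr_fun (fun y hy => ?_) measurableSet_Ioi
  have : 0 < y := hy
  simp only [smul_eq_mul]
  field_simp

lemma exists_propKer_sq_le (hθ : 0 < θ) (K : ℕ) :
    ∃ C : ℝ, 0 < C ∧ ∀ (μ₀ ε : ℝ) (u : C2), 0 < ε → u ≠ 0 →
      propKer θ μ₀ ε u * propKer θ μ₀ ε u * (‖u‖ * br u ^ K) ≤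
        C * (Real.exp (-(freq θ / 2) * ‖u‖ ^ 2) * (‖u‖ ^ 3)⁻¹) := by
  have hω := freq_pos hθ
  obtain ⟨D, hD, hDb⟩ := exists_br_pow_mul_exp_le C2 (half_pos hω) K
  refine ⟨D, hD, fun μ₀ ε u hε hu => ?_⟩
  have h1 := propKer_le_inv_norm_sq hθ μ₀ hε hu
  have h2 := hDb u
  have ha : 0 < ‖u‖ := norm_pos_iff.2 hu
  have hbr : 0 ≤ br u ^ K := pow_nonneg (br_pos u).le K
  set x := Real.exp (-(freq θ / 2) * ‖u‖ ^ 2)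
  have hx : 0 < x := Real.exp_pos _
  calc _ ≤ (x * (‖u‖ ^ 2)⁻¹) * (x * (‖u‖ ^ 2)⁻¹) * (‖u‖ * br u ^ K) := by
        refine mul_le_mul_of_nonneg_right ?_ (by positivity)
        exact mul_le_mul h1 h1 (propKer_nonneg _ _ _ _) (by positivity)
    _ = (br u ^ K * x) * (x * (‖u‖ ^ 3)⁻¹) := by field_simp
    _ ≤ D * (x * (‖u‖ ^ 3)⁻¹) := by gcongr

/-- Uniform bound for the regularized loop integrals, with a logarithm of the displacement. -/
theorem exists_norm_regLoop_le (hθ : 0 < θ) (μ₀ : ℝ) (K : ℕ) :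
    ∃ C : ℝ, 0 < C ∧ ∀ (ε : ℝ) (δ : C2) (P : C2 → ℂ) (M : ℝ), 0 < ε → IsProfile P M K →
      ‖regLoop θ μ₀ ε δ P‖ ≤ C * (M * logW δ) := by
  have hω := freq_pos hθ
  have hc : 0 < freq θ / 4 := by positivity
  obtain ⟨A, hA, hAb⟩ := exists_propKer_mul_propKer_le hθ K
  obtain ⟨I, hI, hIb⟩ := exists_integral_pairBound_le hc
  obtain ⟨B, hB, hBb⟩ := exists_propKer_sq_le hθ K
  set Z := ∫ u : C2, Real.exp (-(freq θ / 2) * ‖u‖ ^ 2) * (‖u‖ ^ 3)⁻¹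
  have hZ : 0 ≤ Z := integral_nonneg fun _ => by positivity
  refine ⟨2 * A * I + B * Z, by positivity, fun ε δ P M hε hP => ?_⟩
  have hM := hP.nonneg
  have hW := logW_pos δ
  rcases eq_or_ne δ 0 with rfl | hδ
  · rw [regLoop_zero hθ μ₀ hε hP, logW_zero, mul_one]
    have hint := (integrable_exp_mul_inv_norm_cube (half_pos hω)).const_mul (M * B)
    refine (norm_integral_le_of_norm_le hint ?_).trans ?_
    · filter_upwards [Measure.ae_ne volume (0 : C2)] with u hu
      rw [norm_mul, norm_mul, norm_propKer]
      have h1 := hBb μ₀ ε u hε hu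
      calc _ ≤ propKer θ μ₀ ε u * propKer θ μ₀ ε u * (M * ‖u‖ * br u ^ K) :=
            mul_le_mul_of_nonneg_left (hP.lip u)
              (mul_nonneg (propKer_nonneg _ _ _ _) (propKer_nonneg _ _ _ _))
        _ = M * (propKer θ μ₀ ε u * propKer θ μ₀ ε u * (‖u‖ * br u ^ K)) := by ring
        _ ≤ M * (B * _) := mul_le_mul_of_nonneg_left h1 hM
        _ = _ := by ring
    · rw [integral_const_mul]
      have : 0 ≤ 2 * A * I * M := by positivity
      nlinarith
  · rw [regLoop_of_ne hδ]
    have i1 := integrable_pairBound hc (norm_pos_iff.2 hδ)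
    have i2 : Integrable fun u : C2 => pairBound (freq θ / 4) ‖δ‖ ‖u + δ‖ := i1.comp_add_right δ
    refine (norm_integral_le_of_norm_le ((i1.add i2).const_mul (M * A)) ?_).trans ?_
    · filter_upwards [ae_ne_zero_and_add_ne_zero δ] with u hu
      rw [norm_loopInt_integrand]
      have h1 := hAb μ₀ ε δ u hε hδ hu.1 hu.2
      calc _ ≤ propKer θ μ₀ ε u * propKer θ μ₀ ε (u + δ) * (M * br u ^ K) :=
            mul_le_mul_of_nonneg_left (hP.bound u)
              (mul_nonneg (propKer_nonneg _ _ _ _) (propKer_nonneg _ _ _ _))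
        _ = M * (propKer θ μ₀ ε u * propKer θ μ₀ ε (u + δ) * br u ^ K) := by ring
        _ ≤ M * (A * _) := mul_le_mul_of_nonneg_left h1 hM
        _ = _ := by simp only [Pi.add_apply]; ring
    · rw [integral_const_mul]
      simp only [Pi.add_apply]
      rw [integral_add i1 i2,
        integral_add_right_eq_self (fun u : C2 => pairBound (freq θ / 4) ‖δ‖ ‖u‖) δ]
      have h1 := hIb δ hδ
      calc _ ≤ M * A * (I * logW δ + I * logW δ) := by gcongr
        _ = 2 * A * I * (M * logW δ) := by ring
        _ ≤ _ := by
          have : 0 ≤ B * Z * (M * logW δ) := by positivity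
          linarith

/-- Every regularized loop integral converges when the cutoff is removed. -/
theorem hasFiniteLimit_regLoop (hθ : 0 < θ) (μ₀ : ℝ) (δ : C2) {P : C2 → ℂ} {M : ℝ} {K : ℕ}
    (hP : IsProfile P M K) : HasFiniteLimit fun ε => regLoop θ μ₀ ε δ P := by
  have hω := freq_pos hθ
  have hc : 0 < freq θ / 4 := by positivity
  have hM := hP.nonneg
  have hlim (u : C2) : ∃ k : ℝ, u ≠ 0 → Tendsto (fun ε => propKer θ μ₀ ε u) (𝓝[>] 0) (𝓝 k) := by
    rcases eq_or_ne u 0 with rfl | hu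
    · exact ⟨0, fun h => (h rfl).elim⟩
    · obtain ⟨k, hk⟩ := exists_tendsto_propKer hθ μ₀ hu
      exact ⟨k, fun _ => hk⟩
  choose k hk using hlim
  have hkc (u : C2) (hu : u ≠ 0) :
      Tendsto (fun ε => (propKer θ μ₀ ε u : ℂ)) (𝓝[>] 0) (𝓝 (k u : ℂ)) :=
    (Complex.continuous_ofReal.tendsto _).comp (hk u hu)
  rcases eq_or_ne δ 0 with rfl | hδ
  · obtain ⟨B, hB, hBb⟩ := exists_propKer_sq_le hθ K
    have hT : Tendsto (fun ε => ∫ u, (propKer θ μ₀ ε u : ℂ) * (propKer θ μ₀ ε u : ℂ) *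
        (P u - P 0)) (𝓝[>] 0) (𝓝 (∫ u, (k u : ℂ) * (k u : ℂ) * (P u - P 0))) := by
      refine tendsto_integral_filter_of_dominated_convergence
        (fun u => M * B * (Real.exp (-(freq θ / 2) * ‖u‖ ^ 2) * (‖u‖ ^ 3)⁻¹)) ?_ ?_
        ((integrable_exp_mul_inv_norm_cube (half_pos hω)).const_mul (M * B)) ?_
      · filter_upwards [self_mem_nhdsWithin] with ε hε
        have h1 := continuous_propKer hθ μ₀ (show 0 < ε from hε)
        have h2 := hP.cont
        exact Continuous.aestronglyMeasurable (by fun_prop)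
      · filter_upwards [self_mem_nhdsWithin] with ε hε
        filter_upwards [Measure.ae_ne volume (0 : C2)] with u hu
        rw [norm_mul, norm_mul, norm_propKer]
        have h1 := hBb μ₀ ε u hε hu
        calc _ ≤ propKer θ μ₀ ε u * propKer θ μ₀ ε u * (M * ‖u‖ * br u ^ K) :=
              mul_le_mul_of_nonneg_left (hP.lip u)
                (mul_nonneg (propKer_nonneg _ _ _ _) (propKer_nonneg _ _ _ _))
          _ = M * (propKer θ μ₀ ε u * propKer θ μ₀ ε u * (‖u‖ * br u ^ K)) := by ring
          _ ≤ M * (B * _) := mul_le_mul_of_nonneg_left h1 hM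
          _ = _ := by ring
      · filter_upwards [Measure.ae_ne volume (0 : C2)] with u hu
        exact ((hkc u hu).mul (hkc u hu)).mul_const _
    exact HasFiniteLimit.congr ⟨_, hT⟩ fun ε hε => (regLoop_zero hθ μ₀ hε hP).symm
  · obtain ⟨A, hA, hAb⟩ := exists_propKer_mul_propKer_le hθ K
    have i1 := integrable_pairBound hc (norm_pos_iff.2 hδ)
    have i2 : Integrable fun u : C2 => pairBound (freq θ / 4) ‖δ‖ ‖u + δ‖ := i1.comp_add_right δ
    have hT : Tendsto (fun ε => loopInt θ μ₀ ε δ P) (𝓝[>] 0)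
        (𝓝 (∫ u, (k u : ℂ) * (k (u + δ) : ℂ) * P u)) := by
      refine tendsto_integral_filter_of_dominated_convergence _ ?_ ?_
        ((i1.add i2).const_mul (M * A)) ?_
      · filter_upwards [self_mem_nhdsWithin] with ε hε
        exact (continuous_loopInt_integrand hθ μ₀ hε δ hP.cont).aestronglyMeasurable
      · filter_upwards [self_mem_nhdsWithin] with ε hε
        filter_upwards [ae_ne_zero_and_add_ne_zero δ] with u hu
        rw [norm_loopInt_integrand]
        have h1 := hAb μ₀ ε δ u hε hδ hu.1 hu.2
        calc _ ≤ propKer θ μ₀ ε u * propKer θ μ₀ ε (u + δ) * (M * br u ^ K) :=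
              mul_le_mul_of_nonneg_left (hP.bound u)
                (mul_nonneg (propKer_nonneg _ _ _ _) (propKer_nonneg _ _ _ _))
          _ = M * (propKer θ μ₀ ε u * propKer θ μ₀ ε (u + δ) * br u ^ K) := by ring
          _ ≤ M * (A * _) := mul_le_mul_of_nonneg_left h1 hM
          _ = _ := by simp only [Pi.add_apply]; ring
      · filter_upwards [ae_ne_zero_and_add_ne_zero δ] with u hu
        exact ((hkc u hu.1).mul (hkc _ hu.2)).mul_const _
    exact HasFiniteLimit.congr ⟨_, hT⟩ fun ε hε => (regLoop_of_ne hδ P).symm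

end LoopBounds

/-! ### Sums of loop integrals -/

section LoopSums

variable {θ : ℝ} {ι : Type*} {δ : ι → C2} {P : ι → C2 → ℂ} {M : ι → ℝ} {K : ℕ}

/-- Tannery's theorem for the regularized loop integrals. -/
theorem hasFiniteLimit_tsum_regLoop (hθ : 0 < θ) (μ₀ : ℝ) (hP : ∀ i, IsProfile (P i) (M i) K)
    (hM : Summable fun i => M i * logW (δ i)) :
    HasFiniteLimit fun ε => ∑' i, regLoop θ μ₀ ε (δ i) (P i) := by
  obtain ⟨C, hC, hb⟩ := exists_norm_regLoop_le hθ μ₀ K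
  choose L hL using fun i => hasFiniteLimit_regLoop hθ μ₀ (δ i) (hP i)
  refine ⟨_, tendsto_tsum_of_dominated_convergence (hM.mul_left C) hL ?_⟩
  filter_upwards [self_mem_nhdsWithin] with ε hε i
  exact hb ε (δ i) (P i) (M i) hε (hP i)

lemma summable_of_mul_logW (hP : ∀ i, IsProfile (P i) (M i) K)
    (hM : Summable fun i => M i * logW (δ i)) : Summable M :=
  Summable.of_nonneg_of_le (fun i => (hP i).nonneg)
    (fun i => le_mul_of_one_le_right (hP i).nonneg (one_le_logW _)) hM

lemma summable_loopInt (hθ : 0 < θ) (μ₀ : ℝ) {ε : ℝ} (hε : 0 < ε)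
    (hP : ∀ i, IsProfile (P i) (M i) K) (hM : Summable M) :
    Summable fun i => loopInt θ μ₀ ε (δ i) (P i) := by
  obtain ⟨C, hC, hb⟩ := exists_loopInt_le_of_cutoff hθ μ₀ hε K
  exact Summable.of_norm_bounded (hM.mul_left C) fun i => (hb _ _ _ (hP i)).2

open scoped Classical in
/-- The divergence of a sum of loop integrals comes from the terms at coinciding positions. -/
theorem hasLogDivergence_tsum_loopInt (hθ : 0 < θ) (μ₀ : ℝ) (hP : ∀ i, IsProfile (P i) (M i) K)
    (hM : Summable fun i => M i * logW (δ i)) :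
    HasLogDivergence (fun ε => ∑' i, loopInt θ μ₀ ε (δ i) (P i))
      ((∑' i, if δ i = 0 then P i 0 else 0) * ((4 * Real.pi ^ 2)⁻¹ : ℝ)) := by
  have hM' := summable_of_mul_logW hP hM
  have hs : Summable fun i => if δ i = 0 then P i 0 else 0 := by
    refine Summable.of_norm_bounded hM' fun i => ?_
    split_ifs
    · simpa using (hP i).bound 0
    · simpa using (hP i).nonneg
  have h1 := hasLogDivergence_loopConst hθ μ₀ (∑' i, if δ i = 0 then P i 0 else 0)
  refine (HasFiniteLimit.add (hasFiniteLimit_tsum_regLoop hθ μ₀ hP hM) h1).congr fun ε hε => ?_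
  have h2 : ∑' i, regLoop θ μ₀ ε (δ i) (P i) = (∑' i, loopInt θ μ₀ ε (δ i) (P i)) -
      (∑' i, if δ i = 0 then P i 0 else 0) * (loopConst θ μ₀ ε : ℂ) := by
    rw [← tsum_mul_right, ← (summable_loopInt hθ μ₀ hε hP hM').tsum_sub (hs.mul_right _)]
    rfl
  rw [h2]
  ring

end LoopSums

/-! ### Smoothness of the matrix coefficients -/

section Smoothness

variable {θ : ℝ}

lemma hasDerivAt_bargmannKer_line (θ : ℝ) (z u : C2) (x : R2) (t : ℝ) :
    HasDerivAt (fun t : ℝ => bargmannKer θ (z + t • u) x)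
      (bargmannKer θ (z + t • u) x * ∑ j, u j * (((Real.sqrt 2 : ℝ) : ℂ) * freq θ * x j -
        freq θ * (z + t • u) j)) t := by
  have hc (j : Fin 2) : HasDerivAt (fun t : ℝ => (z + t • u) j) (u j) t := by
    have h1 : HasDerivAt (fun t : ℝ => z j + (t : ℂ) * u j) (1 * u j) t :=
      ((hasDerivAt_id t).ofReal_comp.mul_const (u j)).const_add (z j)
    simpa using h1
  have h3 := (HasDerivAt.fun_sum (u := Finset.univ) fun i (_ : i ∈ Finset.univ) =>
    ((hc i).pow 2).const_add (((x i : ℝ) : ℂ) ^ 2)).const_mul (-((freq θ : ℂ) / 2))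
  have h4 := (HasDerivAt.fun_sum (u := Finset.univ) fun i (_ : i ∈ Finset.univ) =>
    (hc i).mul_const ((x i : ℝ) : ℂ)).const_mul (((Real.sqrt 2 : ℝ) : ℂ) * (freq θ : ℂ))
  refine ((h3.add h4).cexp).congr_deriv ?_
  rw [bargmannKer]
  congr 1
  simp only [Fin.sum_univ_two]
  simp
  ring

/-- Directional derivatives of a Bargmann transform. -/
lemma exists_hasDerivAt_bargmann (hθ : 0 < θ) (f : 𝓢(R2, ℂ)) :
    ∃ X : Fin 2 → 𝓢(R2, ℂ), ∀ (z u : C2) (t : ℝ),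
      HasDerivAt (fun t : ℝ => bargmann θ f (z + t • u))
        (∑ j, u j * (((Real.sqrt 2 : ℝ) : ℂ) * freq θ * bargmann θ (X j) (z + t • u) -
          freq θ * (z + t • u) j * bargmann θ f (z + t • u))) t := by
  have hω := freq_pos hθ
  set X : Fin 2 → 𝓢(R2, ℂ) := fun j =>
    SchwartzMap.smulLeftCLM ℂ (fun x : R2 => ((x j : ℝ) : ℂ)) f with hX
  have hXa (j : Fin 2) (x : R2) : X j x = (x j : ℂ) * f x := by
    rw [hX, SchwartzMap.smulLeftCLM_apply_apply]
    · rfl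
    · exact (Complex.ofRealCLM.comp (EuclideanSpace.proj (𝕜 := ℝ) j)).hasTemperateGrowth
  refine ⟨X, fun z u t => ?_⟩
  have hn := continuous_normSq2
  obtain ⟨A, hA⟩ := (isCompact_closedBall t 1).bddAbove_image
    (f := fun s : ℝ => Real.exp (freq θ * normSq2 (z + s • u) / 2)) (by fun_prop)
  obtain ⟨B, hB⟩ := (isCompact_closedBall t 1).bddAbove_image
    (f := fun s : ℝ => ‖z + s • u‖) (by fun_prop)
  set F : ℝ → R2 → ℂ := fun s x => bargmannKer θ (z + s • u) x * f x with hF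
  set F' : ℝ → R2 → ℂ := fun s x => bargmannKer θ (z + s • u) x *
    (∑ j, u j * (((Real.sqrt 2 : ℝ) : ℂ) * freq θ * x j - freq θ * (z + s • u) j)) * f x with hF'
  have hF'eq (s : ℝ) (x : R2) : F' s x = ∑ j, u j * (((Real.sqrt 2 : ℝ) : ℂ) * freq θ *
      (bargmannKer θ (z + s • u) x * X j x) -
        freq θ * (z + s • u) j * (bargmannKer θ (z + s • u) x * f x)) := by
    simp only [hF', hXa, Fin.sum_univ_two]
    ring
  have key := hasDerivAt_integral_of_dominated_loc_of_deriv_le (μ := (volume : Measure R2))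
    (F := F) (F' := F') (x₀ := t) (s := Metric.ball t 1)
    (bound := fun x => A * ∑ j, ‖u j‖ * (Real.sqrt 2 * freq θ * ‖X j x‖ + freq θ * B * ‖f x‖))
    (Metric.ball_mem_nhds t one_pos) ?_ ?_ ?_ ?_ ?_ ?_
  · have h1 := key.2.const_mul ((Real.sqrt (freq θ / Real.pi) : ℝ) : ℂ)
    refine h1.congr_deriv ?_
    have i1 (j) := integrable_bargmannKer_mul hθ (z + t • u) (X j).integrable
    have i2 := integrable_bargmannKer_mul hθ (z + t • u) f.integrable
    simp only [hF'eq]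
    have i3 (j : Fin 2) : Integrable fun x => u j * (((Real.sqrt 2 : ℝ) : ℂ) * freq θ *
        (bargmannKer θ (z + t • u) x * X j x) -
          freq θ * (z + t • u) j * (bargmannKer θ (z + t • u) x * f x)) :=
      (((i1 j).const_mul _).sub (i2.const_mul _)).const_mul _
    rw [integral_finsetSum _ fun j _ => i3 j, Finset.mul_sum]
    refine Finset.sum_congr rfl fun j _ => ?_
    rw [integral_const_mul, integral_sub ((i1 j).const_mul _) (i2.const_mul _), integral_const_mul,
      integral_const_mul, bargmann_eq, bargmann_eq]
    ring
  · exact Eventually.of_forall fun s =>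
      (integrable_bargmannKer_mul hθ _ f.integrable).aestronglyMeasurable
  · exact integrable_bargmannKer_mul hθ _ f.integrable
  · have h1 := continuous_bargmannKer_right θ (z + t • u)
    have h2 := f.continuous
    exact Continuous.aestronglyMeasurable (by simp only [hF', Fin.sum_univ_two]; fun_prop)
  · refine Eventually.of_forall fun x s hs => ?_
    have hs' : s ∈ Metric.closedBall t 1 := Metric.ball_subset_closedBall hs
    have hAs := hA ⟨s, hs', rfl⟩
    have hBs := hB ⟨s, hs', rfl⟩
    simp only at hAs hBs
    have hA0 : 0 ≤ A := (Real.exp_pos _).le.trans hAs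
    have hk : ‖bargmannKer θ (z + s • u) x‖ ≤ A := (norm_bargmannKer_le hθ _ _).trans hAs
    rw [hF'eq, Finset.mul_sum]
    refine (norm_sum_le _ _).trans (Finset.sum_le_sum fun j _ => ?_)
    rw [norm_mul, mul_left_comm A]
    refine mul_le_mul_of_nonneg_left ((norm_sub_le _ _).trans ?_) (norm_nonneg _)
    rw [mul_add]
    have hj : ‖(z + s • u) j‖ ≤ B := (norm_le_pi_norm _ j).trans hBs
    have hB0 : 0 ≤ B := (norm_nonneg _).trans hj
    have hs2 : ‖((Real.sqrt 2 : ℝ) : ℂ)‖ = Real.sqrt 2 := by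
      rw [Complex.norm_real, Real.norm_of_nonneg (Real.sqrt_nonneg _)]
    have hwn : ‖(freq θ : ℂ)‖ = freq θ := by rw [Complex.norm_real, Real.norm_of_nonneg hω.le]
    refine add_le_add ?_ ?_
    · rw [norm_mul, norm_mul, norm_mul, hs2, hwn]
      calc _ ≤ Real.sqrt 2 * freq θ * (A * ‖X j x‖) := by gcongr
        _ = _ := by ring
    · rw [norm_mul, norm_mul, norm_mul, hwn]
      calc _ ≤ freq θ * B * (A * ‖f x‖) := by gcongr
        _ = _ := by ring
  · refine Integrable.const_mul (integrable_finsetSum _ fun j _ => Integrable.const_mul ?_ _) _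
    exact ((X j).integrable.norm.const_mul _).add (f.integrable.norm.const_mul _)
  · refine Eventually.of_forall fun x s _ => ?_
    exact (hasDerivAt_bargmannKer_line θ z u x s).mul_const (f x)

lemma norm_exp_transl_mul_exp (θ : ℝ) (v z : C2) :
    ‖Complex.exp (-((freq θ * normSq2 v / 2 : ℝ) : ℂ)
      - (freq θ : ℂ) * cdot (fun j => (starRingEnd ℂ) (v j)) z)‖ *
        Real.exp (-(freq θ * normSq2 z / 2)) = Real.exp (-(freq θ * normSq2 (z + v) / 2)) := by
  have := husimi_transl θ v (fun _ => 1) z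
  simpa [husimi, transl] using this

/-- Translations act on the smooth module in a Lipschitz way, with rapidly decreasing error. -/
lemma exists_husimi_transl_sub_le (hθ : 0 < θ) {φ : C2 → ℂ} (hφ : φ ∈ smoothModule θ) (N : ℕ) :
    ∃ C : ℝ, 0 < C ∧ ∀ u z, husimi θ (fun z => transl θ u φ z - φ z) z ≤
      C * ‖u‖ * br u ^ N * (br z ^ N)⁻¹ := by
  obtain ⟨f, rfl⟩ := hφ
  have hω := freq_pos hθ
  obtain ⟨X, hX⟩ := exists_hasDerivAt_bargmann hθ f
  obtain ⟨A, hA, hAb⟩ := exists_husimi_le hθ ⟨f, rfl⟩ (N + 1)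
  choose B hB hBb using fun j => exists_husimi_le hθ ⟨X j, rfl⟩ N
  have hs2 : ‖((Real.sqrt 2 : ℝ) : ℂ)‖ = Real.sqrt 2 := by
    rw [Complex.norm_real, Real.norm_of_nonneg (Real.sqrt_nonneg _)]
  have hwn : ‖(freq θ : ℂ)‖ = freq θ := by rw [Complex.norm_real, Real.norm_of_nonneg hω.le]
  set D := ∑ j, (Real.sqrt 2 * freq θ * B j + 2 * freq θ * A) with hD
  have hD0 : 0 < D := Finset.sum_pos (fun j _ => by have := hB j; positivity) Finset.univ_nonempty
  refine ⟨D, hD0, fun u z => ?_⟩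
  set E : ℝ → ℂ := fun t => Complex.exp (-((freq θ * normSq2 (t • u) / 2 : ℝ) : ℂ)
      - (freq θ : ℂ) * cdot (fun j => (starRingEnd ℂ) ((t • u) j)) z) with hE
  set G' : ℝ → ℂ := fun t => E t * ∑ j, (u j * (((Real.sqrt 2 : ℝ) : ℂ) * freq θ *
    bargmann θ (X j) (z + t • u)) - (freq θ * (u j + (starRingEnd ℂ) (u j)) * (z + t • u) j) *
      bargmann θ f (z + t • u)) with hG'
  have hEder (t : ℝ) : HasDerivAt E (E t * (-(freq θ : ℂ) *
      cdot (fun j => (starRingEnd ℂ) (u j)) (z + t • u))) t := by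
    have h0 : E = fun t : ℝ => Complex.exp (-((freq θ : ℂ) / 2 * (normSq2 u : ℂ)) * (t : ℂ) ^ 2
        - (freq θ : ℂ) * cdot (fun j => (starRingEnd ℂ) (u j)) z * (t : ℂ)) := by
      funext t
      have h1 : normSq2 (t • u) = t ^ 2 * normSq2 u := by
        have := normSq2_smul (t : ℂ) u
        rwa [Complex.norm_real, Real.norm_eq_abs, sq_abs, Complex.coe_smul] at this
      simp only [hE, h1, cdot_eq]
      congr 1
      simp
      ring
    have ht : HasDerivAt (fun t : ℝ => (t : ℂ)) 1 t := (hasDerivAt_id t).ofReal_comp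
    have h2 := (((ht.pow 2).const_mul (-((freq θ : ℂ) / 2 * (normSq2 u : ℂ)))).sub
      (ht.const_mul ((freq θ : ℂ) * cdot (fun j => (starRingEnd ℂ) (u j)) z))).cexp
    rw [h0]
    refine h2.congr_deriv ?_
    have h3 : cdot (fun j => (starRingEnd ℂ) (u j)) (z + t • u) =
        cdot (fun j => (starRingEnd ℂ) (u j)) z + t * (normSq2 u : ℂ) := by
      rw [normSq2_ofReal, ← cdot_add_smul, Complex.coe_smul]
    simp only [h3]
    simp only [Nat.cast_ofNat, Nat.add_one_sub_one, pow_one, mul_one, Pi.sub_apply, Pi.pow_apply]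
    congr 1
    ring
  have hGder (t : ℝ) : HasDerivAt (fun t : ℝ => transl θ (t • u) (bargmann θ f) z) (G' t) t := by
    refine ((hEder t).mul (hX z u t)).congr_deriv ?_
    simp only [hG', cdot_eq, Fin.sum_univ_two]
    ring
  have hGb (t : ℝ) (h0 : 0 ≤ t) (h1 : t ≤ 1) :
      ‖G' t‖ ≤ D * ‖u‖ * br u ^ N * (br z ^ N)⁻¹ * Real.exp (freq θ * normSq2 z / 2) := by
    have hE' : ‖E t‖ = Real.exp (-(freq θ * normSq2 (z + t • u) / 2)) *
        Real.exp (freq θ * normSq2 z / 2) := by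
      rw [← norm_exp_transl_mul_exp, mul_assoc, ← Real.exp_add, neg_add_cancel, Real.exp_zero,
        mul_one]
    set ζ := z + t • u with hζ
    rw [hG', norm_mul, hE', mul_right_comm]
    refine mul_le_mul_of_nonneg_right ?_ (Real.exp_pos _).le
    have hζ1 : (br ζ ^ N)⁻¹ ≤ br u ^ N * (br z ^ N)⁻¹ := by
      rw [hζ, add_comm]
      exact inv_br_pow_smul_add_le h0 h1 u z N
    refine le_trans ?_ ((mul_le_mul_of_nonneg_left hζ1 (by positivity :
      0 ≤ D * ‖u‖)).trans (le_of_eq (mul_assoc _ _ _).symm))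
    set w := Real.exp (-(freq θ * normSq2 ζ / 2)) with hw
    have hw0 : 0 < w := Real.exp_pos _
    refine (mul_le_mul_of_nonneg_left (norm_sum_le _ _) hw0.le).trans ?_
    rw [hD, Finset.mul_sum, Finset.sum_mul, Finset.sum_mul]
    refine Finset.sum_le_sum fun j _ => ?_
    have hu := norm_le_pi_norm u j
    have hzj : ‖ζ j‖ ≤ br ζ := (norm_le_pi_norm ζ j).trans (norm_le_br ζ)
    have hf : ‖bargmann θ f ζ‖ * w ≤ A * (br ζ ^ (N + 1))⁻¹ := hAb ζ
    have hx : ‖bargmann θ (X j) ζ‖ * w ≤ B j * (br ζ ^ N)⁻¹ := hBb j ζ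
    have hbr := br_pos ζ
    have hBj := hB j
    have h2 : ‖(freq θ : ℂ) * (u j + (starRingEnd ℂ) (u j)) * ζ j‖ ≤ freq θ * (2 * ‖u‖) * br ζ := by
      rw [norm_mul, norm_mul, hwn]
      have : ‖u j + (starRingEnd ℂ) (u j)‖ ≤ 2 * ‖u‖ := by
        refine (norm_add_le _ _).trans ?_
        rw [RCLike.norm_conj]
        linarith
      gcongr
    calc w * ‖u j * (((Real.sqrt 2 : ℝ) : ℂ) * freq θ * bargmann θ (X j) ζ) -
          freq θ * (u j + (starRingEnd ℂ) (u j)) * ζ j * bargmann θ f ζ‖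
        ≤ w * (‖u‖ * (Real.sqrt 2 * freq θ * ‖bargmann θ (X j) ζ‖) +
          freq θ * (2 * ‖u‖) * br ζ * ‖bargmann θ f ζ‖) := by
          refine mul_le_mul_of_nonneg_left ((norm_sub_le _ _).trans ?_) hw0.le
          refine add_le_add ?_ ?_
          · rw [norm_mul, norm_mul, norm_mul, hs2, hwn]
            gcongr
          · rw [norm_mul]
            gcongr
      _ = ‖u‖ * (Real.sqrt 2 * freq θ) * (‖bargmann θ (X j) ζ‖ * w) +
          freq θ * (2 * ‖u‖) * br ζ * (‖bargmann θ f ζ‖ * w) := by ring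
      _ ≤ ‖u‖ * (Real.sqrt 2 * freq θ) * (B j * (br ζ ^ N)⁻¹) +
          freq θ * (2 * ‖u‖) * br ζ * (A * (br ζ ^ (N + 1))⁻¹) := by gcongr
      _ = _ := by rw [pow_succ]; field_simp
  have hmv := norm_image_sub_le_of_norm_deriv_le_segment_01'
    (fun t _ => (hGder t).hasDerivWithinAt) fun t ht => hGb t ht.1 ht.2.le
  rw [one_smul, zero_smul, transl_zero] at hmv
  rw [husimi]
  refine (mul_le_mul_of_nonneg_right hmv (Real.exp_pos _).le).trans (le_of_eq ?_)
  rw [mul_assoc, ← Real.exp_add, add_neg_cancel, Real.exp_zero, mul_one]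

lemma integrable_bInner_integrand (hθ : 0 < θ) {φ χ : C2 → ℂ} (hφ : φ ∈ smoothModule θ)
    (hχ : FockLike θ χ) : Integrable fun z =>
      (((freq θ / Real.pi) ^ 2 * Real.exp (-freq θ * normSq2 z) : ℝ) : ℂ) *
        ((starRingEnd ℂ) (φ z) * χ z) := by
  obtain ⟨B, hB⟩ := hχ.growth
  refine (((integrable_husimi hθ hφ).mul_const B).const_mul ((freq θ / Real.pi) ^ 2)).mono'
    (continuous_bInner_integrand (fockLike_of_mem hθ hφ).cont hχ.cont).aestronglyMeasurable
    (Eventually.of_forall fun z => ?_)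
  rw [norm_bInner_integrand]
  have := husimi_nonneg θ φ z
  gcongr
  exact hB _

lemma bInner_sub (hθ : 0 < θ) {φ χ ψ : C2 → ℂ} (hφ : φ ∈ smoothModule θ) (hχ : FockLike θ χ)
    (hψ : FockLike θ ψ) :
    bInner θ φ (fun z => χ z - ψ z) = bInner θ φ χ - bInner θ φ ψ := by
  rw [bInner, bInner, bInner, ← integral_sub (integrable_bInner_integrand hθ hφ hχ)
    (integrable_bInner_integrand hθ hφ hψ)]
  congr 1
  funext z
  ring

/-- Matrix coefficients are Lipschitz, with rapidly decreasing constants. -/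
theorem exists_norm_matCoef_sub_le (hθ : 0 < θ) {φ χ : C2 → ℂ} (hφ : φ ∈ smoothModule θ)
    (hχ : χ ∈ smoothModule θ) (N : ℕ) :
    ∃ C : ℝ, 0 < C ∧ ∀ u v, ‖matCoef θ φ χ (u + v) - matCoef θ φ χ v‖ ≤
      C * ‖u‖ * br u ^ N * (br v ^ N)⁻¹ := by
  have hω := freq_pos hθ
  obtain ⟨A, hA, hAb⟩ := exists_husimi_le hθ hφ (N + 5)
  obtain ⟨B, hB, hBb⟩ := exists_husimi_transl_sub_le hθ hχ N
  obtain ⟨D, hD, hDb⟩ := exists_norm_matCoef_le hθ hφ hχ (N + 1)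
  have hI := innerBound_nonneg θ
  have hF := fockLike_of_mem hθ hχ
  refine ⟨innerBound θ * A * B + 2 * freq θ * D, by positivity, fun u v => ?_⟩
  have hbu : 1 ≤ br u ^ N := one_le_pow₀ (one_le_br u)
  have hbv := br_pos v
  have h1 := norm_bInner_le (θ := θ) (φ := φ) (v := v)
    (χ := transl θ v fun z => transl θ u χ z - χ z) (B := B * ‖u‖ * br u ^ N) (by positivity) hAb
    fun z => by rw [husimi_transl]; exact hBb u _
  have h2 : bInner θ φ (transl θ v fun z => transl θ u χ z - χ z) =
      phase (freq θ * sform v u) * matCoef θ φ χ (u + v) - matCoef θ φ χ v := by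
    have : transl θ v (fun z => transl θ u χ z - χ z) =
        fun z => transl θ v (transl θ u χ) z - transl θ v χ z := by
      funext z; exact mul_sub _ _ _
    rw [this, bInner_sub hθ hφ (fockLike_transl (fockLike_transl hF u) v) (fockLike_transl hF v),
      bInner_transl_transl, add_comm v u, matCoef, matCoef]
  rw [h2] at h1
  have h3 : ‖phase (freq θ * sform v u) - 1‖ ≤ 2 * freq θ * ‖u‖ * ‖v‖ := by
    have := norm_phase_sub_le (freq θ * sform v u) 0
    rw [phase_zero, sub_zero, abs_mul, abs_of_pos hω] at this
    have h := mul_le_mul_of_nonneg_left (abs_sform_le v u) hω.le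
    linarith
  have h4 : ‖v‖ * ‖matCoef θ φ χ v‖ ≤ D * (br v ^ N)⁻¹ := by
    calc _ ≤ br v * (D * (br v ^ (N + 1))⁻¹) :=
          mul_le_mul (norm_le_br v) (hDb v) (norm_nonneg _) hbv.le
      _ = _ := by rw [pow_succ]; field_simp
  have h5 : ‖matCoef θ φ χ (u + v) - matCoef θ φ χ v‖ =
      ‖phase (freq θ * sform v u) * matCoef θ φ χ (u + v) - matCoef θ φ χ v -
        (phase (freq θ * sform v u) - 1) * matCoef θ φ χ v‖ := by
    rw [show phase (freq θ * sform v u) * matCoef θ φ χ (u + v) - matCoef θ φ χ v -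
        (phase (freq θ * sform v u) - 1) * matCoef θ φ χ v = phase (freq θ * sform v u) *
        (matCoef θ φ χ (u + v) - matCoef θ φ χ v) by ring, norm_mul, norm_phase, one_mul]
  rw [h5]
  refine (norm_sub_le _ _).trans ?_
  rw [norm_mul]
  have hv := inv_br_pow_nonneg v N
  calc _ ≤ innerBound θ * A * (B * ‖u‖ * br u ^ N) * (br v ^ N)⁻¹ +
        2 * freq θ * ‖u‖ * ‖v‖ * ‖matCoef θ φ χ v‖ := by gcongr
    _ = innerBound θ * A * (B * ‖u‖ * br u ^ N) * (br v ^ N)⁻¹ +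
        2 * freq θ * ‖u‖ * (‖v‖ * ‖matCoef θ φ χ v‖) := by ring
    _ ≤ innerBound θ * A * (B * ‖u‖ * br u ^ N) * (br v ^ N)⁻¹ +
        2 * freq θ * ‖u‖ * (D * (br v ^ N)⁻¹) * br u ^ N := by
        refine add_le_add le_rfl ?_
        refine le_trans ?_ (le_mul_of_one_le_right (by positivity) hbu)
        gcongr
    _ = _ := by ring

end Smoothness

/-! ### Profiles of the modes -/

section Profiles

variable {θ : ℝ} {φ : Fin 4 → C2 → ℂ}

lemma exists_isProfile_profileC (hθ : 0 < θ) (hφ : ∀ i, φ i ∈ smoothModule θ) (N : ℕ) :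
    ∃ C : ℝ, ∀ γ σ, IsProfile (profileC θ φ γ σ) (C * ((br γ ^ N)⁻¹ * (br σ ^ N)⁻¹)) 0 := by
  have hω := freq_pos hθ
  obtain ⟨A, hA, hAb⟩ := exists_norm_matCoef_le hθ (hφ 0) (hφ 1) (N + 1)
  obtain ⟨B, hB, hBb⟩ := exists_norm_matCoef_le hθ (hφ 2) (hφ 3) (N + 1)
  refine ⟨A * B * (1 + 2 * freq θ), fun γ σ => ?_⟩
  have hγ := inv_br_pow_nonneg γ N
  have hσ := inv_br_pow_nonneg σ N
  have hγ1 := br_pos γ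
  have hσ1 := br_pos σ
  have h1 : ‖matCoef θ (φ 0) (φ 1) γ * matCoef θ (φ 2) (φ 3) σ‖ ≤
      (A * (br γ ^ (N + 1))⁻¹) * (B * (br σ ^ (N + 1))⁻¹) := by
    rw [norm_mul]
    exact mul_le_mul (hAb γ) (hBb σ) (norm_nonneg _)
      (mul_nonneg hA.le (inv_br_pow_nonneg _ _))
  refine ⟨?_, fun u => ?_, fun u => ?_⟩
  · have : Continuous fun u => phase (freq θ * (sform u (σ - γ) - sform γ σ)) :=
      continuous_phase_comp (continuous_const.mul ((continuous_sform_comp continuous_id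
        continuous_const).sub continuous_const))
    unfold profileC
    fun_prop
  · rw [profileC, norm_mul, norm_phase, one_mul, pow_zero, mul_one]
    refine h1.trans ?_
    calc _ ≤ (A * (br γ ^ N)⁻¹) * (B * (br σ ^ N)⁻¹) := by
          gcongr
          · exact one_le_br γ
          · omega
          · exact one_le_br σ
          · omega
      _ = A * B * 1 * ((br γ ^ N)⁻¹ * (br σ ^ N)⁻¹) := by ring
      _ ≤ _ := by gcongr; linarith
  · rw [profileC, profileC, ← sub_mul, norm_mul, pow_zero, mul_one]
    have h2 : ‖phase (freq θ * (sform u (σ - γ) - sform γ σ)) -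
        phase (freq θ * (sform 0 (σ - γ) - sform γ σ))‖ ≤ 2 * freq θ * ‖u‖ * (br γ * br σ) := by
      refine (norm_phase_sub_le _ _).trans ?_
      rw [show freq θ * (sform u (σ - γ) - sform γ σ) - freq θ * (sform 0 (σ - γ) - sform γ σ) =
        freq θ * sform u (σ - γ) by rw [sform_zero_left]; ring, abs_mul, abs_of_pos hω]
      have h3 : ‖σ - γ‖ ≤ br γ * br σ := by
        rw [mul_comm]
        exact (norm_le_br _).trans (br_sub_le σ γ)
      calc freq θ * |sform u (σ - γ)| ≤ freq θ * (2 * (‖u‖ * ‖σ - γ‖)) := by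
            gcongr; exact abs_sform_le _ _
        _ ≤ freq θ * (2 * (‖u‖ * (br γ * br σ))) := by gcongr
        _ = _ := by ring
    refine (mul_le_mul h2 h1 (norm_nonneg _) (by positivity)).trans ?_
    calc _ = A * B * (2 * freq θ) * ((br γ ^ N)⁻¹ * (br σ ^ N)⁻¹) * ‖u‖ := by
          rw [pow_succ, pow_succ]; field_simp
      _ ≤ _ := by gcongr; linarith

lemma exists_isProfile_profileD (hθ : 0 < θ) (hφ : ∀ i, φ i ∈ smoothModule θ) (N : ℕ) :
    ∃ C : ℝ, ∀ γ σ, IsProfile (profileD θ φ γ σ) (C * ((br γ ^ N)⁻¹ * (br σ ^ N)⁻¹)) (2 * N) := by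
  obtain ⟨A, hA, hAb⟩ := exists_norm_matCoef_le hθ (hφ 0) (hφ 1) N
  obtain ⟨B, hB, hBb⟩ := exists_norm_matCoef_le hθ (hφ 2) (hφ 3) N
  obtain ⟨A', hA', hAb'⟩ := exists_norm_matCoef_sub_le hθ (hφ 0) (hφ 1) N
  obtain ⟨B', hB', hBb'⟩ := exists_norm_matCoef_sub_le hθ (hφ 2) (hφ 3) N
  refine ⟨A * B + A' * B + A * B', fun γ σ => ?_⟩
  have hγ := inv_br_pow_nonneg γ N
  have hσ := inv_br_pow_nonneg σ N
  have h1 (u : C2) : ‖matCoef θ (φ 0) (φ 1) (u + γ)‖ ≤ A * (br u ^ N * (br γ ^ N)⁻¹) :=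
    (hAb _).trans (mul_le_mul_of_nonneg_left (inv_br_pow_add_le u γ N) hA.le)
  have h2 (u : C2) : ‖matCoef θ (φ 2) (φ 3) (u - σ)‖ ≤ B * (br u ^ N * (br σ ^ N)⁻¹) := by
    have := inv_br_pow_add_le u (-σ) N
    rw [br_neg, ← sub_eq_add_neg] at this
    exact (hBb _).trans (mul_le_mul_of_nonneg_left this hB.le)
  refine ⟨?_, fun u => ?_, fun u => ?_⟩
  · have h3 := continuous_matCoef hθ (hφ 0) (fockLike_of_mem hθ (hφ 1))
    have h4 := continuous_matCoef hθ (hφ 2) (fockLike_of_mem hθ (hφ 3))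
    unfold profileD
    fun_prop
  · have hu := pow_nonneg (br_pos u).le N
    rw [profileD, norm_mul, norm_phase, one_mul, norm_mul]
    refine (mul_le_mul (h1 u) (h2 u) (norm_nonneg _) (by positivity)).trans ?_
    calc _ = A * B * ((br γ ^ N)⁻¹ * (br σ ^ N)⁻¹) * br u ^ (2 * N) := by
          rw [two_mul, pow_add]; ring
      _ ≤ _ := by
          have : 0 ≤ A' * B + A * B' := by positivity
          have h5 := pow_nonneg (br_pos u).le (2 * N)
          gcongr
          linarith
  · have hu : 1 ≤ br u ^ N := one_le_pow₀ (one_le_br u)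
    have hu0 : 0 ≤ br u ^ N := zero_le_one.trans hu
    have h3 := hAb' u γ
    have h4 := hBb' u (-σ)
    rw [br_neg, ← sub_eq_add_neg] at h4
    have h5 := h1 0
    rw [br_zero, one_pow, one_mul, zero_add] at h5
    rw [profileD, profileD, ← mul_sub, norm_mul, norm_phase, one_mul, zero_add, zero_sub,
      show matCoef θ (φ 0) (φ 1) (u + γ) * matCoef θ (φ 2) (φ 3) (u - σ) -
        matCoef θ (φ 0) (φ 1) γ * matCoef θ (φ 2) (φ 3) (-σ) =
        (matCoef θ (φ 0) (φ 1) (u + γ) - matCoef θ (φ 0) (φ 1) γ) * matCoef θ (φ 2) (φ 3) (u - σ) +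
        matCoef θ (φ 0) (φ 1) γ * (matCoef θ (φ 2) (φ 3) (u - σ) - matCoef θ (φ 2) (φ 3) (-σ)) by
          ring]
    refine (norm_add_le _ _).trans ?_
    rw [norm_mul, norm_mul]
    calc _ ≤ (A' * ‖u‖ * br u ^ N * (br γ ^ N)⁻¹) * (B * (br u ^ N * (br σ ^ N)⁻¹)) +
          (A * (br γ ^ N)⁻¹) * (B' * ‖u‖ * br u ^ N * (br σ ^ N)⁻¹) :=
          add_le_add (mul_le_mul h3 (h2 u) (norm_nonneg _) (by positivity))
            (mul_le_mul h5 h4 (norm_nonneg _) (by positivity))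
      _ ≤ (A' * ‖u‖ * br u ^ N * (br γ ^ N)⁻¹) * (B * (br u ^ N * (br σ ^ N)⁻¹)) +
          (A * (br γ ^ N)⁻¹) * (B' * ‖u‖ * br u ^ N * (br σ ^ N)⁻¹) * br u ^ N := by
          refine add_le_add le_rfl (le_mul_of_one_le_right (by positivity) hu)
      _ = (A' * B + A * B') * ((br γ ^ N)⁻¹ * (br σ ^ N)⁻¹) * ‖u‖ * br u ^ (2 * N) := by
          rw [two_mul, pow_add]; ring
      _ ≤ _ := by
          have h6 : 0 ≤ A * B := by positivity
          have h7 := pow_nonneg (br_pos u).le (2 * N)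
          gcongr
          linarith

end Profiles

/-! ### Lattice sums of the modes -/

/-- The displacement of a mode is at worst polynomially close to a coincidence, on the logarithmic
scale. -/
def LogBound (θ : ℝ) : Prop :=
  ∃ L : ℝ, ∀ k : LatIdx × LatIdx,
    logW (latPt θ k.1 + Complex.I • dualPt k.2) ≤ L * (br k.1 * br k.2)

section Lattice

variable {θ : ℝ}

lemma latPt_sub (θ : ℝ) (g h : LatIdx) : latPt θ (g - h) = latPt θ g - latPt θ h := by
  funext j; simp [latPt]; ring

@[simp] lemma latPt_zero (θ : ℝ) : latPt θ 0 = 0 := by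
  funext j; simp [latPt]

@[simp] lemma dualPt_zero : dualPt 0 = 0 := by
  funext j; simp [dualPt]

lemma dualPt_neg (g : LatIdx) : dualPt (-g) = -dualPt g := by
  funext j; simp [dualPt]; ring

lemma br_I_smul (z : C2) : br (Complex.I • z) = br z := by simp [br, norm_smul]

lemma logW_neg (z : C2) : logW (-z) = logW z := by simp [logW]

lemma logW_latPt_sub (θ : ℝ) (k : LatIdx × LatIdx) :
    logW (latPt θ k.1 - Complex.I • dualPt k.2) =
      logW (latPt θ k.1 + Complex.I • dualPt (-k.2)) := by
  rw [dualPt_neg, smul_neg, sub_eq_add_neg]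

lemma summable_mode_weight_mul (hθ : 0 < θ) {W : LatIdx × LatIdx → ℝ} {L : ℝ}
    (hW0 : ∀ k, 0 ≤ W k) (hW : ∀ k, W k ≤ L * (br k.1 * br k.2)) :
    Summable fun k : LatIdx × LatIdx =>
      (br (latPt θ k.1) ^ 7)⁻¹ * (br (Complex.I • dualPt k.2) ^ 7)⁻¹ * W k := by
  obtain ⟨A, hA, hA'⟩ := exists_inv_br_latPt_le hθ
  obtain ⟨B, hB, hB'⟩ := exists_inv_br_dualPt_le
  have hs := summable_inv_br_pow_latIdx le_rfl
  refine Summable.of_nonneg_of_le (fun k => ?_) (fun k => ?_)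
    ((hs.mul_of_nonneg hs (fun n => inv_br_pow_nonneg n 6)
      fun n => inv_br_pow_nonneg n 6).mul_left (A ^ 7 * B ^ 7 * L))
  · exact mul_nonneg (mul_nonneg (inv_br_pow_nonneg _ _) (inv_br_pow_nonneg _ _)) (hW0 k)
  · have h1 := br_pos k.1
    have h2 := br_pos k.2
    rw [br_I_smul]
    calc _ ≤ (A ^ 7 * (br k.1 ^ 7)⁻¹) * (B ^ 7 * (br k.2 ^ 7)⁻¹) * (L * (br k.1 * br k.2)) := by
          refine mul_le_mul (mul_le_mul (hA' k.1 7) (hB' k.2 7) (inv_br_pow_nonneg _ _)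
            (by positivity)) (hW k) (hW0 k) (by positivity)
      _ = _ := by rw [pow_succ (br k.1) 6, pow_succ (br k.2) 6]; field_simp

lemma summable_mode_weight (hθ : 0 < θ) : Summable fun k : LatIdx × LatIdx =>
    (br (latPt θ k.1) ^ 7)⁻¹ * (br (Complex.I • dualPt k.2) ^ 7)⁻¹ := by
  have := summable_mode_weight_mul hθ (W := fun _ => 1) (L := 1) (fun _ => zero_le_one) fun k => by
    have := one_le_mul_of_one_le_of_one_le (one_le_br k.1) (one_le_br k.2)
    linarith
  simpa using this

/-- The displacement of the two propagators in a mode of the first graph. -/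
noncomputable def dispC (θ : ℝ) (k : LatIdx × LatIdx) : C2 :=
  -(latPt θ k.1 + Complex.I • dualPt k.2)

/-- The displacement of the two propagators in a mode of the second graph. -/
noncomputable def dispD (θ : ℝ) (k : LatIdx × LatIdx) : C2 :=
  latPt θ k.1 - Complex.I • dualPt k.2

lemma summable_weight_mul_logW_dispC (hθ : 0 < θ) (hL : LogBound θ) :
    Summable fun k : LatIdx × LatIdx =>
      (br (latPt θ k.1) ^ 7)⁻¹ * (br (Complex.I • dualPt k.2) ^ 7)⁻¹ * logW (dispC θ k) := by
  obtain ⟨L, hL⟩ := hL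
  refine summable_mode_weight_mul hθ (fun k => (logW_pos _).le) (L := L) fun k => ?_
  rw [dispC, logW_neg]
  exact hL k

lemma summable_weight_mul_logW_dispD (hθ : 0 < θ) (hL : LogBound θ) :
    Summable fun k : LatIdx × LatIdx =>
      (br (latPt θ k.1) ^ 7)⁻¹ * (br (Complex.I • dualPt k.2) ^ 7)⁻¹ * logW (dispD θ k) := by
  obtain ⟨L, hL⟩ := hL
  refine summable_mode_weight_mul hθ (fun k => (logW_pos _).le) (L := L) fun k => ?_
  rw [dispD, logW_latPt_sub]
  have := hL (k.1, -k.2)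
  rwa [br_neg] at this

/-- The external profile of a mode of the first graph. -/
noncomputable def modeProfileC (θ : ℝ) (φ : Fin 4 → C2 → ℂ) (k : LatIdx × LatIdx) : C2 → ℂ :=
  profileC θ φ (latPt θ k.1) (Complex.I • dualPt k.2)

/-- The external profile of a mode of the second graph. -/
noncomputable def modeProfileD (θ : ℝ) (φ : Fin 4 → C2 → ℂ) (k : LatIdx × LatIdx) : C2 → ℂ :=
  profileD θ φ (latPt θ k.1) (Complex.I • dualPt k.2)

variable {φ : Fin 4 → C2 → ℂ}

lemma modeC_eq (hθ : 0 < θ) (lam μ₀ : ℝ) {ε : ℝ} (hε : 0 < ε) (hφ : ∀ i, φ i ∈ smoothModule θ)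
    (k : LatIdx × LatIdx) : modeC θ lam μ₀ ε φ k =
      -((lam : ℂ) ^ 2 / 4) * loopInt θ μ₀ ε (dispC θ k) (modeProfileC θ φ k) := by
  rw [modeC, poissonMode_ampC hθ μ₀ hε hφ, dispC, modeProfileC]
  ring

lemma modeD_eq (hθ : 0 < θ) (lam μ₀ : ℝ) {ε : ℝ} (hε : 0 < ε) (hφ : ∀ i, φ i ∈ smoothModule θ)
    (k : LatIdx × LatIdx) : modeD θ lam μ₀ ε φ k =
      -((lam : ℂ) ^ 2 / 8) * loopInt θ μ₀ ε (dispD θ k) (modeProfileD θ φ k) := by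
  rw [modeD, poissonMode_ampD hθ μ₀ hε hφ, dispD, modeProfileD]
  ring

lemma exists_isProfile_modeProfileC (hθ : 0 < θ) (hφ : ∀ i, φ i ∈ smoothModule θ) :
    ∃ C : ℝ, ∀ k : LatIdx × LatIdx, IsProfile (modeProfileC θ φ k)
      (C * ((br (latPt θ k.1) ^ 7)⁻¹ * (br (Complex.I • dualPt k.2) ^ 7)⁻¹)) 0 := by
  obtain ⟨C, hC⟩ := exists_isProfile_profileC hθ hφ 7
  exact ⟨C, fun k => hC _ _⟩

lemma exists_isProfile_modeProfileD (hθ : 0 < θ) (hφ : ∀ i, φ i ∈ smoothModule θ) :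
    ∃ C : ℝ, ∀ k : LatIdx × LatIdx, IsProfile (modeProfileD θ φ k)
      (C * ((br (latPt θ k.1) ^ 7)⁻¹ * (br (Complex.I • dualPt k.2) ^ 7)⁻¹)) (2 * 7) := by
  obtain ⟨C, hC⟩ := exists_isProfile_profileD hθ hφ 7
  exact ⟨C, fun k => hC _ _⟩

/-- Poisson resummation of the loop sum of the first graph. -/
theorem hasSum_modeC (hθ : 0 < θ) (lam μ₀ : ℝ) {ε : ℝ} (hε : 0 < ε)
    (hφ : ∀ i, φ i ∈ smoothModule θ) :
    HasSum (modeC θ lam μ₀ ε φ) (graphC θ lam μ₀ ε φ) := by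
  obtain ⟨C, hC⟩ := exists_isProfile_modeProfileC hθ hφ
  set F : LatIdx × LatIdx → ℂ := fun k => poissonMode θ (fun w => ampC θ μ₀ ε φ (latPt θ k.1) w) k.2
    with hF
  have hFs : Summable F := by
    have h1 := (summable_loopInt hθ μ₀ hε (δ := dispC θ) hC
      ((summable_mode_weight hθ).mul_left C)).mul_right (4⁻¹ : ℂ)
    refine h1.congr fun k => ?_
    simp only [hF]
    rw [poissonMode_ampC hθ μ₀ hε hφ, dispC, modeProfileC, div_eq_mul_inv]
  obtain ⟨D, hD, hDb⟩ := exists_norm_ampC_le hθ μ₀ hε hφ 6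
  have h2 (g : LatIdx) : HasSum (fun d => F (g, d))
      (∑' g₂, ampC θ μ₀ ε φ (latPt θ g) (latPt θ g₂)) := by
    have hb (w : C2) : ‖ampC θ μ₀ ε φ (latPt θ g) w‖ ≤ D * (br w ^ 6)⁻¹ :=
      (hDb (latPt θ g) w).trans (mul_le_mul_of_nonneg_right
        (mul_le_of_le_one_right hD.le (inv_br_pow_le_one _ _)) (inv_br_pow_nonneg _ _))
    have hs : Summable (poissonMode θ fun w => ampC θ μ₀ ε φ (latPt θ g) w) := hFs.prod_factor g
    have hp := hasSum_poissonMode (F := fun w => ampC θ μ₀ ε φ (latPt θ g) w) hθ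
      (continuous_ampC_right hθ μ₀ hε hφ (latPt θ g)) (N := 6) le_rfl hb hs
    exact hp
  have h3 := (hFs.hasSum.prod_fiberwise h2).tsum_eq
  have h4 := (summable_ampC hθ μ₀ hε hφ).tsum_prod
  have h5 := hFs.hasSum
  rw [← h3, ← h4] at h5
  have h6 : modeC θ lam μ₀ ε φ = fun k => -4 * ((lam : ℂ) / 2) ^ 2 * F k := rfl
  rw [h6, graphC]
  exact h5.mul_left (-4 * ((lam : ℂ) / 2) ^ 2)

/-- Poisson resummation of the loop sum of the second graph, in the variables
`γ = γ₁ + γ₂` and `γ₁`. -/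
theorem hasSum_modeD (hθ : 0 < θ) (lam μ₀ : ℝ) {ε : ℝ} (hε : 0 < ε)
    (hφ : ∀ i, φ i ∈ smoothModule θ) :
    HasSum (modeD θ lam μ₀ ε φ) (graphD θ lam μ₀ ε φ) := by
  obtain ⟨C, hC⟩ := exists_isProfile_modeProfileD hθ hφ
  set F : LatIdx × LatIdx → ℂ := fun k =>
    poissonMode θ (fun v => ampD θ μ₀ ε φ v (latPt θ k.1 - v)) k.2 with hF
  have hFs : Summable F := by
    have h1 := (summable_loopInt hθ μ₀ hε (δ := dispD θ) hC
      ((summable_mode_weight hθ).mul_left C)).mul_right (4⁻¹ : ℂ)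
    refine h1.congr fun k => ?_
    simp only [hF]
    rw [poissonMode_ampD hθ μ₀ hε hφ, dispD, modeProfileD, div_eq_mul_inv]
  obtain ⟨D, hD, hDb⟩ := exists_norm_ampD_le hθ μ₀ hε hφ 6
  have h2 (g : LatIdx) : HasSum (fun d => F (g, d))
      (∑' g₁, ampD θ μ₀ ε φ (latPt θ g₁) (latPt θ g - latPt θ g₁)) := by
    have hb (w : C2) : ‖ampD θ μ₀ ε φ w (latPt θ g - w)‖ ≤ D * (br w ^ 6)⁻¹ :=
      (hDb w _).trans (mul_le_of_le_one_right
        (mul_nonneg hD.le (inv_br_pow_nonneg _ _)) (inv_br_pow_le_one _ _))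
    have hs : Summable (poissonMode θ fun w => ampD θ μ₀ ε φ w (latPt θ g - w)) :=
      hFs.prod_factor g
    have hp := hasSum_poissonMode (F := fun w => ampD θ μ₀ ε φ w (latPt θ g - w)) hθ
      (continuous_ampD_sub hθ μ₀ hε hφ (latPt θ g)) (N := 6) le_rfl hb hs
    exact hp
  have h3 := (hFs.hasSum.prod_fiberwise h2).tsum_eq
  let e : LatIdx × LatIdx ≃ LatIdx × LatIdx :=
    { toFun := fun k => (k.2, k.1 - k.2)
      invFun := fun k => (k.1 + k.2, k.1)
      left_inv := fun k => by simp
      right_inv := fun k => by simp }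
  have hsum := summable_ampD hθ μ₀ hε hφ
  have h4 := (e.summable_iff.2 hsum).tsum_prod
  rw [show (∑' k, ((fun g : LatIdx × LatIdx => ampD θ μ₀ ε φ (latPt θ g.1) (latPt θ g.2)) ∘ e) k) =
    _ from e.tsum_eq fun g : LatIdx × LatIdx => ampD θ μ₀ ε φ (latPt θ g.1) (latPt θ g.2)] at h4
  simp only [e, Equiv.coe_fn_mk, Function.comp, latPt_sub] at h4
  have h5 := hFs.hasSum
  rw [← h3, ← h4] at h5
  have h6 : modeD θ lam μ₀ ε φ = fun k => -2 * ((lam : ℂ) / 2) ^ 2 * F k := rfl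
  rw [h6, graphD]
  exact h5.mul_left (-2 * ((lam : ℂ) / 2) ^ 2)

open scoped Classical in
theorem hasLogDivergence_graphC (hθ : 0 < θ) (hL : LogBound θ) (lam μ₀ : ℝ)
    (hφ : ∀ i, φ i ∈ smoothModule θ) :
    HasLogDivergence (fun ε => graphC θ lam μ₀ ε φ)
      (-((lam : ℂ) ^ 2 / 4) * ((∑' k, if dispC θ k = 0 then modeProfileC θ φ k 0 else 0) *
        ((4 * Real.pi ^ 2)⁻¹ : ℝ))) := by
  obtain ⟨C, hC⟩ := exists_isProfile_modeProfileC hθ hφ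
  have hs : Summable fun k : LatIdx × LatIdx => C * ((br (latPt θ k.1) ^ 7)⁻¹ *
      (br (Complex.I • dualPt k.2) ^ 7)⁻¹) * logW (dispC θ k) := by
    simpa only [mul_assoc] using (summable_weight_mul_logW_dispC hθ hL).mul_left C
  refine ((hasLogDivergence_tsum_loopInt hθ μ₀ hC hs).const_mul _).congr fun ε hε => ?_
  rw [← tsum_mul_left, ← (hasSum_modeC hθ lam μ₀ hε hφ).tsum_eq]
  exact tsum_congr fun k => (modeC_eq hθ lam μ₀ hε hφ k).symm

open scoped Classical in
theorem hasLogDivergence_graphD (hθ : 0 < θ) (hL : LogBound θ) (lam μ₀ : ℝ)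
    (hφ : ∀ i, φ i ∈ smoothModule θ) :
    HasLogDivergence (fun ε => graphD θ lam μ₀ ε φ)
      (-((lam : ℂ) ^ 2 / 8) * ((∑' k, if dispD θ k = 0 then modeProfileD θ φ k 0 else 0) *
        ((4 * Real.pi ^ 2)⁻¹ : ℝ))) := by
  obtain ⟨C, hC⟩ := exists_isProfile_modeProfileD hθ hφ
  have hs : Summable fun k : LatIdx × LatIdx => C * ((br (latPt θ k.1) ^ 7)⁻¹ *
      (br (Complex.I • dualPt k.2) ^ 7)⁻¹) * logW (dispD θ k) := by
    simpa only [mul_assoc] using (summable_weight_mul_logW_dispD hθ hL).mul_left C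
  refine ((hasLogDivergence_tsum_loopInt hθ μ₀ hC hs).const_mul _).congr fun ε hε => ?_
  rw [← tsum_mul_left, ← (hasSum_modeD hθ lam μ₀ hε hφ).tsum_eq]
  exact tsum_congr fun k => (modeD_eq hθ lam μ₀ hε hφ k).symm

end Lattice

/-! ### The irrational case -/

section Irrational

variable {θ : ℝ}

lemma sqrt_two_mul_norm_disp_ge (θ : ℝ) (k : LatIdx × LatIdx) (j : Fin 2) :
    |θ * k.1.1 j - k.2.2 j| ≤ Real.sqrt 2 * ‖latPt θ k.1 + Complex.I • dualPt k.2‖ ∧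
      |θ * k.1.2 j + k.2.1 j| ≤ Real.sqrt 2 * ‖latPt θ k.1 + Complex.I • dualPt k.2‖ := by
  have hs : 0 < Real.sqrt 2 := by positivity
  have h0 : (latPt θ k.1 + Complex.I • dualPt k.2) j =
      (((Real.sqrt 2)⁻¹ * (θ * k.1.1 j - k.2.2 j) : ℝ) : ℂ) +
        (((Real.sqrt 2)⁻¹ * (θ * k.1.2 j + k.2.1 j) : ℝ) : ℂ) * Complex.I := by
    simp only [latPt, dualPt, Pi.add_apply, Pi.smul_apply, smul_eq_mul]
    push_cast
    linear_combination (((Real.sqrt 2 : ℝ) : ℂ)⁻¹ * k.2.2 j) * Complex.I_mul_I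
  have h1 := norm_le_pi_norm (latPt θ k.1 + Complex.I • dualPt k.2) j
  have h2 := (Complex.abs_re_le_norm _).trans h1
  have h3 := (Complex.abs_im_le_norm _).trans h1
  rw [h0] at h2 h3
  rw [Complex.add_re, Complex.ofReal_re, Complex.re_ofReal_mul, Complex.I_re, mul_zero, add_zero,
    abs_mul, abs_of_pos (inv_pos.2 hs), inv_mul_le_iff₀ hs] at h2
  rw [Complex.add_im, Complex.ofReal_im, Complex.im_ofReal_mul, Complex.I_im, mul_one, zero_add,
    abs_mul, abs_of_pos (inv_pos.2 hs), inv_mul_le_iff₀ hs] at h3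
  exact ⟨h2, h3⟩

lemma exists_component_ne_zero {g : LatIdx} (hg : g ≠ 0) : ∃ j, g.1 j ≠ 0 ∨ g.2 j ≠ 0 := by
  by_contra! h
  exact hg (Prod.ext (funext fun j => (h j).1) (funext fun j => (h j).2))

lemma abs_component_le (g : LatIdx) (j : Fin 2) : |(g.1 j : ℝ)| ≤ ‖g‖ ∧ |(g.2 j : ℝ)| ≤ ‖g‖ := by
  constructor
  · have := (norm_le_pi_norm g.1 j).trans (norm_fst_le g)
    rwa [Int.norm_eq_abs] at this
  · have := (norm_le_pi_norm g.2 j).trans (norm_snd_le g)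
    rwa [Int.norm_eq_abs] at this

lemma WeakDiophantine.exists_le (h : WeakDiophantine θ) :
    ∃ c₁ c₂ : ℝ, 0 < c₁ ∧ 0 < c₂ ∧ ∀ k : LatIdx × LatIdx, k ≠ 0 →
      c₁ * Real.exp (-c₂ * ‖k.1‖) ≤ ‖latPt θ k.1 + Complex.I • dualPt k.2‖ := by
  obtain ⟨C₁, C₂, h1, h2, hD⟩ := h
  have hs : 0 < Real.sqrt 2 := by positivity
  have hD' (n m : ℤ) (hn : n ≠ 0) : C₁ * Real.exp (-C₂ * |(n : ℝ)|) ≤ |θ * n - m| := by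
    refine (hD n hn).trans ?_
    rw [mul_comm θ]
    exact ciInf_le ⟨0, by rintro _ ⟨m, rfl⟩; exact abs_nonneg _⟩ m
  refine ⟨(Real.sqrt 2)⁻¹ * min C₁ 1, C₂, by positivity, h2, fun k hk => ?_⟩
  rw [mul_assoc, inv_mul_le_iff₀ hs]
  have hexp (x : ℝ) (hx : |x| ≤ ‖k.1‖) : min C₁ 1 * Real.exp (-C₂ * ‖k.1‖) ≤
      C₁ * Real.exp (-C₂ * |x|) := by
    refine mul_le_mul (min_le_left _ _) ?_ (Real.exp_pos _).le h1.le
    rw [Real.exp_le_exp]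
    nlinarith
  by_cases hg : k.1 = 0
  · have hd : k.2 ≠ 0 := fun h => hk (Prod.ext hg h)
    obtain ⟨j, hj⟩ := exists_component_ne_zero hd
    obtain ⟨ha, hb⟩ := sqrt_two_mul_norm_disp_ge θ k j
    rw [hg] at ha hb ⊢
    have hone (n : ℤ) (hn : n ≠ 0) : (1 : ℝ) ≤ |(n : ℝ)| := by
      exact_mod_cast Int.one_le_abs hn
    have hle : min C₁ 1 * Real.exp (-C₂ * ‖(0 : LatIdx)‖) ≤ 1 := by
      rw [norm_zero, mul_zero, Real.exp_zero, mul_one]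
      exact min_le_right _ _
    simp only [Prod.fst_zero, Prod.snd_zero, Pi.zero_apply, Int.cast_zero, mul_zero, zero_sub,
      zero_add, abs_neg] at ha hb
    rcases hj with hj | hj
    · exact hle.trans ((hone _ hj).trans (by simpa using hb))
    · exact hle.trans ((hone _ hj).trans (by simpa using ha))
  · obtain ⟨j, hj⟩ := exists_component_ne_zero hg
    obtain ⟨ha, hb⟩ := sqrt_two_mul_norm_disp_ge θ k j
    obtain ⟨na, nb⟩ := abs_component_le k.1 j
    rcases hj with hj | hj
    · exact (hexp _ na).trans ((hD' _ _ hj).trans ha)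
    · refine (hexp _ nb).trans ((hD' _ (-k.2.1 j) hj).trans ?_)
      simpa using hb

lemma logW_le_of_le {δ : C2} {c : ℝ} (hc : 0 < c) (h : c ≤ ‖δ‖) :
    logW δ ≤ 1 + Real.log (1 + c⁻¹) := by
  have hδ := hc.trans_le h
  refine add_le_add le_rfl (Real.log_le_log (by positivity) ?_)
  have := inv_anti₀ hc h
  linarith

/-- The weak Diophantine condition turns the logarithmic near-coincidence singularities into a
linear growth, which the rapid decay of the profiles absorbs. -/
theorem WeakDiophantine.logBound (h : WeakDiophantine θ) : LogBound θ := by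
  obtain ⟨c₁, c₂, h1, h2, hb⟩ := h.exists_le
  refine ⟨1 + Real.log (1 + c₁⁻¹) + c₂, fun k => ?_⟩
  have hl : 0 ≤ Real.log (1 + c₁⁻¹) := Real.log_nonneg (by have := inv_pos.2 h1; linarith)
  have hb1 := one_le_br k.1
  have hb2 := one_le_br k.2
  have hbb := one_le_mul_of_one_le_of_one_le hb1 hb2
  rcases eq_or_ne k 0 with rfl | hk
  · simp only [Prod.fst_zero, Prod.snd_zero, latPt_zero, dualPt_zero, smul_zero, add_zero,
      logW_zero, br_zero, mul_one]
    linarith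
  · have hc : 0 < c₁ * Real.exp (-c₂ * ‖k.1‖) := by positivity
    refine (logW_le_of_le hc (hb k hk)).trans ?_
    have h3 : Real.log (1 + (c₁ * Real.exp (-c₂ * ‖k.1‖))⁻¹) ≤
        Real.log (1 + c₁⁻¹) + c₂ * ‖k.1‖ := by
      rw [← Real.log_exp (c₂ * ‖k.1‖), ← Real.log_mul (by positivity) (Real.exp_pos _).ne']
      refine Real.log_le_log (by positivity) ?_
      rw [mul_inv, ← Real.exp_neg, neg_mul, neg_neg, add_mul, one_mul]
      have : 1 ≤ Real.exp (c₂ * ‖k.1‖) := Real.one_le_exp (by positivity)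
      linarith
    have h4 : ‖k.1‖ ≤ br k.1 * br k.2 :=
      (norm_le_br _).trans (le_mul_of_one_le_right (br_pos _).le hb2)
    nlinarith

lemma WeakDiophantine.dispC_eq_zero_iff (h : WeakDiophantine θ) {k : LatIdx × LatIdx} :
    dispC θ k = 0 ↔ k = 0 := by
  obtain ⟨c₁, c₂, h1, h2, hb⟩ := h.exists_le
  refine ⟨fun hk => ?_, fun hk => by simp [dispC, hk]⟩
  by_contra hk0
  have := hb k hk0
  rw [dispC, neg_eq_zero] at hk
  rw [hk, norm_zero] at this
  exact absurd this (not_le.2 (by positivity))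

lemma WeakDiophantine.dispD_eq_zero_iff (h : WeakDiophantine θ) {k : LatIdx × LatIdx} :
    dispD θ k = 0 ↔ k = 0 := by
  have h1 : dispD θ k = -dispC θ (k.1, -k.2) := by
    rw [dispD, dispC, neg_neg, dualPt_neg, smul_neg, sub_eq_add_neg]
  rw [h1, neg_eq_zero, h.dispC_eq_zero_iff, Prod.mk_eq_zero, neg_eq_zero, ← Prod.mk_eq_zero]

variable {φ : Fin 4 → C2 → ℂ}

lemma matCoef_zero (θ : ℝ) (φ χ : C2 → ℂ) :
    matCoef θ φ χ 0 = torusTrace (hermPairing θ φ χ) := by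
  rw [torusTrace, hermPairing, unitaryU, neg_zero, latPt_zero, matCoef]

lemma modeProfileC_zero (θ : ℝ) (φ : Fin 4 → C2 → ℂ) : modeProfileC θ φ 0 0 =
    torusTrace (hermPairing θ (φ 0) (φ 1)) * torusTrace (hermPairing θ (φ 2) (φ 3)) := by
  simp [modeProfileC, profileC, matCoef_zero]

lemma modeProfileD_zero (θ : ℝ) (φ : Fin 4 → C2 → ℂ) : modeProfileD θ φ 0 0 =
    torusTrace (hermPairing θ (φ 0) (φ 1)) * torusTrace (hermPairing θ (φ 2) (φ 3)) := by
  simp [modeProfileD, profileD, matCoef_zero]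

/-- The two graphs share the coefficient of the divergence in the ratio `2 : 1`. -/
lemma divergence_coeff (hθ : 0 < θ) (lam : ℝ) (S : ℂ) :
    -((lam : ℂ) ^ 2 / 4) * (S * ((4 * Real.pi ^ 2)⁻¹ : ℝ)) +
      -((lam : ℂ) ^ 2 / 8) * (S * ((4 * Real.pi ^ 2)⁻¹ : ℝ)) =
      -((3 * lam ^ 2 / (8 * freq θ ^ 2 * θ ^ 2) : ℝ) : ℂ) * S := by
  have h : 3 * lam ^ 2 / (8 * freq θ ^ 2 * θ ^ 2) = 3 * lam ^ 2 / 8 * (4 * Real.pi ^ 2)⁻¹ := by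
    have := Real.pi_pos
    unfold freq
    field_simp
    norm_num
  rw [h]
  push_cast
  ring

theorem hasLogDivergence_nonPlanar_irrational (hθ : 0 < θ) (hd : WeakDiophantine θ) (lam μ₀ : ℝ)
    (hφ : ∀ i, φ i ∈ smoothModule θ) :
    HasLogDivergence (fun ε => nonPlanar θ lam μ₀ ε φ)
      (-((3 * lam ^ 2 / (8 * freq θ ^ 2 * θ ^ 2) : ℝ) : ℂ) *
        torusTrace (hermPairing θ (φ 0) (φ 1)) * torusTrace (hermPairing θ (φ 2) (φ 3))) := by
  classical
  have h1 := hasLogDivergence_graphC hθ hd.logBound lam μ₀ hφ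
  have h2 := hasLogDivergence_graphD hθ hd.logBound lam μ₀ hφ
  simp only [hd.dispC_eq_zero_iff, hd.dispD_eq_zero_iff, tsum_ite_eq, modeProfileC_zero,
    modeProfileD_zero] at h1 h2
  have h3 := h1.add h2
  rwa [divergence_coeff hθ, ← mul_assoc] at h3

theorem hasLogDivergence_zeroModes (hθ : 0 < θ) (lam μ₀ : ℝ) (hφ : ∀ i, φ i ∈ smoothModule θ) :
    HasLogDivergence (fun ε => modeC θ lam μ₀ ε φ 0 + modeD θ lam μ₀ ε φ 0)
      (-((3 * lam ^ 2 / (8 * freq θ ^ 2 * θ ^ 2) : ℝ) : ℂ) *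
        torusTrace (hermPairing θ (φ 0) (φ 1)) * torusTrace (hermPairing θ (φ 2) (φ 3))) := by
  classical
  obtain ⟨C, hC⟩ := exists_isProfile_modeProfileC hθ hφ
  obtain ⟨D, hD⟩ := exists_isProfile_modeProfileD hθ hφ
  have h1 := hasLogDivergence_tsum_loopInt (ι := Unit) (δ := fun _ => dispC θ 0) hθ μ₀
    (fun _ => hC 0) Summable.of_finite
  have h2 := hasLogDivergence_tsum_loopInt (ι := Unit) (δ := fun _ => dispD θ 0) hθ μ₀
    (fun _ => hD 0) Summable.of_finite
  have e1 : dispC θ 0 = 0 := by simp [dispC]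
  have e2 : dispD θ 0 = 0 := by simp [dispD]
  simp only [tsum_fintype, Finset.univ_unique, Finset.sum_singleton, e1, e2, if_true,
    modeProfileC_zero, modeProfileD_zero] at h1 h2
  have h3 := (h1.const_mul (-((lam : ℂ) ^ 2 / 4))).add (h2.const_mul (-((lam : ℂ) ^ 2 / 8)))
  rw [divergence_coeff hθ, ← mul_assoc] at h3
  refine h3.congr fun ε hε => ?_
  rw [modeC_eq hθ lam μ₀ hε hφ, modeD_eq hθ lam μ₀ hε hφ, e1, e2]

theorem hasFiniteLimit_modeC (hθ : 0 < θ) (hd : WeakDiophantine θ) (lam μ₀ : ℝ)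
    (hφ : ∀ i, φ i ∈ smoothModule θ) {k : LatIdx × LatIdx} (hk : k ≠ 0) :
    HasFiniteLimit fun ε => modeC θ lam μ₀ ε φ k := by
  obtain ⟨C, hC⟩ := exists_isProfile_modeProfileC hθ hφ
  refine ((hasFiniteLimit_regLoop hθ μ₀ (dispC θ k) (hC k)).const_mul
    (-((lam : ℂ) ^ 2 / 4))).congr fun ε hε => ?_
  rw [modeC_eq hθ lam μ₀ hε hφ, regLoop_of_ne (mt hd.dispC_eq_zero_iff.1 hk)]

theorem hasFiniteLimit_modeD (hθ : 0 < θ) (hd : WeakDiophantine θ) (lam μ₀ : ℝ)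
    (hφ : ∀ i, φ i ∈ smoothModule θ) {k : LatIdx × LatIdx} (hk : k ≠ 0) :
    HasFiniteLimit fun ε => modeD θ lam μ₀ ε φ k := by
  obtain ⟨C, hC⟩ := exists_isProfile_modeProfileD hθ hφ
  refine ((hasFiniteLimit_regLoop hθ μ₀ (dispD θ k) (hC k)).const_mul
    (-((lam : ℂ) ^ 2 / 8))).congr fun ε hε => ?_
  rw [modeD_eq hθ lam μ₀ hε hφ, regLoop_of_ne (mt hd.dispD_eq_zero_iff.1 hk)]

theorem hasFiniteLimit_tsum_modeC (hθ : 0 < θ) (hd : WeakDiophantine θ) (lam μ₀ : ℝ)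
    (hφ : ∀ i, φ i ∈ smoothModule θ) :
    HasFiniteLimit fun ε => ∑' k : {k : LatIdx × LatIdx // k ≠ 0}, modeC θ lam μ₀ ε φ k := by
  obtain ⟨C, hC⟩ := exists_isProfile_modeProfileC hθ hφ
  have hs : Summable fun k : LatIdx × LatIdx => C * ((br (latPt θ k.1) ^ 7)⁻¹ *
      (br (Complex.I • dualPt k.2) ^ 7)⁻¹) * logW (dispC θ k) := by
    simpa only [mul_assoc] using (summable_weight_mul_logW_dispC hθ hd.logBound).mul_left C
  refine ((hasFiniteLimit_tsum_regLoop (ι := {k : LatIdx × LatIdx // k ≠ 0})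
    (δ := fun k => dispC θ k) hθ μ₀ (fun k => hC k)
    (hs.comp_injective Subtype.val_injective)).const_mul (-((lam : ℂ) ^ 2 / 4))).congr
    fun ε hε => ?_
  rw [← tsum_mul_left]
  refine tsum_congr fun k => ?_
  rw [modeC_eq hθ lam μ₀ hε hφ, regLoop_of_ne (mt hd.dispC_eq_zero_iff.1 k.2)]

theorem hasFiniteLimit_tsum_modeD (hθ : 0 < θ) (hd : WeakDiophantine θ) (lam μ₀ : ℝ)
    (hφ : ∀ i, φ i ∈ smoothModule θ) :
    HasFiniteLimit fun ε => ∑' k : {k : LatIdx × LatIdx // k ≠ 0}, modeD θ lam μ₀ ε φ k := by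
  obtain ⟨C, hC⟩ := exists_isProfile_modeProfileD hθ hφ
  have hs : Summable fun k : LatIdx × LatIdx => C * ((br (latPt θ k.1) ^ 7)⁻¹ *
      (br (Complex.I • dualPt k.2) ^ 7)⁻¹) * logW (dispD θ k) := by
    simpa only [mul_assoc] using (summable_weight_mul_logW_dispD hθ hd.logBound).mul_left C
  refine ((hasFiniteLimit_tsum_regLoop (ι := {k : LatIdx × LatIdx // k ≠ 0})
    (δ := fun k => dispD θ k) hθ μ₀ (fun k => hC k)
    (hs.comp_injective Subtype.val_injective)).const_mul (-((lam : ℂ) ^ 2 / 8))).congr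
    fun ε hε => ?_
  rw [← tsum_mul_left]
  refine tsum_congr fun k => ?_
  rw [modeD_eq hθ lam μ₀ hε hφ, regLoop_of_ne (mt hd.dispD_eq_zero_iff.1 k.2)]

end Irrational

/-! ### Inversion and isometry of the Bargmann transform -/

open scoped FourierTransform in
/-- Fourier inversion on `ℝ²`, with the frequencies rescaled by `c`. -/
lemma integral_fourier_mul_phase_R2 {c : ℝ} (hc : 0 < c) {F : R2 → ℂ} (hF : Continuous F)
    (hFi : Integrable F)
    (hft : Integrable fun b : Fin 2 → ℝ => ∫ x, F x * phase (c * ∑ j, b j * x j)) (x₀ : R2) :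
    ∫ b : Fin 2 → ℝ, (∫ x, F x * phase (c * ∑ j, b j * x j)) * phase (-(c * ∑ j, b j * x₀ j)) =
      (((2 * Real.pi / c) ^ 2 : ℝ) : ℂ) * F x₀ := by
  have hpi := Real.pi_pos
  set r : ℝ := -(2 * Real.pi / c) with hr
  have hr0 : r ≠ 0 := neg_ne_zero.2 (by positivity)
  set K : (Fin 2 → ℝ) → ℂ := fun b => ∫ x, F x * phase (c * ∑ j, b j * x j) with hK
  have hE := EuclideanSpace.volume_preserving_symm_measurableEquiv_toLp (Fin 2)
  have hin (ξ x : R2) : c * ∑ j, (r • ξ.ofLp) j * x j = -2 * Real.pi * inner ℝ x ξ := by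
    simp only [hr, PiLp.inner_apply, Fin.sum_univ_two, Pi.smul_apply, smul_eq_mul]
    simp
    field_simp
    ring
  have hFT (ξ : R2) : 𝓕 F ξ = K (r • ξ.ofLp) := by
    rw [Real.fourier_eq', hK]
    refine integral_congr_ae (Eventually.of_forall fun x => ?_)
    beta_reduce
    rw [hin, phase, smul_eq_mul, mul_comm]
  have hcv (G : (Fin 2 → ℝ) → ℂ) :
      ∫ b, G b = (((2 * Real.pi / c) ^ 2 : ℝ) : ℂ) * ∫ ξ : R2, G (r • ξ.ofLp) := by
    have h1 : ∫ ξ : R2, G (r • ξ.ofLp) = ∫ b, G (r • b) :=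
      hE.integral_comp (MeasurableEquiv.measurableEmbedding _) fun b => G (r • b)
    rw [h1, Measure.integral_comp_smul, Module.finrank_fin_fun, hr, neg_sq,
      abs_of_pos (by positivity), Complex.real_smul, ← mul_assoc, ← Complex.ofReal_mul,
      mul_inv_cancel₀ (by positivity), Complex.ofReal_one, one_mul]
  have hKi : Integrable fun ξ : R2 => K (r • ξ.ofLp) :=
    (hE.integrable_comp_emb (MeasurableEquiv.measurableEmbedding _)).2 (hft.comp_smul hr0)
  have hinv := hFi.fourierInv_fourier_eq (hKi.congr (Eventually.of_forall fun ξ => (hFT ξ).symm))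
    (v := x₀) hF.continuousAt
  rw [hcv, ← hinv, Real.fourierInv_eq']
  congr 1
  refine integral_congr_ae (Eventually.of_forall fun ξ => ?_)
  beta_reduce
  rw [hFT, hin, smul_eq_mul, mul_comm, phase]
  congr 2
  rw [real_inner_comm]
  push_cast
  ring

section Inversion

variable {θ : ℝ}

/-- On `z = a + i b` the weighted kernel is a Gaussian centred at `√2 a`, modulated with
frequency proportional to `b`. -/
lemma bargmannKer_complexify (θ : ℝ) (a b : Fin 2 → ℝ) (x : R2) :
    (Real.exp (-(freq θ * normSq2 (complexify (a, b)) / 2)) : ℂ) *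
        bargmannKer θ (complexify (a, b)) x =
      (Real.exp (-(freq θ / 2) * ∑ j, (x j - Real.sqrt 2 * a j) ^ 2) : ℂ) *
        phase (-(freq θ * ∑ j, a j * b j)) * phase (Real.sqrt 2 * freq θ * ∑ j, b j * x j) := by
  have h2 : ((Real.sqrt 2 : ℝ) : ℂ) ^ 2 = 2 := by
    rw [← Complex.ofReal_pow, Real.sq_sqrt (by norm_num)]; norm_num
  rw [bargmannKer, phase, phase, Complex.ofReal_exp, Complex.ofReal_exp, ← Complex.exp_add,
    ← Complex.exp_add, ← Complex.exp_add]
  congr 1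
  simp only [normSq2_eq, complexify_apply, Fin.sum_univ_two]
  simp
  linear_combination ((freq θ / 2 : ℂ) * ((a 0 : ℂ) ^ 2 + (a 1 : ℂ) ^ 2)) * h2 +
    ((freq θ / 2 : ℂ) * (-(b 0 : ℂ) ^ 2 - (b 1 : ℂ) ^ 2)) * Complex.I_sq

lemma integral_gaussian_shift {r : ℝ} (hr : 0 < r) (x : R2) :
    ∫ a : Fin 2 → ℝ, Real.exp (-r * ∑ j, (x j - Real.sqrt 2 * a j) ^ 2) =
      Real.pi / (2 * r) := by
  have h2 : Real.sqrt 2 ^ 2 = 2 := Real.sq_sqrt (by norm_num)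
  have h1 (a : Fin 2 → ℝ) : Real.exp (-r * ∑ j, (x j - Real.sqrt 2 * a j) ^ 2) =
      ∏ j, Real.exp (-(2 * r) * (a j - x j / Real.sqrt 2) ^ 2) := by
    rw [← Real.exp_sum, Finset.mul_sum]
    congr 1
    refine Finset.sum_congr rfl fun j _ => ?_
    have : x j = Real.sqrt 2 * (x j / Real.sqrt 2) := by field_simp
    conv_lhs => rw [this, ← mul_sub, mul_pow, h2]
    ring
  simp only [h1]
  rw [integral_fintype_prod_volume_eq_prod (fun j (t : ℝ) =>
    Real.exp (-(2 * r) * (t - x j / Real.sqrt 2) ^ 2))]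
  have h3 (j : Fin 2) : ∫ t : ℝ, Real.exp (-(2 * r) * (t - x j / Real.sqrt 2) ^ 2) =
      Real.sqrt (Real.pi / (2 * r)) := by
    rw [integral_sub_right_eq_self (fun t : ℝ => Real.exp (-(2 * r) * t ^ 2)), integral_gaussian]
  simp only [h3, Fin.prod_univ_two]
  exact Real.mul_self_sqrt (by positivity)

/-- The Bargmann transform is inverted by integration against the conjugate kernel. -/
lemma integral_bargmann_mul_conj_ker (hθ : 0 < θ) (f : 𝓢(R2, ℂ)) (x₀ : R2) :
    ∫ z : C2, (((freq θ / Real.pi) ^ 2 * Real.exp (-freq θ * normSq2 z) : ℝ) : ℂ) *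
      (bargmann θ f z * (starRingEnd ℂ) (bargmannKer θ z x₀)) =
      ((Real.sqrt (freq θ / Real.pi) : ℝ) : ℂ)⁻¹ * f x₀ := by
  have hω := freq_pos hθ
  have hpi := Real.pi_pos
  have hφ : bargmann θ f ∈ smoothModule θ := ⟨f, rfl⟩
  have hφc := continuous_bargmann hθ f
  have hn := continuous_normSq2
  set c : ℝ := Real.sqrt (freq θ / Real.pi) with hc
  have hc2 : c ^ 2 = freq θ / Real.pi := Real.sq_sqrt (by positivity)
  have hc0 : 0 < c := Real.sqrt_pos.2 (by positivity)
  have hcC : (c : ℂ) ≠ 0 := Complex.ofReal_ne_zero.2 hc0.ne'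
  -- the Gaussian weight is split evenly between the function and the kernel
  set J : C2 → ℂ := fun z => (Real.exp (-(freq θ * normSq2 z / 2)) : ℂ) * bargmann θ f z with hJ
  set k : C2 → ℂ := fun z => (starRingEnd ℂ)
    ((Real.exp (-(freq θ * normSq2 z / 2)) : ℂ) * bargmannKer θ z x₀) with hk
  have hJi : Integrable J := by
    refine (integrable_husimi hθ hφ).mono' (Continuous.aestronglyMeasurable (by fun_prop))
      (Eventually.of_forall fun z => ?_)
    rw [norm_mul, Complex.norm_real, Real.norm_of_nonneg (Real.exp_pos _).le, mul_comm, husimi]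
  have hkc : Continuous k := by
    have := continuous_bargmannKer_left θ x₀
    fun_prop
  have hkb (z) : ‖k z‖ ≤ 1 := by
    rw [RCLike.norm_conj, norm_mul, Complex.norm_real, Real.norm_of_nonneg (Real.exp_pos _).le,
      mul_comm]
    exact norm_bargmannKer_mul_exp_le_one hθ z x₀
  have hHJ (z : C2) : (((freq θ / Real.pi) ^ 2 * Real.exp (-freq θ * normSq2 z) : ℝ) : ℂ) *
      (bargmann θ f z * (starRingEnd ℂ) (bargmannKer θ z x₀)) =
      (((freq θ / Real.pi) ^ 2 : ℝ) : ℂ) * (J z * k z) := by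
    have : Real.exp (-freq θ * normSq2 z) = Real.exp (-(freq θ * normSq2 z / 2)) *
        Real.exp (-(freq θ * normSq2 z / 2)) := by
      rw [← Real.exp_add]; congr 1; ring
    simp only [hJ, hk, this, map_mul, Complex.conj_ofReal]
    push_cast
    ring
  simp only [hHJ]
  have hJk : Integrable fun z => J z * k z :=
    hJi.mul_bdd hkc.aestronglyMeasurable (Eventually.of_forall hkb)
  rw [integral_const_mul, ← measurePreserving_complexify.integral_comp
    complexify.measurableEmbedding]
  have hJkp : Integrable fun p => J (complexify p) * k (complexify p) :=
    (measurePreserving_complexify.integrable_comp_emb complexify.measurableEmbedding).2 hJk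
  have hJp : Integrable fun p => J (complexify p) :=
    (measurePreserving_complexify.integrable_comp_emb complexify.measurableEmbedding).2 hJi
  rw [Measure.volume_eq_prod, integral_prod _ hJkp]
  set G : (Fin 2 → ℝ) → R2 → ℝ :=
    fun a x => Real.exp (-(freq θ / 2) * ∑ j, (x j - Real.sqrt 2 * a j) ^ 2) with hG
  set F : (Fin 2 → ℝ) → (Fin 2 → ℝ) → ℂ := fun a b =>
    ∫ x, ((G a x : ℂ) * f x) * phase (Real.sqrt 2 * freq θ * ∑ j, b j * x j) with hF
  have hcp (t : ℝ) : (starRingEnd ℂ) (phase t) = phase (-t) := by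
    simp [phase, ← Complex.exp_conj]
  have hpp (t : ℝ) : phase t * phase (-t) = 1 := by
    rw [← phase_add, add_neg_cancel, phase_zero]
  have hJF (a b) : J (complexify (a, b)) = c * (phase (-(freq θ * ∑ j, a j * b j)) * F a b) := by
    simp only [hJ, bargmann_eq, hF, ← hc]
    rw [mul_left_comm]
    congr 1
    rw [← integral_const_mul, ← integral_const_mul]
    congr 1
    funext x
    rw [← mul_assoc, bargmannKer_complexify]
    ring
  have hkG (a b) : k (complexify (a, b)) = (G a x₀ : ℂ) * (phase (freq θ * ∑ j, a j * b j) *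
      phase (-(Real.sqrt 2 * freq θ * ∑ j, b j * x₀ j))) := by
    simp only [hk]
    rw [bargmannKer_complexify]
    simp only [map_mul, Complex.conj_ofReal, hcp, neg_neg, hG]
    ring
  have hprod (a b) : J (complexify (a, b)) * k (complexify (a, b)) =
      (c * (G a x₀ : ℂ)) * (F a b * phase (-(Real.sqrt 2 * freq θ * ∑ j, b j * x₀ j))) := by
    rw [hJF, hkG]
    linear_combination (c * F a b * (G a x₀ : ℂ) *
      phase (-(Real.sqrt 2 * freq θ * ∑ j, b j * x₀ j))) * hpp (freq θ * ∑ j, a j * b j)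
  have hGc (a) : Continuous (G a) := by fun_prop
  have hin : ∀ᵐ a : Fin 2 → ℝ, ∫ b, J (complexify (a, b)) * k (complexify (a, b)) =
      ((c * (2 * Real.pi / (Real.sqrt 2 * freq θ)) ^ 2 *
        Real.exp (-freq θ * ∑ j, (x₀ j - Real.sqrt 2 * a j) ^ 2) : ℝ) : ℂ) * f x₀ := by
    filter_upwards [hJp.prod_right_ae] with a ha
    have hFi : Integrable (F a) := by
      have h1 : Integrable fun b => (c : ℂ)⁻¹ *
          (J (complexify (a, b)) * phase (freq θ * ∑ j, a j * b j)) := by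
        refine (ha.mul_bdd (c := 1) (Continuous.aestronglyMeasurable ?_)
          (Eventually.of_forall fun b => (norm_phase _).le)).const_mul _
        exact continuous_phase.comp (by fun_prop)
      refine h1.congr (Eventually.of_forall fun b => ?_)
      simp only [hJF]
      field_simp
      linear_combination (F a b) * hpp (freq θ * ∑ j, a j * b j)
    simp only [hprod]
    rw [integral_const_mul, integral_fourier_mul_phase_R2 (F := fun x => (G a x : ℂ) * f x)
      (by positivity) (by have := f.continuous; fun_prop) ?_ hFi]
    · have : Real.exp (-freq θ * ∑ j, (x₀ j - Real.sqrt 2 * a j) ^ 2) = G a x₀ * G a x₀ := by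
        rw [hG, ← Real.exp_add]; congr 1; ring
      rw [this]
      push_cast
      ring
    · refine f.integrable.bdd_mul (c := 1) (Continuous.aestronglyMeasurable (by fun_prop))
        (Eventually.of_forall fun x => ?_)
      rw [Complex.norm_real, Real.norm_of_nonneg (Real.exp_pos _).le, Real.exp_le_one_iff]
      have : 0 ≤ freq θ / 2 * ∑ j, (x j - Real.sqrt 2 * a j) ^ 2 :=
        mul_nonneg (by positivity) (Finset.sum_nonneg fun _ _ => sq_nonneg _)
      linarith
  rw [integral_congr_ae hin, integral_mul_const, integral_complex_ofReal, integral_const_mul,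
    integral_gaussian_shift hω, ← mul_assoc]
  congr 1
  rw [← Complex.ofReal_mul, ← Complex.ofReal_inv]
  congr 1
  have h2 : Real.sqrt 2 ^ 2 = 2 := Real.sq_sqrt (by norm_num)
  refine eq_inv_of_mul_eq_one_left ?_
  have h3 : (freq θ / Real.pi) ^ 2 * (c * (2 * Real.pi / (Real.sqrt 2 * freq θ)) ^ 2 *
      (Real.pi / (2 * freq θ))) * c = (freq θ / Real.pi) ^ 2 *
      ((2 * Real.pi) ^ 2 / (Real.sqrt 2 ^ 2 * freq θ ^ 2) * (Real.pi / (2 * freq θ))) * c ^ 2 := by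
    rw [div_pow (2 * Real.pi), mul_pow (Real.sqrt 2)]
    ring
  rw [h3, h2, hc2]
  field_simp

/-- Scalar product of a Bargmann transform with the transform of an arbitrary integrable
function; with `h` a Schwartz function this is the isometry of the Bargmann transform. -/
theorem bInner_bargmann (hθ : 0 < θ) (f : 𝓢(R2, ℂ)) {h : R2 → ℂ} (hh : Integrable h) :
    bInner θ (bargmann θ f)
      (fun z => ((Real.sqrt (freq θ / Real.pi) : ℝ) : ℂ) * ∫ x, bargmannKer θ z x * h x) =
      ∫ x, (starRingEnd ℂ) (f x) * h x := by
  have hω := freq_pos hθ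
  have hpi := Real.pi_pos
  have hφc := continuous_bargmann hθ f
  have hkc := continuous_bargmannKer θ
  have hn := continuous_normSq2
  set c : ℝ := Real.sqrt (freq θ / Real.pi) with hc
  have hc0 : 0 < c := Real.sqrt_pos.2 (by positivity)
  have hcC : (c : ℂ) ≠ 0 := Complex.ofReal_ne_zero.2 hc0.ne'
  set m : C2 → R2 → ℂ := fun z x =>
    (((freq θ / Real.pi) ^ 2 * Real.exp (-freq θ * normSq2 z) : ℝ) : ℂ) *
      (bargmann θ f z * (starRingEnd ℂ) (bargmannKer θ z x)) with hm
  have e1 (z : C2) : (((freq θ / Real.pi) ^ 2 * Real.exp (-freq θ * normSq2 z) : ℝ) : ℂ) *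
      ((starRingEnd ℂ) (bargmann θ f z) * (c * ∫ x, bargmannKer θ z x * h x)) =
      ∫ x, c * ((starRingEnd ℂ) (m z x) * h x) := by
    rw [← integral_const_mul, ← integral_const_mul, ← integral_const_mul]
    congr 1
    funext x
    simp only [hm, map_mul, Complex.conj_ofReal, Complex.conj_conj]
    ring
  rw [bInner]
  simp only [e1]
  rw [integral_integral_swap]
  · congr 1
    funext x
    rw [integral_const_mul, integral_mul_const, integral_conj,
      integral_bargmann_mul_conj_ker hθ f x,
      map_mul, map_inv₀, Complex.conj_ofReal, ← hc]
    field_simp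
  · have hb : Integrable fun p : C2 × R2 =>
        (c * (freq θ / Real.pi) ^ 2) * (husimi θ (bargmann θ f) p.1 * ‖h p.2‖) :=
      ((integrable_husimi hθ ⟨f, rfl⟩).mul_prod hh.norm).const_mul _
    refine hb.mono' ?_ (Eventually.of_forall fun p => ?_)
    · refine AEStronglyMeasurable.const_mul (AEStronglyMeasurable.mul ?_ hh.1.comp_snd) _
      simp only [hm]
      exact Continuous.aestronglyMeasurable (by fun_prop)
    · simp only [Function.uncurry, hm, norm_mul, RCLike.norm_conj, Complex.norm_real,
        Real.norm_of_nonneg hc0.le, norm_pow, husimi]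
      have hE : Real.exp (-freq θ * normSq2 p.1) = Real.exp (-(freq θ * normSq2 p.1 / 2)) *
          Real.exp (-(freq θ * normSq2 p.1 / 2)) := by
        rw [← Real.exp_add]; congr 1; ring
      have h1 := norm_bargmannKer_mul_exp_le_one hθ p.1 p.2
      rw [Real.norm_of_nonneg (Real.exp_pos _).le, hE,
        Real.norm_of_nonneg (show 0 ≤ freq θ / Real.pi by positivity)]
      have h0 : 0 ≤ c * (freq θ / Real.pi) ^ 2 *
          (‖bargmann θ f p.1‖ * Real.exp (-(freq θ * normSq2 p.1 / 2)) * ‖h p.2‖) := by positivity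
      nlinarith [mul_le_mul_of_nonneg_left h1 h0]

/-- The projective action on the Bargmann kernel is a translation and a modulation. -/
lemma transl_bargmannKer (θ : ℝ) (a b : Fin 2 → ℝ) (z : C2) (x : R2) :
    transl θ (complexify (a, b))
        (fun z => bargmannKer θ z (x + WithLp.toLp 2 (fun j => Real.sqrt 2 * a j))) z =
      bargmannKer θ z x *
        phase (freq θ * ∑ j, a j * b j + Real.sqrt 2 * freq θ * ∑ j, b j * x j) := by
  have h2 : ((Real.sqrt 2 : ℝ) : ℂ) ^ 2 = 2 := by
    rw [← Complex.ofReal_pow, Real.sq_sqrt (by norm_num)]; norm_num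
  rw [transl, bargmannKer, bargmannKer, phase, ← Complex.exp_add, ← Complex.exp_add]
  congr 1
  simp only [normSq2_eq, complexify_apply, Fin.sum_univ_two, cdot, Pi.add_apply, PiLp.add_apply]
  simp
  linear_combination (freq θ : ℂ) * (-(1 / 2) * ((b 0 : ℂ) ^ 2 + (b 1 : ℂ) ^ 2)) * Complex.I_sq +
    (freq θ : ℂ) * ((a 0 : ℂ) ^ 2 / 2 + (a 1 : ℂ) ^ 2 / 2 + a 0 * z 0 + a 1 * z 1 +
      Complex.I * (a 0 * b 0 + a 1 * b 1)) * h2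

/-- Matrix coefficients of the projective action, computed in the position representation. -/
theorem matCoef_bargmann (hθ : 0 < θ) (f g : 𝓢(R2, ℂ)) (a b : Fin 2 → ℝ) :
    matCoef θ (bargmann θ f) (bargmann θ g) (complexify (a, b)) =
      phase (freq θ * ∑ j, a j * b j) *
        ∫ x, (starRingEnd ℂ) (f x) * (g (x + WithLp.toLp 2 (fun j => Real.sqrt 2 * a j)) *
          phase (Real.sqrt 2 * freq θ * ∑ j, b j * x j)) := by
  set t : R2 := WithLp.toLp 2 (fun j => Real.sqrt 2 * a j) with ht
  set h : R2 → ℂ := fun x => g (x + t) *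
    phase (freq θ * ∑ j, a j * b j + Real.sqrt 2 * freq θ * ∑ j, b j * x j) with hh
  have hhi : Integrable h := by
    refine (g.integrable.comp_add_right t).mul_bdd (c := 1) (Continuous.aestronglyMeasurable ?_)
      (Eventually.of_forall fun x => (norm_phase _).le)
    exact continuous_phase.comp (by fun_prop)
  have e1 : transl θ (complexify (a, b)) (bargmann θ g) =
      fun z => ((Real.sqrt (freq θ / Real.pi) : ℝ) : ℂ) * ∫ x, bargmannKer θ z x * h x := by
    funext z
    rw [transl, bargmann_eq, mul_left_comm,
      ← integral_add_right_eq_self (fun x => bargmannKer θ (z + complexify (a, b)) x * g x) t,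
      ← integral_const_mul]
    congr 2
    funext x
    have := transl_bargmannKer θ a b z x
    rw [transl] at this
    rw [← mul_assoc, this, hh]
    ring
  rw [matCoef, e1, bInner_bargmann hθ f hhi, ← integral_const_mul]
  congr 1
  funext x
  simp only [hh, phase_add]
  ring

end Inversion

/-! ### Resonant modes for rational `θ` -/

lemma dispC_eq_zero_iff_components (θ : ℝ) (k : LatIdx × LatIdx) : dispC θ k = 0 ↔
    ∀ j, θ * k.1.1 j - k.2.2 j = 0 ∧ θ * k.1.2 j + k.2.1 j = 0 := by
  rw [dispC, neg_eq_zero]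
  constructor
  · intro h j
    obtain ⟨h1, h2⟩ := sqrt_two_mul_norm_disp_ge θ k j
    rw [h, norm_zero, mul_zero] at h1 h2
    exact ⟨abs_nonpos_iff.1 h1, abs_nonpos_iff.1 h2⟩
  · intro h
    funext j
    obtain ⟨h1, h2⟩ := h j
    have h0 : (latPt θ k.1 + Complex.I • dualPt k.2) j = ((Real.sqrt 2 : ℝ) : ℂ)⁻¹ *
        (((θ * k.1.1 j - k.2.2 j : ℝ) : ℂ) + ((θ * k.1.2 j + k.2.1 j : ℝ) : ℂ) * Complex.I) := by
      simp only [latPt, dualPt, Pi.add_apply, Pi.smul_apply, smul_eq_mul]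
      push_cast
      linear_combination ((Real.sqrt 2 : ℝ) : ℂ)⁻¹ * (k.2.2 j : ℂ) * Complex.I_sq
    rw [h0, h1, h2]
    simp

lemma dispD_eq (θ : ℝ) (k : LatIdx × LatIdx) : dispD θ k = -dispC θ (k.1, -k.2) := by
  rw [dispD, dispC, dualPt_neg]; simp [sub_eq_add_neg]

/-- The label of `i γ*`, up to the sign, when `h` is the label of `γ*`. -/
def rotIdx (h : LatIdx) : LatIdx := (-h.2, h.1)

section Rational

variable {p q : ℕ}

/-- For `θ = p/q` the displacements which do not vanish are bounded below by a multiple of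
`1/q`, so the logarithmic weights are bounded. -/
lemma logBound_rational (hq : 0 < q) : LogBound ((p : ℝ) / q) := by
  have hq' : (0 : ℝ) < q := by exact_mod_cast hq
  set c : ℝ := (Real.sqrt 2 * q)⁻¹ with hc
  have hc0 : 0 < c := by positivity
  have hL : 1 ≤ 1 + Real.log (1 + c⁻¹) := by
    have := Real.log_nonneg (show 1 ≤ 1 + c⁻¹ by have := inv_pos.2 hc0; linarith)
    linarith
  refine ⟨1 + Real.log (1 + c⁻¹), fun k => ?_⟩
  have h1 : logW (latPt ((p : ℝ) / q) k.1 + Complex.I • dualPt k.2) ≤ 1 + Real.log (1 + c⁻¹) := by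
    by_cases h0 : dispC ((p : ℝ) / q) k = 0
    · rw [dispC, neg_eq_zero] at h0
      rwa [h0, logW_zero]
    · refine logW_le_of_le hc0 ?_
      have key {t : ℝ} (n : ℤ) (ht : t ≠ 0) (h : t * q = n) : (q : ℝ)⁻¹ ≤ |t| := by
        have hn : n ≠ 0 := by
          rintro rfl
          exact ht (by simpa [hq'.ne'] using h)
        have : (1 : ℝ) ≤ |(n : ℝ)| := by exact_mod_cast Int.one_le_abs hn
        rw [← h, abs_mul, abs_of_pos hq'] at this
        rwa [inv_le_iff_one_le_mul₀ hq']
      have h2 : (q : ℝ)⁻¹ ≤ Real.sqrt 2 * ‖latPt ((p : ℝ) / q) k.1 + Complex.I • dualPt k.2‖ := by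
        simp only [dispC_eq_zero_iff_components, not_forall, not_and_or] at h0
        obtain ⟨j, hj⟩ := h0
        obtain ⟨ha, hb⟩ := sqrt_two_mul_norm_disp_ge ((p : ℝ) / q) k j
        rcases hj with hj | hj
        · refine (key (p * k.1.1 j - q * k.2.2 j) hj ?_).trans ha
          push_cast; field_simp
        · refine (key (p * k.1.2 j + q * k.2.1 j) hj ?_).trans hb
          push_cast; field_simp
      rw [hc, mul_inv, inv_mul_eq_div, div_le_iff₀' (by positivity)]
      exact h2
  exact h1.trans (le_mul_of_one_le_right (by linarith)
    (one_le_mul_of_one_le_of_one_le (one_le_br _) (one_le_br _)))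

lemma latPt_rational (hq : 0 < q) (h : LatIdx) :
    latPt ((p : ℝ) / q) ((q : ℤ) • h) = latPt p h := by
  have hq' : (q : ℂ) ≠ 0 := by exact_mod_cast hq.ne'
  funext j
  simp only [latPt, Prod.smul_fst, Prod.smul_snd, Pi.smul_apply, smul_eq_mul]
  push_cast
  field_simp

lemma I_smul_dualPt_rotIdx (h : LatIdx) :
    Complex.I • dualPt ((p : ℤ) • rotIdx h) = -latPt p h := by
  funext j
  simp only [latPt, dualPt, rotIdx, Prod.smul_fst, Prod.smul_snd, Pi.smul_apply, smul_eq_mul,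
    Pi.neg_apply]
  push_cast
  linear_combination (((Real.sqrt 2 : ℝ) : ℂ)⁻¹ * (p : ℂ) * (h.1 j : ℂ)) * Complex.I_sq

lemma exists_of_mul_eq (hq : 0 < q) (hpq : Nat.Coprime p q) {m n : ℤ} (h : p * m = q * n) :
    ∃ a : ℤ, m = q * a ∧ n = p * a := by
  have hd : (q : ℤ) ∣ m :=
    (Nat.isCoprime_iff_coprime.2 hpq).symm.dvd_of_dvd_mul_left ⟨n, h⟩
  obtain ⟨a, rfl⟩ := hd
  refine ⟨a, rfl, ?_⟩
  have hq' : (q : ℤ) ≠ 0 := by exact_mod_cast hq.ne'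
  exact mul_left_cancel₀ hq' (by rw [← h]; ring)

/-- For `θ = p/q` the displacement of the first graph vanishes exactly on a sublattice of
modes of rank four. -/
lemma dispC_eq_zero_iff_rational (hq : 0 < q) (hpq : Nat.Coprime p q) {k : LatIdx × LatIdx} :
    dispC ((p : ℝ) / q) k = 0 ↔ ∃ h : LatIdx, ((q : ℤ) • h, (p : ℤ) • rotIdx h) = k := by
  have hq' : (q : ℝ) ≠ 0 := by exact_mod_cast hq.ne'
  constructor
  · rw [dispC_eq_zero_iff_components]
    intro h
    have h1 (j) : ∃ a : ℤ, k.1.1 j = q * a ∧ k.2.2 j = p * a := by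
      refine exists_of_mul_eq hq hpq ?_
      have := (h j).1
      field_simp at this
      have h3 : (p : ℝ) * k.1.1 j = q * k.2.2 j := by linarith
      exact_mod_cast h3
    have h2 (j) : ∃ b : ℤ, k.1.2 j = q * b ∧ -k.2.1 j = p * b := by
      refine exists_of_mul_eq hq hpq ?_
      have := (h j).2
      field_simp at this
      have h3 : (p : ℝ) * k.1.2 j = q * -k.2.1 j := by linarith
      exact_mod_cast h3
    choose a ha ha' using h1
    choose b hb hb' using h2
    refine ⟨(a, b), ?_⟩
    refine Prod.ext (Prod.ext ?_ ?_) (Prod.ext ?_ ?_) <;> funext j <;>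
      simp [rotIdx, ha, ha', hb, ← hb']
  · rintro ⟨h, rfl⟩
    rw [dispC, latPt_rational hq, I_smul_dualPt_rotIdx]
    simp

lemma dispD_eq_zero_iff_rational (hq : 0 < q) (hpq : Nat.Coprime p q) {k : LatIdx × LatIdx} :
    dispD ((p : ℝ) / q) k = 0 ↔ ∃ h : LatIdx, ((q : ℤ) • h, -((p : ℤ) • rotIdx h)) = k := by
  rw [dispD_eq, neg_eq_zero, dispC_eq_zero_iff_rational hq hpq]
  refine exists_congr fun h => ?_
  simp only [Prod.ext_iff (x := (_, _)) (y := k), Prod.ext_iff (y := (k.1, -k.2)),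
    neg_eq_iff_eq_neg]

lemma smul_idx_injective (hq : 0 < q) : Function.Injective fun h : LatIdx => (q : ℤ) • h := by
  have hq' : q ≠ 0 := hq.ne'
  intro h h' e
  have e1 := congrArg Prod.fst e
  have e2 := congrArg Prod.snd e
  refine Prod.ext (funext fun j => ?_) (funext fun j => ?_)
  · simpa [hq'] using congrFun e1 j
  · simpa [hq'] using congrFun e2 j

variable {θ : ℝ}

/-- The sum of the residues of all resonant modes of either graph, for `θ = p/q`. -/
noncomputable def resonanceSum (θ : ℝ) (p : ℕ) (φ : Fin 4 → C2 → ℂ) : ℂ :=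
  ∑' h : LatIdx, matCoef θ (φ 0) (φ 1) (latPt p h) * matCoef θ (φ 2) (φ 3) (-latPt p h)

open scoped Classical in
lemma tsum_resonantC (hq : 0 < q) (hpq : Nat.Coprime p q) (hθ : θ = (p : ℝ) / q)
    (φ : Fin 4 → C2 → ℂ) : (∑' k, if dispC θ k = 0 then modeProfileC θ φ k 0 else 0) =
      resonanceSum θ p φ := by
  have hinj : Function.Injective
      fun h : LatIdx => (((q : ℤ) • h, (p : ℤ) • rotIdx h) : LatIdx × LatIdx) :=
    fun h h' e => smul_idx_injective hq (congrArg Prod.fst e)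
  rw [← hinj.tsum_eq]
  · refine tsum_congr fun h => ?_
    rw [if_pos (by rw [hθ]; exact (dispC_eq_zero_iff_rational hq hpq).2 ⟨h, rfl⟩), modeProfileC,
      profileC, I_smul_dualPt_rotIdx]
    have : latPt θ ((q : ℤ) • h) = latPt p h := by rw [hθ, latPt_rational hq]
    rw [this, sform_zero_left, sform_neg_right, sform_self]
    simp
  · intro k hk
    rw [Function.mem_support] at hk
    rw [hθ] at hk
    exact (dispC_eq_zero_iff_rational hq hpq).1 (by_contra fun h => hk (if_neg h))

open scoped Classical in
lemma tsum_resonantD (hq : 0 < q) (hpq : Nat.Coprime p q) (hθ : θ = (p : ℝ) / q)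
    (φ : Fin 4 → C2 → ℂ) : (∑' k, if dispD θ k = 0 then modeProfileD θ φ k 0 else 0) =
      resonanceSum θ p φ := by
  have hinj : Function.Injective
      fun h : LatIdx => (((q : ℤ) • h, -((p : ℤ) • rotIdx h)) : LatIdx × LatIdx) :=
    fun h h' e => smul_idx_injective hq (congrArg Prod.fst e)
  rw [← hinj.tsum_eq]
  · refine tsum_congr fun h => ?_
    rw [if_pos (by rw [hθ]; exact (dispD_eq_zero_iff_rational hq hpq).2 ⟨h, rfl⟩), modeProfileD,
      profileD, dualPt_neg, smul_neg, I_smul_dualPt_rotIdx, neg_neg]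
    have : latPt θ ((q : ℤ) • h) = latPt p h := by rw [hθ, latPt_rational hq]
    rw [this, sform_self]
    simp
  · intro k hk
    rw [Function.mem_support] at hk
    rw [hθ] at hk
    exact (dispD_eq_zero_iff_rational hq hpq).1 (by_contra fun h => hk (if_neg h))

/-- For rational `θ` the divergence is the sum over the lattice of resonant modes. -/
theorem hasLogDivergence_nonPlanar_resonanceSum (hp : 0 < p) (hq : 0 < q) (hpq : Nat.Coprime p q)
    (hθ : θ = (p : ℝ) / q) (lam μ₀ : ℝ) {φ : Fin 4 → C2 → ℂ} (hφ : ∀ i, φ i ∈ smoothModule θ) :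
    HasLogDivergence (fun ε => nonPlanar θ lam μ₀ ε φ)
      (-((3 * lam ^ 2 / (8 * freq θ ^ 2 * θ ^ 2) : ℝ) : ℂ) * resonanceSum θ p φ) := by
  have hθ0 : 0 < θ := by rw [hθ]; positivity
  have hL : LogBound θ := by rw [hθ]; exact logBound_rational hq
  have h1 := hasLogDivergence_graphC hθ0 hL lam μ₀ hφ
  have h2 := hasLogDivergence_graphD hθ0 hL lam μ₀ hφ
  rw [tsum_resonantC hq hpq hθ] at h1
  rw [tsum_resonantD hq hpq hθ] at h2
  have h3 := h1.add h2
  rwa [divergence_coeff hθ0] at h3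

end Rational

/-! ### Overlap integrals of Schwartz functions -/

lemma exists_norm_schwartz_le (f : 𝓢(R2, ℂ)) (N : ℕ) :
    ∃ C : ℝ, 0 ≤ C ∧ ∀ x : Fin 2 → ℝ, ‖f (WithLp.toLp 2 x)‖ ≤ C * (br x ^ N)⁻¹ := by
  refine ⟨2 ^ N * (Finset.Iic (N, 0)).sup (fun m => SchwartzMap.seminorm ℝ m.1 m.2) f,
    by positivity, fun x => ?_⟩
  have h := SchwartzMap.one_add_le_sup_seminorm_apply (𝕜 := ℝ) (m := (N, 0)) le_rfl le_rfl f
    (WithLp.toLp 2 x)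
  rw [norm_iteratedFDeriv_zero] at h
  rw [← div_eq_mul_inv, le_div_iff₀' (pow_pos (br_pos x) N)]
  refine le_trans (mul_le_mul_of_nonneg_right ?_ (norm_nonneg _)) h
  refine pow_le_pow_left₀ (br_pos x).le (add_le_add_right ?_ 1) N
  exact (pi_norm_le_iff_of_nonneg (norm_nonneg _)).2 fun j =>
    PiLp.norm_apply_le (WithLp.toLp 2 x) j

/-- The pointwise overlap `conj(f(y)) g(y + t)` of `f` with a translate of `g`. -/
noncomputable def overlap (f g : 𝓢(R2, ℂ)) (t y : Fin 2 → ℝ) : ℂ :=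
  (starRingEnd ℂ) (f (WithLp.toLp 2 y)) * g (WithLp.toLp 2 (y + t))

lemma continuous_overlap (f g : 𝓢(R2, ℂ)) (t : Fin 2 → ℝ) : Continuous (overlap f g t) := by
  have hf := f.continuous
  have hg := g.continuous
  unfold overlap
  fun_prop

lemma exists_norm_overlap_le (f g : 𝓢(R2, ℂ)) (N : ℕ) :
    ∃ C : ℝ, 0 ≤ C ∧ ∀ t y, ‖overlap f g t y‖ ≤ C * ((br y ^ N)⁻¹ * (br t ^ N)⁻¹) := by
  obtain ⟨A, hA0, hA⟩ := exists_norm_schwartz_le f (N + N)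
  obtain ⟨B, hB0, hB⟩ := exists_norm_schwartz_le g N
  refine ⟨A * B, mul_nonneg hA0 hB0, fun t y => ?_⟩
  rw [overlap, norm_mul, RCLike.norm_conj]
  refine (mul_le_mul (hA y) (hB (y + t)) (norm_nonneg _)
    (mul_nonneg hA0 (inv_br_pow_nonneg _ _))).trans ?_
  have h := inv_br_pow_mul_le (-y) (y + t) N
  rw [neg_add_cancel_left, br_neg] at h
  have h0 := inv_br_pow_nonneg y N
  calc A * (br y ^ (N + N))⁻¹ * (B * (br (y + t) ^ N)⁻¹)
      = A * B * ((br y ^ N)⁻¹ * ((br y ^ N)⁻¹ * (br (y + t) ^ N)⁻¹)) := by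
        rw [pow_add, mul_inv]; ring
    _ ≤ _ := by gcongr

/-- The Fourier coefficient `∫ conj(f(y)) g(y + pk) exp(2πi q b·y) dy`, where `h = (k, b)`. -/
noncomputable def overlapCoef (p q : ℕ) (f g : 𝓢(R2, ℂ)) (h : LatIdx) : ℂ :=
  ∫ y, overlap f g ((p : ℝ) • intVec h.1) y * expChar h.2 ((q : ℝ) • y)

section Rational

variable {p q : ℕ} {θ : ℝ}

lemma latPt_eq_complexify (p : ℕ) (h : LatIdx) : latPt p h =
    complexify ((p / Real.sqrt 2) • intVec h.1, ((p : ℝ) / Real.sqrt 2) • intVec h.2) := by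
  funext j
  rw [complexify_apply]
  simp only [latPt, Pi.smul_apply, intVec, smul_eq_mul]
  push_cast
  ring

lemma matCoef_latPt_rational (hp : 0 < p) (hq : 0 < q) (hθ : θ = (p : ℝ) / q) (f g : 𝓢(R2, ℂ))
    (h : LatIdx) : matCoef θ (bargmann θ f) (bargmann θ g) (latPt p h) =
      phase (Real.pi * ((p * q * ∑ j, h.1 j * h.2 j : ℤ) : ℝ)) * overlapCoef p q f g h := by
  have hp' : (p : ℝ) ≠ 0 := by exact_mod_cast hp.ne'
  have hq' : (q : ℝ) ≠ 0 := by exact_mod_cast hq.ne'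
  have hθ0 : 0 < θ := by rw [hθ]; positivity
  have hs : Real.sqrt 2 ≠ 0 := by positivity
  have h2 : Real.sqrt 2 ^ 2 = 2 := Real.sq_sqrt (by norm_num)
  have hω : freq θ = 2 * Real.pi * q / p := by rw [freq, hθ]; field_simp
  rw [latPt_eq_complexify, matCoef_bargmann hθ0, overlapCoef]
  refine congrArg₂ _ (congrArg phase ?_) ?_
  · rw [hω]
    simp only [Fin.sum_univ_two, Pi.smul_apply, smul_eq_mul, intVec]
    push_cast
    field_simp
    rw [h2]
  · have hE := (EuclideanSpace.volume_preserving_symm_measurableEquiv_toLp (Fin 2)).symm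
    rw [← hE.integral_comp (MeasurableEquiv.measurableEmbedding _)]
    congr 1
    funext y
    have e1 : ((MeasurableEquiv.toLp 2 (Fin 2 → ℝ)).symm.symm y) = WithLp.toLp 2 y := rfl
    have e2 : WithLp.toLp 2 y + WithLp.toLp 2
        (fun j => Real.sqrt 2 * (((p : ℝ) / Real.sqrt 2) • intVec h.1) j) =
        WithLp.toLp 2 (y + (p : ℝ) • intVec h.1) := by
      ext j
      simp only [PiLp.add_apply, Pi.add_apply, Pi.smul_apply, smul_eq_mul]
      field_simp
    rw [e1, e2, overlap, ← mul_assoc]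
    congr 1
    rw [phase, expChar, hω]
    congr 1
    simp only [Fin.sum_univ_two, Pi.smul_apply, smul_eq_mul, intVec]
    have hpC : (p : ℂ) ≠ 0 := by exact_mod_cast hp'
    have hsC : ((Real.sqrt 2 : ℝ) : ℂ) ≠ 0 := by exact_mod_cast hs
    push_cast
    field_simp

lemma phase_mul_phase_pi_int (n : ℤ) : phase (Real.pi * n) * phase (Real.pi * n) = 1 := by
  rw [← phase_add, phase]
  have : ((Real.pi * n + Real.pi * n : ℝ) : ℂ) * Complex.I =
      (n : ℂ) * (2 * Real.pi * Complex.I) := by push_cast; ring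
  rw [this, Complex.exp_int_mul_two_pi_mul_I]

/-- The resonant residues are products of overlap coefficients; the phases cancel. -/
lemma resonanceSum_eq (hp : 0 < p) (hq : 0 < q) (hθ : θ = (p : ℝ) / q) (f : Fin 4 → 𝓢(R2, ℂ)) :
    resonanceSum θ p (fun i => bargmann θ (f i)) =
      ∑' h : LatIdx, overlapCoef p q (f 0) (f 1) h * overlapCoef p q (f 2) (f 3) (-h) := by
  refine tsum_congr fun h => ?_
  have h1 : -latPt p h = latPt p (-h) := by
    funext j; simp only [latPt, Pi.neg_apply, Prod.fst_neg, Prod.snd_neg]; push_cast; ring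
  rw [h1, matCoef_latPt_rational hp hq hθ, matCoef_latPt_rational hp hq hθ]
  have h2 : ∑ j, (-h).1 j * (-h).2 j = ∑ j, h.1 j * h.2 j := by simp
  rw [h2]
  linear_combination overlapCoef p q (f 0) (f 1) h * overlapCoef p q (f 2) (f 3) (-h) *
    phase_mul_phase_pi_int (p * q * ∑ j, h.1 j * h.2 j)

lemma exists_norm_overlapCoef_le (hp : 0 < p) (hq : 0 < q) (f g : 𝓢(R2, ℂ)) (N : ℕ) :
    ∃ C : ℝ, 0 ≤ C ∧ ∀ h, ‖overlapCoef p q f g h‖ ≤ C * (br h ^ N)⁻¹ := by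
  have hp' : (0 : ℝ) < p := by exact_mod_cast hp
  have hθ0 : 0 < (p : ℝ) / q := by positivity
  obtain ⟨C, hC0, hC⟩ := exists_norm_matCoef_le hθ0 (φ := bargmann ((p : ℝ) / q) f)
    (χ := bargmann ((p : ℝ) / q) g) ⟨f, rfl⟩ ⟨g, rfl⟩ N
  obtain ⟨A, hA0, hA⟩ := exists_inv_br_latPt_le hp'
  refine ⟨C * A ^ N, by positivity, fun h => ?_⟩
  have h1 := matCoef_latPt_rational hp hq rfl f g h
  have h2 := hC (latPt p h)
  rw [h1, norm_mul, norm_phase, one_mul] at h2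
  refine h2.trans ?_
  rw [mul_assoc]
  exact mul_le_mul_of_nonneg_left (hA h N) hC0.le

lemma summable_norm_overlapCoef (hp : 0 < p) (hq : 0 < q) (f g : 𝓢(R2, ℂ)) :
    Summable fun h => ‖overlapCoef p q f g h‖ := by
  obtain ⟨C, hC0, hC⟩ := exists_norm_overlapCoef_le hp hq f g 6
  exact Summable.of_nonneg_of_le (fun _ => norm_nonneg _) hC
    ((summable_inv_br_pow_latIdx le_rfl).mul_left C)

lemma inv_br_pow_smul_le {E : Type*} [NormedAddCommGroup E] [NormedSpace ℝ E] {r : ℝ}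
    (hr : 1 ≤ r) (x : E) (N : ℕ) : (br (r • x) ^ N)⁻¹ ≤ (br x ^ N)⁻¹ := by
  refine inv_anti₀ (pow_pos (br_pos x) N) (pow_le_pow_left₀ (br_pos x).le ?_ N)
  simp only [br, norm_smul, Real.norm_of_nonneg (zero_le_one.trans hr)]
  have := norm_nonneg x
  nlinarith

lemma inv_br_pow_inv_smul_le {E : Type*} [NormedAddCommGroup E] [NormedSpace ℝ E] {r : ℝ}
    (hr : 1 ≤ r) (x : E) (N : ℕ) : (br (r⁻¹ • x) ^ N)⁻¹ ≤ r ^ N * (br x ^ N)⁻¹ := by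
  have hr0 : 0 < r := zero_lt_one.trans_le hr
  have h : br x ≤ r * br (r⁻¹ • x) := by
    simp only [br, norm_smul, norm_inv, Real.norm_of_nonneg hr0.le]
    rw [mul_add, mul_inv_cancel_left₀ hr0.ne']
    linarith
  rw [← div_eq_mul_inv, le_div_iff₀ (pow_pos (br_pos x) N), inv_mul_le_iff₀ (pow_pos (br_pos _) N),
    ← mul_pow, mul_comm (br _)]
  exact pow_le_pow_left₀ (br_pos x).le h N

/-- Poisson summation of the overlaps over the points `x + s/q`. -/
lemma hasSum_overlapCoef (hp : 0 < p) (hq : 0 < q) (f g : 𝓢(R2, ℂ)) (k : Fin 2 → ℤ)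
    (x : Fin 2 → ℝ) :
    HasSum (fun m => (q : ℂ) ^ 2 * overlapCoef p q f g (k, -m) * expChar m ((q : ℝ) • x))
      (∑' s : Fin 2 → ℤ, overlap f g ((p : ℝ) • intVec k) (x + (q : ℝ)⁻¹ • intVec s)) := by
  have hq1 : (1 : ℝ) ≤ q := by exact_mod_cast hq
  have hq0 : (q : ℝ) ≠ 0 := by positivity
  set F : (Fin 2 → ℝ) → ℂ := fun t => overlap f g ((p : ℝ) • intVec k) ((q : ℝ)⁻¹ • t) with hF
  obtain ⟨C, hC0, hC⟩ := exists_norm_overlap_le f g 3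
  have hFc : Continuous F := by
    have := continuous_overlap f g ((p : ℝ) • intVec k)
    fun_prop
  have hFb (t) : ‖F t‖ ≤ C * (q : ℝ) ^ 3 * (br t ^ 3)⁻¹ := by
    refine (hC _ _).trans ?_
    rw [mul_assoc]
    refine mul_le_mul_of_nonneg_left ?_ hC0
    exact (mul_le_of_le_one_right (inv_br_pow_nonneg _ _) (inv_br_pow_le_one _ _)).trans
      (inv_br_pow_inv_smul_le hq1 t 3)
  have hcoef (m) : fourierInt F m = (q : ℂ) ^ 2 * overlapCoef p q f g (k, -m) := by
    have h := Measure.integral_comp_inv_smul (volume : Measure (Fin 2 → ℝ))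
      (fun y => overlap f g ((p : ℝ) • intVec k) y * expChar (-m) ((q : ℝ) • y)) (q : ℝ)
    rw [Module.finrank_fin_fun, abs_of_pos (by positivity), Complex.real_smul] at h
    simp only [smul_inv_smul₀ hq0] at h
    rw [fourierInt, h, overlapCoef]
    push_cast
    rfl
  have hs : Summable (fourierInt F) := by
    have h1 : Function.Injective fun m : Fin 2 → ℤ => ((k, -m) : LatIdx) :=
      fun m m' e => neg_injective (congrArg Prod.snd e)
    have h2 := ((summable_norm_overlapCoef hp hq f g).comp_injective h1).of_norm.mul_left
      ((q : ℂ) ^ 2)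
    exact h2.congr fun m => (hcoef m).symm
  have := hasSum_fourierInt hFc hFb (summable_inv_br_pow_int2 le_rfl)
    (integrable_inv_br_pow volume (by simp)) hs ((q : ℝ) • x)
  simp only [hcoef] at this
  convert this using 3 with s
  simp only [hF, smul_add, inv_smul_smul₀ hq0]

end Rational

/-! ### Traces of products of the matrix fields -/

/-- The label `iq + jp + npq` of a translate in the definition of the matrix field. -/
def crtLabel (p q : ℕ) (s : ((Fin 2 → Fin p) × (Fin 2 → Fin q)) × (Fin 2 → ℤ)) : Fin 2 → ℤ :=
  fun l => (s.1.1 l : ℕ) * q + (s.1.2 l : ℕ) * p + s.2 l * (p * q)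

section Crt

variable {p q : ℕ}

/-- The Chinese remainder theorem in one dimension: `(i, j, n) ↦ iq + jp + npq` is injective. -/
lemma crt_injective (hp : 0 < p) (hq : 0 < q) (hpq : Nat.Coprime p q) {i i' : Fin p}
    {j j' : Fin q} {n n' : ℤ} (h : (i : ℕ) * (q : ℤ) + (j : ℕ) * p + n * (p * q) =
      (i' : ℕ) * (q : ℤ) + (j' : ℕ) * p + n' * (p * q)) : i = i' ∧ j = j' ∧ n = n' := by
  have hc := Nat.isCoprime_iff_coprime.2 hpq
  have small {m : ℕ} (a b : Fin m) (hd : (m : ℤ) ∣ ((a : ℕ) : ℤ) - (b : ℕ)) : a = b := by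
    have ha := a.2
    have hb := b.2
    have := Int.eq_zero_of_abs_lt_dvd hd (by rw [abs_lt]; omega)
    exact Fin.ext (by omega)
  have hi : i = i' := by
    refine small i i' (hc.dvd_of_dvd_mul_right (z := (q : ℤ)) ?_)
    exact ⟨(j' : ℕ) - (j : ℕ) + (n' - n) * q, by linear_combination h⟩
  have hj : j = j' := by
    refine small j j' (hc.symm.dvd_of_dvd_mul_right (z := (p : ℤ)) ?_)
    exact ⟨(i' : ℕ) - (i : ℕ) + (n' - n) * p, by linear_combination h⟩
  subst hi hj
  refine ⟨rfl, rfl, ?_⟩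
  have h0 : (p * q : ℤ) ≠ 0 := by positivity
  exact mul_right_cancel₀ h0 (by linarith)

lemma crt_surjective (hp : 0 < p) (hq : 0 < q) (hpq : Nat.Coprime p q) (s : ℤ) :
    ∃ (i : Fin p) (j : Fin q) (n : ℤ), (i : ℕ) * (q : ℤ) + (j : ℕ) * p + n * (p * q) = s := by
  obtain ⟨u, v, huv⟩ := Nat.isCoprime_iff_coprime.2 hpq
  have hp' : (p : ℤ) ≠ 0 := by positivity
  have hq' : (q : ℤ) ≠ 0 := by positivity
  have hi := Int.emod_nonneg (s * v) hp'
  have hi' := Int.emod_lt_of_pos (s * v) (by positivity : (0 : ℤ) < p)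
  have hj := Int.emod_nonneg (s * u) hq'
  have hj' := Int.emod_lt_of_pos (s * u) (by positivity : (0 : ℤ) < q)
  refine ⟨⟨(s * v % p).toNat, by omega⟩, ⟨(s * u % q).toNat, by omega⟩, s * v / p + s * u / q, ?_⟩
  simp only [Int.toNat_of_nonneg hi, Int.toNat_of_nonneg hj]
  linear_combination (q : ℤ) * Int.emod_add_mul_ediv (s * v) p +
    (p : ℤ) * Int.emod_add_mul_ediv (s * u) q + s * huv

lemma crtLabel_bijective (hp : 0 < p) (hq : 0 < q) (hpq : Nat.Coprime p q) :
    Function.Bijective (crtLabel p q) := by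
  constructor
  · rintro ⟨⟨i, j⟩, n⟩ ⟨⟨i', j'⟩, n'⟩ h
    have h1 (l) := crt_injective hp hq hpq (congrFun h l)
    exact Prod.ext (Prod.ext (funext fun l => (h1 l).1) (funext fun l => (h1 l).2.1))
      (funext fun l => (h1 l).2.2)
  · intro s
    choose i j n h using fun l => crt_surjective hp hq hpq (s l)
    exact ⟨((i, j), n), funext h⟩

/-- The summand of the trace of a product of two matrix fields, in terms of the position `x + s/q`
of the first factor and the offset `pk` of the second. -/
noncomputable def traceTerm (p q : ℕ) (f g : 𝓢(R2, ℂ)) (x y : Fin 2 → ℝ)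
    (w : (Fin 2 → ℤ) × (Fin 2 → ℤ)) : ℂ :=
  overlap f g ((p : ℝ) • intVec w.2) (x + (q : ℝ)⁻¹ • intVec w.1) * expChar (-w.2) ((q : ℝ) • y)

lemma summable_traceTerm (hp : 0 < p) (hq : 0 < q) (f g : 𝓢(R2, ℂ)) (x y : Fin 2 → ℝ) :
    Summable (traceTerm p q f g x y) := by
  obtain ⟨C, hC0, hC⟩ := exists_norm_overlap_le f g 3
  have hq1 : (1 : ℝ) ≤ q := by exact_mod_cast hq
  have hp1 : (1 : ℝ) ≤ p := by exact_mod_cast hp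
  have h3 := summable_inv_br_pow_int2 (le_refl 3)
  refine Summable.of_norm_bounded ((h3.mul_of_nonneg h3 (fun n => inv_br_pow_nonneg n 3)
    fun n => inv_br_pow_nonneg n 3).mul_left (C * (br x ^ 3 * q ^ 3))) fun w => ?_
  rw [traceTerm, norm_mul, norm_expChar, mul_one]
  refine (hC _ _).trans ?_
  have h1 : (br (x + (q : ℝ)⁻¹ • intVec w.1) ^ 3)⁻¹ ≤ br x ^ 3 * (q ^ 3 * (br w.1 ^ 3)⁻¹) := by
    refine (inv_br_pow_add_le x _ 3).trans ?_
    have := inv_br_pow_inv_smul_le hq1 (intVec w.1) 3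
    rw [br_intVec] at this
    exact mul_le_mul_of_nonneg_left this (pow_pos (br_pos x) 3).le
  have h2 : (br ((p : ℝ) • intVec w.2) ^ 3)⁻¹ ≤ (br w.2 ^ 3)⁻¹ := by
    have := inv_br_pow_smul_le hp1 (intVec w.2) 3
    rwa [br_intVec] at this
  calc C * ((br (x + (q : ℝ)⁻¹ • intVec w.1) ^ 3)⁻¹ * (br ((p : ℝ) • intVec w.2) ^ 3)⁻¹)
      ≤ C * (br x ^ 3 * (q ^ 3 * (br w.1 ^ 3)⁻¹) * (br w.2 ^ 3)⁻¹) := by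
        have := inv_br_pow_nonneg ((p : ℝ) • intVec w.2) 3
        have := br_pos x
        have := inv_br_pow_nonneg w.1 3
        gcongr
    _ = _ := by ring

lemma expChar_neg_conj (m : Fin 2 → ℤ) (x : Fin 2 → ℝ) :
    (starRingEnd ℂ) (expChar m x) = expChar (-m) x := by
  simp only [expChar, ← Complex.exp_conj]
  congr 1
  have h2 : (starRingEnd ℂ) 2 = 2 := Complex.conj_ofReal 2
  simp only [Fin.sum_univ_two, Pi.neg_apply, map_mul, map_add, h2, Complex.conj_ofReal,
    Complex.conj_I, map_intCast]
  push_cast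
  ring

lemma matrixField_eq (hq : 0 < q) (f : 𝓢(R2, ℂ)) (x y : Fin 2 → ℝ) (i : Fin 2 → Fin p)
    (j : Fin 2 → Fin q) : matrixField p q f x y i j =
      ∑' n, f (WithLp.toLp 2 (x + (q : ℝ)⁻¹ • intVec (crtLabel p q ((i, j), n)))) *
        expChar (-n) ((q : ℝ) • y) := by
  refine tsum_congr fun n => ?_
  congr 1
  · congr 2
    funext l
    simp only [Pi.add_apply, Pi.smul_apply, smul_eq_mul, intVec, crtLabel]
    push_cast
    field_simp
  · rw [expChar]
    congr 1
    simp only [Fin.sum_univ_two, Pi.neg_apply, Pi.smul_apply, smul_eq_mul]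
    push_cast
    ring

/-- The trace of `M₁†M₂` as a sum over all translates. -/
lemma trace_matrixField_eq_tsum (hp : 0 < p) (hq : 0 < q) (hpq : Nat.Coprime p q)
    (f g : 𝓢(R2, ℂ)) (x y : Fin 2 → ℝ) :
    ((matrixField p q f x y)ᴴ * matrixField p q g x y).trace =
      ∑' w, traceTerm p q f g x y w := by
  have hq0 : (q : ℝ) ≠ 0 := by positivity
  have hsum := summable_traceTerm hp hq f g x y
  let e : ((Fin 2 → Fin p) × (Fin 2 → Fin q)) × (Fin 2 → ℤ) ≃ (Fin 2 → ℤ) :=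
    Equiv.ofBijective _ (crtLabel_bijective hp hq hpq)
  let E : ((Fin 2 → Fin p) × (Fin 2 → Fin q)) × ((Fin 2 → ℤ) × (Fin 2 → ℤ)) ≃
      (Fin 2 → ℤ) × (Fin 2 → ℤ) :=
    (Equiv.prodAssoc _ _ _).symm.trans (e.prodCongr (Equiv.refl _))
  have hE : Summable fun w => traceTerm p q f g x y (E w) := E.summable_iff.2 hsum
  rw [← E.tsum_eq, hE.tsum_prod, tsum_fintype, Matrix.trace]
  simp only [Matrix.diag_apply, Matrix.mul_apply, Matrix.conjTranspose_apply]
  rw [Finset.sum_comm, ← Finset.sum_product', Finset.univ_product_univ]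
  refine Finset.sum_congr rfl fun ij _ => ?_
  obtain ⟨i, j⟩ := ij
  set u : (Fin 2 → ℤ) → Fin 2 → ℝ :=
    fun n => x + (q : ℝ)⁻¹ • intVec (crtLabel p q ((i, j), n)) with hu
  have hshift (n k : Fin 2 → ℤ) : u (n + k) = u n + (p : ℝ) • intVec k := by
    funext l
    simp only [hu, Pi.add_apply, Pi.smul_apply, smul_eq_mul, intVec, crtLabel]
    push_cast
    field_simp
    ring
  have hterm (f : 𝓢(R2, ℂ)) :
      Summable fun n => ‖f (WithLp.toLp 2 (u n)) * expChar (-n) ((q : ℝ) • y)‖ := by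
    obtain ⟨C, hC0, hC⟩ := exists_norm_schwartz_le f 3
    have hp1 : (1 : ℝ) ≤ p := by exact_mod_cast hp
    refine Summable.of_nonneg_of_le (fun _ => norm_nonneg _) (fun n => ?_)
      (((summable_inv_br_pow_int2 (le_refl 3)).mul_left (br (u 0) ^ 3)).mul_left C)
    rw [norm_mul, norm_expChar, mul_one]
    refine (hC _).trans (mul_le_mul_of_nonneg_left ?_ hC0)
    have h0 := hshift 0 n
    rw [zero_add] at h0
    rw [h0]
    refine (inv_br_pow_add_le _ _ 3).trans ?_
    have := inv_br_pow_smul_le hp1 (intVec n) 3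
    rw [br_intVec] at this
    exact mul_le_mul_of_nonneg_left this (pow_pos (br_pos _) 3).le
  -- the offset `k = n' - n` replaces the summation variable of the second factor
  let T : (Fin 2 → ℤ) × (Fin 2 → ℤ) ≃ (Fin 2 → ℤ) × (Fin 2 → ℤ) :=
    { toFun := fun w => (w.1, w.1 + w.2)
      invFun := fun w => (w.1, w.2 - w.1)
      left_inv := fun w => by simp
      right_inv := fun w => by simp }
  have hf' : Summable fun n =>
      ‖(starRingEnd ℂ) (f (WithLp.toLp 2 (u n)) * expChar (-n) ((q : ℝ) • y))‖ := by
    simpa only [RCLike.norm_conj] using hterm f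
  rw [matrixField_eq hq, matrixField_eq hq, ← starRingEnd_apply, Complex.conj_tsum,
    tsum_mul_tsum_of_summable_norm hf' (hterm g), ← T.tsum_eq]
  refine tsum_congr fun w => ?_
  have h1 : T w = (w.1, w.1 + w.2) := rfl
  have h2 : E ((i, j), w) = (crtLabel p q ((i, j), w.1), w.2) := rfl
  rw [h1, h2, traceTerm, overlap]
  change (starRingEnd ℂ) (f (WithLp.toLp 2 (u w.1)) * _) * (g (WithLp.toLp 2 (u (w.1 + w.2))) * _) =
    (starRingEnd ℂ) (f (WithLp.toLp 2 (u w.1))) * g (WithLp.toLp 2 (u w.1 + _)) * _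
  rw [hshift, map_mul, expChar_neg_conj, neg_neg, neg_add, expChar_add]
  have h3 : expChar w.1 ((q : ℝ) • y) * expChar (-w.1) ((q : ℝ) • y) = 1 := by
    rw [← expChar_add, add_neg_cancel]; simp [expChar]
  linear_combination ((starRingEnd ℂ) (f (WithLp.toLp 2 (u w.1))) *
    g (WithLp.toLp 2 (u w.1 + (p : ℝ) • intVec w.2)) * expChar (-w.2) ((q : ℝ) • y)) * h3

/-- The Fourier expansion of the trace of a product of two matrix fields. -/
lemma trace_matrixField_eq (hp : 0 < p) (hq : 0 < q) (hpq : Nat.Coprime p q)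
    (f g : 𝓢(R2, ℂ)) (x y : Fin 2 → ℝ) :
    ((matrixField p q f x y)ᴴ * matrixField p q g x y).trace =
      ∑' h : LatIdx, (q : ℂ) ^ 2 * overlapCoef p q f g h *
        (expChar (-h.2) ((q : ℝ) • x) * expChar (-h.1) ((q : ℝ) • y)) := by
  rw [trace_matrixField_eq_tsum hp hq hpq]
  have hsum := summable_traceTerm hp hq f g x y
  have hs : Summable fun h : LatIdx => (q : ℂ) ^ 2 * overlapCoef p q f g h *
      (expChar (-h.2) ((q : ℝ) • x) * expChar (-h.1) ((q : ℝ) • y)) := by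
    refine Summable.of_norm_bounded ((summable_norm_overlapCoef hp hq f g).mul_left ((q : ℝ) ^ 2))
      fun h => ?_
    simp [norm_expChar]
  rw [hs.tsum_prod, ← (Equiv.prodComm _ _).tsum_eq]
  have hsum' : Summable fun w => traceTerm p q f g x y
      (Equiv.prodComm (Fin 2 → ℤ) (Fin 2 → ℤ) w) := (Equiv.prodComm _ _).summable_iff.2 hsum
  rw [Summable.tsum_prod hsum']
  refine tsum_congr fun k => ?_
  have h1 := (hasSum_overlapCoef hp hq f g k x).tsum_eq
  rw [← (Equiv.neg _).tsum_eq] at h1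
  change ∑' s, overlap f g ((p : ℝ) • intVec k) (x + (q : ℝ)⁻¹ • intVec s) *
    expChar (-k) ((q : ℝ) • y) = _
  rw [tsum_mul_right, ← h1, ← tsum_mul_right]
  refine tsum_congr fun m => ?_
  simp only [Equiv.neg_apply, neg_neg]
  ring

end Crt

/-! ### The double trace as a sum over resonant modes -/

/-- Termwise integration of an absolutely convergent series of unimodular functions. -/
lemma integral_tsum_unimodular {ι α : Type*} [Countable ι] [MeasurableSpace α] {μ : Measure α}
    [IsFiniteMeasure μ] {c : ι → ℂ} (hc : Summable fun i => ‖c i‖) {u : ι → α → ℂ}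
    (hu : ∀ i, AEStronglyMeasurable (u i) μ) (h1 : ∀ i x, ‖u i x‖ = 1) :
    ∫ x, ∑' i, c i * u i x ∂μ = ∑' i, c i * ∫ x, u i x ∂μ := by
  have hint (i) : Integrable (fun x => c i * u i x) μ :=
    (Integrable.of_bound (hu i) 1 (Eventually.of_forall fun x => (h1 i x).le)).const_mul _
  have hn : Summable fun i => ∫ x, ‖c i * u i x‖ ∂μ := by
    simp only [norm_mul, h1, mul_one, integral_const, smul_eq_mul]
    exact hc.mul_left _
  rw [← integral_tsum_of_summable_integral_norm hint hn]
  refine tsum_congr fun i => ?_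
  rw [integral_const_mul]

lemma integral_Icc_exp_int_mul {r : ℝ} (hr : 0 < r) (m : ℤ) :
    ∫ t in Set.Icc (0 : ℝ) (1 / r), Complex.exp (2 * Real.pi * Complex.I * (m * (r * t : ℝ))) =
      if m = 0 then ((r⁻¹ : ℝ) : ℂ) else 0 := by
  rw [integral_Icc_eq_integral_Ioc, ← intervalIntegral.integral_of_le (by positivity)]
  split_ifs with h
  · subst h
    simp
  · have hrC : (r : ℂ) ≠ 0 := Complex.ofReal_ne_zero.2 hr.ne'
    have hm : (m : ℂ) ≠ 0 := Int.cast_ne_zero.2 h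
    have hc : 2 * Real.pi * Complex.I * (m * r : ℂ) ≠ 0 :=
      mul_ne_zero Complex.two_pi_I_ne_zero (mul_ne_zero hm hrC)
    have h1 (t : ℝ) : Complex.exp (2 * Real.pi * Complex.I * (m * (r * t : ℝ))) =
        Complex.exp (2 * Real.pi * Complex.I * (m * r : ℂ) * t) := by
      congr 1; push_cast; ring
    simp only [h1]
    rw [integral_exp_mul_complex hc]
    have h2 : 2 * Real.pi * Complex.I * (m * r : ℂ) * ((1 / r : ℝ) : ℂ) =
        m * (2 * Real.pi * Complex.I) := by
      push_cast; field_simp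
    rw [h2, Complex.exp_int_mul_two_pi_mul_I]
    simp

/-- Orthogonality of the characters over the cube `[0, 1/q]²`. -/
lemma integral_Icc_expChar {q : ℕ} (hq : 0 < q) (m : Fin 2 → ℤ) :
    ∫ x in Set.Icc (0 : Fin 2 → ℝ) (fun _ => 1 / (q : ℝ)), expChar m ((q : ℝ) • x) =
      if m = 0 then (((q : ℂ) ^ 2)⁻¹) else 0 := by
  have hq' : (0 : ℝ) < q := by exact_mod_cast hq
  have h1 (x : Fin 2 → ℝ) : expChar m ((q : ℝ) • x) =
      ∏ j, Complex.exp (2 * Real.pi * Complex.I * (m j * (q * x j : ℝ))) := by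
    rw [← Complex.exp_sum, ← Finset.mul_sum]
    rfl
  have h2 : Set.Icc (0 : Fin 2 → ℝ) (fun _ => 1 / (q : ℝ)) =
      Set.univ.pi fun _ => Set.Icc (0 : ℝ) (1 / q) :=
    (Set.pi_univ_Icc (0 : Fin 2 → ℝ) fun _ => 1 / (q : ℝ)).symm
  simp only [h1]
  rw [h2, volume_pi, Measure.restrict_pi_pi, integral_fintype_prod_eq_prod (fun j (t : ℝ) =>
    Complex.exp (2 * Real.pi * Complex.I * (m j * (q * t : ℝ))))]
  simp only [integral_Icc_exp_int_mul hq', Fin.prod_univ_two]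
  by_cases h : m = 0
  · subst h
    simp [sq]
  · rw [if_neg h]
    have : m 0 ≠ 0 ∨ m 1 ≠ 0 := by
      by_contra! h'
      exact h (funext fun j => by fin_cases j <;> simp [h'])
    rcases this with h' | h' <;> simp [h']

section Rational

variable {p q : ℕ} {θ : ℝ}

lemma matrixDoubleTrace_eq (hp : 0 < p) (hq : 0 < q) (hpq : Nat.Coprime p q)
    (f : Fin 4 → 𝓢(R2, ℂ)) : matrixDoubleTrace p q f =
      ∑' h : LatIdx, overlapCoef p q (f 0) (f 1) h * overlapCoef p q (f 2) (f 3) (-h) := by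
  have hq0 : (q : ℂ) ≠ 0 := by exact_mod_cast hq.ne'
  have hA := summable_norm_overlapCoef hp hq (f 0) (f 1)
  have hB := summable_norm_overlapCoef hp hq (f 2) (f 3)
  set A := overlapCoef p q (f 0) (f 1) with hAdef
  set B := overlapCoef p q (f 2) (f 3) with hBdef
  set c : LatIdx × LatIdx → ℂ := fun w => (q : ℂ) ^ 4 * (A w.1 * B w.2) with hc
  have hcs : Summable fun w => ‖c w‖ := by
    simp only [hc, norm_mul]
    exact (hA.mul_of_nonneg hB (fun _ => norm_nonneg _) fun _ => norm_nonneg _).mul_left _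
  set X : LatIdx × LatIdx → (Fin 2 → ℝ) → ℂ :=
    fun w x => expChar (-(w.1.2 + w.2.2)) ((q : ℝ) • x) with hX
  set Y : LatIdx × LatIdx → (Fin 2 → ℝ) → ℂ :=
    fun w y => expChar (-(w.1.1 + w.2.1)) ((q : ℝ) • y) with hY
  have hprod (x y : Fin 2 → ℝ) :
      ((matrixField p q (f 0) x y)ᴴ * matrixField p q (f 1) x y).trace *
        ((matrixField p q (f 2) x y)ᴴ * matrixField p q (f 3) x y).trace =
      ∑' w, (c w * X w x) * Y w y := by
    have hn {D : LatIdx → ℂ} (hD : Summable fun h => ‖D h‖) : Summable fun h : LatIdx =>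
        ‖(q : ℂ) ^ 2 * D h * (expChar (-h.2) ((q : ℝ) • x) * expChar (-h.1) ((q : ℝ) • y))‖ := by
      simp only [norm_mul, norm_expChar, mul_one]
      exact hD.mul_left _
    rw [trace_matrixField_eq hp hq hpq, trace_matrixField_eq hp hq hpq,
      tsum_mul_tsum_of_summable_norm (hn hA) (hn hB)]
    refine tsum_congr fun w => ?_
    simp only [hc, hX, hY, neg_add, expChar_add]
    ring
  have hfin : IsFiniteMeasure ((volume : Measure (Fin 2 → ℝ)).restrict
      (Set.Icc (0 : Fin 2 → ℝ) (fun _ => 1 / (q : ℝ)))) :=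
    ⟨by rw [Measure.restrict_apply_univ]; exact isCompact_Icc.measure_lt_top⟩
  have hm (m : Fin 2 → ℤ) : AEStronglyMeasurable (fun x => expChar m ((q : ℝ) • x))
      ((volume : Measure (Fin 2 → ℝ)).restrict (Set.Icc (0 : Fin 2 → ℝ) (fun _ => 1 / (q : ℝ)))) :=
    ((continuous_expChar m).comp (continuous_const_smul _)).aestronglyMeasurable
  have hin (x : Fin 2 → ℝ) : ∫ y in Set.Icc (0 : Fin 2 → ℝ) (fun _ => 1 / (q : ℝ)),
      ∑' w, (c w * X w x) * Y w y =
      ∑' w, (c w * if w.1.1 + w.2.1 = 0 then (((q : ℂ) ^ 2)⁻¹) else 0) * X w x := by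
    rw [integral_tsum_unimodular]
    · refine tsum_congr fun w => ?_
      rw [integral_Icc_expChar hq]
      simp only [neg_eq_zero]
      ring
    · simpa only [hX, norm_mul, norm_expChar, mul_one] using hcs
    · exact fun w => hm _
    · exact fun w y => norm_expChar _ _
  rw [matrixDoubleTrace]
  simp only [hprod, hin]
  rw [integral_tsum_unimodular]
  · simp only [hX, integral_Icc_expChar hq, neg_eq_zero]
    have hinj : Function.Injective fun h : LatIdx => ((h, -h) : LatIdx × LatIdx) :=
      fun h h' e => congrArg Prod.fst e
    rw [← hinj.tsum_eq]
    · refine tsum_congr fun h => ?_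
      simp only [hc, Prod.fst_neg, Prod.snd_neg, add_neg_cancel, if_true]
      field_simp
    · intro w hw
      rw [Function.mem_support] at hw
      have h2 : w.1.2 + w.2.2 = 0 := by
        by_contra h; exact hw (by rw [if_neg h, mul_zero])
      have h1 : w.1.1 + w.2.1 = 0 := by
        by_contra h; exact hw (by rw [if_neg h, mul_zero, zero_mul])
      refine ⟨w.1, Prod.ext rfl ?_⟩
      exact Prod.ext (neg_eq_of_add_eq_zero_right h1) (neg_eq_of_add_eq_zero_right h2)
  · refine Summable.of_nonneg_of_le (fun _ => norm_nonneg _) (fun w => ?_)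
      (hcs.mul_right ‖((q : ℂ) ^ 2)⁻¹‖)
    rw [norm_mul]
    refine mul_le_mul_of_nonneg_left ?_ (norm_nonneg _)
    split_ifs
    · exact le_rfl
    · rw [norm_zero]; exact norm_nonneg _
  · exact fun w => hm _
  · exact fun w y => norm_expChar _ _

/-- For `θ = p/q` the divergence is local in the matrix picture. -/
theorem hasLogDivergence_nonPlanar_rational (hp : 0 < p) (hq : 0 < q) (hpq : Nat.Coprime p q)
    (hθ : θ = (p : ℝ) / q) (lam μ₀ : ℝ) (f : Fin 4 → 𝓢(R2, ℂ)) :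
    HasLogDivergence (fun ε => nonPlanar θ lam μ₀ ε (fun i => bargmann θ (f i)))
      (-((3 * lam ^ 2 / (8 * freq θ ^ 2 * θ ^ 2) : ℝ) : ℂ) * matrixDoubleTrace p q f) := by
  rw [matrixDoubleTrace_eq hp hq hpq, ← resonanceSum_eq hp hq hθ]
  exact hasLogDivergence_nonPlanar_resonanceSum hp hq hpq hθ lam μ₀ fun i => ⟨f i, rfl⟩

end Rational

end HeisenbergQFT

theorem mainTheorem6 :
    -- the lattice sums of the regularized graphs converge absolutely
    (∀ (θ μ₀ ε : ℝ), 0 < θ → 0 < ε →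
      ∀ φ : Fin 4 → C2 → ℂ, (∀ i, φ i ∈ smoothModule θ) →
        Summable (fun g : LatIdx × LatIdx => ampC θ μ₀ ε φ (latPt θ g.1) (latPt θ g.2)) ∧
        Summable (fun g : LatIdx × LatIdx => ampD θ μ₀ ε φ (latPt θ g.1) (latPt θ g.2))) ∧
    -- rational case
    (∀ (p q : ℕ), 0 < p → 0 < q → Nat.Coprime p q →
      ∀ (θ : ℝ), θ = (p : ℝ) / (q : ℝ) →
      ∀ (lam μ₀ : ℝ) (f : Fin 4 → 𝓢(R2, ℂ)),
        HasLogDivergence (fun ε => nonPlanar θ lam μ₀ ε (fun i => bargmann θ (f i)))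
          (-((3 * lam ^ 2 / (8 * freq θ ^ 2 * θ ^ 2) : ℝ) : ℂ) * matrixDoubleTrace p q f)) ∧
    -- irrational case
    (∀ (θ : ℝ), 0 < θ → Irrational θ → WeakDiophantine θ →
      ∀ (lam μ₀ : ℝ) (φ : Fin 4 → C2 → ℂ), (∀ i, φ i ∈ smoothModule θ) →
        HasLogDivergence (fun ε => nonPlanar θ lam μ₀ ε φ)
          (-((3 * lam ^ 2 / (8 * freq θ ^ 2 * θ ^ 2) : ℝ) : ℂ) *
            torusTrace (hermPairing θ (φ 0) (φ 1)) * torusTrace (hermPairing θ (φ 2) (φ 3))) ∧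
        -- decomposition into lattice modes
        (∀ ε : ℝ, 0 < ε →
          HasSum (modeC θ lam μ₀ ε φ) (graphC θ lam μ₀ ε φ) ∧
          HasSum (modeD θ lam μ₀ ε φ) (graphD θ lam μ₀ ε φ)) ∧
        -- the zero modes carry the whole divergence
        HasLogDivergence (fun ε => modeC θ lam μ₀ ε φ 0 + modeD θ lam μ₀ ε φ 0)
          (-((3 * lam ^ 2 / (8 * freq θ ^ 2 * θ ^ 2) : ℝ) : ℂ) *
            torusTrace (hermPairing θ (φ 0) (φ 1)) * torusTrace (hermPairing θ (φ 2) (φ 3))) ∧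
        -- all other modes are finite, one by one and summed up
        (∀ k : LatIdx × LatIdx, k ≠ 0 →
          HasFiniteLimit (fun ε => modeC θ lam μ₀ ε φ k) ∧
          HasFiniteLimit (fun ε => modeD θ lam μ₀ ε φ k)) ∧
        HasFiniteLimit (fun ε => ∑' k : {k : LatIdx × LatIdx // k ≠ 0}, modeC θ lam μ₀ ε φ k) ∧
        HasFiniteLimit (fun ε => ∑' k : {k : LatIdx × LatIdx // k ≠ 0}, modeD θ lam μ₀ ε φ k)) := by
  refine ⟨fun θ μ₀ ε hθ hε φ hφ => ⟨summable_ampC hθ μ₀ hε hφ, summable_ampD hθ μ₀ hε hφ⟩,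
    fun p q hp hq hpq θ hθ lam μ₀ f =>
      hasLogDivergence_nonPlanar_rational hp hq hpq hθ lam μ₀ f,
    fun θ hθ _ hd lam μ₀ φ hφ => ⟨hasLogDivergence_nonPlanar_irrational hθ hd lam μ₀ hφ,
      fun ε hε => ⟨hasSum_modeC hθ lam μ₀ hε hφ, hasSum_modeD hθ lam μ₀ hε hφ⟩,
      hasLogDivergence_zeroModes hθ lam μ₀ hφ,
      fun k hk =>
        ⟨hasFiniteLimit_modeC hθ hd lam μ₀ hφ hk, hasFiniteLimit_modeD hθ hd lam μ₀ hφ hk⟩,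
      hasFiniteLimit_tsum_modeC hθ hd lam μ₀ hφ, hasFiniteLimit_tsum_modeD hθ hd lam μ₀ hφ⟩⟩
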